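/- The \emph{augmented square antiprism graph} has a central vertex $v_0$, an external quadrilateral $w_0w_1w_2w_3$ and an internal quadrilateral $u_0u_1u_2u_3$ (indices mod $4$); besides the sides of the two cycles its edges join each $u_i$ to $w_i$ and $w_{i+1}$, and $v_0$ to all other eight vertices. (An automorphism exchanges the two quadrilaterals.) A \emph{side} of an instance of this graph is a pair of consecutive external vertices $v=w_i$, $v'=w_{i+1}$ together with their common internal neighbour $u=u_i$. Let $H$ be a graph glued together from such instances. A (horizontal or vertical) \emph{extension} of $H$ along a side $(v,v',u)$ of one of its instances, not used by an earlier extension, adds a new instance, identifies two consecutive external vertices of the new instance with $v$ and $v'$, and adds one more edge $uu'$, where $u'$ is the internal vertex of the new instance adjacent to both identified vertices. The other three sides of the new instance may be used, each once, by later extensions (so that the structure may turn or branch). Let $\mathcal C$ be the class of all graphs that arise, up to isomorphism, from a single instance by at least one extension. A \emph{straight-line RAC drawing} of a graph maps the vertices to distinct points of the plane and the edges to straight segments, such that no vertex lies on an edge of which it is not an end and any two crossing edges cross at a right angle. The \emph{combinatorial embedding} of a drawing is the rotation system of its planarization, with labelled vertices: the pairs of edges that cross, the order of the crossings along each edge,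 and the cyclic orders of the edges around each vertex and each crossing. \textbf{Theorem.} The class $\mathcal C$ is infinite; more precisely, it contains finite graphs with arbitrarily many vertices. Every graph $G\in\mathcal C$ has a unique RAC combinatorial embedding: $G$ has a straight-line RAC drawing, and any two straight-line RAC drawings of $G$ have the same combinatorial embedding up to reflection. -/

import Mathlib

/-! ### Straight-line RAC drawings

The plane is `ℂ`.  A straight-line drawing of a graph on `V` is given by the positions
`p : V → ℂ` of its vertices; the edge `ab` is drawn as the segment from `p a` to `p b`. -/

/-- The distinct edges `ab` and `cd` cross in the point `x` of the drawing `p`. -/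
def CrossAt {V : Type*} (G : SimpleGraph V) (p : V → ℂ) (a b c d : V) (x : ℂ) : Prop :=
  G.Adj a b ∧ G.Adj c d ∧ s(a, b) ≠ s(c, d) ∧
    x ∈ openSegment ℝ (p a) (p b) ∧ x ∈ openSegment ℝ (p c) (p d)

/-- `p` is a straight-line RAC drawing of `G`: distinct vertices are distinct points, no vertex
lies on an edge of which it is not an end (so that no two edges overlap), and any two edges that
cross do so at a right angle. -/
structure IsRACDrawing {V : Type*} (G : SimpleGraph V) (p : V → ℂ) : Prop where
  injective : Function.Injective p
  vertex_not_on_edge : ∀ a b w : V, G.Adj a b → w ≠ a → w ≠ b → p w ∉ segment ℝ (p a) (p b)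
  right_angle : ∀ (a b c d : V) (x : ℂ), CrossAt G p a b c d x →
    inner ℝ (p b - p a) (p d - p c) = 0

/-! ### Combinatorial embeddings -/

/-- The data of a combinatorial embedding of a drawn graph with vertex set `V`, that is, of the
rotation system of its planarization (in which the crossings are additional vertices).
* `rotation a b c d`: the edges `ab`, `ac`, `ad` leave `a` in this counterclockwise cyclic order.
* `crosses (a, b) (c, d)`: the edges `ab` and `cd` cross, and `cd`, directed from `c` to `d`,
  crosses `ab`, directed from `a` to `b`, from right to left (so that `a`, `c`, `b`, `d` is the
  counterclockwise order of the four ends around the crossing).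
* `before (a, b) (c, d) (e, f)`: on the way from `a` to `b` along the edge `ab`, the crossing with
  the edge `cd` comes before the crossing with the edge `ef`. -/
@[ext]
structure CombinatorialEmbedding (V : Type*) where
  rotation : V → V → V → V → Prop
  crosses : V × V → V × V → Prop
  before : V × V → V × V → V × V → Prop

/-- The mirror image: all cyclic orders, around vertices and around crossings, are reversed. -/
def CombinatorialEmbedding.mirror {V : Type*} (E : CombinatorialEmbedding V) :
    CombinatorialEmbedding V where
  rotation a b c d := E.rotation a d c b
  crosses e f := E.crosses e f.swap
  before := E.before

/-- The combinatorial embedding that the drawing `p` of `G` induces.  Directions of edges are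
compared in the circular order of `Real.Angle`. -/
def embeddingOf {V : Type*} (G : SimpleGraph V) (p : V → ℂ) : CombinatorialEmbedding V where
  rotation a b c d := G.Adj a b ∧ G.Adj a c ∧ G.Adj a d ∧
    sbtw (Complex.arg (p b - p a) : Real.Angle) (Complex.arg (p c - p a) : Real.Angle)
      (Complex.arg (p d - p a) : Real.Angle)
  crosses e f := (∃ x : ℂ, CrossAt G p e.1 e.2 f.1 f.2 x) ∧
    0 < ((starRingEnd ℂ) (p e.2 - p e.1) * (p f.2 - p f.1)).im
  before e f g := ∃ x y : ℂ, CrossAt G p e.1 e.2 f.1 f.2 x ∧ CrossAt G p e.1 e.2 g.1 g.2 y ∧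
    dist (p e.1) x < dist (p e.1) y

/-- `G` has a unique RAC combinatorial embedding: `G` has a straight-line RAC drawing, and the
combinatorial embeddings of its straight-line RAC drawings are one embedding and its mirror
image. -/
def HasUniqueRACEmbedding {V : Type*} (G : SimpleGraph V) : Prop :=
  ∃ E : CombinatorialEmbedding V,
    {F | ∃ p : V → ℂ, IsRACDrawing G p ∧ embeddingOf G p = F} = {E, E.mirror}

/-! ### The augmented square antiprism graph and its extensions -/

/-- The vertices of the augmented square antiprism graph: the central vertex and the vertices of
two quadrilaterals. -/
inductive AntiprismVertex : Type
  | center : AntiprismVertex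
  | outer : ZMod 4 → AntiprismVertex
  | inner : ZMod 4 → AntiprismVertex

namespace AntiprismVertex

/-- One orientation of each edge: the spokes, the sides of the two quadrilaterals, and the edges
that join `inner i` to `outer i` and to `outer (i + 1)`. -/
def Edge : AntiprismVertex → AntiprismVertex → Prop
  | center, outer _ => True
  | center, inner _ => True
  | outer i, outer j => j = i + 1
  | inner i, inner j => j = i + 1
  | inner i, outer j => j = i ∨ j = i + 1
  | _, _ => False

end AntiprismVertex

/-- The augmented square antiprism graph. -/
def augmentedSquareAntiprism : SimpleGraph AntiprismVertex :=
  SimpleGraph.fromRel AntiprismVertex.Edge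

/-- A graph built from instances of the augmented square antiprism graph, together with its free
sides.  A side of an instance is a triple `(v, v', u)` of two consecutive vertices `v`, `v'` of its
external quadrilateral and their common neighbour `u` on the internal quadrilateral; it is free as
long as no other instance has been glued to it. -/
structure GluedGraph where
  V : Type
  graph : SimpleGraph V
  freeSides : Set (V × V × V)

namespace GluedGraph

open AntiprismVertex

/-- A single instance.  Its external quadrilateral is taken to be `outer`; an automorphism of the
augmented square antiprism graph exchanges the two quadrilaterals. -/
def single : GluedGraph where
  V := AntiprismVertex
  graph := augmentedSquareAntiprism
  freeSides := Set.range fun i : ZMod 4 => (outer i, outer (i + 1), .inner i)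

/-- The vertices after one more extension: those of `H` and those of the new instance, except that
its vertices `outer 0` and `outer 1` are not added. -/
abbrev ExtendV (H : GluedGraph) : Type :=
  H.V ⊕ {x : AntiprismVertex // x ≠ outer 0 ∧ x ≠ outer 1}

open Classical in
/-- The new instance in the extended graph: its vertices `outer 0` and `outer 1` are identified
with `v` and `v'`. -/
noncomputable def place (H : GluedGraph) (v v' : H.V) (x : AntiprismVertex) : H.ExtendV :=
  if h0 : x = outer 0 then Sum.inl v
  else if h1 : x = outer 1 then Sum.inl v'
  else Sum.inr ⟨x, h0, h1⟩

/-- The horizontal or vertical extension of `H` by a new instance along the side `(v, v', u)`: two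
consecutive external vertices of the new instance are identified with `v` and `v'`, and an
additional edge joins `u` to the corresponding internal vertex of the new instance, the common
neighbour `inner 0` of the two.  By the symmetries of the new instance, neither the choice of its
side nor the order in which `v` and `v'` are identified matters, up to isomorphism.  The other three
sides of the new instance become free; which of them are used later decides where the structure
branches or turns. -/
noncomputable def extend (H : GluedGraph) (v v' u : H.V) : GluedGraph where
  V := H.ExtendV
  graph := SimpleGraph.fromEdgeSet
    (Sym2.map Sum.inl '' H.graph.edgeSet ∪
      Sym2.map (H.place v v') '' augmentedSquareAntiprism.edgeSet ∪
      {s(Sum.inl u, H.place v v' (.inner 0))})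
  freeSides :=
    {t | ∃ a b c : H.V, (a, b, c) ∈ H.freeSides ∧ (a, b, c) ≠ (v, v', u) ∧
      t = (Sum.inl a, Sum.inl b, Sum.inl c)} ∪
    {t | ∃ i : ZMod 4, i ≠ 0 ∧
      t = (H.place v v' (outer i), H.place v v' (outer (i + 1)), H.place v v' (.inner i))}

/-- `H` is glued together from `n` instances of the augmented square antiprism graph, by successive
extensions along free sides. -/
inductive IsGluedFrom : ℕ → GluedGraph → Prop
  | single : IsGluedFrom 1 single
  | extend {n : ℕ} {H : GluedGraph} {v v' u : H.V} :
      IsGluedFrom n H → (v, v', u) ∈ H.freeSides → IsGluedFrom (n + 1) (H.extend v v' u)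

end GluedGraph

/-- The class of the graphs that are glued together from at least two instances of the augmented
square antiprism graph by horizontal and vertical extensions. -/
def InAntiprismClass {V : Type*} (G : SimpleGraph V) : Prop :=
  ∃ n : ℕ, 2 ≤ n ∧ ∃ H : GluedGraph, H.IsGluedFrom n ∧ Nonempty (G ≃g H.graph)

/-! Large members of the class exist because every glued graph still has a free side and each
extension adds vertices. The substance is uniqueness and existence of the embedding.

Uniqueness. What matters in a straight-line drawing is the orientation of its triples of vertices.
`IsRACDrawing.exists_pattern` moves the vertices slightly into general position and records the
orientations as an `IsPattern`: axioms that hold for points of the plane, together with two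
consequences of right angles. First, no edge crosses two edges with a common end, since both would
lie on the perpendicular from that end. Second, if two edges at y cross two edges at a, the
crossings are the feet of perpendiculars from y, which puts y inside the angle at a. Conversely, the
embedding can be read off from the pattern as soon as every edge is crossed at most once
(`IsRACDrawing.embeddingOf_eq`).

For the nine points of one instance, or the sixteen points of two glued instances, the axioms form a
finite propositional problem. Such problems are settled by refutation trees, with unit propagation
and case distinctions, whose checker is proved sound (`Tree.false_of_facts`). The results: one
instance is drawn as two nested quadrilaterals around the centre, each side of the inner one
crossing one spoke, up to reflection and up to the choice of the external quadrilateral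
(`isStandard_or`). A second instance glued to a side removes this choice and must have the opposite
orientation (`IsGlued.isStandard`), the connecting edge crosses the common side (`IsGlued.crosses`),
and the two instances keep out of each other's small triangles (`IsGlued.separated`).

From local to global: a vertex with two neighbours inside a triangle of edges is inside, and a
vertex inside cannot have four neighbours outside. Hence an instance that meets a triangle in at
most one external vertex lies, apart from this vertex, entirely inside or entirely outside
(`inside_or_outside`). Induction on the gluing then shows that instances do not overlap
(`GluedGraph.IsAssembly.not_inside`). So an edge can cross an edge of an instance only if it ends at
an internal vertex of that instance, which leaves exactly the crossings of `CrossingPair`, at most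
one on each edge. The rotations of two drawings are compared by inserting the edges at a vertex one
after the other: a new edge either directly follows a known edge along an empty triangle, or leaves
through the opposite side of such a triangle (`GluedGraph.IsAssembly.agreeOn`). Since neighbouring
instances have opposite orientations, the orientation of one instance determines all, and only a
global reflection remains free.

Existence. One instance is drawn as a kite whose length W is a free parameter, with the crossings
parallel to the axes and each inner vertex on the perpendicular bisector of its side. At every free
side the drawing keeps an empty region, a `Room`. A sufficiently elongated kite, placed by a
similarity, fits into any room, the connecting edge runs along the perpendicular bisector of the
common side, and the new kite again has rooms at its three other sides. This gives
`GluedGraph.IsAssembly.hasRooms` by induction. -/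

section

/-! ### Orientation patterns

An orientation pattern records which triples of points are in counterclockwise order, for points in
general position, together with the consequences of the right angle condition. -/

/-- The segments `ab` and `cd` cross, in terms of orientations. -/
def Crosses {V : Type*} (χ : V → V → V → Prop) (a b c d : V) : Prop :=
  ¬(χ a b c ↔ χ a b d) ∧ ¬(χ c d a ↔ χ c d b)

/-- The point `x` lies inside the triangle `abc`, in terms of orientations. -/
def Inside {V : Type*} (χ : V → V → V → Prop) (a b c x : V) : Prop :=
  (χ a b x ↔ χ b c x) ∧ (χ b c x ↔ χ c a x)

/-- The properties of the orientations of a straight-line RAC drawing in general position.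
`fan` says that no edge crosses two edges with a common end, and `corner₁`, `corner₂` that two edges
`yx₁`, `yx₂` that cross edges `ab`, `ac` form a convex quadrilateral with them. -/
structure IsPattern {V : Type*} (G : SimpleGraph V) (χ : V → V → V → Prop) : Prop where
  rotate : ∀ a b c, χ a b c → χ b c a
  swap : ∀ a b c, [a, b, c].Nodup → (χ b a c ↔ ¬χ a b c)
  interior : ∀ p q r t, χ t q r → χ p t r → χ p q t → χ p q r
  -- The directions from t to points on one side of the line tu are linearly ordered; `trans'` is
  -- the same for the other side.
  trans : ∀ t u p q r, χ t u p → χ t u q → χ t u r → χ t p q → χ t q r → χ t p r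
  trans' : ∀ t u p q r, χ u t p → χ u t q → χ u t r → χ t p q → χ t q r → χ t p r
  fan : ∀ a b c e f, [a, b, c, e, f].Nodup → G.Adj a b → G.Adj a c → G.Adj e f →
    Crosses χ a b e f → ¬Crosses χ a c e f
  corner₁ : ∀ a b c y x₁ x₂, [a, b, c, y, x₁, x₂].Nodup → G.Adj a b → G.Adj a c → G.Adj y x₁ →
    G.Adj y x₂ → Crosses χ y x₁ a b → Crosses χ y x₂ a c → (χ a b y ↔ χ a y c)
  corner₂ : ∀ a b c y x₁ x₂, [a, b, c, y, x₁, x₂].Nodup → G.Adj a b → G.Adj a c → G.Adj y x₁ →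
    G.Adj y x₂ → Crosses χ y x₁ a b → Crosses χ y x₂ a c → (χ a b c ↔ χ a y c)

theorem crosses_comm {V : Type*} {χ : V → V → V → Prop} {a b c d : V} :
    Crosses χ c d a b ↔ Crosses χ a b c d :=
  and_comm

theorem inside_rotate {V : Type*} {χ : V → V → V → Prop} {a b c x : V} :
    Inside χ b c a x ↔ Inside χ a b c x := by
  unfold Inside
  tauto

namespace IsPattern

variable {V : Type*} {G : SimpleGraph V} {χ : V → V → V → Prop}

theorem rotate_iff (h : IsPattern G χ) (a b c : V) : χ a b c ↔ χ b c a :=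
  ⟨h.rotate a b c, fun k => h.rotate _ _ _ (h.rotate _ _ _ k)⟩

/-- The mirror image of a pattern. -/
theorem mirror (h : IsPattern G χ) : IsPattern G fun a b c => χ b a c := by
  have hs : ∀ a b c, a ≠ b → b ≠ c → a ≠ c → (χ b a c ↔ ¬χ a b c) :=
    fun a b c h1 h2 h3 => h.swap a b c (by simp [*])
  have hc : ∀ a b c d, [a, b, c, d].Nodup → Crosses (fun a b c => χ b a c) a b c d →
      Crosses χ a b c d := by
    intro a b c d hn hx
    simp only [List.nodup_cons, List.mem_cons, List.not_mem_nil, or_false, not_or] at hn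
    have h1 := hs a b c (by tauto) (by tauto) (by tauto)
    have h2 := hs a b d (by tauto) (by tauto) (by tauto)
    have h3 := hs c d a (by tauto) (by tauto) (by tauto)
    have h4 := hs c d b (by tauto) (by tauto) (by tauto)
    unfold Crosses at hx ⊢
    tauto
  refine ⟨fun a b c k => h.rotate _ _ _ (h.rotate _ _ _ k), fun a b c hn => ?_,
    fun p q r t k1 k2 k3 => h.interior q p r t k2 k1 k3,
    -- Reflection exchanges `trans` and `trans'`, so having both as axioms makes patterns closed
    -- under it.
    fun t u p q r k1 k2 k3 k4 k5 => h.rotate _ _ _ (h.rotate _ _ _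
      (h.trans' t u r q p k3 k2 k1 (h.rotate _ _ _ k5) (h.rotate _ _ _ k4))),
    fun t u p q r k1 k2 k3 k4 k5 => h.rotate _ _ _ (h.rotate _ _ _
      (h.trans t u r q p k3 k2 k1 (h.rotate _ _ _ k5) (h.rotate _ _ _ k4))), ?_, ?_, ?_⟩
  · have := h.swap a b c hn
    tauto
  · intro a b c e f hn h1 h2 h3 k1 k2
    have hn' := hn
    simp only [List.nodup_cons, List.mem_cons, List.not_mem_nil, or_false, not_or] at hn'
    exact h.fan a b c e f hn h1 h2 h3 (hc _ _ _ _ (by simp; grind) k1)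
      (hc _ _ _ _ (by simp; grind) k2)
  · intro a b c y x₁ x₂ hn h1 h2 h3 h4 k1 k2
    have hn' := hn
    simp only [List.nodup_cons, List.mem_cons, List.not_mem_nil, or_false, not_or] at hn'
    have := h.corner₁ a b c y x₁ x₂ hn h1 h2 h3 h4 (hc _ _ _ _ (by simp; grind) k1)
      (hc _ _ _ _ (by simp; grind) k2)
    have e1 := hs a b y (by grind) (by grind) (by grind)
    have e2 := hs a y c (by grind) (by grind) (by grind)
    grind
  · intro a b c y x₁ x₂ hn h1 h2 h3 h4 k1 k2
    have hn' := hn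
    simp only [List.nodup_cons, List.mem_cons, List.not_mem_nil, or_false, not_or] at hn'
    have := h.corner₂ a b c y x₁ x₂ hn h1 h2 h3 h4 (hc _ _ _ _ (by simp; grind) k1)
      (hc _ _ _ _ (by simp; grind) k2)
    have e1 := hs a b c (by grind) (by grind) (by grind)
    have e2 := hs a y c (by grind) (by grind) (by grind)
    grind

theorem swap_iff (h : IsPattern G χ) {a b c : V} (h1 : a ≠ b) (h2 : b ≠ c) (h3 : a ≠ c) :
    χ b a c ↔ ¬χ a b c :=
  h.swap a b c (by simp [*])

theorem crosses_swap (h : IsPattern G χ) {a b c d : V} (hn : [a, b, c, d].Nodup) :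
    Crosses χ b a c d ↔ Crosses χ a b c d := by
  simp only [List.nodup_cons, List.mem_cons, List.not_mem_nil, or_false, not_or] at hn
  unfold Crosses
  rw [h.swap_iff (by tauto : a ≠ b) (by tauto : b ≠ c) (by tauto),
    h.swap_iff (by tauto : a ≠ b) (by tauto : b ≠ d) (by tauto)]
  tauto

theorem inside_swap (h : IsPattern G χ) {a b c x : V} (hn : [a, b, c, x].Nodup) :
    Inside χ b a c x ↔ Inside χ a b c x := by
  simp only [List.nodup_cons, List.mem_cons, List.not_mem_nil, or_false, not_or] at hn
  unfold Inside
  rw [h.swap_iff (by tauto : a ≠ b) (by tauto : b ≠ x) (by tauto),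
    h.swap_iff (by tauto : b ≠ c) (by tauto : c ≠ x) (by tauto),
    h.swap_iff (by grind : c ≠ a) (by tauto : a ≠ x) (by tauto)]
  tauto

/-- This restricts a pattern of an extended graph to the graph before the extension, which is what
the inductions over the gluing need. -/
theorem comap {W : Type*} {G' : SimpleGraph W} (h : IsPattern G χ) (f : G' →g G)
    (hf : Function.Injective f) : IsPattern G' fun a b c => χ (f a) (f b) (f c) where
  rotate a b c := h.rotate _ _ _
  swap a b c hn := h.swap _ _ _ (by simpa using hn.map hf)
  interior p q r t := h.interior _ _ _ _
  trans t u p q r := h.trans _ _ _ _ _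
  trans' t u p q r := h.trans' _ _ _ _ _
  fan a b c e f' hn h1 h2 h3 := h.fan _ _ _ _ _ (by simpa using hn.map hf) (f.map_adj h1)
    (f.map_adj h2) (f.map_adj h3)
  corner₁ a b c y x₁ x₂ hn h1 h2 h3 h4 := h.corner₁ _ _ _ _ _ _ (by simpa using hn.map hf)
    (f.map_adj h1) (f.map_adj h2) (f.map_adj h3) (f.map_adj h4)
  corner₂ a b c y x₁ x₂ hn h1 h2 h3 h4 := h.corner₂ _ _ _ _ _ _ (by simpa using hn.map hf)
    (f.map_adj h1) (f.map_adj h2) (f.map_adj h3) (f.map_adj h4)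

end IsPattern

/-! ### Refutation of orientation constraints by unit propagation

Points are numbered; literals about their orientations, crossings and triangles are coded by natural
numbers, `neg l` being the negation of `l`.  Clauses that hold in every pattern are coded by
numbers as well, and a refutation is a tree of lists of clauses that unit propagation uses. -/

namespace Refutation

/-- The literal for the orientation of three points. -/
def orient (a b c : ℕ) : ℕ :=
  -- Points are digits in base 16. The lowest bit of a literal is its sign and the next two bits are
  -- the kind of the atom. Sorting the points lets all six orders of a triple share one atom, with
  -- odd permutations negated.
  let l (i j k : ℕ) := 8 * (i + 16 * (j + 16 * k))
  bif Nat.blt a b then bif Nat.blt b c then l a b c else bif Nat.blt a c then l a c b + 1 else l c a b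
  else bif Nat.blt a c then l b a c + 1 else bif Nat.blt b c then l b c a else l c b a + 1

/-- The literal for the crossing of `ab` and `cd`. -/
def cross (a b c d : ℕ) : ℕ :=
  let l (i j k l : ℕ) := 8 * (i + 16 * (j + 16 * (k + 16 * l))) + 2
  let r (i j k m : ℕ) := bif Nat.blt i k then l i j k m else l k m i j
  bif Nat.blt a b then bif Nat.blt c d then r a b c d else r a b d c
  else bif Nat.blt c d then r b a c d else r b a d c

/-- The literal for a point inside a triangle. -/
def inside (a b c x : ℕ) : ℕ :=
  let l (i j k : ℕ) := 8 * (i + 16 * (j + 16 * (k + 16 * x))) + 4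
  bif Nat.blt a b then bif Nat.blt b c then l a b c else bif Nat.blt a c then l a c b else l c a b
  else bif Nat.blt a c then l b a c else bif Nat.blt b c then l b c a else l c b a

/-- The negation of a literal. -/
def neg (l : ℕ) : ℕ := l + 1 - 2 * (l % 2)

end Refutation

namespace Refutation

/-- Whether the numbers are distinct and less than `n`. -/
def distinct (n : ℕ) : List ℕ → Bool
  | [] => true
  | a :: l => Nat.blt a n && (l.all fun b => !Nat.beq a b) && distinct n l

/-- The clause `c`, subject to a condition. -/
def guard (b : Bool) (c : List ℕ) : List ℕ := bif b then c else [7]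

/-- The kinds of clauses: axioms of orientations, properties of right angle crossings, definitions of
crossings and of triangles, and consequences of them. -/
def kinds (n : ℕ) (adj : ℕ → ℕ → Bool) : List ((ℕ → ℕ) → List ℕ) := [
  fun d => guard (distinct n [d 0, d 1, d 2, d 3])
    [neg (orient (d 3) (d 1) (d 2)), neg (orient (d 0) (d 3) (d 2)), neg (orient (d 0) (d 1) (d 3)),
      orient (d 0) (d 1) (d 2)],
  fun d => guard (distinct n [d 0, d 1, d 2, d 3, d 4])
    [neg (orient (d 0) (d 1) (d 2)), neg (orient (d 0) (d 1) (d 3)), neg (orient (d 0) (d 1) (d 4)),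
      neg (orient (d 0) (d 2) (d 3)), neg (orient (d 0) (d 3) (d 4)), orient (d 0) (d 2) (d 4)],
  fun d => guard (distinct n [d 0, d 1, d 2, d 3, d 4] && adj (d 0) (d 1) && adj (d 0) (d 2) &&
      adj (d 3) (d 4))
    [neg (cross (d 0) (d 1) (d 3) (d 4)), neg (cross (d 0) (d 2) (d 3) (d 4))],
  fun d => guard (distinct n [d 0, d 1, d 2, d 3, d 4, d 5] && adj (d 0) (d 1) && adj (d 0) (d 2) &&
      adj (d 3) (d 4) && adj (d 3) (d 5))
    [neg (cross (d 3) (d 4) (d 0) (d 1)), neg (cross (d 3) (d 5) (d 0) (d 2)),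
      orient (d 0) (d 1) (d 3), neg (orient (d 0) (d 3) (d 2))],
  fun d => guard (distinct n [d 0, d 1, d 2, d 3, d 4, d 5] && adj (d 0) (d 1) && adj (d 0) (d 2) &&
      adj (d 3) (d 4) && adj (d 3) (d 5))
    [neg (cross (d 3) (d 4) (d 0) (d 1)), neg (cross (d 3) (d 5) (d 0) (d 2)),
      neg (orient (d 0) (d 1) (d 3)), orient (d 0) (d 3) (d 2)],
  fun d => guard (distinct n [d 0, d 1, d 2, d 3, d 4, d 5] && adj (d 0) (d 1) && adj (d 0) (d 2) &&
      adj (d 3) (d 4) && adj (d 3) (d 5))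
    [neg (cross (d 3) (d 4) (d 0) (d 1)), neg (cross (d 3) (d 5) (d 0) (d 2)),
      orient (d 0) (d 1) (d 2), neg (orient (d 0) (d 3) (d 2))],
  fun d => guard (distinct n [d 0, d 1, d 2, d 3, d 4, d 5] && adj (d 0) (d 1) && adj (d 0) (d 2) &&
      adj (d 3) (d 4) && adj (d 3) (d 5))
    [neg (cross (d 3) (d 4) (d 0) (d 1)), neg (cross (d 3) (d 5) (d 0) (d 2)),
      neg (orient (d 0) (d 1) (d 2)), orient (d 0) (d 3) (d 2)],
  -- A kind is available for every choice of the points, so symmetric variants of these clauses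
  -- arise by permuting the arguments, under which the codes of crossings and triangles do not
  -- change.
  fun d => guard (distinct n [d 0, d 1, d 2, d 3])
    [neg (cross (d 0) (d 1) (d 2) (d 3)), orient (d 0) (d 1) (d 2), orient (d 0) (d 1) (d 3)],
  fun d => guard (distinct n [d 0, d 1, d 2, d 3])
    [cross (d 0) (d 1) (d 2) (d 3), neg (orient (d 0) (d 1) (d 2)), orient (d 0) (d 1) (d 3),
      orient (d 2) (d 3) (d 0), neg (orient (d 2) (d 3) (d 1))],
  fun d => guard (distinct n [d 0, d 1, d 2, d 3])
    [neg (inside (d 0) (d 1) (d 2) (d 3)), neg (orient (d 0) (d 1) (d 3)),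
      orient (d 1) (d 2) (d 3)],
  fun d => guard (distinct n [d 0, d 1, d 2, d 3])
    [inside (d 0) (d 1) (d 2) (d 3), neg (orient (d 0) (d 1) (d 3)),
      neg (orient (d 1) (d 2) (d 3)), neg (orient (d 2) (d 0) (d 3))]]

/-- A refutation: lists of clauses for unit propagation, and case distinctions on literals. -/
inductive Tree
  | leaf (hints : List ℕ)
  | node (hints : List ℕ) (l : ℕ) (t₁ t₂ : Tree)

/-- Evaluates a number before it is used. -/
def force (n : ℕ) (k : ℕ → Bool) : Bool :=
  match n with
  | 0 => k 0
  | m + 1 => k (m + 1)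

/-- Unit propagation from the set `M` of literals with the given clauses; yields `true` when a
clause is violated, and goes on with `k` otherwise. -/
def propagate (cl : ℕ → List ℕ) : List ℕ → ℕ → (ℕ → Bool) → Bool
  | [], M, k => k M
  | h :: hs, M, k =>
    match (cl h).filter fun l => !M.testBit (neg l) with
    | [] => true
    | [l] => force (M ||| 2 ^ l) fun M' => propagate cl hs M' k
    | _ => false

/-- Whether the tree refutes the set `M` of literals. -/
def Tree.check (cl : ℕ → List ℕ) : Tree → ℕ → Bool
  | .leaf hs, M => propagate cl hs M fun _ => false
  | .node hs l t₁ t₂, M => propagate cl hs M fun M' =>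
    force (M' ||| 2 ^ l) (Tree.check cl t₁) && force (M' ||| 2 ^ neg l) (Tree.check cl t₂)

/-- The clause with a given code: one of the extra clauses `ex`, or one of the kinds `ks`. -/
def clause (ks : List ((ℕ → ℕ) → List ℕ)) (ex : List (List ℕ)) (h : ℕ) : List ℕ :=
  -- The residue modulo 32 selects the kind, 31 being reserved for the extra clauses; the remaining
  -- digits in base 16 are the points to which the kind is applied.
  bif Nat.beq (h % 32) 31 then ex.getD (h / 32) [7]
  else ks.getD (h % 32) (fun _ => [7]) fun i => h / (32 * 16 ^ i) % 16

/-! #### Soundness -/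

section

variable {V : Type*} (χ : V → V → V → Prop) (pt : ℕ → V)

/-- The meaning of an atom. -/
def Atom (k : ℕ) : Prop :=
  match k % 4 with
  | 0 => χ (pt (k / 4 % 16)) (pt (k / 64 % 16)) (pt (k / 1024 % 16))
  | 1 => Crosses χ (pt (k / 4 % 16)) (pt (k / 64 % 16)) (pt (k / 1024 % 16)) (pt (k / 16384 % 16))
  | 2 => Inside χ (pt (k / 4 % 16)) (pt (k / 64 % 16)) (pt (k / 1024 % 16)) (pt (k / 16384 % 16))
  | _ => False

/-- The meaning of a literal. -/
def Holds (l : ℕ) : Prop := Atom χ pt (l / 2) ↔ l % 2 = 0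

variable {χ pt}

theorem holds_neg (l : ℕ) : Holds χ pt (neg l) ↔ ¬Holds χ pt l := by
  have h1 : neg l / 2 = l / 2 := by unfold neg; omega
  have h2 : neg l % 2 = 0 ↔ ¬l % 2 = 0 := by unfold neg; omega
  unfold Holds
  rw [h1, h2]
  tauto

theorem force_eq (n : ℕ) (k : ℕ → Bool) : force n k = k n := by
  cases n <;> rfl

theorem holds_of_testBit_or {M l : ℕ} (hM : ∀ m, M.testBit m = true → Holds χ pt m)
    (hl : Holds χ pt l) (m : ℕ) (hm : (M ||| 2 ^ l).testBit m = true) : Holds χ pt m := by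
  rw [Nat.testBit_or, Bool.or_eq_true, Nat.testBit_two_pow, decide_eq_true_eq] at hm
  rcases hm with hm | rfl
  exacts [hM m hm, hl]

theorem propagate_sound {cl : ℕ → List ℕ} (hcl : ∀ h, ∃ l ∈ cl h, Holds χ pt l) :
    ∀ (hs : List ℕ) (M : ℕ) (k : ℕ → Bool), propagate cl hs M k = true →
      (∀ l, M.testBit l = true → Holds χ pt l) →
      ∃ M', k M' = true ∧ ∀ l, M'.testBit l = true → Holds χ pt l
  | [], M, k, h, hM => ⟨M, h, hM⟩
  | h :: hs, M, k, hp, hM => by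
    obtain ⟨l, hl, hol⟩ := hcl h
    -- The filter removes only literals that are already known to be false, so the literal that
    -- makes the clause true survives it. In particular the clause cannot become empty, and a single
    -- remaining literal is the true one.
    have hmem : l ∈ (cl h).filter fun l => !M.testBit (neg l) := by
      refine List.mem_filter.2 ⟨hl, ?_⟩
      by_contra hc
      exact (holds_neg l).1 (hM _ (by simpa using hc)) hol
    unfold propagate at hp
    split at hp
    · rename_i he
      rw [he] at hmem
      simp at hmem
    · rename_i l' he
      rw [he, List.mem_singleton] at hmem
      subst hmem
      rw [force_eq] at hp
      exact propagate_sound hcl hs _ k hp (holds_of_testBit_or hM hol)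
    · exact absurd hp (by simp)

theorem Tree.check_sound {cl : ℕ → List ℕ} (hcl : ∀ h, ∃ l ∈ cl h, Holds χ pt l) :
    ∀ (t : Tree) (M : ℕ), t.check cl M = true → (∀ l, M.testBit l = true → Holds χ pt l) → False
  | .leaf hs, M, h, hM => by
    obtain ⟨M', h', -⟩ := propagate_sound hcl hs M _ h hM
    exact absurd h' (by simp)
  | .node hs l t₁ t₂, M, h, hM => by
    obtain ⟨M', h', hM'⟩ := propagate_sound hcl hs M _ h hM
    rw [Bool.and_eq_true, force_eq, force_eq] at h'
    by_cases hl : Holds χ pt l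
    · exact t₁.check_sound hcl _ h'.1 (holds_of_testBit_or hM' hl)
    · exact t₂.check_sound hcl _ h'.2 (holds_of_testBit_or hM' ((holds_neg l).2 hl))

/-- Code 7 negates an atom of the fourth, unused kind, whose meaning is `False`. It is the harmless
default for violated guards and for lookups out of range. -/
theorem holds_seven : Holds χ pt 7 := by
  simp [Holds, Atom]

theorem exists_mem_guard {b : Bool} {c : List ℕ} (h : b = true → ∃ l ∈ c, Holds χ pt l) :
    ∃ l ∈ guard b c, Holds χ pt l := by
  cases b
  · exact ⟨7, by simp [guard], holds_seven⟩
  · exact h rfl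

/-- A refutation, given that all clauses of the kinds `ks` and the extra clauses are satisfied. -/
theorem Tree.false_of_check {ks : List ((ℕ → ℕ) → List ℕ)} {ex : List (List ℕ)} (t : Tree)
    (hks : ∀ f ∈ ks, ∀ d : ℕ → ℕ, (∀ i, d i < 16) → ∃ l ∈ f d, Holds χ pt l)
    (hex : ∀ c ∈ ex, ∃ l ∈ c, Holds χ pt l) (ht : t.check (clause ks ex) 0 = true) : False := by
  refine t.check_sound (χ := χ) (pt := pt) (fun h => ?_) 0 ht (by simp)
  unfold clause
  cases Nat.beq (h % 32) 31
  · rw [cond_false, List.getD_eq_getElem?_getD]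
    cases hk : ks[h % 32]? with
    | none => exact ⟨7, by simp, holds_seven⟩
    | some f => exact hks f (List.mem_of_getElem? hk) _ fun i => Nat.mod_lt _ (by norm_num)
  · rw [cond_true, List.getD_eq_getElem?_getD]
    cases hk : ex[h / 32]? with
    | none => exact ⟨7, by simp, holds_seven⟩
    | some c => exact hex c (List.mem_of_getElem? hk)

theorem distinct_iff {n : ℕ} : ∀ {l : List ℕ}, distinct n l = true ↔ l.Nodup ∧ ∀ a ∈ l, a < n
  | [] => by simp [distinct]
  | a :: l => by
    simp only [distinct, Bool.and_eq_true, distinct_iff, List.nodup_cons, List.all_eq_true,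
      List.mem_cons, forall_eq_or_imp, Nat.blt_eq]
    have : (∀ x ∈ l, (!Nat.beq a x) = true) ↔ a ∉ l := by
      constructor
      · intro h hm
        simpa using h a hm
      · intro h x hx
        simp only [Bool.not_eq_true', ← Bool.not_eq_true, Nat.beq_eq]
        rintro rfl
        exact h hx
    rw [this]
    tauto

variable {G : SimpleGraph V} {n : ℕ}

theorem holds_orient_code {a b c : ℕ} (ha : a < 16) (hb : b < 16) (hc : c < 16) :
    (Holds χ pt (8 * (a + 16 * (b + 16 * c))) ↔ χ (pt a) (pt b) (pt c)) ∧
      (Holds χ pt (8 * (a + 16 * (b + 16 * c)) + 1) ↔ ¬χ (pt a) (pt b) (pt c)) := by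
  have key : Atom χ pt (4 * (a + 16 * (b + 16 * c))) ↔ χ (pt a) (pt b) (pt c) := by
    have h0 : 4 * (a + 16 * (b + 16 * c)) % 4 = 0 := by omega
    have h1 : 4 * (a + 16 * (b + 16 * c)) / 4 % 16 = a := by omega
    have h2 : 4 * (a + 16 * (b + 16 * c)) / 64 % 16 = b := by omega
    have h3 : 4 * (a + 16 * (b + 16 * c)) / 1024 % 16 = c := by omega
    simp only [Atom, h0, h1, h2, h3]
  have e1 : 8 * (a + 16 * (b + 16 * c)) / 2 = 4 * (a + 16 * (b + 16 * c)) := by omega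
  have e2 : (8 * (a + 16 * (b + 16 * c)) + 1) / 2 = 4 * (a + 16 * (b + 16 * c)) := by omega
  have e3 : 8 * (a + 16 * (b + 16 * c)) % 2 = 0 := by omega
  have e4 : (8 * (a + 16 * (b + 16 * c)) + 1) % 2 = 1 := by omega
  simp only [Holds, e1, e2, e3, e4, key]
  simp

theorem holds_cross_code {a b c d : ℕ} (ha : a < 16) (hb : b < 16) (hc : c < 16) (hd : d < 16) :
    Holds χ pt (8 * (a + 16 * (b + 16 * (c + 16 * d))) + 2) ↔
      Crosses χ (pt a) (pt b) (pt c) (pt d) := by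
  have h : (8 * (a + 16 * (b + 16 * (c + 16 * d))) + 2) / 2 =
    4 * (a + 16 * (b + 16 * (c + 16 * d))) + 1 := by omega
  have h' : (8 * (a + 16 * (b + 16 * (c + 16 * d))) + 2) % 2 = 0 := by omega
  have h0 : (4 * (a + 16 * (b + 16 * (c + 16 * d))) + 1) % 4 = 1 := by omega
  have h1 : (4 * (a + 16 * (b + 16 * (c + 16 * d))) + 1) / 4 % 16 = a := by omega
  have h2 : (4 * (a + 16 * (b + 16 * (c + 16 * d))) + 1) / 64 % 16 = b := by omega
  have h3 : (4 * (a + 16 * (b + 16 * (c + 16 * d))) + 1) / 1024 % 16 = c := by omega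
  have h4 : (4 * (a + 16 * (b + 16 * (c + 16 * d))) + 1) / 16384 % 16 = d := by omega
  simp only [Holds, h, h', Atom, h0, h1, h2, h3, h4, iff_true]

theorem holds_inside_code {a b c d : ℕ} (ha : a < 16) (hb : b < 16) (hc : c < 16) (hd : d < 16) :
    Holds χ pt (8 * (a + 16 * (b + 16 * (c + 16 * d))) + 4) ↔
      Inside χ (pt a) (pt b) (pt c) (pt d) := by
  have h : (8 * (a + 16 * (b + 16 * (c + 16 * d))) + 4) / 2 =
    4 * (a + 16 * (b + 16 * (c + 16 * d))) + 2 := by omega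
  have h' : (8 * (a + 16 * (b + 16 * (c + 16 * d))) + 4) % 2 = 0 := by omega
  have h0 : (4 * (a + 16 * (b + 16 * (c + 16 * d))) + 2) % 4 = 2 := by omega
  have h1 : (4 * (a + 16 * (b + 16 * (c + 16 * d))) + 2) / 4 % 16 = a := by omega
  have h2 : (4 * (a + 16 * (b + 16 * (c + 16 * d))) + 2) / 64 % 16 = b := by omega
  have h3 : (4 * (a + 16 * (b + 16 * (c + 16 * d))) + 2) / 1024 % 16 = c := by omega
  have h4 : (4 * (a + 16 * (b + 16 * (c + 16 * d))) + 2) / 16384 % 16 = d := by omega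
  simp only [Holds, h, h', Atom, h0, h1, h2, h3, h4, iff_true]

theorem nodup_map_of_distinct (hpt : Set.InjOn pt {i | i < n}) {l : List ℕ}
    (h : distinct n l = true) : (l.map pt).Nodup := by
  rw [distinct_iff] at h
  exact h.1.map_on fun x hx y hy hxy => hpt (h.2 x hx) (h.2 y hy) hxy

theorem lt_of_distinct (hn : n ≤ 16) {l : List ℕ} (h : distinct n l = true) : ∀ a ∈ l, a < 16 :=
  fun a ha => ((distinct_iff.1 h).2 a ha).trans_le hn

theorem holds_orient (hχ : IsPattern G χ) (hpt : Set.InjOn pt {i | i < n}) (hn : n ≤ 16) {a b c : ℕ}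
    (h : distinct n [a, b, c] = true) :
    Holds χ pt (orient a b c) ↔ χ (pt a) (pt b) (pt c) := by
  have hd := nodup_map_of_distinct hpt h
  have hl := lt_of_distinct hn h
  simp only [List.map_cons, List.map_nil, List.nodup_cons, List.mem_cons, List.not_mem_nil,
    or_false, not_or, forall_eq_or_imp, forall_eq] at hd hl
  obtain ⟨ha, hb, hc⟩ := hl
  have s1 := hχ.swap_iff (a := pt a) (b := pt b) (c := pt c) (by tauto) (by tauto) (by tauto)
  have r1 := hχ.rotate_iff (pt a) (pt b) (pt c)
  have r2 := hχ.rotate_iff (pt b) (pt c) (pt a)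
  have r3 := hχ.rotate_iff (pt b) (pt a) (pt c)
  have r4 := hχ.rotate_iff (pt a) (pt c) (pt b)
  simp only [orient]
  cases Nat.blt a b <;> cases Nat.blt b c <;> cases Nat.blt a c <;>
    simp only [cond_true, cond_false, holds_orient_code, *] <;> tauto

theorem holds_cross (hχ : IsPattern G χ) (hpt : Set.InjOn pt {i | i < n}) (hn : n ≤ 16)
    {a b c d : ℕ} (h : distinct n [a, b, c, d] = true) :
    Holds χ pt (cross a b c d) ↔ Crosses χ (pt a) (pt b) (pt c) (pt d) := by
  have hd := nodup_map_of_distinct hpt h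
  have hl := lt_of_distinct hn h
  simp only [List.map_cons, List.map_nil] at hd
  simp only [List.mem_cons, List.not_mem_nil, or_false, forall_eq_or_imp, forall_eq] at hl
  obtain ⟨ha, hb, hc, hd'⟩ := hl
  have s1 := hχ.crosses_swap hd
  have s2 := hχ.crosses_swap (a := pt c) (b := pt d) (c := pt a) (d := pt b) (by
    simp only [List.nodup_cons, List.mem_cons, List.not_mem_nil, or_false, not_or] at hd ⊢; grind)
  have s3 := hχ.crosses_swap (a := pt c) (b := pt d) (c := pt b) (d := pt a) (by
    simp only [List.nodup_cons, List.mem_cons, List.not_mem_nil, or_false, not_or] at hd ⊢; grind)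
  have c1 := crosses_comm (χ := χ) (a := pt a) (b := pt b) (c := pt c) (d := pt d)
  have c2 := crosses_comm (χ := χ) (a := pt b) (b := pt a) (c := pt c) (d := pt d)
  have c3 := crosses_comm (χ := χ) (a := pt a) (b := pt b) (c := pt d) (d := pt c)
  have c4 := crosses_comm (χ := χ) (a := pt b) (b := pt a) (c := pt d) (d := pt c)
  simp only [cross]
  generalize Nat.blt a b = b1
  generalize Nat.blt c d = b2
  generalize Nat.blt a c = b3
  generalize Nat.blt a d = b4
  generalize Nat.blt b c = b5
  generalize Nat.blt b d = b6
  cases b1 <;> cases b2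
  · cases b6 <;> (simp only [cond_true, cond_false, holds_cross_code, *]; try tauto)
  · cases b5 <;> simp only [cond_true, cond_false, holds_cross_code, *]
  · cases b4 <;> (simp only [cond_true, cond_false, holds_cross_code, *]; try tauto)
  · cases b3 <;> simp only [cond_true, cond_false, holds_cross_code, *]

theorem holds_inside (hχ : IsPattern G χ) (hpt : Set.InjOn pt {i | i < n}) (hn : n ≤ 16)
    {a b c x : ℕ} (h : distinct n [a, b, c, x] = true) :
    Holds χ pt (inside a b c x) ↔ Inside χ (pt a) (pt b) (pt c) (pt x) := by
  have hd := nodup_map_of_distinct hpt h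
  have hl := lt_of_distinct hn h
  simp only [List.map_cons, List.map_nil] at hd
  simp only [List.mem_cons, List.not_mem_nil, or_false, forall_eq_or_imp, forall_eq] at hl
  obtain ⟨ha, hb, hc, hx⟩ := hl
  have s1 := hχ.inside_swap hd
  have r1 := inside_rotate (χ := χ) (a := pt a) (b := pt b) (c := pt c) (x := pt x)
  have r2 := inside_rotate (χ := χ) (a := pt b) (b := pt c) (c := pt a) (x := pt x)
  have r3 := inside_rotate (χ := χ) (a := pt b) (b := pt a) (c := pt c) (x := pt x)
  have r4 := inside_rotate (χ := χ) (a := pt a) (b := pt c) (c := pt b) (x := pt x)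
  simp only [inside]
  cases Nat.blt a b <;> cases Nat.blt b c <;> cases Nat.blt a c <;>
    simp only [cond_true, cond_false, holds_inside_code, *]

/-- Every clause of the basic kinds is satisfied in a pattern. -/
theorem exists_holds_of_mem_kinds (hχ : IsPattern G χ) (hpt : Set.InjOn pt {i | i < n}) (hn : n ≤ 16)
    {adj : ℕ → ℕ → Bool} (hadj : ∀ i j, i < n → j < n → adj i j = true → G.Adj (pt i) (pt j)) :
    ∀ f ∈ kinds n adj, ∀ d : ℕ → ℕ, (∀ i, d i < 16) → ∃ l ∈ f d, Holds χ pt l := by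
  simp only [kinds, List.mem_cons, List.not_mem_nil, or_false, forall_eq_or_imp, forall_eq]
  refine ⟨?_, ?_, ?_, ?_, ?_, ?_, ?_, ?_, ?_, ?_, ?_⟩ <;> rintro d - <;>
    refine exists_mem_guard fun h => ?_
  all_goals
    simp only [List.mem_cons, List.not_mem_nil, or_false, exists_eq_or_imp, exists_eq_left, holds_neg]
  · have hd := distinct_iff.1 h
    simp only [List.nodup_cons, List.mem_cons, List.not_mem_nil, or_false, not_or,
      forall_eq_or_imp, forall_eq] at hd
    simp (disch := (rw [distinct_iff]; simp; grind)) only [holds_orient hχ hpt hn]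
    have := hχ.interior (pt (d 0)) (pt (d 1)) (pt (d 2)) (pt (d 3))
    tauto
  · have hd := distinct_iff.1 h
    simp only [List.nodup_cons, List.mem_cons, List.not_mem_nil, or_false, not_or,
      forall_eq_or_imp, forall_eq] at hd
    simp (disch := (rw [distinct_iff]; simp; grind)) only [holds_orient hχ hpt hn]
    have := hχ.trans (pt (d 0)) (pt (d 1)) (pt (d 2)) (pt (d 3)) (pt (d 4))
    tauto
  · simp only [Bool.and_eq_true, and_assoc] at h
    obtain ⟨h, h1, h2, h3⟩ := h
    have hd := distinct_iff.1 h
    simp only [List.nodup_cons, List.mem_cons, List.not_mem_nil, or_false, not_or,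
      forall_eq_or_imp, forall_eq] at hd
    simp (disch := (rw [distinct_iff]; simp; grind)) only [holds_cross hχ hpt hn]
    have := hχ.fan _ _ _ _ _ (nodup_map_of_distinct hpt h) (hadj _ _ (by tauto) (by tauto) h1)
      (hadj _ _ (by tauto) (by tauto) h2) (hadj _ _ (by tauto) (by tauto) h3)
    tauto
  · simp only [Bool.and_eq_true, and_assoc] at h
    obtain ⟨h, h1, h2, h3, h4⟩ := h
    have hd := distinct_iff.1 h
    simp only [List.nodup_cons, List.mem_cons, List.not_mem_nil, or_false, not_or,
      forall_eq_or_imp, forall_eq] at hd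
    simp (disch := (rw [distinct_iff]; simp; grind)) only [holds_cross hχ hpt hn, holds_orient hχ hpt hn]
    have := hχ.corner₁ _ _ _ _ _ _ (nodup_map_of_distinct hpt h) (hadj _ _ (by tauto) (by tauto) h1)
      (hadj _ _ (by tauto) (by tauto) h2) (hadj _ _ (by tauto) (by tauto) h3)
      (hadj _ _ (by tauto) (by tauto) h4)
    tauto
  · simp only [Bool.and_eq_true, and_assoc] at h
    obtain ⟨h, h1, h2, h3, h4⟩ := h
    have hd := distinct_iff.1 h
    simp only [List.nodup_cons, List.mem_cons, List.not_mem_nil, or_false, not_or,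
      forall_eq_or_imp, forall_eq] at hd
    simp (disch := (rw [distinct_iff]; simp; grind)) only [holds_cross hχ hpt hn, holds_orient hχ hpt hn]
    have := hχ.corner₁ _ _ _ _ _ _ (nodup_map_of_distinct hpt h) (hadj _ _ (by tauto) (by tauto) h1)
      (hadj _ _ (by tauto) (by tauto) h2) (hadj _ _ (by tauto) (by tauto) h3)
      (hadj _ _ (by tauto) (by tauto) h4)
    tauto
  · simp only [Bool.and_eq_true, and_assoc] at h
    obtain ⟨h, h1, h2, h3, h4⟩ := h
    have hd := distinct_iff.1 h
    simp only [List.nodup_cons, List.mem_cons, List.not_mem_nil, or_false, not_or,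
      forall_eq_or_imp, forall_eq] at hd
    simp (disch := (rw [distinct_iff]; simp; grind)) only [holds_cross hχ hpt hn, holds_orient hχ hpt hn]
    have := hχ.corner₂ _ _ _ _ _ _ (nodup_map_of_distinct hpt h) (hadj _ _ (by tauto) (by tauto) h1)
      (hadj _ _ (by tauto) (by tauto) h2) (hadj _ _ (by tauto) (by tauto) h3)
      (hadj _ _ (by tauto) (by tauto) h4)
    tauto
  · simp only [Bool.and_eq_true, and_assoc] at h
    obtain ⟨h, h1, h2, h3, h4⟩ := h
    have hd := distinct_iff.1 h
    simp only [List.nodup_cons, List.mem_cons, List.not_mem_nil, or_false, not_or,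
      forall_eq_or_imp, forall_eq] at hd
    simp (disch := (rw [distinct_iff]; simp; grind)) only [holds_cross hχ hpt hn, holds_orient hχ hpt hn]
    have := hχ.corner₂ _ _ _ _ _ _ (nodup_map_of_distinct hpt h) (hadj _ _ (by tauto) (by tauto) h1)
      (hadj _ _ (by tauto) (by tauto) h2) (hadj _ _ (by tauto) (by tauto) h3)
      (hadj _ _ (by tauto) (by tauto) h4)
    tauto
  · have hd := distinct_iff.1 h
    simp only [List.nodup_cons, List.mem_cons, List.not_mem_nil, or_false, not_or,
      forall_eq_or_imp, forall_eq] at hd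
    simp (disch := (rw [distinct_iff]; simp; grind)) only [holds_cross hχ hpt hn, holds_orient hχ hpt hn]
    unfold Crosses
    tauto
  · have hd := distinct_iff.1 h
    simp only [List.nodup_cons, List.mem_cons, List.not_mem_nil, or_false, not_or,
      forall_eq_or_imp, forall_eq] at hd
    simp (disch := (rw [distinct_iff]; simp; grind)) only [holds_cross hχ hpt hn, holds_orient hχ hpt hn]
    unfold Crosses
    tauto
  · have hd := distinct_iff.1 h
    simp only [List.nodup_cons, List.mem_cons, List.not_mem_nil, or_false, not_or,
      forall_eq_or_imp, forall_eq] at hd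
    simp (disch := (rw [distinct_iff]; simp; grind)) only [holds_inside hχ hpt hn, holds_orient hχ hpt hn]
    unfold Inside
    tauto
  · have hd := distinct_iff.1 h
    simp only [List.nodup_cons, List.mem_cons, List.not_mem_nil, or_false, not_or,
      forall_eq_or_imp, forall_eq] at hd
    simp (disch := (rw [distinct_iff]; simp; grind)) only [holds_inside hχ hpt hn, holds_orient hχ hpt hn]
    unfold Inside
    tauto

end

end Refutation

namespace Refutation

variable {V : Type*} {χ : V → V → V → Prop} {G : SimpleGraph V}

/-- The adjacency relation with a given list of edges. -/
def adjOf (E : List (ℕ × ℕ)) (i j : ℕ) : Bool :=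
  E.any fun e => (Nat.beq e.1 i && Nat.beq e.2 j) || (Nat.beq e.1 j && Nat.beq e.2 i)

theorem adj_of_adjOf {E : List (ℕ × ℕ)} {pt : ℕ → V} (hE : ∀ e ∈ E, G.Adj (pt e.1) (pt e.2))
    {i j : ℕ} (h : adjOf E i j = true) : G.Adj (pt i) (pt j) := by
  simp only [adjOf, List.any_eq_true, Bool.or_eq_true, Bool.and_eq_true, Nat.beq_eq] at h
  obtain ⟨e, he, ⟨rfl, rfl⟩ | ⟨rfl, rfl⟩⟩ := h
  exacts [hE e he, (hE e he).symm]

theorem injOn_getD {l : List V} (hl : l.Nodup) (v : V) :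
    Set.InjOn (fun i => l.getD i v) {i | i < l.length} := by
  intro i hi j hj hij
  simp only [Set.mem_ofPred_eq] at hi hj
  simpa [List.getD_eq_getElem?_getD, List.getElem?_eq_getElem, hi, hj, hl.getElem_inj_iff] using hij

/-- A statement about the orientations of numbered points. -/
inductive Fact
  | orient (a b c : ℕ)
  | cross (a b c d : ℕ)
  | inside (a b c x : ℕ)
  | not (f : Fact)

namespace Fact

/-- The points that a fact is about are distinct and have numbers less than `n`. -/
def wf (n : ℕ) : Fact → Bool
  | orient a b c => distinct n [a, b, c]
  | cross a b c d => distinct n [a, b, c, d]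
  | inside a b c x => distinct n [a, b, c, x]
  | not f => f.wf n

/-- The literal that expresses a fact. -/
def code : Fact → ℕ
  | orient a b c => Refutation.orient a b c
  | cross a b c d => Refutation.cross a b c d
  | inside a b c x => Refutation.inside a b c x
  | not f => neg f.code

/-- The meaning of a fact. -/
def Means (χ : V → V → V → Prop) (pt : ℕ → V) : Fact → Prop
  | orient a b c => χ (pt a) (pt b) (pt c)
  | cross a b c d => Crosses χ (pt a) (pt b) (pt c) (pt d)
  | inside a b c x => Inside χ (pt a) (pt b) (pt c) (pt x)
  | not f => ¬f.Means χ pt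

theorem holds_code {n : ℕ} {pt : ℕ → V} (hχ : IsPattern G χ) (hpt : Set.InjOn pt {i | i < n})
    (hn : n ≤ 16) : ∀ {f : Fact}, f.wf n = true → (Holds χ pt f.code ↔ f.Means χ pt)
  | orient _ _ _, h => holds_orient hχ hpt hn h
  | cross _ _ _ _, h => holds_cross hχ hpt hn h
  | inside _ _ _ _, h => holds_inside hχ hpt hn h
  | not f, h => (holds_neg _).trans (not_congr (f.holds_code hχ hpt hn h))

end Fact

/-- Whether the tree refutes clauses of facts about `n` points, for clauses of the kinds `ks`. -/
def Tree.refutes (n : ℕ) (ks : List ((ℕ → ℕ) → List ℕ)) (ex : List (List Fact)) (t : Tree) : Bool :=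
  (ex.all fun c => c.all fun f => f.wf n) && t.check (clause ks (ex.map fun c => c.map Fact.code)) 0

theorem Tree.false_of_refutes {n : ℕ} {pt : ℕ → V} {ks : List ((ℕ → ℕ) → List ℕ)}
    {ex : List (List Fact)} {t : Tree} (ht : t.refutes n ks ex = true) (hχ : IsPattern G χ)
    (hpt : Set.InjOn pt {i | i < n}) (hn : n ≤ 16)
    (hks : ∀ f ∈ ks, ∀ d : ℕ → ℕ, (∀ i, d i < 16) → ∃ l ∈ f d, Holds χ pt l)
    (hex : ∀ c ∈ ex, ∃ f ∈ c, f.Means χ pt) : False := by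
  simp only [Tree.refutes, Bool.and_eq_true, List.all_eq_true] at ht
  refine t.false_of_check hks (fun c hc => ?_) ht.2
  obtain ⟨c, hc', rfl⟩ := List.mem_map.1 hc
  obtain ⟨f, hf, hm⟩ := hex c hc'
  exact ⟨f.code, List.mem_map_of_mem hf, (Fact.holds_code hχ hpt hn (ht.1 c hc' f hf)).2 hm⟩

/-- A refutation for a list of points, some of which are joined by edges. -/
theorem Tree.false_of_points {n : ℕ} {E : List (ℕ × ℕ)} {ex : List (List Fact)} {t : Tree}
    (ht : t.refutes n (kinds n (adjOf E)) ex = true) (hχ : IsPattern G χ) (v : V) {l : List V}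
    (hl : l.Nodup) (hn : l.length = n) (hn' : n ≤ 16)
    (hE : ∀ e ∈ E, G.Adj (l.getD e.1 v) (l.getD e.2 v))
    (hex : ∀ c ∈ ex, ∃ f ∈ c, f.Means χ fun i => l.getD i v) : False := by
  subst hn
  exact t.false_of_refutes ht hχ (injOn_getD hl v) hn' (exists_holds_of_mem_kinds hχ (injOn_getD hl v)
    hn' fun _ _ _ _ h => adj_of_adjOf (pt := fun i => l.getD i v) hE h) hex

/-- In this and all later trees the hints congruent to 31 modulo 32 are the hypotheses of the
refutation, in their listed order; the others name instances of the general clauses. The number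
after a list of hints is the literal for the case distinction, here the orientation of the points 1,
2, 3. -/
def enterTriangle : Tree :=
  .node [31, 63, 95, 127, 159] 6408
   (.node [402441, 409641, 410112] 8456
    (.node [] 8320
     (.leaf [541194, 6832641, 548936, 4327521, 6561921])
     (.leaf [6816801, 549384, 4327521, 4588161, 548936]))
    (.node [] 8448
     (.leaf [295424, 6832641, 548936, 4327521, 549928])
     (.leaf [6824001, 549928, 4327521, 6423681, 549384])))
   (.node [410121, 409641, 287232] 8456
    (.node [] 8320
     (.leaf [541184, 6824961, 548904, 2361441, 549448])
     (.leaf [6832161, 549448, 2361441, 6554241, 549896]))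
    (.node [] 8448
     (.leaf [533514, 6824961, 548904, 2361441, 4595841])
     (.leaf [6816321, 549896, 2361441, 2491521, 548904])))

def crossSide : Tree :=
  .node [31, 63, 95, 8798722, 8798242] 6272
   (.node [548903] 8585
    (.leaf [426496, 133223])
    (.node [132743] 6408
     (.leaf [410122, 8659041, 549896, 6554241, 533514])
     (.node [] 8456
      (.leaf [549448, 6554241, 549896, 4597761, 8790081])
      (.leaf [4720161, 533514, 4597761, 6816321, 549896]))))
   (.node [549383] 8584
    (.leaf [549376, 132743])
    (.node [133223] 6400
     (.leaf [402442, 8651361, 549928, 6561921, 541194])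
     (.node [] 8448
      (.leaf [548936, 6561921, 549928, 4589601, 8782401])
      (.leaf [4728321, 541194, 4589601, 6824001, 549928]))))

def staysInside : Tree :=
  .node [31, 63, 95] 6408
   (.leaf [402441, 409641, 410112, 548903, 540713, 295424, 533513])
   (.leaf [410121, 549383, 409641, 541193, 287232, 541184, 533513])

def fromApex : Tree :=
  .node [31, 63] 6408
   (.leaf [132199, 409641, 410112, 409639])
   (.leaf [132679, 410121, 287232, 410119])

end Refutation

/-! ### Edges and triangles of edges in a pattern -/

namespace IsPattern

open Refutation

variable {V : Type*} {χ : V → V → V → Prop} {G : SimpleGraph V}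

/-- An edge from the inside of a triangle to its outside crosses a side of the triangle. -/
theorem crosses_of_inside (hχ : IsPattern G χ) {a b c x y : V} (hn : [a, b, c, x, y].Nodup)
    (hab : G.Adj a b) (hbc : G.Adj b c) (hac : G.Adj a c) (hxy : G.Adj x y)
    (hx : Inside χ a b c x) (hy : ¬Inside χ a b c y) :
    Crosses χ x y a b ∨ Crosses χ x y b c ∨ Crosses χ x y c a := by
  by_contra! hc
  refine Tree.false_of_points (n := 5) (E := [(0, 1), (1, 2), (0, 2), (3, 4)])
    (ex := [[.inside 0 1 2 3], [.not (.inside 0 1 2 4)], [.not (.cross 3 4 0 1)],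
      [.not (.cross 3 4 1 2)], [.not (.cross 3 4 2 0)]])
    (t := enterTriangle) (by decide +kernel) hχ a hn rfl (by simp) (by simp [*]) ?_
  simp [Fact.Means, *]

/-- An edge that crosses a side of a triangle has an end inside. -/
theorem inside_of_crosses (hχ : IsPattern G χ) {a b c x y : V} (hn : [a, b, c, x, y].Nodup)
    (hab : G.Adj a b) (hbc : G.Adj b c) (hac : G.Adj a c) (hxy : G.Adj x y)
    (hc : Crosses χ x y a b) : Inside χ a b c x ∨ Inside χ a b c y := by
  -- An edge with both ends outside would pass through the triangle and cross two of its sides. Any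
  -- two sides have a common end, so `fan` forbids this; for segments without right angles the
  -- statement fails.
  by_contra! hc
  refine Tree.false_of_points (n := 5) (E := [(0, 1), (1, 2), (0, 2), (3, 4)])
    (ex := [[.cross 3 4 0 1], [.not (.inside 0 1 2 3)], [.not (.inside 0 1 2 4)]])
    (t := crossSide) (by decide +kernel) hχ a hn rfl (by simp) (by simp [*]) ?_
  simp [Fact.Means, *]

/-- An edge that crosses a side of a triangle has an end outside. -/
theorem not_inside_of_crosses (hχ : IsPattern G χ) {a b c x y : V} (hn : [a, b, c, x, y].Nodup)
    (hc : Crosses χ x y a b) (hx : Inside χ a b c x) : ¬Inside χ a b c y := by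
  intro hy
  refine Tree.false_of_points (n := 5) (E := [])
    (ex := [[.cross 3 4 0 1], [.inside 0 1 2 3], [.inside 0 1 2 4]])
    (t := staysInside) (by decide +kernel) hχ a hn rfl (by simp) (by simp [*]) ?_
  simp [Fact.Means, *]

/-- A segment from a vertex of a triangle that crosses the opposite side ends outside. -/
theorem not_inside_of_crosses_apex (hχ : IsPattern G χ) {a b c x : V} (hn : [a, b, c, x].Nodup)
    (hc : Crosses χ c x a b) : ¬Inside χ a b c x := by
  intro hy
  refine Tree.false_of_points (n := 4) (E := []) (ex := [[.cross 2 3 0 1], [.inside 0 1 2 3]])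
    (t := fromApex) (by decide +kernel) hχ a hn rfl (by simp) (by simp [*]) ?_
  simp [Fact.Means, *]

end IsPattern

namespace Refutation

variable {V : Type*} {χ : V → V → V → Prop} {G : SimpleGraph V}

/-- Kinds of clauses about edges and triangles of edges. -/
def triangleKinds (n : ℕ) (adj : ℕ → ℕ → Bool) : List ((ℕ → ℕ) → List ℕ) := [
  fun d => guard (distinct n [d 0, d 1, d 2, d 3, d 4] && adj (d 0) (d 1) && adj (d 1) (d 2) &&
      adj (d 0) (d 2) && adj (d 3) (d 4))
    [neg (inside (d 0) (d 1) (d 2) (d 3)), inside (d 0) (d 1) (d 2) (d 4),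
      cross (d 3) (d 4) (d 0) (d 1), cross (d 3) (d 4) (d 1) (d 2), cross (d 3) (d 4) (d 2) (d 0)],
  fun d => guard (distinct n [d 0, d 1, d 2, d 3, d 4] && adj (d 0) (d 1) && adj (d 1) (d 2) &&
      adj (d 0) (d 2) && adj (d 3) (d 4))
    [neg (cross (d 3) (d 4) (d 0) (d 1)), inside (d 0) (d 1) (d 2) (d 3),
      inside (d 0) (d 1) (d 2) (d 4)],
  fun d => guard (distinct n [d 0, d 1, d 2, d 3, d 4])
    [neg (cross (d 3) (d 4) (d 0) (d 1)), neg (inside (d 0) (d 1) (d 2) (d 3)),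
      neg (inside (d 0) (d 1) (d 2) (d 4))],
  fun d => guard (distinct n [d 0, d 1, d 2, d 3])
    [neg (cross (d 2) (d 3) (d 0) (d 1)), neg (inside (d 0) (d 1) (d 2) (d 3))]]

theorem exists_holds_of_mem_triangleKinds {n : ℕ} {pt : ℕ → V} (hχ : IsPattern G χ)
    (hpt : Set.InjOn pt {i | i < n}) (hn : n ≤ 16) {adj : ℕ → ℕ → Bool}
    (hadj : ∀ i j, i < n → j < n → adj i j = true → G.Adj (pt i) (pt j)) :
    ∀ f ∈ triangleKinds n adj, ∀ d : ℕ → ℕ, (∀ i, d i < 16) → ∃ l ∈ f d, Holds χ pt l := by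
  simp only [triangleKinds, List.mem_cons, List.not_mem_nil, or_false, forall_eq_or_imp, forall_eq]
  refine ⟨?_, ?_, ?_, ?_⟩ <;> rintro d - <;> refine exists_mem_guard fun h => ?_
  all_goals
    simp only [List.mem_cons, List.not_mem_nil, or_false, exists_eq_or_imp, exists_eq_left, holds_neg]
  · simp only [Bool.and_eq_true, and_assoc] at h
    obtain ⟨h, h1, h2, h3, h4⟩ := h
    have hd := distinct_iff.1 h
    simp only [List.nodup_cons, List.mem_cons, List.not_mem_nil, or_false, not_or,
      forall_eq_or_imp, forall_eq] at hd
    simp (disch := (rw [distinct_iff]; simp; grind)) only [holds_cross hχ hpt hn, holds_inside hχ hpt hn]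
    have := hχ.crosses_of_inside (nodup_map_of_distinct hpt h) (hadj _ _ (by tauto) (by tauto) h1)
      (hadj _ _ (by tauto) (by tauto) h2) (hadj _ _ (by tauto) (by tauto) h3) (hadj _ _ (by tauto) (by tauto) h4)
    tauto
  · simp only [Bool.and_eq_true, and_assoc] at h
    obtain ⟨h, h1, h2, h3, h4⟩ := h
    have hd := distinct_iff.1 h
    simp only [List.nodup_cons, List.mem_cons, List.not_mem_nil, or_false, not_or,
      forall_eq_or_imp, forall_eq] at hd
    simp (disch := (rw [distinct_iff]; simp; grind)) only [holds_cross hχ hpt hn, holds_inside hχ hpt hn]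
    have := hχ.inside_of_crosses (nodup_map_of_distinct hpt h) (hadj _ _ (by tauto) (by tauto) h1)
      (hadj _ _ (by tauto) (by tauto) h2) (hadj _ _ (by tauto) (by tauto) h3) (hadj _ _ (by tauto) (by tauto) h4)
    tauto
  · have hd := distinct_iff.1 h
    simp only [List.nodup_cons, List.mem_cons, List.not_mem_nil, or_false, not_or,
      forall_eq_or_imp, forall_eq] at hd
    simp (disch := (rw [distinct_iff]; simp; grind)) only [holds_cross hχ hpt hn, holds_inside hχ hpt hn]
    have := hχ.not_inside_of_crosses (nodup_map_of_distinct hpt h)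
    tauto
  · have hd := distinct_iff.1 h
    simp only [List.nodup_cons, List.mem_cons, List.not_mem_nil, or_false, not_or,
      forall_eq_or_imp, forall_eq] at hd
    simp (disch := (rw [distinct_iff]; simp; grind)) only [holds_cross hχ hpt hn, holds_inside hχ hpt hn]
    have := hχ.not_inside_of_crosses_apex (nodup_map_of_distinct hpt h)
    tauto

def twoInside : Tree :=
  .node [31, 63, 95] 8456
   (.node [533513, 540713, 541184] 137346
    (.leaf [2140258, 548903, 145105925, 145097766, 6963723])
    (.node [] 137474
     (.leaf [4237410, 549895, 145113606, 145097285, 6963723])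
     (.leaf [6832651, 4368482, 549447, 145113125, 145104966, 6963723])))
   (.node [541193, 540713, 295424] 137346
    (.leaf [2140258, 549383, 145105926, 145097765, 6963723])
    (.node [] 137474
     (.leaf [4237410, 548935, 145113605, 145097286, 6963723])
     (.leaf [6832651, 4368482, 549927, 145113126, 145104965, 6963723])))

def fourOutside : Tree :=
  .node [31, 63, 95, 127, 159] 137346
   (.node [2140258, 2148450, 2156642] 170242
    (.leaf [4246114, 4254306, 12993035, 15090187, 4385890])
    (.leaf [10895883, 4377186, 4385378, 12993035, 15090187, 4254818]))
   (.node [] 170242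
    (.leaf [4237410, 4246114, 4254306, 8798731, 4376674, 4384866, 12993035, 15090187, 2157666])
    (.node [] 137475
     (.leaf [8798731, 4368482, 4376674, 4384866, 10895883, 2148962, 2157154, 12993035, 15090187,
       4254818])
     (.node [4245602, 4253794] 170114
      (.leaf [2148962, 2157154, 12993035, 15090187, 4385890])
      (.leaf [10895883, 4377186, 4385378, 12993035, 15090187, 2157666]))))

end Refutation

namespace IsPattern

open Refutation

variable {V : Type*} {χ : V → V → V → Prop} {G : SimpleGraph V}

/-- A vertex with two neighbours inside a triangle is inside, too. -/
theorem inside_of_two_inside (hχ : IsPattern G χ) {a b c y x₁ x₂ : V}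
    (hn : [a, b, c, y, x₁, x₂].Nodup) (hab : G.Adj a b) (hbc : G.Adj b c) (hac : G.Adj a c)
    (h₁ : G.Adj y x₁) (h₂ : G.Adj y x₂) (i₁ : Inside χ a b c x₁) (i₂ : Inside χ a b c x₂) :
    Inside χ a b c y := by
  -- If y were outside, both edges would cross sides. They cannot cross the same side by `fan`. If
  -- they cross two sides with the common end a, the `corner` axioms put y into the angle at a; but
  -- from the part of this angle beyond the third side, a segment into the triangle crosses that
  -- third side instead.
  by_contra hc
  have hadj : ∀ e ∈ [(0, 1), (1, 2), (0, 2), (3, 4), (3, 5)],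
      G.Adj ([a, b, c, y, x₁, x₂].getD e.1 a) ([a, b, c, y, x₁, x₂].getD e.2 a) := by simp [*]
  have hpt := injOn_getD hn a
  refine Tree.false_of_refutes (n := 6) (t := twoInside) (pt := fun i => [a, b, c, y, x₁, x₂].getD i a)
    (ks := kinds 6 (adjOf [(0, 1), (1, 2), (0, 2), (3, 4), (3, 5)]) ++
      triangleKinds 6 (adjOf [(0, 1), (1, 2), (0, 2), (3, 4), (3, 5)]))
    (ex := [[.inside 0 1 2 4], [.inside 0 1 2 5], [.not (.inside 0 1 2 3)]]) (by decide +kernel)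
    hχ hpt (by simp) (fun f hf => ?_) ?_
  · exact (List.mem_append.1 hf).elim
      (exists_holds_of_mem_kinds hχ hpt (by simp) (fun _ _ _ _ h =>
        adj_of_adjOf (pt := fun i => [a, b, c, y, x₁, x₂].getD i a) hadj h) f)
      (exists_holds_of_mem_triangleKinds hχ hpt (by simp) (fun _ _ _ _ h =>
        adj_of_adjOf (pt := fun i => [a, b, c, y, x₁, x₂].getD i a) hadj h) f)
  · simp [Fact.Means, *]

/-- A vertex inside a triangle does not have four neighbours outside. -/
theorem not_four_outside (hχ : IsPattern G χ) {a b c y x₁ x₂ x₃ x₄ : V}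
    (hn : [a, b, c, y, x₁, x₂, x₃, x₄].Nodup) (hab : G.Adj a b) (hbc : G.Adj b c) (hac : G.Adj a c)
    (h₁ : G.Adj y x₁) (h₂ : G.Adj y x₂) (h₃ : G.Adj y x₃) (h₄ : G.Adj y x₄)
    (hy : Inside χ a b c y) :
    Inside χ a b c x₁ ∨ Inside χ a b c x₂ ∨ Inside χ a b c x₃ ∨ Inside χ a b c x₄ := by
  -- Pigeonhole: four edges from y would leave through three sides, so two edges with the common end
  -- y would cross the same side, against `fan`.
  by_contra! hc
  have hadj : ∀ e ∈ [(0, 1), (1, 2), (0, 2), (3, 4), (3, 5), (3, 6), (3, 7)],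
      G.Adj ([a, b, c, y, x₁, x₂, x₃, x₄].getD e.1 a) ([a, b, c, y, x₁, x₂, x₃, x₄].getD e.2 a) := by
    simp [*]
  have hpt := injOn_getD hn a
  refine Tree.false_of_refutes (n := 8) (t := fourOutside)
    (pt := fun i => [a, b, c, y, x₁, x₂, x₃, x₄].getD i a)
    (ks := kinds 8 (adjOf [(0, 1), (1, 2), (0, 2), (3, 4), (3, 5), (3, 6), (3, 7)]) ++
      triangleKinds 8 (adjOf [(0, 1), (1, 2), (0, 2), (3, 4), (3, 5), (3, 6), (3, 7)]))
    (ex := [[.inside 0 1 2 3], [.not (.inside 0 1 2 4)], [.not (.inside 0 1 2 5)],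
      [.not (.inside 0 1 2 6)], [.not (.inside 0 1 2 7)]]) (by decide +kernel)
    hχ hpt (by simp) (fun f hf => ?_) ?_
  · exact (List.mem_append.1 hf).elim
      (exists_holds_of_mem_kinds hχ hpt (by simp) (fun _ _ _ _ h =>
        adj_of_adjOf (pt := fun i => [a, b, c, y, x₁, x₂, x₃, x₄].getD i a) hadj h) f)
      (exists_holds_of_mem_triangleKinds hχ hpt (by simp) (fun _ _ _ _ h =>
        adj_of_adjOf (pt := fun i => [a, b, c, y, x₁, x₂, x₃, x₄].getD i a) hadj h) f)
  · simp [Fact.Means, *]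

end IsPattern

namespace Refutation

variable {V : Type*} {χ : V → V → V → Prop} {G : SimpleGraph V}

/-- Kinds of clauses about the neighbours of a vertex and a triangle of edges. -/
def neighborKinds (n : ℕ) (adj : ℕ → ℕ → Bool) : List ((ℕ → ℕ) → List ℕ) := [
  fun d => guard (distinct n [d 0, d 1, d 2, d 3, d 4, d 5] && adj (d 0) (d 1) && adj (d 1) (d 2) &&
      adj (d 0) (d 2) && adj (d 3) (d 4) && adj (d 3) (d 5))
    [neg (inside (d 0) (d 1) (d 2) (d 4)), neg (inside (d 0) (d 1) (d 2) (d 5)),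
      inside (d 0) (d 1) (d 2) (d 3)],
  fun d => guard (distinct n [d 0, d 1, d 2, d 3, d 4, d 5, d 6, d 7] && adj (d 0) (d 1) &&
      adj (d 1) (d 2) && adj (d 0) (d 2) && adj (d 3) (d 4) && adj (d 3) (d 5) && adj (d 3) (d 6) &&
      adj (d 3) (d 7))
    [neg (inside (d 0) (d 1) (d 2) (d 3)), inside (d 0) (d 1) (d 2) (d 4),
      inside (d 0) (d 1) (d 2) (d 5), inside (d 0) (d 1) (d 2) (d 6), inside (d 0) (d 1) (d 2) (d 7)]]

theorem exists_holds_of_mem_neighborKinds {n : ℕ} {pt : ℕ → V} (hχ : IsPattern G χ)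
    (hpt : Set.InjOn pt {i | i < n}) (hn : n ≤ 16) {adj : ℕ → ℕ → Bool}
    (hadj : ∀ i j, i < n → j < n → adj i j = true → G.Adj (pt i) (pt j)) :
    ∀ f ∈ neighborKinds n adj, ∀ d : ℕ → ℕ, (∀ i, d i < 16) → ∃ l ∈ f d, Holds χ pt l := by
  simp only [neighborKinds, List.mem_cons, List.not_mem_nil, or_false, forall_eq_or_imp, forall_eq]
  refine ⟨?_, ?_⟩ <;> rintro d - <;> refine exists_mem_guard fun h => ?_
  all_goals
    simp only [List.mem_cons, List.not_mem_nil, or_false, exists_eq_or_imp, exists_eq_left, holds_neg]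
  · simp only [Bool.and_eq_true, and_assoc] at h
    obtain ⟨h, h1, h2, h3, h4, h5⟩ := h
    have hd := distinct_iff.1 h
    simp only [List.nodup_cons, List.mem_cons, List.not_mem_nil, or_false, not_or,
      forall_eq_or_imp, forall_eq] at hd
    simp (disch := (rw [distinct_iff]; simp; grind)) only [holds_inside hχ hpt hn]
    have := hχ.inside_of_two_inside (nodup_map_of_distinct hpt h) (hadj _ _ (by tauto) (by tauto) h1)
      (hadj _ _ (by tauto) (by tauto) h2) (hadj _ _ (by tauto) (by tauto) h3) (hadj _ _ (by tauto) (by tauto) h4)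
      (hadj _ _ (by tauto) (by tauto) h5)
    tauto
  · simp only [Bool.and_eq_true, and_assoc] at h
    obtain ⟨h, h1, h2, h3, h4, h5, h6, h7⟩ := h
    have hd := distinct_iff.1 h
    simp only [List.nodup_cons, List.mem_cons, List.not_mem_nil, or_false, not_or,
      forall_eq_or_imp, forall_eq] at hd
    simp (disch := (rw [distinct_iff]; simp; grind)) only [holds_inside hχ hpt hn]
    have := hχ.not_four_outside (nodup_map_of_distinct hpt h) (hadj _ _ (by tauto) (by tauto) h1)
      (hadj _ _ (by tauto) (by tauto) h2) (hadj _ _ (by tauto) (by tauto) h3) (hadj _ _ (by tauto) (by tauto) h4)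
      (hadj _ _ (by tauto) (by tauto) h5) (hadj _ _ (by tauto) (by tauto) h6) (hadj _ _ (by tauto) (by tauto) h7)
    tauto

/-- All kinds of clauses. -/
def allKinds (n : ℕ) (adj : ℕ → ℕ → Bool) : List ((ℕ → ℕ) → List ℕ) :=
  kinds n adj ++ triangleKinds n adj ++ neighborKinds n adj

/-- A refutation of facts about the points `pt 0`, `pt 1`, … of a pattern. -/
theorem Tree.false_of_facts {n : ℕ} {E : List (ℕ × ℕ)} {ex : List (List Fact)} {t : Tree}
    (ht : t.refutes n (allKinds n (adjOf E)) ex = true) (hχ : IsPattern G χ) {pt : ℕ → V}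
    (hpt : Set.InjOn pt {i | i < n}) (hn : n ≤ 16) (hE : ∀ e ∈ E, G.Adj (pt e.1) (pt e.2))
    (hex : ∀ c ∈ ex, ∃ f ∈ c, f.Means χ pt) : False := by
  have hadj : ∀ i j, i < n → j < n → adjOf E i j = true → G.Adj (pt i) (pt j) :=
    fun _ _ _ _ h => adj_of_adjOf hE h
  refine t.false_of_refutes ht hχ hpt hn (fun f hf => ?_) hex
  rw [allKinds, List.mem_append, List.mem_append] at hf
  rcases hf with (hf | hf) | hf
  exacts [exists_holds_of_mem_kinds hχ hpt hn hadj f hf,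
    exists_holds_of_mem_triangleKinds hχ hpt hn hadj f hf,
    exists_holds_of_mem_neighborKinds hχ hpt hn hadj f hf]

end Refutation

namespace Refutation

variable {V : Type*} {χ : V → V → V → Prop} {G : SimpleGraph V}

/-! ### The augmented square antiprism

The vertices of the two quadrilaterals are numbered `0`, …, `7` in such a way that those with numbers
at distance at most two modulo `8` are adjacent; the central vertex has the number `8`. -/

/-- The edges of the augmented square antiprism. -/
def antiprismEdges : List (ℕ × ℕ) :=
  (List.range 8).flatMap fun j => [(j, (j + 1) % 8), (j, (j + 2) % 8), (j, 8)]

/-- The points `pt 0`, …, `pt 8` span an augmented square antiprism in `G`. -/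
def IsAntiprism (G : SimpleGraph V) (pt : ℕ → V) : Prop :=
  Set.InjOn pt {i | i < 9} ∧ ∀ e ∈ antiprismEdges, G.Adj (pt e.1) (pt e.2)

/-- The symmetries of the augmented square antiprism. -/
def symm (k : ℕ) (r : Bool) (i : ℕ) : ℕ :=
  bif Nat.ble 8 i then i else bif r then (k + 8 - i) % 8 else (i + k) % 8

theorem IsAntiprism.symm {pt : ℕ → V} (h : IsAntiprism G pt) {k : ℕ} (hk : k < 8) (r : Bool) :
    IsAntiprism G fun i => pt (symm k r i) := by
  have h1 : ∀ k < 8, ∀ r : Bool, ∀ i < 9, Refutation.symm k r i < 9 := by decide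
  have h2 : ∀ k < 8, ∀ r : Bool, ∀ i < 9, ∀ j < 9, Refutation.symm k r i = Refutation.symm k r j →
      i = j := by decide
  have h3 : ∀ k < 8, ∀ r : Bool, ∀ e ∈ antiprismEdges,
      adjOf antiprismEdges (Refutation.symm k r e.1) (Refutation.symm k r e.2) = true := by
    decide +kernel
  exact ⟨fun i hi j hj hij => h2 k hk r i hi j hj (h.1 (h1 k hk r i hi) (h1 k hk r j hj) hij),
    fun e he => adj_of_adjOf h.2 (h3 k hk r e he)⟩

/-- The images under symmetries of the fact that a point does not lie inside a triangle. -/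
def orbit (t : ℕ × ℕ × ℕ × ℕ) : List Fact :=
  (List.range 8).flatMap fun k => [false, true].map fun r =>
    .not (.inside (symm k r t.1) (symm k r t.2.1) (symm k r t.2.2.1) (symm k r t.2.2.2))

/-- The clauses given by facts. -/
def units (l : List Fact) : List (List Fact) := l.map fun f => [f]

theorem exists_means_of_mem_units {pt : ℕ → V} {l : List Fact} (h : ∀ f ∈ l, f.Means χ pt) :
    ∀ c ∈ units l, ∃ f ∈ c, f.Means χ pt := by
  intro c hc
  obtain ⟨f, hf, rfl⟩ := List.mem_map.1 hc
  exact ⟨f, List.mem_singleton_self f, h f hf⟩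

/-- To exclude that a point lies inside a triangle, up to symmetries. -/
theorem means_orbit {a b c x : ℕ} (ts : List (ℕ × ℕ × ℕ × ℕ)) (t : Tree)
    (ht : t.refutes 9 (allKinds 9 (adjOf antiprismEdges))
      ([.inside a b c x] :: units (ts.flatMap orbit)) = true)
    (hts : ∀ (pt : ℕ → V), IsAntiprism G pt → ∀ f ∈ ts.flatMap orbit, f.Means χ pt)
    (hχ : IsPattern G χ) (pt : ℕ → V) (hpt : IsAntiprism G pt) :
    ∀ f ∈ ((a, b, c, x) :: ts).flatMap orbit, f.Means χ pt := by
  intro f hf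
  rw [List.flatMap_cons, List.mem_append] at hf
  rcases hf with hf | hf
  · obtain ⟨k, hk, hf⟩ := List.mem_flatMap.1 hf
    obtain ⟨r, -, rfl⟩ := List.mem_map.1 hf
    -- The hypotheses on the points are invariant under the symmetries of the graph, so one
    -- refutation, applied to renumbered points, excludes a whole orbit.
    have hs := hpt.symm (List.mem_range.1 hk) r
    intro hin
    refine Tree.false_of_facts ht hχ hs.1 (by norm_num) hs.2 fun c hc => ?_
    rcases List.mem_cons.1 hc with rfl | hc
    · exact ⟨_, List.mem_singleton_self _, hin⟩
    · exact exists_means_of_mem_units (hts _ hs) c hc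
  · exact hts pt hpt f hf

def innerFar : Tree :=
  .node [31, 590350] 82053
   (.leaf [140837391, 176620047, 54329410064, 210436623])
   (.node [138871311, 141230607, 10883117, 11014189, 177013263, 212795919, 13173261, 13111341,
     13304333, 13242413, 13246733, 15532557, 852494, 790574, 983566] 14464
    (.node [983561, 929801, 69152, 61481, 1106441, 196841] 12417
     (.leaf [852009, 199680, 790569])
     (.node [852489, 790569, 53481, 200395] 115636
      (.leaf [105057999, 140840655, 45166825168, 174657231])
      (.node [] 178308
       (.leaf [212918799, 177005071, 174645775, 72081924624])
       (.node [] 207746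
        (.leaf [14723266, 14748354, 13246700, 17621515, 210428431, 14878914, 9232907])
        (.node [] 207754
         (.leaf [14854338, 14879426, 13241900, 17621515, 210428431, 14747842, 9232907])
         (.node [11330059, 17567276, 17572076] 17328
          (.node [1097960, 855562, 847913] 277290
           (.leaf [17746082, 13250796, 708846, 177016367, 10932460, 9113131, 174657071, 7015979,
             14845602])
           (.leaf [11341323, 212405775, 176623119, 105057807, 140840463]))
          (.node [1101352, 847914, 205590063] 148364
           (.leaf [140840495, 176623151, 210439727])
           (.leaf [212405807, 11341355, 17735874, 17737922, 855595, 9244203, 14844098]))))))))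
    (.node [983081, 929801, 200192, 192521, 1105961, 66281] 12416
     (.leaf [852489, 1059840, 790569])
     (.node [852009, 790569, 184553] 115636
      (.leaf [105057999, 140840655, 45166825168, 174657231])
      (.node [] 178308
       (.leaf [212918799, 177005071, 174645775, 72081924624])
       (.node [] 275338
        (.leaf [14878914, 14879426, 14862594, 210772197, 17567276, 11330059, 17359371, 9232907,
          14723266])
        (.node [] 211076
         (.leaf [17621515, 210428431, 14747842, 14748354, 9232907, 11330059, 14854338])
         (.node [13241900, 13246700, 17572076] 17328
          (.node [1098472, 855594, 205590063] 148364
           (.leaf [140840495, 176623151, 210439727])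
           (.leaf [212405807, 11341355, 17735874, 17737922, 855595, 9244203, 14844098]))
          (.node [1101320, 847882] 181124
           (.leaf [212405775, 176623119, 105057807, 140840463])
           (.node [11341323, 17746082, 708846, 10932460] 213900
            (.leaf [844553, 798473])
            (.leaf [13250796, 177016367, 9113131, 174657071, 14845602, 7015979]))))))))))

def outerFar : Tree :=
  .node [31, 127, 159, 319, 383, 415, 479, 721934, 2134188, 4377356] 213253
   (.leaf [177013775, 246219791, 174654479, 63491998736])
   (.node [212403215, 212796431, 176620559, 241370127] 4224
    (.node [196681, 151561, 328192, 1065001, 17449483] 10496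
     (.leaf [721929, 721920, 675849])
     (.node [720969, 675849] 10504
      (.leaf [1090600, 672266, 667658])
      (.leaf [675882, 5245473, 667658])))
    (.node [197641, 151561, 1065472, 1057801, 17449483] 17040
     (.leaf [721929, 1090560, 720969])
     (.node [675849, 1089608] 10368
      (.leaf [721418, 17041953, 721962])
      (.leaf [1089576, 664586, 721962]))))

def innerNear : Tree :=
  .node [31, 159, 575, 607, 959, 1023, 1055, 105447951, 8839436, 6607084] 137347
   (.leaf [8847883, 16942178, 16951394, 8839948, 105451055, 174657071, 4656683, 6610978, 14853218,
     4653579, 10948139, 6611212, 10883308, 172428815])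
   (.node [] 145540
    (.leaf [8839693, 138863119, 176611855, 277275151, 71509271056])
    (.leaf [8839692, 105439759, 174645775, 275309071, 71542694416]))

def outerNear : Tree :=
  .leaf [31, 95, 127, 415, 575, 1119, 1151, 1343, 11067660, 11022412, 4262540, 11076619]

def innerNext : Tree :=
  .node [31, 95, 447, 511, 543, 575, 1023, 1119, 1183, 1407, 1599, 1631, 8700172, 6603020,
    6598892, 8655084] 103434
   (.leaf [16942658, 6611724, 8716811, 8719915, 8708130])
   (.leaf [6619659, 6610978, 2131522, 6622763, 8716811, 8708876])

def outerNext : Tree :=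
  .leaf [31, 127, 351, 575, 607, 1151, 1631, 2399, 8794188, 4261996, 8848395, 8831244]

def evenOrOdd : Tree :=
  .node [31, 127, 159, 191, 223, 255, 287, 319, 351, 383, 415, 447, 479, 511, 543, 575, 607, 639,
    703, 735, 767, 799, 863, 927, 959, 991, 1055, 1087, 1183, 1215, 1247, 1279, 1343, 1375, 1407,
    1439, 1471, 1503, 1535, 1567, 1599, 1823, 1951, 1983, 2111, 2175, 2207, 2239, 2271, 2303,
    2367, 2431, 2495, 2687, 2751, 2815, 10883148, 10883276, 13119596, 13119724, 15356044,
    15352076, 12611756, 12608268, 14705420, 14717132, 14848204, 2131212, 14845196, 2142444,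
    4239596, 4237068, 4374796, 6471948, 6473996, 8708876, 8659212, 10896140, 13133068, 14692428,
    14732044, 4329708, 8719372, 15402540, 10948140] 240386
   (.leaf [15368386, 15401154, 12624610, 12651234, 15404044, 12652204, 15404171, 9244331, 3083275,
     12652075, 10930444, 13136044, 929799, 1052206, 14827788, 61482, 45026308, 45026310, 1101320,
     1106442, 196681, 132361, 218145507, 281029349, 961543, 53418, 848041, 192682, 1065472,
     1093128, 283803843, 252315845, 11536577, 823463, 1099776, 569449, 36938, 591529, 438410,
     540936, 684074, 17580161, 17719969, 960040, 275432581, 272688678, 10946635, 6489099, 6456588])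
   (.node [] 232194
    (.leaf [14861314, 14879746, 12649186, 191502, 14879756, 12652076, 14877707, 4263467, 855723,
      11471883, 61481, 12041, 79760934, 262919, 1056846, 4219660, 13167372, 15372492, 1100526,
      970761, 790055, 183818, 1065482, 197642, 328297, 159818, 170852549, 962759, 1109162,
      855722, 17574629, 251839494, 1098752, 708745, 1108512, 723145, 577706, 176234, 823370,
      680712, 9438401, 543752, 17719969, 274860102, 277669541, 8717867, 13175403, 8693516])
    (.node [] 205466
     (.leaf [10929282, 10947714, 13166242, 13174434, 10947724, 10946635, 15404171, 9244331,
       6456588, 15339724, 1100526, 12628204, 3083275, 12652075, 929799, 1052206, 14827788, 61482,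
       170836227, 1106442, 6489099, 272688678, 962759, 1109162, 855722, 946218, 962666, 277669541])
     (.node [] 275370
      (.leaf [15339724, 15372492, 3083275, 7015563, 14827788, 63, 10899596, 6489099, 2558027,
        6455362])
      (.node [11471883, 14860556] 4225
       (.leaf [20522, 1065000, 197642, 14877707, 4253218, 925767, 265774, 4263468, 6489099,
         273930, 331274, 61481, 12041, 12652075, 17098276, 17098278, 1066535, 402695, 6456588,
         3146977, 790759, 970762, 271500294, 1106119, 12628204, 1107488, 459913, 299114, 848041,
         1098752, 854761, 315530, 1109152, 820488, 9438401, 962666, 279840965, 11544289, 683560,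
         15404171, 277097062, 10930444, 10946635])
       (.node [196681, 6489100, 14877708] 268818
        (.leaf [8663148, 8693516, 329259, 13175403, 4252428, 95, 12652075])
        (.node [] 14465
         (.leaf [200202, 1105960, 61482, 4263467, 12652075, 1057799, 262919, 4219660, 238076932,
           1108999, 328297, 159818, 329257, 8717867, 541287, 168042, 8692322, 117604420,
           117604421, 6490188, 1081960, 8798977, 10946635, 1082368, 10930444, 53386, 15404171,
           279840965])
         (.node [] 16649
          (.leaf [270600, 328202])
          (.node [] 17288
           (.leaf [1057000, 1106442, 5300747, 320009, 1106504, 331306])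
           (.leaf [925960, 983562])))))))))

def standardFromCrossings : Tree :=
  .leaf [31, 63, 95, 127, 159, 223, 255, 287, 319, 351, 415, 447, 479, 511, 543, 575, 607, 639,
    671, 703, 735, 767, 799, 831, 863, 895, 927, 959, 991, 1023, 1055, 1087, 1119, 1151, 1183,
    1215, 1247, 1279, 1311, 1343, 1375, 1407, 1439, 1471, 1503, 1535, 1567, 1599, 1631, 1663,
    1695, 1727, 1759, 1791, 1823, 1855, 1887, 1919, 1951, 1983, 2015, 2047, 2079, 2111, 2143,
    2175, 2207, 2239, 2271, 2303, 2335, 2367, 2399, 2463, 2527, 2591, 2783, 2815, 2847, 2879,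
    2911, 2943, 2975, 3007, 3039, 3071, 3103, 3135, 3167, 3199, 3231, 3263, 115491076, 241304838,
    274439, 929799, 14877698, 14879746, 16836130, 16818914, 16827106, 14827778, 14835970,
    14844162, 14852354, 14860546, 45024262, 47121414, 170836227, 170836230, 44958981, 47056133,
    239209734, 241306886, 1052206, 69166, 17063970, 6488130, 6490178, 17072738, 17080930,
    6456578, 6464770, 6481154, 402695, 1065582, 329262, 17343586, 10945666, 10947714, 17352354,
    17360546, 10912002, 10912514, 10930434, 10938626, 170296580, 170296581, 682247, 1083054,
    592494, 17623202, 15401154, 15403202, 17604834, 15385346, 15386370, 241879300, 241879301,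
    168741126, 1100526, 855726, 8848396, 8798476, 10945548, 10947596, 11078668, 11059468,
    8663148, 8676108, 11077164, 11022444, 11035404, 13174316, 13119596, 13132556, 12595436,
    12641036, 13176364, 13119724, 13307436, 13250796, 13296396, 13305932, 13272332, 15403084,
    12611756, 12625676, 13136044, 15534700, 15495340, 15509260, 4206700, 4219660, 12650028,
    14747180, 14692460, 14705420, 14748812, 2164812, 2117772, 14878796, 2166444, 2142444,
    2157324, 4239596, 4254476, 4393580, 4354220, 4368140, 8679596, 4393996, 6622348, 6590668,
    6622764, 6566124, 6611724, 8663276, 8851116, 8827116, 8841996, 6619660, 6562060, 8659212,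
    13164812, 13307404, 13295884, 8848428, 8798988, 15532556, 15470636, 11077196, 11035916,
    13133068, 12595276, 14746668, 14692428, 13305964, 13272844, 2117740, 12626188, 15534732,
    15509772, 4223116, 4354188, 14732044, 6590636, 2157836, 4254988, 8696012, 8827084, 4329708,
    11063532, 11076620, 13173772, 8719372, 8850444, 13305388, 15402540, 10948140, 11079212,
    15534156, 13304844, 14748268, 15533612, 2165900, 14747724, 4394668, 2165356, 6622220,
    4394124, 8850988, 6622892, 8847884, 11079180, 11076652, 13304332, 13305420, 15533100,
    15534188, 14747212, 11076108, 8850956, 13304876, 15533644, 1056840, 1057801, 1074218, 329258,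
    16802859, 1109000, 1106442, 1106121, 61482, 16837803, 17097227, 17228299, 17359371, 17490443,
    17621515, 322731, 1109162, 855722, 17099787, 17580555, 17589291, 17082475, 17327147,
    17458219, 17720363, 1074312, 17362091, 16820331, 16951403, 17606763, 17737835, 1075273,
    1091690, 592490, 1091784, 16968875, 17231019, 1092745, 17361931, 16811595, 9104395, 16829067,
    16942667, 17222283, 16960139, 16968715, 3066507, 17091211, 17230859, 17187339, 17318411,
    3049035, 17711627, 17449483, 17466955, 191, 17598027]

/-- The triangles at the centre contain no point other than those that they have to. -/
def emptyTriangles : List (ℕ × ℕ × ℕ × ℕ) :=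
  [(8, 0, 2, 3), (8, 0, 1, 2), (8, 0, 2, 4), (8, 0, 1, 3), (8, 0, 2, 5), (8, 0, 1, 4)]

theorem means_emptyTriangles (hχ : IsPattern G χ) (pt : ℕ → V) (hpt : IsAntiprism G pt) :
    ∀ f ∈ emptyTriangles.flatMap orbit, f.Means χ pt := by
  -- Points are excluded from the triangles at the centre beginning with the far ones, and each
  -- refutation may use all orbits excluded before it. For the last two triangles of the form 8 0 2
  -- this makes propagation succeed without any case distinction. The point 1 is never excluded from
  -- the triangle 8 0 2, because it does lie there in the standard drawing.
  have h1 := means_orbit (χ := χ) (G := G) [] innerFar (a := 8) (b := 0) (c := 1) (x := 4)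
    (by decide +kernel) (by simp) hχ
  have h2 := means_orbit _ outerFar (a := 8) (b := 0) (c := 2) (x := 5) (by decide +kernel) h1 hχ
  have h3 := means_orbit _ innerNear (a := 8) (b := 0) (c := 1) (x := 3) (by decide +kernel) h2 hχ
  have h4 := means_orbit _ outerNear (a := 8) (b := 0) (c := 2) (x := 4) (by decide +kernel) h3 hχ
  have h5 := means_orbit _ innerNext (a := 8) (b := 0) (c := 1) (x := 2) (by decide +kernel) h4 hχ
  exact means_orbit _ outerNext (a := 8) (b := 0) (c := 2) (x := 3) (by decide +kernel) h5 hχ pt hpt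

/-- The crossings of the standard drawing. -/
def standardCrossings : List Fact :=
  [.cross 0 8 7 1, .cross 2 8 1 3, .cross 4 8 3 5, .cross 6 8 5 7]

/-- Triples of points in counterclockwise order in the standard drawing. -/
def standardOrients : List (ℕ × ℕ × ℕ) :=
  ((List.range 8).flatMap fun j => [(8, j, (j + 1) % 8), (8, j, (j + 2) % 8)]) ++
    [0, 2, 4, 6].flatMap fun j => [(j, (j + 2) % 8, j + 1), ((j + 7) % 8, j, j + 1)]

/-- Which edges cross in the standard drawing. -/
def standardCrosses : List Fact :=
  antiprismEdges.flatMap fun e => (antiprismEdges.filter fun f =>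
      distinct 9 [e.1, e.2, f.1, f.2]).map fun f =>
    bif standardCrossings.any fun g => Nat.beq g.code (cross e.1 e.2 f.1 f.2) then
      .cross e.1 e.2 f.1 f.2 else .not (.cross e.1 e.2 f.1 f.2)

/-- The triangles without points inside in the standard drawing. -/
def standardTriangles : List (ℕ × ℕ × ℕ) :=
  ((List.range 8).flatMap fun j => [(8, j, (j + 1) % 8), (j, (j + 1) % 8, (j + 2) % 8)]) ++
    [1, 3, 5, 7].map fun j => (8, j, (j + 2) % 8)

/-- That there are no points inside of these triangles. -/
def standardEmpty : List Fact :=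
  standardTriangles.flatMap fun t => ((List.range 9).filter fun x =>
    distinct 9 [t.1, t.2.1, t.2.2, x]).map fun x => .not (.inside t.1 t.2.1 t.2.2 x)

/-- The properties of the standard drawing of the augmented square antiprism, in which the
quadrilateral of the points with even numbers is the external one. -/
def standardFacts : List Fact :=
  standardOrients.map (fun t => .orient t.1 t.2.1 t.2.2) ++ standardCrosses ++ standardEmpty

/-- The points are drawn as in the standard drawing. -/
def IsStandard (χ : V → V → V → Prop) (pt : ℕ → V) : Prop :=
  ∀ f ∈ standardFacts, f.Means χ pt

theorem isStandard_of_crosses (hχ : IsPattern G χ) {pt : ℕ → V} (hpt : IsAntiprism G pt)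
    (h : χ (pt 8) (pt 0) (pt 1)) (hc : ∀ f ∈ standardCrossings, f.Means χ pt) :
    IsStandard χ pt := by
  intro f hf
  by_contra hn
  -- The negations of all standard facts form one clause, so a single refutation treats the failure
  -- of any of them.
  refine Tree.false_of_facts (n := 9) (E := antiprismEdges) (t := standardFromCrossings)
    (ex := units (.orient 8 0 1 :: standardCrossings) ++
      [standardFacts.map .not] ++ units (emptyTriangles.flatMap orbit)) (by decide +kernel)
    hχ hpt.1 (by norm_num) hpt.2 fun c hc' => ?_
  rw [List.mem_append, List.mem_append] at hc'
  rcases hc' with (hc' | hc') | hc'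
  · exact exists_means_of_mem_units (by simpa [Fact.Means, h] using hc) c hc'
  · rw [List.mem_singleton.1 hc']
    exact ⟨.not f, List.mem_map_of_mem hf, hn⟩
  · exact exists_means_of_mem_units (means_emptyTriangles hχ pt hpt) c hc'

/-- The graph does not distinguish its two quadrilaterals, since the rotation of the numbers by one
step exchanges them. The refutation leaves only these two possibilities: either all four spokes to
even numbers are crossed, or all four spokes to odd numbers. -/
theorem crosses_even_or_odd (hχ : IsPattern G χ) {pt : ℕ → V} (hpt : IsAntiprism G pt)
    (h : χ (pt 8) (pt 0) (pt 1)) : (∀ f ∈ standardCrossings, f.Means χ pt) ∨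
      ∀ f ∈ standardCrossings, f.Means χ fun i => pt (symm 1 false i) := by
  by_contra! hc
  refine Tree.false_of_facts (n := 9) (E := antiprismEdges) (t := evenOrOdd)
    (ex := [[.orient 8 0 1], standardCrossings.map .not,
      [.not (.cross 1 8 0 2), .not (.cross 3 8 2 4), .not (.cross 5 8 4 6), .not (.cross 7 8 6 0)]] ++
      units (emptyTriangles.flatMap orbit)) (by decide +kernel)
    hχ hpt.1 (by norm_num) hpt.2 fun c hc' => ?_
  rw [List.mem_append] at hc'
  obtain ⟨⟨f, hf, hf'⟩, ⟨g, hg, hg'⟩⟩ := hc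
  rcases hc' with hc' | hc'
  · simp only [List.mem_cons, List.not_mem_nil, or_false] at hc'
    rcases hc' with rfl | rfl | rfl
    · exact ⟨_, List.mem_singleton_self _, h⟩
    · exact ⟨.not f, List.mem_map_of_mem hf, hf'⟩
    · simp only [standardCrossings, List.mem_cons, List.not_mem_nil, or_false] at hg
      rcases hg with rfl | rfl | rfl | rfl
      · exact ⟨.not (.cross 1 8 0 2), by simp, hg'⟩
      · exact ⟨.not (.cross 3 8 2 4), by simp, hg'⟩
      · exact ⟨.not (.cross 5 8 4 6), by simp, hg'⟩
      · exact ⟨.not (.cross 7 8 6 0), by simp, hg'⟩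
  · exact exists_means_of_mem_units (means_emptyTriangles hχ pt hpt) c hc'

end Refutation

namespace Refutation

variable {V : Type*} {χ : V → V → V → Prop} {G : SimpleGraph V}

/-! ### Two augmented square antiprisms that are glued together -/

/-- Renumbering of the points in a fact. -/
def Fact.map (g : ℕ → ℕ) : Fact → Fact
  | orient a b c => orient (g a) (g b) (g c)
  | cross a b c d => cross (g a) (g b) (g c) (g d)
  | inside a b c x => inside (g a) (g b) (g c) (g x)
  | not f => not (f.map g)

theorem Fact.means_map {pt : ℕ → V} {g : ℕ → ℕ} :
    ∀ {f : Fact}, (f.map g).Means χ pt ↔ f.Means χ fun i => pt (g i)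
  | orient _ _ _ => Iff.rfl
  | cross _ _ _ _ => Iff.rfl
  | inside _ _ _ _ => Iff.rfl
  | not f => not_congr f.means_map

/-- The mirror image of a fact. -/
def Fact.mirror : Fact → Fact
  | orient a b c => orient b a c
  | cross a b c d => cross a b c d
  | inside a b c x => inside a b c x
  | not f => not f.mirror

theorem Fact.means_mirror {n : ℕ} {pt : ℕ → V} (hχ : IsPattern G χ) (hpt : Set.InjOn pt {i | i < n}) :
    ∀ {f : Fact}, f.wf n = true → (f.Means (fun a b c => χ b a c) pt ↔ f.mirror.Means χ pt)
  | orient _ _ _, _ => Iff.rfl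
  | cross a b c d, h => by
    have hn := nodup_map_of_distinct hpt h
    simp only [List.map_cons, List.map_nil, List.nodup_cons, List.mem_cons, List.not_mem_nil, or_false,
      not_or] at hn
    simp only [Means, mirror, Crosses]
    rw [hχ.swap_iff (a := pt a) (b := pt b) (c := pt c) (by tauto) (by tauto) (by tauto),
      hχ.swap_iff (a := pt a) (b := pt b) (c := pt d) (by tauto) (by tauto) (by tauto),
      hχ.swap_iff (a := pt c) (b := pt d) (c := pt a) (by tauto) (by grind) (by grind),
      hχ.swap_iff (a := pt c) (b := pt d) (c := pt b) (by tauto) (by grind) (by grind)]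
    tauto
  | inside a b c x, h => by
    have hn := nodup_map_of_distinct hpt h
    simp only [List.map_cons, List.map_nil, List.nodup_cons, List.mem_cons, List.not_mem_nil, or_false,
      not_or] at hn
    simp only [Means, mirror, Inside]
    rw [hχ.swap_iff (a := pt a) (b := pt b) (c := pt x) (by tauto) (by tauto) (by tauto),
      hχ.swap_iff (a := pt b) (b := pt c) (c := pt x) (by tauto) (by tauto) (by tauto),
      hχ.swap_iff (a := pt c) (b := pt a) (c := pt x) (by grind) (by tauto) (by tauto)]
    tauto
  | not f, h => not_congr (f.means_mirror hχ hpt h)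

theorem wf_standardFacts : ∀ f ∈ standardFacts, f.wf 9 = true := by
  have : (standardFacts.all fun f => f.wf 9) = true := by decide +kernel
  simpa [List.all_eq_true] using this

/-- The numbers of the points of the second antiprism; the points `0` and `2` are common. -/
def second (i : ℕ) : ℕ := [0, 9, 2, 10, 11, 12, 13, 14, 15].getD i 16

theorem wf_map_second : ∀ f ∈ standardFacts, (f.map second).wf 16 = true := by
  have : (standardFacts.all fun f => (f.map second).wf 16) = true := by decide +kernel
  simpa [List.all_eq_true] using this

theorem Fact.means_congr {n : ℕ} {pt pt' : ℕ → V} (h : ∀ i < n, pt i = pt' i) :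
    ∀ {f : Fact}, f.wf n = true → (f.Means χ pt ↔ f.Means χ pt')
  | orient a b c, hf => by
    have := (distinct_iff.1 hf).2
    simp only [List.mem_cons, List.not_mem_nil, or_false, forall_eq_or_imp, forall_eq] at this
    simp only [Means, h a this.1, h b this.2.1, h c this.2.2]
  | cross a b c d, hf => by
    have := (distinct_iff.1 hf).2
    simp only [List.mem_cons, List.not_mem_nil, or_false, forall_eq_or_imp, forall_eq] at this
    simp only [Means, h a this.1, h b this.2.1, h c this.2.2.1, h d this.2.2.2]
  | inside a b c d, hf => by
    have := (distinct_iff.1 hf).2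
    simp only [List.mem_cons, List.not_mem_nil, or_false, forall_eq_or_imp, forall_eq] at this
    simp only [Means, h a this.1, h b this.2.1, h c this.2.2.1, h d this.2.2.2]
  | not f, hf => not_congr (f.means_congr h hf)

theorem IsStandard.congr {pt pt' : ℕ → V} (h : ∀ i < 9, pt i = pt' i) (hs : IsStandard χ pt) :
    IsStandard χ pt' :=
  fun f hf => (Fact.means_congr h (wf_standardFacts f hf)).1 (hs f hf)

theorem IsPattern.swap_of_distinct {n : ℕ} {pt : ℕ → V} (hχ : IsPattern G χ)
    (hpt : Set.InjOn pt {i | i < n}) {a b c : ℕ} (h : distinct n [a, b, c] = true) :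
    χ (pt b) (pt a) (pt c) ↔ ¬χ (pt a) (pt b) (pt c) :=
  hχ.swap _ _ _ (nodup_map_of_distinct hpt h)

theorem means_mirror_standardCrossings (hχ : IsPattern G χ) {pt : ℕ → V} (hpt : IsAntiprism G pt) :
    (∀ f ∈ standardCrossings, f.Means (fun a b c => χ b a c) pt) ↔
      ∀ f ∈ standardCrossings, f.Means χ pt := by
  have hw : ∀ f ∈ standardCrossings, f.wf 9 = true ∧ f.mirror = f := by
    simp [standardCrossings, Fact.wf, Fact.mirror, distinct_iff]
  refine forall₂_congr fun f hf => ?_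
  rw [Fact.means_mirror hχ hpt.1 (hw f hf).1, (hw f hf).2]

/-- An augmented square antiprism is drawn in the standard way, up to symmetries. -/
theorem isStandard_or (hχ : IsPattern G χ) {pt : ℕ → V} (hpt : IsAntiprism G pt) :
    (IsStandard χ pt ∨ IsStandard (fun a b c => χ b a c) pt) ∨
      (IsStandard χ (fun i => pt (symm 1 false i)) ∨
        IsStandard (fun a b c => χ b a c) fun i => pt (symm 1 false i)) := by
  have hcr : ∀ (pt : ℕ → V), IsAntiprism G pt → (∀ f ∈ standardCrossings, f.Means χ pt) →
      IsStandard χ pt ∨ IsStandard (fun a b c => χ b a c) pt := by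
    intro pt hpt hc
    by_cases h : χ (pt 8) (pt 0) (pt 1)
    · exact Or.inl (isStandard_of_crosses hχ hpt h hc)
    · exact Or.inr (isStandard_of_crosses hχ.mirror hpt
        ((IsPattern.swap_of_distinct hχ hpt.1 (by decide)).2 h)
        ((means_mirror_standardCrossings hχ hpt).2 hc))
  have hs := hpt.symm (k := 1) (by norm_num) false
  by_cases h : χ (pt 8) (pt 0) (pt 1)
  · exact (crosses_even_or_odd hχ hpt h).imp (hcr pt hpt) (hcr _ hs)
  · refine (crosses_even_or_odd hχ.mirror hpt
      ((IsPattern.swap_of_distinct hχ hpt.1 (by decide)).2 h)).imp (fun k => hcr pt hpt ?_)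
      fun k => hcr _ hs ?_
    · exact (means_mirror_standardCrossings hχ hpt).1 k
    · exact (means_mirror_standardCrossings hχ hs).1 k

/-- The edges of two glued antiprisms. -/
def gluedEdges : List (ℕ × ℕ) :=
  antiprismEdges ++ antiprismEdges.map (fun e => (second e.1, second e.2)) ++ [(1, 9)]

/-- The points `pt 0`, …, `pt 15` span two augmented square antiprisms in `G` that are glued
along a side. -/
def IsGlued (G : SimpleGraph V) (pt : ℕ → V) : Prop :=
  Set.InjOn pt {i | i < 16} ∧ ∀ e ∈ gluedEdges, G.Adj (pt e.1) (pt e.2)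

theorem IsGlued.first {pt : ℕ → V} (h : IsGlued G pt) : IsAntiprism G pt :=
  ⟨h.1.mono fun _ hi => Nat.lt_trans hi (by norm_num), fun e he => h.2 e (by simp [gluedEdges, he])⟩

theorem IsGlued.second {pt : ℕ → V} (h : IsGlued G pt) : IsAntiprism G fun i => pt (second i) := by
  have h1 : ∀ i < 9, Refutation.second i < 16 := by decide
  have h2 : ∀ i < 9, ∀ j < 9, Refutation.second i = Refutation.second j → i = j := by decide
  exact ⟨fun i hi j hj hij => h2 i hi j hj (h.1 (h1 i hi) (h1 j hj) hij),
    fun e he => h.2 (Refutation.second e.1, Refutation.second e.2) (by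
      simp only [gluedEdges, List.mem_append, List.mem_map]
      exact Or.inl (Or.inr ⟨e, he, rfl⟩))⟩

/-- Exchanges the two antiprisms. -/
def exchange (i : ℕ) : ℕ := [0, 9, 2, 10, 11, 12, 13, 14, 15, 1, 3, 4, 5, 6, 7, 8].getD i 16

theorem IsGlued.exchange {pt : ℕ → V} (h : IsGlued G pt) : IsGlued G fun i => pt (exchange i) := by
  have h1 : ∀ i < 16, Refutation.exchange i < 16 := by decide
  have h2 : ∀ i < 16, ∀ j < 16, Refutation.exchange i = Refutation.exchange j → i = j := by decide
  have h3 : ∀ e ∈ gluedEdges,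
      adjOf gluedEdges (Refutation.exchange e.1) (Refutation.exchange e.2) = true := by
    decide +kernel
  exact ⟨fun i hi j hj hij => h2 i hi j hj (h.1 (h1 i hi) (h1 j hj) hij),
    fun e he => adj_of_adjOf h.2 (h3 e he)⟩

def notShifted : Tree :=
  .leaf [31, 63, 95, 479, 511, 543, 575, 1056840, 329258, 86050342, 98633254, 85993221, 98576133,
    16983042, 17032194, 4219661, 1246763, 2033195, 134520047152, 340985391]

def notSameSide : Tree :=
  .leaf [31, 63, 95, 127, 159, 479, 511, 543, 575, 639, 15391, 15423, 15455, 15487, 15519, 15839,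
    15871, 15903, 15935, 15999, 925960, 197642, 1065576, 5301797, 1187911, 299951654, 1909224,
    1303562, 1392200, 16854562, 17114658, 6488130, 6549570, 19072011, 31572770, 22274114,
    22278210, 31802146, 1246217, 1200137, 3400715, 492040195, 6546443, 103932943, 22217739,
    1050089, 356451343, 2032649]

def connectionCrosses : Tree :=
  .leaf [31, 63, 95, 127, 159, 479, 511, 543, 575, 639, 15903, 30751, 925960, 197642, 1065576,
    16854562, 17114658, 19072011, 1245257, 1183817, 1123328]

def separation : Tree :=
  .node [31, 63, 95, 127, 159, 191, 223, 255, 287, 319, 351, 383, 415, 447, 479, 511, 543, 575,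
    607, 639, 671, 703, 735, 767, 799, 895, 15391, 15423, 15455, 15487, 15519, 15551, 15583,
    15615, 15647, 15679, 15711, 15743, 15775, 15807, 15839, 15871, 15903, 15935, 15967, 15999,
    16031, 16063, 16095, 16127, 16159, 16255, 30751, 274439, 925960, 1049321, 197642, 196841,
    12361, 45024262, 47121414, 66211845, 66195526, 44958981, 47056133, 132359, 1056839, 1049641,
    327721, 1065576, 413735, 328297, 151657, 272135, 1058377, 42401861, 44499013, 42352902,
    44450054, 553031, 460874, 290953, 100862022, 119736390, 100813061, 119687429, 411911,
    1074311, 1067113, 1083048, 430249, 139502182, 722473, 1075849, 113968261, 831623, 724106,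
    170331270, 172428422, 172395781, 691463, 1084585, 854185, 1100520, 854761, 210822822,
    202416869, 831239, 985705, 1093321, 168757445, 170854597, 921799, 970762, 847881, 986281,
    239275013, 241372165, 253955077, 243990726, 239209734, 241306886, 253889798, 1108999, 966919,
    1097961, 68841, 921641, 69161, 5301797, 200361, 318922246, 318905925, 287368742, 299951654,
    83963428, 297806565, 299903717, 17114659, 277114405, 287600165, 300183077, 1196519, 1916424,
    2039881, 1203722, 1187785, 127945, 329114629, 331211781, 328992230, 331089382, 2040839,
    1187399, 270121, 124201, 1332199, 1385960, 1303881, 326492230, 328589382, 326386149,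
    328483301, 1525223, 2049385, 1408586, 390441, 336852549, 338949701, 366212677, 336746470,
    338843622, 1335143, 2053703, 2062664, 2061705, 1439625, 375362373, 364504422, 1808359,
    1687402, 408288101, 422968165, 408255462, 1671079, 1802121, 2080136, 2079177, 461362565,
    438277062, 1810375, 1703209, 1941417, 404617126, 423491494, 1842151, 2087433, 1964554,
    1834377, 473168390, 475265542, 492042758, 494526885, 473045989, 475143141, 491920357,
    2081191, 1949191, 1827273, 114633, 1973545, 6280486, 1962825, 135751, 507626277, 505533733,
    520213797, 505493958, 515979718, 518076870, 520174022, 503661350, 505765158, 520445222,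
    505755973, 509950277, 512047429, 520436037, 1331753, 19063810, 19121154, 19030082, 19087426,
    17114662, 83963429, 1187918, 266798, 19072013, 205838, 19129357, 17198, 14877698, 14888962,
    14929922, 14938114, 16836130, 16854562, 16818914, 14827778, 14835970, 14844162, 14852354,
    14860546, 7402021, 14827789, 14860557, 6426701, 15401995, 15533067, 20907019, 3269643,
    17114658, 6488130, 6490178, 6549570, 17080930, 6456578, 6464770, 78672422, 82866726, 6456589,
    3343947, 17589291, 6882315, 10899597, 2164811, 3344459, 10912514, 10938626, 10930445, 927399,
    15372493, 6491275, 6622347, 15401154, 15339725, 14879339, 2427915, 2558987, 3345419, 459497,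
    2614283, 250377, 1180711, 1204809, 3082315, 3089419, 3138571, 30663170, 30663682, 30665730,
    30666242, 30666754, 31572770, 31577378, 31560642, 30556642, 30622178, 30630370, 30638562,
    30646754, 23053094, 30556653, 30646765, 22158925, 31056907, 31187979, 22274114, 22274626,
    22278210, 22279746, 31802146, 31822658, 22242786, 22250978, 98517797, 22242797, 19133515,
    22537227, 26500973, 19002955, 19134027, 20837963, 26571746, 26597346, 26589165, 1938727,
    1915207, 1308041, 31031213, 21363563, 22281067, 31056290, 31044578, 31045090, 30941101,
    26606891, 19134987, 19266059, 20314635, 31061291, 20201995, 20251659, 20726283, 20775947,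
    3345931, 19135499, 918313, 11076620, 11014220, 11026700, 13242444, 13254924, 13111372,
    13123852, 32772172, 33296460, 33308940, 17178188, 17187308, 17702476, 17711596, 6227499,
    17082475, 11339851, 12616972, 14700684, 14714124, 18942028, 18908428, 7015979, 14748811,
    2165900, 4376844, 4231372, 4245772, 11078667, 6622220, 6603020, 8655052, 8700172, 19205132,
    19140812, 19185932, 8786124, 26731532, 26615372, 26624492, 28959756, 28843596, 28852716,
    5371179, 31823691, 26998347, 2225740, 2188780, 27354604, 29384556, 29451756, 29490027,
    4292524, 4306924, 19249132, 19004268, 18972588, 26737163, 4454924, 4333484, 4432364,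
    21363212, 21340652, 23338924, 23437804, 24387500, 17091211, 16820331, 16829067, 17099947,
    16837803, 17099787, 17359371, 17097227, 4792843, 5317131, 9232907, 17318411, 12608555,
    4653579, 16811595, 17598027, 861227, 31561547, 31841163, 31579019, 5710347, 31840779,
    33018379, 31838731, 33235979, 32973835, 24891915, 1778731, 2040875, 31552587, 33256523,
    17703212, 18884172, 165451, 71975208528, 15500876, 4399564, 32842796, 1274955, 136132260944,
    31159372, 4661771, 14845516, 14829676, 16926828, 16934028, 14714444, 17729100, 17713260,
    4647947, 30635084, 30562124, 32659276, 32720236, 29455436, 33387596, 33314636, 5626379,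
    8786476, 72618811920, 4645387, 6622763, 3081803, 6884907, 6881803, 4785707, 17219820,
    5624331, 20837451, 21364011, 22543659, 5764395, 32874956, 3311179, 10883628, 11014700,
    15340076, 72654594576, 17228300, 72081924624, 4206828, 6229547, 14747211, 11079212, 11077164,
    11035404, 32887308, 136220103184, 29488203, 4276172, 5373227, 26737964, 26735916, 26694636,
    3345003, 3346091, 13111852, 13242924, 10887404, 11018476, 13296140, 13241900, 13246700,
    17490444, 17441004, 331467, 18894956, 6490763, 16951403, 26550732, 26681804, 28843308,
    28910028, 33149452, 33104332, 2225228, 2121548, 392619, 22280555, 32741195, 3345547,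
    14879915, 13307403, 14748843, 3082891, 3345035, 2124428, 2131628, 4368492, 4352652, 3319915,
    30669707, 28965899, 29490059, 5579275, 20838763, 18962796, 18969996, 19240780, 19224940,
    3345579, 10948107, 14748299, 9060875, 9110027, 182923, 2165355, 8798731, 4393067, 26606603,
    24453644, 29489515, 24716299, 19003723, 24454155, 6622731, 12619948, 17433644, 17440844,
    15401484, 4361388, 16944300, 3328651, 17178700, 2164843, 3344491, 21363723, 27361164,
    28840524, 33104908, 33034828, 32842764, 4394508, 19205644, 19140844, 12652203, 2427531,
    2428075, 330347, 331435, 11338251, 4261419, 4333516, 19266572, 27393419, 19266443, 391499,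
    391531, 392587, 22954507, 4322603, 992299, 5431819, 15803403, 15532556, 1909803, 32653836,
    32637996, 33309196, 259371, 15479372, 15483692, 16912972, 16924972, 191659, 31138860,
    136824038448, 258635, 4452875, 4455723, 17036588, 16990028, 5434379, 5443275, 3337387,
    5440011, 5443115, 1246251, 1246763, 4455851, 28910636, 31007788, 33104940, 136253482032,
    17038636, 16990156, 20251147, 20775435, 32706092, 32649452, 32695052, 20907051, 32704044,
    32649324, 2227628, 4447115, 4455307, 30949899, 4455819, 4454731, 24454188, 26682412,
    32973868, 33358891, 3142219, 20906507, 31469644, 32834603, 2617867, 2218892, 2210284,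
    26886667, 22430219, 4454763, 29372492, 14704428, 5372939, 6561580, 6627820, 20898315,
    20909579, 20866091, 20907595] 294764
   (.leaf [274988463, 26878279088])
   (.node [16907692, 16899052, 17038764, 17169836, 17161196, 31130123, 31130635, 31130667,
     136169587216, 136824030224, 136824030256, 26493196, 28840012, 28852492, 30937164, 33034316,
     33046796, 136253473808, 28853004, 33047308, 136253473840, 5372811, 28901899, 5373323,
     5372235, 26611788, 26624268, 32903244, 5372267] 261988
    (.leaf [247594383, 246283663, 54258564496])
    (.node [14786508, 14801388, 14917580, 14932460, 17825164, 17801164, 17816044, 33350155,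
      33361419, 33088011, 33099275, 3144715, 33361451, 33099307, 135599022608, 135632708112,
      136792695312, 135599033872, 135632719376, 136792706576, 17824780, 135599033904,
      135632719408, 136792706608, 26480172, 32771628, 26611244, 32902700, 28839468, 33164844,
      33169644, 3144011, 3144043, 3144587] 196452
     (.leaf [212860303, 72688074128, 177077647])
     (.leaf [15465868, 15441868, 15456748, 17563020, 17553900, 71473560976, 72646262160, 15465483,
       6528972, 6543852, 6684044, 6660044, 6674924, 11009420, 11000300, 17300876, 17276876,
       17291756, 12689356, 13368716, 15596940, 15572940, 17694092, 17670092, 72113323408,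
       17562636, 17547756, 71473560592, 71509343248, 72654650384, 33317931, 33359403, 33055787,
       33097259, 33359435, 33097291, 8781196, 8912268, 8903148, 11140492, 11131372, 13237644,
       17431948, 17422828, 1904299, 2035371, 6683660, 8911884, 8897004, 11009036, 10994156,
       17300492, 8780812, 8765932, 11140108, 11125228, 13237260, 13222380, 17431564, 17416684,
       13368332, 13353452, 15596556, 15581676, 17693708, 17678828, 136769594416, 136769635888,
       135599031856, 136253474352, 136769635920, 31002283, 135599034032, 135632719536,
       136792706736, 1869387, 1878123, 1902699, 2000459, 2009195, 2033771, 1903211, 2034283,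
       1902667, 2033739, 1886859, 1903243, 2017931, 2034315, 1903755, 2034827, 1895595, 1903787,
       2026667, 2034859, 1904331, 2035403, 26543660, 26488940, 26620012, 26545836, 26676908,
       28905132, 32837292, 32968364, 33230508, 30967371, 136769603152, 33073259, 135599007856,
       136769611888, 33097835, 135599032432, 136769636464, 31001195, 135599032944, 135632718448,
       136792705648, 31000651, 136769636432, 30984843, 135599016592, 135632702096, 136792689296,
       33098379, 135599032976, 136769637008, 31001739, 135599033488, 135632718992, 136792706192,
       30993579, 31001771, 135599025328, 135632710832, 136792698032, 135599033520, 135632719024,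
       136792706224, 30609100, 30600460, 31002315, 135599034064, 135632719568, 136792706768,
       26502187, 26543691, 15464779, 15464811, 15465355, 26519660, 136236673136, 26505356,
       136236697712, 26544203, 136253474896, 136236698256, 20769803, 20777995, 26537228,
       26668300, 33230540, 33221900, 136253432880, 72646261072, 72646261104, 72646261648,
       26510923, 30993419, 31386635, 31001611, 31394827, 26617420, 12712268, 12712300, 12689324,
       136253441616, 135599025168, 33221643, 136236690448, 26545163, 26676235, 33229835, 30783,
       26674763])))

/-- If the odd quadrilateral of the first instance were external, 2 would lie inside the triangle 1
3 8, and the edge 02 would leave this triangle through the spoke 18. The right angle conditions then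
keep 9 and 15, which are neighbours of 0, outside. Since 2 cannot have the four outside neighbours
0, 9, 10, 15, the point 10 is inside; then 9 has the inside neighbours 2 and 10 and is inside as
well, a contradiction. -/
theorem not_isStandard_shift (hχ : IsPattern G χ) {pt : ℕ → V} (hpt : IsGlued G pt) :
    ¬IsStandard χ fun i => pt (symm 1 false i) := by
  intro h
  refine Tree.false_of_facts (n := 16) (E := gluedEdges) (t := notShifted)
    (ex := units (standardFacts.map (Fact.map (symm 1 false)))) (by decide +kernel)
    hχ hpt.1 le_rfl hpt.2 (exists_means_of_mem_units fun f hf => ?_)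
  obtain ⟨f, hf', rfl⟩ := List.mem_map.1 hf
  exact Fact.means_map.2 (h f hf')

/-- With equal orientations the two centres 8 and 15 would be on the same side of the common edge
02, and the two instances would overlap. -/
theorem not_isStandard_same (hχ : IsPattern G χ) {pt : ℕ → V} (hpt : IsGlued G pt)
    (h : IsStandard χ pt) : ¬IsStandard χ fun i => pt (second i) := by
  intro h'
  refine Tree.false_of_facts (n := 16) (E := gluedEdges) (t := notSameSide)
    (ex := units (standardFacts ++ standardFacts.map (Fact.map second))) (by decide +kernel)
    hχ hpt.1 le_rfl hpt.2 (exists_means_of_mem_units fun f hf => ?_)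
  rcases List.mem_append.1 hf with hf | hf
  · exact h f hf
  · obtain ⟨f, hf', rfl⟩ := List.mem_map.1 hf
    exact Fact.means_map.2 (h' f hf')

/-- Each of two glued antiprisms is drawn in the standard way, with opposite orientations. -/
theorem IsGlued.isStandard (hχ : IsPattern G χ) {pt : ℕ → V} (hpt : IsGlued G pt) :
    IsStandard χ pt ∧ IsStandard (fun a b c => χ b a c) (fun i => pt (Refutation.second i)) ∨
      IsStandard (fun a b c => χ b a c) pt ∧ IsStandard χ fun i => pt (Refutation.second i) := by
  have e := hpt.exchange
  have h1 := not_isStandard_shift hχ hpt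
  have h2 := not_isStandard_shift hχ.mirror hpt
  have h3 := not_isStandard_shift hχ e
  have h4 := not_isStandard_shift hχ.mirror e
  have h5 := not_isStandard_same hχ hpt
  have h6 := not_isStandard_same hχ.mirror hpt
  have h7 := isStandard_or hχ hpt.first
  have h8 := isStandard_or hχ hpt.second
  -- The second instance of the pair is the first one of the exchanged pair, so the exclusion of the
  -- shifted drawing applies to it, too.
  have key : ∀ {χ : V → V → V → Prop},
      IsStandard χ (fun i => pt (Refutation.second (symm 1 false i))) →
      IsStandard χ fun i => pt (Refutation.exchange (symm 1 false i)) := by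
    intro χ hχ
    have : ∀ i < 9, Refutation.second (symm 1 false i) = Refutation.exchange (symm 1 false i) := by
      decide
    exact hχ.congr fun i hi => congrArg pt (this i hi)
  have h9 := mt (key (χ := χ)) h3
  have h10 := mt (key (χ := fun a b c => χ b a c)) h4
  tauto

/-- That no point of the second antiprism lies inside a triangle of the first, and that the additional
edge crosses no edge of the first but the common side. -/
def separatedFacts : List Fact :=
  ((List.range 8).flatMap fun j =>
      [(8, j, (j + 1) % 8), (j, (j + 1) % 8, (j + 2) % 8), (8, j, (j + 2) % 8)]).flatMap
    (fun t => (List.range 7).map fun x => .not (.inside t.1 t.2.1 t.2.2 (x + 9))) ++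
  (antiprismEdges.filter fun e => distinct 9 [e.1, e.2, 1] &&
    !(Nat.beq e.1 0 && Nat.beq e.2 2)).map fun e => .not (.cross e.1 e.2 1 9)

theorem IsGlued.means (hχ : IsPattern G χ) {pt : ℕ → V} (hpt : IsGlued G pt) (h : IsStandard χ pt)
    (h' : IsStandard (fun a b c => χ b a c) fun i => pt (Refutation.second i)) :
    ∀ f ∈ standardFacts ++ standardFacts.map (fun f => (f.map Refutation.second).mirror),
      f.Means χ pt := by
  intro f hf
  rcases List.mem_append.1 hf with hf | hf
  · exact h f hf
  · obtain ⟨f, hf', rfl⟩ := List.mem_map.1 hf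
    exact (Fact.means_mirror hχ hpt.1 (wf_map_second f hf')).1 (Fact.means_map.2 (h' f hf'))

/-- The point 1 lies inside the triangle 0 2 8 and 9 does not, so the edge 19 crosses a side of this
triangle. The spokes 08 and 28 are already crossed by the edges 17 and 13, which have the end 1 in
common with 19; by `fan` only the side 02 is left. -/
theorem IsGlued.crosses (hχ : IsPattern G χ) {pt : ℕ → V} (hpt : IsGlued G pt)
    (h : IsStandard χ pt) (h' : IsStandard (fun a b c => χ b a c) fun i => pt (Refutation.second i)) :
    Crosses χ (pt 1) (pt 9) (pt 0) (pt 2) := by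
  by_contra hn
  refine Tree.false_of_facts (n := 16) (E := gluedEdges) (t := connectionCrosses)
    (ex := units (standardFacts ++ standardFacts.map (fun f => (f.map Refutation.second).mirror)) ++
      [[.not (.cross 1 9 0 2)]]) (by decide +kernel)
    hχ hpt.1 le_rfl hpt.2 fun c hc => ?_
  rcases List.mem_append.1 hc with hc | hc
  · exact exists_means_of_mem_units (hpt.means hχ h h') c hc
  · rw [List.mem_singleton.1 hc]
    exact ⟨_, List.mem_singleton_self _, hn⟩

/-- This is the local form of the fact that instances do not overlap. It starts the induction in
`GluedGraph.IsAssembly.not_inside`, where all other pairs of instances are reduced to glued ones. -/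
theorem IsGlued.separated (hχ : IsPattern G χ) {pt : ℕ → V} (hpt : IsGlued G pt)
    (h : IsStandard χ pt) (h' : IsStandard (fun a b c => χ b a c) fun i => pt (Refutation.second i)) :
    ∀ f ∈ separatedFacts, f.Means χ pt := by
  intro f hf
  by_contra hn
  refine Tree.false_of_facts (n := 16) (E := gluedEdges) (t := separation)
    (ex := units (standardFacts ++ standardFacts.map (fun f => (f.map Refutation.second).mirror)) ++
      [[.cross 1 9 0 2], separatedFacts.map .not]) (by decide +kernel)
    hχ hpt.1 le_rfl hpt.2 fun c hc => ?_
  rcases List.mem_append.1 hc with hc | hc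
  · exact exists_means_of_mem_units (hpt.means hχ h h') c hc
  · simp only [List.mem_cons, List.not_mem_nil, or_false] at hc
    rcases hc with rfl | rfl
    · exact ⟨_, List.mem_singleton_self _, hpt.crosses hχ h h'⟩
    · exact ⟨.not f, List.mem_map_of_mem hf, hn⟩

end Refutation

end

section

/-! ### The orientation pattern of a straight-line RAC drawing -/

/-- The signed area of the parallelogram spanned by two vectors. -/
def area (z w : ℂ) : ℝ := z.re * w.im - z.im * w.re

/-- Twice the signed area of a triangle. -/
def triArea (a b c : ℂ) : ℝ := area (b - a) (c - a)

theorem area_eq_im (z w : ℂ) : area z w = (starRingEnd ℂ z * w).im := by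
  simp [area]; ring

theorem inner_eq_re (z w : ℂ) : inner ℝ z w = z.re * w.re + z.im * w.im := by
  rw [Complex.inner]; simp; ring

theorem triArea_rotate (a b c : ℂ) : triArea b c a = triArea a b c := by
  simp only [triArea, area, Complex.sub_re, Complex.sub_im]; ring

theorem triArea_swap (a b c : ℂ) : triArea b a c = -triArea a b c := by
  simp only [triArea, area, Complex.sub_re, Complex.sub_im]; ring

theorem triArea_interior {p q r t : ℂ} (h₁ : 0 < triArea t q r) (h₂ : 0 < triArea p t r)
    (h₃ : 0 < triArea p q t) : 0 < triArea p q r := by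
  have : triArea p q r = triArea t q r + triArea p t r + triArea p q t := by
    simp only [triArea, area, Complex.sub_re, Complex.sub_im]; ring
  linarith

/-- The three-term Grassmann–Plücker relation; both transitivity laws of orientations are read off
from its signs. -/
theorem triArea_identity (t u p q r : ℂ) : triArea t u q * triArea t p r =
    triArea t u p * triArea t q r + triArea t u r * triArea t p q := by
  simp only [triArea, area, Complex.sub_re, Complex.sub_im]; ring

theorem triArea_trans {t u p q r : ℂ} (h₁ : 0 < triArea t u p) (h₂ : 0 < triArea t u q)
    (h₃ : 0 < triArea t u r) (h₄ : 0 < triArea t p q) (h₅ : 0 < triArea t q r) :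
    0 < triArea t p r := by
  have h := triArea_identity t u p q r
  exact pos_of_mul_pos_right (by rw [h]; positivity) h₂.le

theorem triArea_trans' {t u p q r : ℂ} (h₁ : 0 < triArea u t p) (h₂ : 0 < triArea u t q)
    (h₃ : 0 < triArea u t r) (h₄ : 0 < triArea t p q) (h₅ : 0 < triArea t q r) :
    0 < triArea t p r := by
  have h := triArea_identity t u p q r
  rw [triArea_swap u t q, triArea_swap u t p, triArea_swap u t r] at h
  refine pos_of_mul_pos_right (b := triArea t p r) (a := triArea u t q) ?_ h₂.le
  nlinarith [mul_pos h₁ h₅, mul_pos h₃ h₄]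

/-- Segments that separate each other's ends intersect. -/
theorem exists_mem_openSegment {a b c d : ℂ} (h₁ : triArea a b c * triArea a b d < 0)
    (h₂ : triArea c d a * triArea c d b < 0) :
    ∃ x, x ∈ openSegment ℝ a b ∧ x ∈ openSegment ℝ c d := by
  -- A segment whose ends have heights u and v of opposite signs above a line meets the line in the
  -- convex combination of its ends with these weights.
  have key : ∀ u v : ℝ, u * v < 0 → 0 < u / (u - v) ∧ 0 < -v / (u - v) ∧
      u / (u - v) + -v / (u - v) = 1 := by
    intro u v h
    rcases mul_neg_iff.1 h with ⟨hu, hv⟩ | ⟨hu, hv⟩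
    · have : 0 < u - v := by linarith
      exact ⟨by positivity, div_pos (by linarith) this, by field_simp; ring⟩
    · have : u - v < 0 := by linarith
      exact ⟨div_pos_of_neg_of_neg hu this, div_pos_of_neg_of_neg (by linarith) this,
        by rw [← add_div, ← sub_eq_add_neg, div_self this.ne]⟩
  obtain ⟨k1, k2, k3⟩ := key _ _ h₁
  obtain ⟨l1, l2, l3⟩ := key _ _ h₂
  have hne : triArea a b c - triArea a b d ≠ 0 := by
    intro h
    rw [sub_eq_zero.1 h] at h₁
    nlinarith [mul_self_nonneg (triArea a b d)]
  have hD : triArea c d a - triArea c d b = -(triArea a b c - triArea a b d) := by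
    simp only [triArea, area, Complex.sub_re, Complex.sub_im]; ring
  refine ⟨_, ⟨_, _, l2, l1, by linarith, rfl⟩, ⟨_, _, k2, k1, by linarith, ?_⟩⟩
  rw [hD]
  apply Complex.ext <;>
  · simp only [Complex.add_re, Complex.add_im, Complex.real_smul, Complex.re_ofReal_mul,
      Complex.im_ofReal_mul]
    field_simp
    simp only [triArea, area, Complex.sub_re, Complex.sub_im]
    ring

variable {V : Type*} {G : SimpleGraph V} {p : V → ℂ}

/-- Points of crossing edges, in coordinates. -/
theorem CrossAt.exists_eq {a b c d : V} {x : ℂ} (h : CrossAt G p a b c d x) :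
    ∃ t s : ℝ, (0 < t ∧ t < 1) ∧ (0 < s ∧ s < 1) ∧ x = p a + t * (p b - p a) ∧
      x = p c + s * (p d - p c) := by
  obtain ⟨-, -, -, h1, h2⟩ := h
  rw [openSegment_eq_image'] at h1 h2
  obtain ⟨t, ht, rfl⟩ := h1
  obtain ⟨s, hs, hx⟩ := h2
  exact ⟨t, s, ht, hs, by simp, by simpa using hx.symm⟩

namespace IsRACDrawing

/-- The squares of the inner product and of the area of two vectors add up to the product of their
squared lengths, so two nonzero orthogonal vectors span a nonzero area. -/
theorem area_ne_zero (hp : IsRACDrawing G p) {a b c d : V} {x : ℂ} (h : CrossAt G p a b c d x) :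
    area (p b - p a) (p d - p c) ≠ 0 := by
  intro h0
  have h1 := hp.right_angle a b c d x h
  have n1 : p b - p a ≠ 0 := sub_ne_zero.2 fun e => h.1.ne (hp.injective e).symm
  have n2 : p d - p c ≠ 0 := sub_ne_zero.2 fun e => h.2.1.ne (hp.injective e).symm
  rw [inner_eq_re] at h1
  have hz : Complex.normSq (p b - p a) * Complex.normSq (p d - p c) = 0 := by
    rw [Complex.normSq_apply, Complex.normSq_apply]
    simp only [area] at h0
    linear_combination ((p b - p a).re * (p d - p c).re + (p b - p a).im * (p d - p c).im) * h1 +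
      ((p b - p a).re * (p d - p c).im - (p b - p a).im * (p d - p c).re) * h0
  rcases mul_eq_zero.1 hz with h | h
  exacts [n1 (Complex.normSq_eq_zero.1 h), n2 (Complex.normSq_eq_zero.1 h)]

/-- The signed distance from the line ab is an affine function along cd that vanishes at the
crossing. -/
theorem triArea_of_crossAt {a b c d : V} {x : ℂ} (h : CrossAt G p a b c d x) :
    ∃ s : ℝ, 0 < s ∧ s < 1 ∧ triArea (p a) (p b) (p c) = -s * area (p b - p a) (p d - p c) ∧
      triArea (p a) (p b) (p d) = (1 - s) * area (p b - p a) (p d - p c) := by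
  obtain ⟨t, s, ht, hs, h1, h2⟩ := h.exists_eq
  have h3 := h1.symm.trans h2
  have hre := congrArg Complex.re h3
  have him := congrArg Complex.im h3
  simp only [Complex.add_re, Complex.add_im, Complex.re_ofReal_mul, Complex.im_ofReal_mul,
    Complex.sub_re, Complex.sub_im] at hre him
  refine ⟨s, hs.1, hs.2, ?_, ?_⟩ <;>
    simp only [triArea, area, Complex.sub_re, Complex.sub_im]
  · linear_combination ((p b).im - (p a).im) * hre - ((p b).re - (p a).re) * him
  · linear_combination ((p b).im - (p a).im) * hre - ((p b).re - (p a).re) * him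

theorem _root_.CrossAt.symm {a b c d : V} {x : ℂ} (h : CrossAt G p a b c d x) :
    CrossAt G p c d a b x :=
  ⟨h.2.1, h.1, h.2.2.1.symm, h.2.2.2.2, h.2.2.2.1⟩

theorem mul_triArea_neg (hp : IsRACDrawing G p) {a b c d : V} {x : ℂ}
    (h : CrossAt G p a b c d x) : triArea (p a) (p b) (p c) * triArea (p a) (p b) (p d) < 0 := by
  obtain ⟨s, h0, h1, e1, e2⟩ := triArea_of_crossAt h
  rw [e1, e2]
  have := mul_pos (mul_pos h0 (sub_pos.2 h1)) (mul_self_pos.2 (hp.area_ne_zero h))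
  nlinarith

end IsRACDrawing

end

/-! ### Right angle crossings and perturbation into general position -/

section

open Filter Topology

variable {V : Type*} {G : SimpleGraph V} {p : V → ℂ}

/-- The orientation pattern `χ` agrees with the drawing `p`, as far as this determines it. -/
structure Refines (G : SimpleGraph V) (p : V → ℂ) (χ : V → V → V → Prop) : Prop where
  pos : ∀ a b c, 0 < triArea (p a) (p b) (p c) → χ a b c
  neg : ∀ a b c, triArea (p a) (p b) (p c) < 0 → ¬χ a b c
  cross : ∀ a b c d, [a, b, c, d].Nodup → G.Adj a b → G.Adj c d → Crosses χ a b c d →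
    ∃ x, CrossAt G p a b c d x

theorem area_mul_normSq (b c z : ℂ) :
    area b c * Complex.normSq z = area b z * inner ℝ z c + inner ℝ z b * area z c := by
  simp only [inner_eq_re, Complex.normSq_apply, area]; ring

theorem inner_mul_normSq (b c z : ℂ) :
    inner ℝ b c * Complex.normSq z = inner ℝ z b * inner ℝ z c + area b z * area c z := by
  simp only [inner_eq_re, Complex.normSq_apply, area]; ring

/-- If `s • c` is the foot of `z` on the line through `c`, and `b` lies between `c` and `z` in
angular order, then the segment from `z` to this foot meets the segment from `0` to `b` if this
contains the foot of `z`. -/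
theorem exists_mem_segment_foot {b c z : ℂ} {t s : ℝ} (ht : 0 < t) (ht' : t < 1) (hs : 0 < s)
    (hb : inner ℝ z b = t * Complex.normSq b) (hc : inner ℝ z c = s * Complex.normSq c)
    (hbz : 0 < area b z) (hcz : 0 < area c z) (hcb : 0 ≤ area c b) :
    ∃ k r : ℝ, 0 < k ∧ k < 1 ∧ 0 < r ∧ r ≤ 1 ∧ (k : ℂ) * b = z + r * (s * c - z) := by
  have hz : 0 < Complex.normSq z := Complex.normSq_pos.2 (by rintro rfl; simp [area] at hbz)
  have hb0 : 0 < Complex.normSq b := Complex.normSq_pos.2 (by rintro rfl; simp [area] at hbz)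
  have hc0 : 0 < Complex.normSq c := Complex.normSq_pos.2 (by rintro rfl; simp [area] at hcz)
  have hzb : 0 < inner ℝ z b := by rw [hb]; positivity
  have hzc : 0 < inner ℝ z c := by rw [hc]; positivity
  have hbc : 0 < inner ℝ b c := by
    refine pos_of_mul_pos_left ?_ hz.le
    rw [inner_mul_normSq]; positivity
  have hD : 0 < area b z + s * area c b := by positivity
  -- The area spanned by b and a point of the segment from z to the foot is affine in the parameter
  -- of the point; r is its zero, that is, where the segment meets the line through b.
  set r := area b z / (area b z + s * area c b) with hr
  have hr0 : 0 < r := by positivity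
  have hr1 : r ≤ 1 := (div_le_one hD).2 (by nlinarith)
  have hrD : r * (area b z + s * area c b) = area b z := div_mul_cancel₀ _ hD.ne'
  -- The foot on c projects to the direction of b no farther out than z does. The intersection
  -- therefore stays strictly before the end of b, as the projection of z does.
  have hle : s * inner ℝ b c ≤ inner ℝ z b := by
    refine le_of_mul_le_mul_right ?_ (mul_pos hc0 hz)
    have e1 : s * inner ℝ b c * (Complex.normSq c * Complex.normSq z) =
        inner ℝ z c * (inner ℝ b c * Complex.normSq z) := by rw [hc]; ring
    have e2 : inner ℝ z b * (Complex.normSq c * Complex.normSq z) =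
        inner ℝ z b * (inner ℝ z c ^ 2 + area c z ^ 2) := by
      simp only [inner_eq_re, Complex.normSq_apply, area]; ring
    rw [e1, e2, inner_mul_normSq]
    have e3 := area_mul_normSq c b z
    have e4 : area z b = -area b z := by simp only [area]; ring
    rw [e4] at e3
    have e5 := mul_nonneg hcb hz.le
    rw [e3] at e5
    nlinarith [mul_nonneg hcz.le e5]
  -- The coordinate along b of the point with parameter r.
  set k := ((1 - r) * inner ℝ z b + r * (s * inner ℝ b c)) / Complex.normSq b with hk
  have hkb : k * Complex.normSq b = (1 - r) * inner ℝ z b + r * (s * inner ℝ b c) :=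
    div_mul_cancel₀ _ hb0.ne'
  refine ⟨k, r, ?_, ?_, hr0, hr1, ?_⟩
  · have h1 := mul_nonneg (sub_nonneg.2 hr1) hzb.le
    have h2 : 0 < r * (s * inner ℝ b c) := by positivity
    exact div_pos (by linarith) hb0
  · rw [hk, div_lt_one hb0]
    have : inner ℝ z b < Complex.normSq b := by rw [hb]; nlinarith
    nlinarith [mul_le_mul_of_nonneg_left hle hr0.le]
  · have harea : area b (z + r * (s * c - z)) = 0 := by
      have : area b (z + r * (s * c - z)) = area b z - r * (area b z + s * area c b) := by
        simp [area]; ring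
      rw [this, hrD, sub_self]
    have hinner : inner ℝ b (z + r * (s * c - z)) = k * Complex.normSq b := by
      rw [hkb]; simp; ring
    have key : ∀ w : ℂ, area b w = 0 → inner ℝ b w = k * Complex.normSq b → (k : ℂ) * b = w := by
      intro w h1 h2
      simp only [inner_eq_re, area] at h1 h2
      have e : ∀ x y : ℝ, Complex.normSq b * x = Complex.normSq b * y → x = y :=
        fun x y => mul_left_cancel₀ hb0.ne'
      apply Complex.ext <;> apply e <;>
        simp only [Complex.re_ofReal_mul, Complex.im_ofReal_mul]
      · rw [Complex.normSq_apply] at h2 ⊢; linear_combination (-b.re) * h2 + b.im * h1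
      · rw [Complex.normSq_apply] at h2 ⊢; linear_combination (-b.im) * h2 - b.re * h1
    exact key _ harea hinner

namespace IsRACDrawing

theorem ne_add_mul (hp : IsRACDrawing G p) {a b c : V} (h : G.Adj a b) (hc : c ≠ a) (hc' : c ≠ b)
    {r : ℝ} (h0 : 0 ≤ r) (h1 : r ≤ 1) : p c - p a ≠ r * (p b - p a) := by
  intro e
  refine hp.vertex_not_on_edge a b c h hc hc' ?_
  rw [segment_eq_image']
  refine ⟨r, ⟨h0, h1⟩, ?_⟩
  simp only [Complex.real_smul, ← e]; ring

/-- Both crossings are the foot of the perpendicular from a to the line ef, hence the same point. So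
ab and ac have the same direction, and the end of the shorter one lies on the longer one. -/
theorem false_of_common_crossing (hp : IsRACDrawing G p) {a b c e f : V} {x y : ℂ} (hbc : b ≠ c)
    (h₁ : CrossAt G p a b e f x) (h₂ : CrossAt G p a c e f y) : False := by
  obtain ⟨t, s, ht, hs, h1, h2⟩ := h₁.exists_eq
  obtain ⟨t', s', ht', hs', h1', h2'⟩ := h₂.exists_eq
  have o1 := hp.right_angle _ _ _ _ _ h₁
  have o2 := hp.right_angle _ _ _ _ _ h₂
  have n : p f - p e ≠ 0 := sub_ne_zero.2 fun k => h₁.2.1.ne (hp.injective k).symm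
  have hss : s = s' := by
    have n' : Complex.normSq (p f - p e) ≠ 0 := by simpa using n
    rw [inner_eq_re] at o1 o2
    have h3 := h1.symm.trans h2
    have h4 := h1'.symm.trans h2'
    have hre := congrArg Complex.re h3
    have him := congrArg Complex.im h3
    have hre' := congrArg Complex.re h4
    have him' := congrArg Complex.im h4
    simp only [Complex.add_re, Complex.add_im, Complex.re_ofReal_mul, Complex.im_ofReal_mul] at *
    refine mul_right_cancel₀ n' ?_
    rw [Complex.normSq_apply]
    linear_combination t * o1 - t' * o2 - (p f - p e).re * hre - (p f - p e).im * him +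
      (p f - p e).re * hre' + (p f - p e).im * him'
  have hxy : (t : ℂ) * (p b - p a) = t' * (p c - p a) := by
    have : x = y := by rw [h2, h2', hss]
    rw [h1, h1'] at this
    exact add_left_cancel this
  have div_le : ∀ u v : ℝ, 0 < u → 0 < v → u ≤ v → 0 ≤ u / v ∧ u / v ≤ 1 :=
    fun u v hu hv h => ⟨by positivity, (div_le_one hv).2 h⟩
  rcases le_total t t' with h | h
  · obtain ⟨g1, g2⟩ := div_le t t' ht.1 ht'.1 h
    refine hp.ne_add_mul h₁.1 h₂.1.ne' hbc.symm g1 g2 ?_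
    have : (t' : ℂ) ≠ 0 := by exact_mod_cast ht'.1.ne'
    push_cast
    field_simp
    linear_combination -hxy
  · obtain ⟨g1, g2⟩ := div_le t' t ht'.1 ht.1 h
    refine hp.ne_add_mul h₂.1 h₁.1.ne' hbc g1 g2 ?_
    have : (t : ℂ) ≠ 0 := by exact_mod_cast ht.1.ne'
    push_cast
    field_simp
    linear_combination hxy

/-- Because of the right angle, the crossing is the foot of the perpendicular from y to the line ab.
The number t is its position on ab, and l its position on the crossing edge. -/
theorem inner_of_crossAt (hp : IsRACDrawing G p) {a b y x₁ : V} {x : ℂ}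
    (h : CrossAt G p y x₁ a b x) : ∃ t l : ℝ, (0 < t ∧ t < 1) ∧ (0 < l ∧ l < 1) ∧
      inner ℝ (p y - p a) (p b - p a) = t * Complex.normSq (p b - p a) ∧
      (t : ℂ) * (p b - p a) - (p y - p a) = l * (p x₁ - p y) := by
  obtain ⟨l, t, hl, ht, h1, h2⟩ := h.exists_eq
  have o := hp.right_angle _ _ _ _ _ h
  rw [inner_eq_re] at o
  have h3 := h1.symm.trans h2
  have hre := congrArg Complex.re h3
  have him := congrArg Complex.im h3
  refine ⟨t, l, ht, hl, ?_, by linear_combination -h3⟩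
  rw [inner_eq_re, Complex.normSq_apply]
  simp only [Complex.add_re, Complex.add_im, Complex.re_ofReal_mul, Complex.im_ofReal_mul,
    Complex.sub_re, Complex.sub_im] at *
  linear_combination (-l) * o + ((p b).re - (p a).re) * hre + ((p b).im - (p a).im) * him

theorem triArea_ne_zero_of_crossAt (hp : IsRACDrawing G p) {a b y x₁ : V} {x : ℂ}
    (h : CrossAt G p y x₁ a b x) : area (p b - p a) (p y - p a) ≠ 0 := by
  have := hp.mul_triArea_neg h.symm
  intro h0
  rw [triArea, h0] at this
  simp at this

/-- When b lies between c and y in the angular order around a, the perpendicular from y to ac meets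
ab before it reaches its foot. The edge from y to x₂ would thus cross two edges with the common end
a. -/
theorem corner_aux (hp : IsRACDrawing G p) {a b c y x₁ x₂ : V} {x x' : ℂ} (hbc : b ≠ c)
    (h₁ : CrossAt G p y x₁ a b x) (h₂ : CrossAt G p y x₂ a c x')
    (hn : s(y, x₂) ≠ s(a, b)) (hcb : 0 ≤ area (p c - p a) (p b - p a))
    (h : 0 < area (p b - p a) (p y - p a)) (h' : 0 < area (p c - p a) (p y - p a)) : False := by
  obtain ⟨t, l, ht, hl, hi, -⟩ := hp.inner_of_crossAt h₁
  obtain ⟨s, l', hs, hl', hi', e⟩ := hp.inner_of_crossAt h₂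
  obtain ⟨k, r, k0, k1, r0, r1, he⟩ := exists_mem_segment_foot ht.1 ht.2 hs.1 hi hi' h h' hcb
  refine hp.false_of_common_crossing (a := a) (b := b) (c := c) (e := y) (f := x₂)
    (x := p a + k * (p b - p a)) hbc ⟨h₁.2.1, h₂.1, hn.symm, ?_, ?_⟩ h₂.symm
  · rw [openSegment_eq_image']
    exact ⟨k, ⟨k0, k1⟩, by simp⟩
  · rw [openSegment_eq_image']
    refine ⟨r * l', ⟨by nlinarith, by nlinarith⟩, ?_⟩
    simp only [Complex.real_smul]
    push_cast
    rw [he]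
    linear_combination (-(r : ℂ)) * e

theorem conj (hp : IsRACDrawing G p) : IsRACDrawing G fun v => (starRingEnd ℂ) (p v) := by
  have hseg : ∀ a b x : ℂ, x ∈ segment ℝ ((starRingEnd ℂ) a) ((starRingEnd ℂ) b) ↔
      (starRingEnd ℂ) x ∈ segment ℝ a b := by
    intro a b x
    constructor
    · rintro ⟨s, t, h1, h2, h3, rfl⟩
      exact ⟨s, t, h1, h2, h3, by simp⟩
    · rintro ⟨s, t, h1, h2, h3, h⟩
      exact ⟨s, t, h1, h2, h3, by simpa using congrArg (starRingEnd ℂ) h⟩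
  have hop : ∀ a b x : ℂ, x ∈ openSegment ℝ ((starRingEnd ℂ) a) ((starRingEnd ℂ) b) →
      (starRingEnd ℂ) x ∈ openSegment ℝ a b := by
    rintro a b x ⟨s, t, h1, h2, h3, rfl⟩
    exact ⟨s, t, h1, h2, h3, by simp⟩
  refine ⟨fun a b h => hp.injective (star_injective h), fun a b w h h1 h2 h3 => ?_,
    fun a b c d x h => ?_⟩
  · rw [hseg] at h3
    exact hp.vertex_not_on_edge a b w h h1 h2 (by simpa using h3)
  · have := hp.right_angle a b c d _ ⟨h.1, h.2.1, h.2.2.1, hop _ _ _ h.2.2.2.1,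
      hop _ _ _ h.2.2.2.2⟩
    rw [inner_eq_re] at this ⊢
    simp only [Complex.sub_re, Complex.sub_im, Complex.conj_re, Complex.conj_im] at this ⊢
    linear_combination this

theorem _root_.CrossAt.conj {a b c d : V} {x : ℂ} (h : CrossAt G p a b c d x) :
    CrossAt G (fun v => (starRingEnd ℂ) (p v)) a b c d ((starRingEnd ℂ) x) := by
  have hop : ∀ a b x : ℂ, x ∈ openSegment ℝ a b →
      (starRingEnd ℂ) x ∈ openSegment ℝ ((starRingEnd ℂ) a) ((starRingEnd ℂ) b) := by
    rintro a b x ⟨s, t, h1, h2, h3, rfl⟩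
    exact ⟨s, t, h1, h2, h3, by simp⟩
  exact ⟨h.1, h.2.1, h.2.2.1, hop _ _ _ h.2.2.2.1, hop _ _ _ h.2.2.2.2⟩

/-- By `corner_aux`, applied to the drawing or to its reflection, b and c are on different sides of
the line ay. Since the feet of y lie on the rays from a to b and to c, both angles with ay are
acute, so the angle bac is less than π and contains y. The identity `area_mul_normSq` turns this
into the sign of the area of abc. -/
theorem corner (hp : IsRACDrawing G p) {a b c y x₁ x₂ : V} {x x' : ℂ}
    (hd : [a, b, c, y, x₁, x₂].Nodup)
    (h₁ : CrossAt G p y x₁ a b x) (h₂ : CrossAt G p y x₂ a c x') :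
    0 < triArea (p a) (p b) (p y) ∧ 0 < triArea (p a) (p y) (p c) ∧
      0 < triArea (p a) (p b) (p c) ∨
    triArea (p a) (p b) (p y) < 0 ∧ triArea (p a) (p y) (p c) < 0 ∧
      triArea (p a) (p b) (p c) < 0 := by
  have hne : b ≠ c ∧ s(y, x₂) ≠ s(a, b) ∧ s(y, x₁) ≠ s(a, c) := by
    simp only [List.nodup_cons, List.mem_cons, List.not_mem_nil, or_false, not_or] at hd
    refine ⟨by tauto, ?_, ?_⟩ <;> simp only [ne_eq, Sym2.eq_iff] <;> grind
  have same : ∀ {q : V → ℂ} (_ : IsRACDrawing G q) {x x' : ℂ} (_ : CrossAt G q y x₁ a b x)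
      (_ : CrossAt G q y x₂ a c x'), 0 < area (q b - q a) (q y - q a) →
      0 < area (q c - q a) (q y - q a) → False := by
    intro q hq x x' h₁ h₂ h h'
    have e : area (q b - q a) (q c - q a) = -area (q c - q a) (q b - q a) := by
      simp only [area]; ring
    -- Whichever of b and c has the direction closer to that of y plays the first role in
    -- `corner_aux`.
    rcases le_total 0 (area (q c - q a) (q b - q a)) with hs | hs
    · exact hq.corner_aux hne.1 h₁ h₂ hne.2.1 hs h h'
    · exact hq.corner_aux hne.1.symm h₂ h₁ hne.2.2 (by linarith) h' h
  have hB := hp.triArea_ne_zero_of_crossAt h₁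
  have hC := hp.triArea_ne_zero_of_crossAt h₂
  have hbc := area_mul_normSq (p b - p a) (p c - p a) (p y - p a)
  obtain ⟨t, -, ht, -, hi, -⟩ := hp.inner_of_crossAt h₁
  obtain ⟨s, -, hs, -, hi', -⟩ := hp.inner_of_crossAt h₂
  have pos : ∀ u v : V, G.Adj u v → 0 < Complex.normSq (p v - p u) := fun u v h =>
    Complex.normSq_pos.2 (sub_ne_zero.2 fun k => h.ne (hp.injective k).symm)
  have i1 := mul_pos ht.1 (pos _ _ h₁.2.1)
  have i2 := mul_pos hs.1 (pos _ _ h₂.2.1)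
  rw [← hi] at i1
  rw [← hi'] at i2
  have hz : 0 < Complex.normSq (p y - p a) := Complex.normSq_pos.2 fun k => by
    simp [k, area] at hB
  have ec : area (p y - p a) (p c - p a) = -area (p c - p a) (p y - p a) := by
    simp only [area]; ring
  simp only [triArea]
  have flip : ∀ u v w : ℂ, area ((starRingEnd ℂ) u - (starRingEnd ℂ) v)
      ((starRingEnd ℂ) w - (starRingEnd ℂ) v) = -area (u - v) (w - v) := by
    intro u v w; simp [area]; ring
  rw [ec] at hbc ⊢
  rcases hB.lt_or_gt with hB | hB <;> rcases hC.lt_or_gt with hC | hC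
  · refine (same hp.conj h₁.conj h₂.conj ?_ ?_).elim <;> rw [flip] <;> linarith
  · refine Or.inr ⟨hB, by linarith, ?_⟩
    nlinarith [mul_pos i1 hC, mul_pos (neg_pos.2 hB) i2]
  · refine Or.inl ⟨hB, by linarith, ?_⟩
    nlinarith [mul_pos i1 (neg_pos.2 hC), mul_pos hB i2]
  · exact (same hp h₁ h₂ hB hC).elim

/-- A small general perturbation of the vertices makes all triples of vertices positively or
negatively oriented. -/
theorem eventually_triArea_ne_zero (p : V → ℂ) {f : V → ℝ} (hf : Function.Injective f) {a b c : V}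
    (h : [a, b, c].Nodup) : ∀ᶠ ε : ℝ in 𝓝[>] 0,
      triArea (p a + ε * ⟨f a, f a ^ 2⟩) (p b + ε * ⟨f b, f b ^ 2⟩) (p c + ε * ⟨f c, f c ^ 2⟩) ≠ 0 := by
  -- The vertices move in the directions of points of a parabola, so the area is a quadratic
  -- polynomial in ε whose leading coefficient is the Vandermonde determinant of three distinct
  -- parameters. It is not the zero polynomial and has no zeros at small positive ε.
  obtain ⟨B, hB⟩ : ∃ B : ℝ, ∀ ε : ℝ,
      triArea (p a + ε * ⟨f a, f a ^ 2⟩) (p b + ε * ⟨f b, f b ^ 2⟩) (p c + ε * ⟨f c, f c ^ 2⟩) =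
      triArea (p a) (p b) (p c) + ε * (B + ε * ((f b - f a) * (f c - f a) * (f c - f b))) := by
    refine ⟨((p b).re - (p a).re) * (f c ^ 2 - f a ^ 2) + (f b - f a) * ((p c).im - (p a).im) -
      ((p b).im - (p a).im) * (f c - f a) - (f b ^ 2 - f a ^ 2) * ((p c).re - (p a).re), ?_⟩
    intro ε
    simp only [triArea, area, Complex.sub_re, Complex.sub_im, Complex.add_re, Complex.add_im,
      Complex.re_ofReal_mul, Complex.im_ofReal_mul]
    ring
  simp only [List.nodup_cons, List.mem_cons, List.not_mem_nil, or_false, not_or] at h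
  have hC : (f b - f a) * (f c - f a) * (f c - f b) ≠ 0 :=
    mul_ne_zero (mul_ne_zero (sub_ne_zero.2 fun e => by have := hf e; tauto)
      (sub_ne_zero.2 fun e => by have := hf e; tauto))
      (sub_ne_zero.2 fun e => by have := hf e; tauto)
  simp only [hB]
  generalize (f b - f a) * (f c - f a) * (f c - f b) = C at hC
  generalize triArea (p a) (p b) (p c) = A
  have lim : ∀ u : ℝ → ℝ, Continuous u → u 0 ≠ 0 → ∀ᶠ ε : ℝ in 𝓝[>] 0, u ε ≠ 0 :=
    fun u hu h0 => (hu.continuousAt.eventually_ne h0).filter_mono nhdsWithin_le_nhds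
  by_cases hA : A = 0
  · subst hA
    have : ∀ᶠ ε : ℝ in 𝓝[>] 0, B + ε * C ≠ 0 := by
      by_cases hB : B = 0
      · filter_upwards [self_mem_nhdsWithin] with ε hε
        rw [hB, zero_add]
        exact mul_ne_zero (ne_of_gt hε) hC
      · exact lim _ (by fun_prop) (by simpa using hB)
    filter_upwards [this, self_mem_nhdsWithin] with ε h1 h2
    rw [zero_add]
    exact mul_ne_zero (ne_of_gt h2) h1
  · exact lim _ (by fun_prop) (by simpa using hA)

/-- Disjoint segments are strictly separated by a linear functional, and strict inequalities at the
four ends survive a small motion. -/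
theorem eventually_disjoint {a b c d : ℂ} (h : Disjoint (segment ℝ a b) (segment ℝ c d))
    (a' b' c' d' : ℂ) : ∀ᶠ ε : ℝ in 𝓝[>] 0, Disjoint (segment ℝ (a + ε * a') (b + ε * b'))
      (segment ℝ (c + ε * c') (d + ε * d')) := by
  have hcpt : IsCompact (segment ℝ a b) := by
    rw [segment_eq_image]
    exact isCompact_Icc.image (by fun_prop)
  have hcpt' : IsCompact (segment ℝ c d) := by
    rw [segment_eq_image]
    exact isCompact_Icc.image (by fun_prop)
  obtain ⟨f, u, v, h1, huv, h2⟩ := geometric_hahn_banach_compact_closed (convex_segment a b) hcpt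
    (convex_segment c d) hcpt'.isClosed h
  have lt : ∀ z z' : ℂ, f z < u → ∀ᶠ ε : ℝ in 𝓝[>] 0, f (z + ε * z') < u := fun z z' hz =>
    (ContinuousAt.eventually_lt (f := fun ε : ℝ => f (z + ε * z')) (by fun_prop)
      continuousAt_const (by simpa using hz)).filter_mono nhdsWithin_le_nhds
  have gt : ∀ z z' : ℂ, v < f z → ∀ᶠ ε : ℝ in 𝓝[>] 0, v < f (z + ε * z') := fun z z' hz =>
    (ContinuousAt.eventually_lt (g := fun ε : ℝ => f (z + ε * z')) continuousAt_const
      (by fun_prop) (by simpa using hz)).filter_mono nhdsWithin_le_nhds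
  filter_upwards [lt a a' (h1 _ (left_mem_segment ℝ a b)), lt b b' (h1 _ (right_mem_segment ℝ a b)),
    gt c c' (h2 _ (left_mem_segment ℝ c d)), gt d d' (h2 _ (right_mem_segment ℝ c d))]
    with ε ha hb hc hd
  refine Set.disjoint_left.2 fun x hx hx' => ?_
  have k1 : f x < u := (convex_halfSpace_lt f.isLinear u).segment_subset ha hb hx
  have k2 : v < f x := (convex_halfSpace_gt f.isLinear v).segment_subset hc hd hx'
  linarith

theorem crossAt_of_not_disjoint (hp : IsRACDrawing G p) {a b c d : V} (hn : [a, b, c, d].Nodup)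
    (h₁ : G.Adj a b) (h₂ : G.Adj c d)
    (h : ¬Disjoint (segment ℝ (p a) (p b)) (segment ℝ (p c) (p d))) :
    ∃ x, CrossAt G p a b c d x := by
  obtain ⟨x, hx, hx'⟩ := Set.not_disjoint_iff.1 h
  simp only [List.nodup_cons, List.mem_cons, List.not_mem_nil, or_false, not_or] at hn
  have hp' := hp.vertex_not_on_edge
  refine ⟨x, h₁, h₂, ?_, mem_openSegment_of_ne_left_right ?_ ?_ hx,
    mem_openSegment_of_ne_left_right ?_ ?_ hx'⟩
  · simp only [ne_eq, Sym2.eq_iff]; tauto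
  · rintro rfl; exact hp' c d a h₂ (by tauto) (by tauto) hx'
  · rintro rfl; exact hp' c d b h₂ (by tauto) (by tauto) hx'
  · rintro rfl; exact hp' a b c h₁ (by grind) (by grind) hx
  · rintro rfl; exact hp' a b d h₁ (by grind) (by grind) hx

/-- For small positive ε the moved vertices are in general position, strict orientations are kept,
and disjoint segments remain disjoint. By the last property a crossing of independent edges after
the motion comes from a crossing of the original drawing. The right angle conditions can therefore
be taken from the original drawing; the moved one need not be a RAC drawing. -/
theorem exists_pattern [Finite V] (hp : IsRACDrawing G p) :
    ∃ χ, IsPattern G χ ∧ Refines G p χ := by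
  obtain ⟨n, ⟨e⟩⟩ := Finite.exists_equiv_fin V
  let f : V → ℝ := fun v => ((e v : ℕ) : ℝ)
  have hf : Function.Injective f := fun a b h => e.injective (Fin.ext (by simpa [f] using h))
  let q : ℝ → V → ℂ := fun ε v => p v + ε * ⟨f v, f v ^ 2⟩
  have e1 : ∀ᶠ ε : ℝ in 𝓝[>] 0, ∀ a b c, [a, b, c].Nodup →
      triArea (q ε a) (q ε b) (q ε c) ≠ 0 := by
    simp only [Filter.eventually_all]
    exact fun a b c h => eventually_triArea_ne_zero p hf h
  have hcont : ∀ a b c, Continuous fun ε => triArea (q ε a) (q ε b) (q ε c) := by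
    intro a b c
    simp only [q, triArea, area]
    fun_prop
  have hq0 : ∀ v, q 0 v = p v := fun v => by simp [q]
  have e2 : ∀ᶠ ε : ℝ in 𝓝[>] 0, ∀ a b c, 0 < triArea (p a) (p b) (p c) →
      0 < triArea (q ε a) (q ε b) (q ε c) := by
    simp only [Filter.eventually_all]
    exact fun a b c h => (continuousAt_const.eventually_lt (hcont a b c).continuousAt
      (by simpa only [hq0] using h)).filter_mono nhdsWithin_le_nhds
  have e3 : ∀ᶠ ε : ℝ in 𝓝[>] 0, ∀ a b c d, Disjoint (segment ℝ (p a) (p b)) (segment ℝ (p c) (p d)) →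
      Disjoint (segment ℝ (q ε a) (q ε b)) (segment ℝ (q ε c) (q ε d)) := by
    simp only [Filter.eventually_all]
    exact fun a b c d h => eventually_disjoint h _ _ _ _
  obtain ⟨ε, h1, h2, h3⟩ := (e1.and (e2.and e3)).exists
  generalize q ε = q at h1 h2 h3
  have neg : ∀ a b c, triArea (p a) (p b) (p c) < 0 → ¬0 < triArea (q a) (q b) (q c) := by
    intro a b c h
    have := h2 b a c (by rw [triArea_swap]; linarith)
    rw [triArea_swap] at this
    linarith
  have hX : ∀ a b c d, [a, b, c, d].Nodup → G.Adj a b → G.Adj c d →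
      Crosses (fun a b c => 0 < triArea (q a) (q b) (q c)) a b c d →
      ∃ x, CrossAt G p a b c d x := by
    intro a b c d hn k1 k2 k3
    refine hp.crossAt_of_not_disjoint hn k1 k2 fun k => ?_
    simp only [List.nodup_cons, List.mem_cons, List.not_mem_nil, or_false, not_or] at hn
    have key : ∀ u v : ℝ, u ≠ 0 → v ≠ 0 → ¬(0 < u ↔ 0 < v) → u * v < 0 := by
      intro u v hu hv h
      rcases hu.lt_or_gt with hu | hu <;> rcases hv.lt_or_gt with hv | hv
      · exact (h ⟨fun _ => by linarith, fun _ => by linarith⟩).elim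
      · exact mul_neg_of_neg_of_pos hu hv
      · exact mul_neg_of_pos_of_neg hu hv
      · tauto
    obtain ⟨x, g1, g2⟩ := exists_mem_openSegment
      (key _ _ (h1 a b c (by simp; tauto)) (h1 a b d (by simp; tauto)) k3.1)
      (key _ _ (h1 c d a (by simp; grind)) (h1 c d b (by simp; grind)) k3.2)
    exact Set.disjoint_left.1 (h3 a b c d k) (openSegment_subset_segment ℝ _ _ g1)
      (openSegment_subset_segment ℝ _ _ g2)
  have hcorner : ∀ a b c y x₁ x₂, [a, b, c, y, x₁, x₂].Nodup → G.Adj a b → G.Adj a c →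
      G.Adj y x₁ → G.Adj y x₂ →
      Crosses (fun a b c => 0 < triArea (q a) (q b) (q c)) y x₁ a b →
      Crosses (fun a b c => 0 < triArea (q a) (q b) (q c)) y x₂ a c →
      (0 < triArea (q a) (q b) (q y) ↔ 0 < triArea (q a) (q y) (q c)) ∧
      (0 < triArea (q a) (q b) (q c) ↔ 0 < triArea (q a) (q y) (q c)) := by
    intro a b c y x₁ x₂ hn k1 k2 k3 k4 k5 k6
    have hn' := hn
    simp only [List.nodup_cons, List.mem_cons, List.not_mem_nil, or_false, not_or] at hn'
    obtain ⟨x, hx⟩ := hX _ _ _ _ (by simp; grind) k3 k1 k5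
    obtain ⟨x', hx'⟩ := hX _ _ _ _ (by simp; grind) k4 k2 k6
    rcases hp.corner hn hx hx' with ⟨l1, l2, l3⟩ | ⟨l1, l2, l3⟩
    · have := h2 _ _ _ l1; have := h2 _ _ _ l2; have := h2 _ _ _ l3; tauto
    · have := neg _ _ _ l1; have := neg _ _ _ l2; have := neg _ _ _ l3; tauto
  refine ⟨fun a b c => 0 < triArea (q a) (q b) (q c), ⟨?_, ?_, ?_, ?_, ?_, ?_, ?_, ?_⟩, h2, neg, hX⟩
  · intro a b c h
    rwa [triArea_rotate]
  · intro a b c h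
    have := h1 a b c h
    rw [triArea_swap, not_lt, neg_pos]
    exact ⟨le_of_lt, fun k => lt_of_le_of_ne k this⟩
  · exact fun p q r t => triArea_interior
  · exact fun t u p q r => triArea_trans
  · exact fun t u p q r => triArea_trans'
  · intro a b c e f hn k1 k2 k3 k4 k5
    have hn' := hn
    simp only [List.nodup_cons, List.mem_cons, List.not_mem_nil, or_false, not_or] at hn'
    obtain ⟨x, hx⟩ := hX _ _ _ _ (by simp; grind) k1 k3 k4
    obtain ⟨x', hx'⟩ := hX _ _ _ _ (by simp; grind) k2 k3 k5
    exact hp.false_of_common_crossing (by tauto) hx hx'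
  · exact fun a b c y x₁ x₂ hn k1 k2 k3 k4 k5 k6 => (hcorner a b c y x₁ x₂ hn k1 k2 k3 k4 k5 k6).1
  · exact fun a b c y x₁ x₂ hn k1 k2 k3 k4 k5 k6 => (hcorner a b c y x₁ x₂ hn k1 k2 k3 k4 k5 k6).2

end IsRACDrawing

end

section

/-! ### The combinatorial embedding of a drawing, in terms of its orientation pattern -/

/-- The edges `ab`, `ac`, `ad` leave `a` in this cyclic order, in terms of orientations. -/
def Cyclic {V : Type*} (χ : V → V → V → Prop) (a b c d : V) : Prop :=
  (χ a b c ∨ χ a c d) ∧ (χ a c d ∨ χ a d b) ∧ (χ a d b ∨ χ a b c)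

theorem area_eq_sin (z w : ℂ) : area z w = ‖z‖ * ‖w‖ * Real.sin (w.arg - z.arg) := by
  rw [Real.sin_sub, area]
  conv_lhs => rw [← Complex.norm_mul_cos_arg z, ← Complex.norm_mul_sin_arg z,
    ← Complex.norm_mul_cos_arg w, ← Complex.norm_mul_sin_arg w]
  ring

/-- In counterclockwise order u, z, w, the angles from u to z and from z to w add up to less than
2π, so one of them is less than π and has a positive sine. The representatives s and t of the
directions z and w are normalised to a period that begins at u. -/
theorem area_pos_of_sbtw {z w u : ℂ} (hz : z ≠ 0) (hw : w ≠ 0) (hu : u ≠ 0)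
    (h : sbtw (z.arg : Real.Angle) (w.arg : Real.Angle) (u.arg : Real.Angle)) :
    0 < area u z ∨ 0 < area z w := by
  have hpi : (0 : ℝ) < 2 * Real.pi := by positivity
  have : Fact (0 < 2 * Real.pi) := ⟨hpi⟩
  rw [sbtw_iff_not_btw] at h
  have h' : ¬toIcoMod hpi u.arg w.arg ≤ toIocMod hpi u.arg z.arg := fun k =>
    h (QuotientAddGroup.btw_coe_iff.2 k)
  rw [not_le] at h'
  have h1 := toIocMod_mem_Ioc hpi u.arg z.arg
  have h2 := toIcoMod_mem_Ico hpi u.arg w.arg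
  have e1 := toIocMod_add_toIocDiv_zsmul hpi u.arg z.arg
  have e2 := toIcoMod_add_toIcoDiv_zsmul hpi u.arg w.arg
  generalize toIocMod hpi u.arg z.arg = s at h' h1 e1
  generalize toIcoMod hpi u.arg w.arg = t at h' h2 e2
  generalize toIocDiv hpi u.arg z.arg = m at e1
  generalize toIcoDiv hpi u.arg w.arg = n at e2
  rw [area_eq_sin, area_eq_sin]
  have k1 : Real.sin (z.arg - u.arg) = Real.sin (s - u.arg) := by
    rw [← e1, zsmul_eq_mul, add_sub_right_comm, Real.sin_add_int_mul_two_pi]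
  have k2 : Real.sin (w.arg - z.arg) = Real.sin (t - s) := by
    have : w.arg - z.arg = t - s + ((n - m : ℤ) : ℝ) * (2 * Real.pi) := by
      rw [← e1, ← e2, zsmul_eq_mul, zsmul_eq_mul]; push_cast; ring
    rw [this, Real.sin_add_int_mul_two_pi]
  rw [k1, k2]
  by_cases hs : s - u.arg < Real.pi
  · have := Real.sin_pos_of_pos_of_lt_pi (sub_pos.2 h1.1) hs
    exact Or.inl (by positivity)
  · have := Real.sin_pos_of_pos_of_lt_pi (sub_pos.2 h') (by linarith [h2.2])
    exact Or.inr (by positivity)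

variable {V : Type*} {G : SimpleGraph V} {p : V → ℂ} {χ : V → V → V → Prop}

namespace IsRACDrawing

theorem sub_ne_zero_of_adj (hp : IsRACDrawing G p) {a b : V} (h : G.Adj a b) : p b - p a ≠ 0 :=
  sub_ne_zero.2 fun k => h.ne (hp.injective k).symm

/-- Two edges that leave a vertex in the same direction would have the end of the shorter one on the
longer one. -/
theorem arg_ne (hp : IsRACDrawing G p) {a b c : V} (hb : G.Adj a b) (hc : G.Adj a c) (h : b ≠ c) :
    ((p b - p a).arg : Real.Angle) ≠ (p c - p a).arg := by
  rw [Ne, Complex.arg_coe_angle_eq_iff,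
    Complex.arg_eq_arg_iff (hp.sub_ne_zero_of_adj hb) (hp.sub_ne_zero_of_adj hc)]
  intro e
  have n1 := norm_pos_iff.2 (hp.sub_ne_zero_of_adj hb)
  have n2 := norm_pos_iff.2 (hp.sub_ne_zero_of_adj hc)
  rcases le_total ‖p c - p a‖ ‖p b - p a‖ with hl | hl
  · refine hp.ne_add_mul hb hc.ne' h.symm (r := ‖p c - p a‖ / ‖p b - p a‖) (by positivity)
      ((div_le_one n1).2 hl) ?_
    push_cast; exact e.symm
  · refine hp.ne_add_mul hc hb.ne' h (r := ‖p b - p a‖ / ‖p c - p a‖) (by positivity)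
      ((div_le_one n2).2 hl) ?_
    push_cast
    have : (‖p b - p a‖ : ℂ) ≠ 0 := by exact_mod_cast n1.ne'
    have : (‖p c - p a‖ : ℂ) ≠ 0 := by exact_mod_cast n2.ne'
    field_simp at e ⊢
    linear_combination e

/-- Of any two consecutive angles between the three directions one is less than π, so at least two
of the three orientations are strict and correctly reproduced by χ. `Cyclic` asks for a majority and
does not depend on what the perturbation did to a degenerate triple. -/
theorem cyclic_of_sbtw (hp : IsRACDrawing G p) (hr : Refines G p χ) {a b c d : V} (hb : G.Adj a b)
    (hc : G.Adj a c) (hd : G.Adj a d)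
    (h : sbtw ((p b - p a).arg : Real.Angle) (p c - p a).arg (p d - p a).arg) :
    Cyclic χ a b c d ∧ ¬Cyclic χ a d c b := by
  have zb := hp.sub_ne_zero_of_adj hb
  have zc := hp.sub_ne_zero_of_adj hc
  have zd := hp.sub_ne_zero_of_adj hd
  have h1 := area_pos_of_sbtw zb zc zd h
  have h2 := area_pos_of_sbtw zc zd zb (sbtw_cyclic_left h)
  have h3 := area_pos_of_sbtw zd zb zc (sbtw_cyclic_left (sbtw_cyclic_left h))
  have key : ∀ x y, 0 < area (p x - p a) (p y - p a) → χ a x y ∧ ¬χ a y x := by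
    intro x y hxy
    refine ⟨hr.pos _ _ _ hxy, hr.neg _ _ _ ?_⟩
    have : triArea (p a) (p y) (p x) = -area (p x - p a) (p y - p a) := by
      simp only [triArea, area]; ring
    linarith
  have k1 := key b c
  have k2 := key c d
  have k3 := key d b
  unfold Cyclic
  tauto

theorem rotation_iff (hp : IsRACDrawing G p) (hr : Refines G p χ) (a b c d : V) :
    (embeddingOf G p).rotation a b c d ↔
      G.Adj a b ∧ G.Adj a c ∧ G.Adj a d ∧ [b, c, d].Nodup ∧ Cyclic χ a b c d := by
  simp only [embeddingOf]
  constructor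
  · rintro ⟨hb, hc, hd, h⟩
    refine ⟨hb, hc, hd, ?_, (hp.cyclic_of_sbtw hr hb hc hd h).1⟩
    have n1 : b ≠ c := by rintro rfl; exact sbtw_iff_not_btw.1 h btw_rfl_right
    have n2 : c ≠ d := by rintro rfl; exact sbtw_iff_not_btw.1 h btw_rfl_left
    have n3 : b ≠ d := by rintro rfl; exact sbtw_iff_not_btw.1 h btw_rfl_left_right
    simp [n1, n2, n3]
  · rintro ⟨hb, hc, hd, hn, h⟩
    refine ⟨hb, hc, hd, ?_⟩
    simp only [List.nodup_cons, List.mem_cons, List.not_mem_nil, or_false, not_or] at hn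
    by_contra hs
    rw [sbtw_iff_not_btw, not_not] at hs
    have hs' : sbtw ((p d - p a).arg : Real.Angle) (p c - p a).arg (p b - p a).arg := by
      rw [sbtw_iff_not_btw]
      intro k
      rcases btw_antisymm k hs with e | e | e
      · exact hp.arg_ne hb hc hn.1.1 e
      · exact hp.arg_ne hc hd (by tauto) e
      · exact hp.arg_ne hd hb (by tauto) e
    exact (hp.cyclic_of_sbtw hr hd hc hb hs').2 h

theorem not_crossAt_of_common (hp : IsRACDrawing G p) {a b c : V} {x : ℂ} :
    ¬CrossAt G p a b a c x := by
  intro h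
  have harea := hp.area_ne_zero h
  obtain ⟨t, s, ht, hs, h1, h2⟩ := h.exists_eq
  refine harea ?_
  have h3 : (t : ℂ) * (p b - p a) = s * (p c - p a) := add_left_cancel (h1.symm.trans h2)
  have hre := congrArg Complex.re h3
  have him := congrArg Complex.im h3
  simp only [Complex.re_ofReal_mul, Complex.im_ofReal_mul] at hre him
  refine mul_left_cancel₀ ht.1.ne' ?_
  rw [area, mul_zero]
  linear_combination (p c - p a).im * hre - (p c - p a).re * him

theorem _root_.CrossAt.swap_left {a b c d : V} {x : ℂ} (h : CrossAt G p a b c d x) :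
    CrossAt G p b a c d x :=
  ⟨h.1.symm, h.2.1, by rw [Sym2.eq_swap]; exact h.2.2.1, by rw [openSegment_symm]; exact h.2.2.2.1,
    h.2.2.2.2⟩

theorem nodup_of_crossAt (hp : IsRACDrawing G p) {a b c d : V} {x : ℂ}
    (h : CrossAt G p a b c d x) : [a, b, c, d].Nodup := by
  have h1 : a ≠ c := by rintro rfl; exact hp.not_crossAt_of_common h
  have h2 : b ≠ c := by rintro rfl; exact hp.not_crossAt_of_common h.swap_left
  have h3 : a ≠ d := by rintro rfl; exact hp.not_crossAt_of_common h.symm.swap_left.symm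
  have h4 : b ≠ d := by rintro rfl; exact hp.not_crossAt_of_common h.symm.swap_left.symm.swap_left
  simp [h1, h2, h3, h4, h.1.ne, h.2.1.ne]

theorem crosses_of_crossAt (hp : IsRACDrawing G p) (hr : Refines G p χ) {a b c d : V} {x : ℂ}
    (h : CrossAt G p a b c d x) : Crosses χ a b c d := by
  have key : ∀ {a b c d : V}, CrossAt G p a b c d x → ¬(χ a b c ↔ χ a b d) := by
    intro a b c d h
    have p1 := hr.pos a b c
    have p2 := hr.pos a b d
    have n1 := hr.neg a b c
    have n2 := hr.neg a b d
    rcases mul_neg_iff.1 (hp.mul_triArea_neg h) with ⟨h1, h2⟩ | ⟨h1, h2⟩ <;> tauto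
  exact ⟨key h, key h.symm⟩

theorem crosses_iff (hp : IsRACDrawing G p) (hr : Refines G p χ) (a b c d : V) :
    (embeddingOf G p).crosses (a, b) (c, d) ↔
      G.Adj a b ∧ G.Adj c d ∧ [a, b, c, d].Nodup ∧ Crosses χ a b c d ∧ χ a b d := by
  have key : ∀ {x}, CrossAt G p a b c d x → (0 < area (p b - p a) (p d - p c) ↔ χ a b d) := by
    intro x h
    obtain ⟨s, h0, h1, -, e⟩ := triArea_of_crossAt h
    have h1 : 0 < 1 - s := sub_pos.2 h1
    constructor
    · intro k
      exact hr.pos _ _ _ (by rw [e]; positivity)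
    · intro k
      by_contra hn
      refine hr.neg _ _ _ ?_ k
      rw [e]
      exact mul_neg_of_pos_of_neg h1 (lt_of_le_of_ne (not_lt.1 hn) (hp.area_ne_zero h))
  simp only [embeddingOf, ← area_eq_im]
  constructor
  · rintro ⟨⟨x, h⟩, k⟩
    exact ⟨h.1, h.2.1, hp.nodup_of_crossAt h, hp.crosses_of_crossAt hr h, (key h).1 k⟩
  · rintro ⟨h1, h2, h3, h4, k⟩
    obtain ⟨x, h⟩ := hr.cross a b c d h3 h1 h2 h4
    exact ⟨⟨x, h⟩, (key h).2 k⟩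

theorem crossAt_unique (hp : IsRACDrawing G p) {a b c d : V} {x y : ℂ}
    (h : CrossAt G p a b c d x) (h' : CrossAt G p a b c d y) : x = y := by
  have harea := hp.area_ne_zero h
  obtain ⟨t, s, -, -, h1, h2⟩ := h.exists_eq
  obtain ⟨t', s', -, -, h1', h2'⟩ := h'.exists_eq
  have h3 := h1.symm.trans h2
  have h3' := h1'.symm.trans h2'
  have hre := congrArg Complex.re h3
  have him := congrArg Complex.im h3
  have hre' := congrArg Complex.re h3'
  have him' := congrArg Complex.im h3'
  simp only [Complex.add_re, Complex.add_im, Complex.re_ofReal_mul, Complex.im_ofReal_mul]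
    at hre him hre' him'
  have : t = t' := by
    refine mul_right_cancel₀ harea ?_
    rw [area]
    linear_combination (p d - p c).im * (hre - hre') - (p d - p c).re * (him - him')
  rw [h1, h1', this]

theorem comp {W : Type*} {G' : SimpleGraph W} (hp : IsRACDrawing G p) (f : G' →g G)
    (hf : Function.Injective f) : IsRACDrawing G' fun v => p (f v) where
  injective a b h := hf (hp.injective h)
  vertex_not_on_edge a b w h h1 h2 :=
    hp.vertex_not_on_edge _ _ _ (f.map_adj h) (hf.ne h1) (hf.ne h2)
  right_angle a b c d x h := hp.right_angle _ _ _ _ x ⟨f.map_adj h.1, f.map_adj h.2.1, fun e =>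
    h.2.2.1 (Sym2.map.injective hf (by simpa using e)), h.2.2.2⟩

end IsRACDrawing

/-- The combinatorial embedding that an orientation pattern describes, if every edge crosses at most
one other edge. -/
def patternEmbedding (G : SimpleGraph V) (χ : V → V → V → Prop) : CombinatorialEmbedding V where
  rotation a b c d := G.Adj a b ∧ G.Adj a c ∧ G.Adj a d ∧ [b, c, d].Nodup ∧ Cyclic χ a b c d
  crosses e f := G.Adj e.1 e.2 ∧ G.Adj f.1 f.2 ∧ [e.1, e.2, f.1, f.2].Nodup ∧
    Crosses χ e.1 e.2 f.1 f.2 ∧ χ e.1 e.2 f.2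
  before _ _ _ := False

/-- Every edge crosses at most one other edge. -/
def AtMostOneCrossing (G : SimpleGraph V) (χ : V → V → V → Prop) : Prop :=
  ∀ a b c d e f, G.Adj a b → G.Adj c d → G.Adj e f → [a, b, c, d].Nodup → [a, b, e, f].Nodup →
    Crosses χ a b c d → Crosses χ a b e f → s(c, d) = s(e, f)

/-- Rotations and crossings depend only on χ. The order of crossings along an edge is void: two
crossings on the same edge would be with the same second edge and hence at the same point. -/
theorem IsRACDrawing.embeddingOf_eq (hp : IsRACDrawing G p) (hr : Refines G p χ)
    (h : AtMostOneCrossing G χ) : embeddingOf G p = patternEmbedding G χ := by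
  ext a b c d
  · exact hp.rotation_iff hr a b c d
  · exact hp.crosses_iff hr a.1 a.2 b.1 b.2
  · simp only [patternEmbedding, iff_false]
    rintro ⟨x, y, h1, h2, h3⟩
    have := h _ _ _ _ _ _ h1.1 h1.2.1 h2.2.1 (hp.nodup_of_crossAt h1) (hp.nodup_of_crossAt h2)
      (hp.crosses_of_crossAt hr h1) (hp.crosses_of_crossAt hr h2)
    rcases Sym2.eq_iff.1 this with ⟨e1, e2⟩ | ⟨e1, e2⟩
    · rw [← e1, ← e2] at h2
      rw [hp.crossAt_unique h1 h2] at h3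
      exact lt_irrefl _ h3
    · rw [← e1, ← e2] at h2
      rw [hp.crossAt_unique h1 h2.symm.swap_left.symm] at h3
      exact lt_irrefl _ h3

theorem IsPattern.mirror_crosses (h : IsPattern G χ) {a b c d : V} (hn : [a, b, c, d].Nodup) :
    Crosses (fun a b c => χ b a c) a b c d ↔ Crosses χ a b c d := by
  simp only [List.nodup_cons, List.mem_cons, List.not_mem_nil, or_false, not_or] at hn
  unfold Crosses
  beta_reduce
  rw [h.swap_iff (by tauto : a ≠ b) (by tauto : b ≠ c) (by tauto),
    h.swap_iff (by tauto : a ≠ b) (by tauto : b ≠ d) (by tauto),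
    h.swap_iff (by tauto : c ≠ d) (by grind : d ≠ a) (by grind),
    h.swap_iff (by tauto : c ≠ d) (by grind : d ≠ b) (by grind), not_iff_not, not_iff_not]

theorem Refines.conj (hr : Refines G p χ) (hχ : IsPattern G χ) :
    Refines G (fun v => (starRingEnd ℂ) (p v)) fun a b c => χ b a c where
  pos a b c h := hr.pos _ _ _ (by
    rw [triArea_swap]; simp only [triArea, area] at h ⊢; simp at h ⊢; linarith)
  neg a b c h := hr.neg _ _ _ (by
    rw [triArea_swap]; simp only [triArea, area] at h ⊢; simp at h ⊢; linarith)
  cross a b c d hn h1 h2 h := by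
    obtain ⟨x, hx⟩ := hr.cross a b c d hn h1 h2 ((hχ.mirror_crosses hn).1 h)
    exact ⟨_, hx.conj⟩

end

section

open Refutation

/-! ### Numbered instances of the augmented square antiprism -/

namespace AntiprismVertex

/-- The vertex with a given number. -/
def ofNumber (i : ℕ) : AntiprismVertex :=
  if i < 8 then if i % 2 = 0 then outer (i / 2 : ℕ) else inner (i / 2 : ℕ) else center

/-- The number of a vertex. -/
def number : AntiprismVertex → ℕ
  | center => 8
  | outer i => 2 * i.val
  | inner i => 2 * i.val + 1

theorem number_lt (x : AntiprismVertex) : x.number < 9 := by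
  rcases x with _ | i | i
  · decide
  · revert i; decide
  · revert i; decide

theorem ofNumber_number (x : AntiprismVertex) : ofNumber x.number = x := by
  rcases x with _ | i | i
  · rfl
  · have h : ∀ i : ZMod 4, 2 * i.val < 8 ∧ 2 * i.val % 2 = 0 ∧ ((2 * i.val / 2 : ℕ) : ZMod 4) = i := by
      decide
    simp only [number, ofNumber, (h i).1, (h i).2, if_true]
  · have h : ∀ i : ZMod 4, 2 * i.val + 1 < 8 ∧ ¬(2 * i.val + 1) % 2 = 0 ∧
      (((2 * i.val + 1) / 2 : ℕ) : ZMod 4) = i := by decide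
    simp only [number, ofNumber, (h i).1, (h i).2, if_true, if_false]

theorem number_ofNumber : ∀ i < 9, (ofNumber i).number = i := by decide

theorem ofNumber_injOn : Set.InjOn ofNumber {i | i < 9} := fun i hi j hj h => by
  rw [← number_ofNumber i hi, h, number_ofNumber j hj]

theorem adj_iff (x y : AntiprismVertex) : augmentedSquareAntiprism.Adj x y ↔
    adjOf antiprismEdges x.number y.number = true := by
  rw [augmentedSquareAntiprism, SimpleGraph.fromRel_adj]
  rcases x with _ | i | i <;> rcases y with _ | j | j <;>
    simp only [Edge, number, ne_eq, reduceCtorEq, not_true, not_false_eq_true, outer.injEq,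
      inner.injEq, or_false, false_or, true_and, and_self, or_true, or_self]
  · decide
  · revert j; decide
  · revert j; decide
  · revert i; decide
  · revert i j; decide
  · revert i j; decide
  · revert i; decide
  · revert i j; decide
  · revert i j; decide

theorem _root_.Refutation.mem_or_mem_of_adjOf {E : List (ℕ × ℕ)} {i j : ℕ} (h : adjOf E i j = true) :
    (i, j) ∈ E ∨ (j, i) ∈ E := by
  simp only [adjOf, List.any_eq_true, Bool.or_eq_true, Bool.and_eq_true, Nat.beq_eq] at h
  obtain ⟨e, he, ⟨rfl, rfl⟩ | ⟨rfl, rfl⟩⟩ := h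
  exacts [Or.inl he, Or.inr he]

theorem exists_edge {x y : AntiprismVertex} (h : augmentedSquareAntiprism.Adj x y) :
    ∃ e ∈ antiprismEdges, s(x, y) = s(ofNumber e.1, ofNumber e.2) := by
  rw [adj_iff] at h
  rcases mem_or_mem_of_adjOf h with k | k
  · exact ⟨_, k, by simp [ofNumber_number]⟩
  · exact ⟨_, k, by simp [ofNumber_number]⟩

theorem adj_ofNumber : ∀ e ∈ antiprismEdges,
    augmentedSquareAntiprism.Adj (ofNumber e.1) (ofNumber e.2) := by
  simp only [adj_iff]
  decide +kernel

end AntiprismVertex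

open AntiprismVertex

/-- The graph `G'` arises from `G` by gluing an instance with points `N 0`, …, `N 8` to the side
`(v, v', u)`. -/
structure IsExtension {V W : Type*} (G : SimpleGraph V) (G' : SimpleGraph W) (ι : V → W) (N : ℕ → W)
    (v v' u : V) : Prop where
  injective : Function.Injective ι
  left : N 0 = ι v
  right : N 2 = ι v'
  injOn : Set.InjOn N {i | i < 9}
  new : ∀ i < 9, i ≠ 0 → i ≠ 2 → N i ∉ Set.range ι
  cover : ∀ w, w ∈ Set.range ι ∨ ∃ i < 9, w = N i
  adj : ∀ a b, G'.Adj a b ↔ (∃ x y, G.Adj x y ∧ a = ι x ∧ b = ι y) ∨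
    (∃ e ∈ antiprismEdges, s(a, b) = s(N e.1, N e.2)) ∨ s(a, b) = s(ι u, N 1)

namespace GluedGraph

theorem place_ofNumber_zero (H : GluedGraph) (v v' : H.V) :
    H.place v v' (ofNumber 0) = Sum.inl v := by
  have : ofNumber 0 = outer 0 := rfl
  simp [place, this]

theorem place_ofNumber_two (H : GluedGraph) (v v' : H.V) :
    H.place v v' (ofNumber 2) = Sum.inl v' := by
  have : ofNumber 2 = outer 1 := rfl
  have h : (1 : ZMod 4) ≠ 0 := by decide
  simp [place, this, h]

theorem place_of_ne (H : GluedGraph) (v v' : H.V) {x : AntiprismVertex} (h0 : x ≠ outer 0)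
    (h1 : x ≠ outer 1) : H.place v v' x = Sum.inr ⟨x, h0, h1⟩ := by
  simp [place, h0, h1]

theorem ofNumber_ne : ∀ i < 9, i ≠ 0 → i ≠ 2 → ofNumber i ≠ outer 0 ∧ ofNumber i ≠ outer 1 := by
  intro i hi h0 h2
  constructor <;> intro h <;> have := congrArg number h <;> rw [number_ofNumber i hi] at this
  · exact h0 this
  · exact h2 this

theorem isExtension (H : GluedGraph) {v v' u : H.V} (hv : v ≠ v') :
    IsExtension H.graph (H.extend v v' u).graph Sum.inl (fun i => H.place v v' (ofNumber i)) v v' u := by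
  have hnew : ∀ i (hi : i < 9) (h0 : i ≠ 0) (h2 : i ≠ 2), H.place v v' (ofNumber i) =
      Sum.inr ⟨ofNumber i, ofNumber_ne i hi h0 h2⟩ := fun i hi h0 h2 =>
    H.place_of_ne v v' (ofNumber_ne i hi h0 h2).1 (ofNumber_ne i hi h0 h2).2
  have hinj : Set.InjOn (fun i => H.place v v' (ofNumber i)) {i | i < 9} := by
    intro i hi j hj h
    have hi' : i < 9 := hi
    have hj' : j < 9 := hj
    simp only at h
    by_cases i0 : i = 0
    · subst i0
      by_cases j0 : j = 0
      · exact j0.symm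
      by_cases j2 : j = 2
      · subst j2
        rw [place_ofNumber_zero, place_ofNumber_two] at h
        exact (hv (Sum.inl_injective h)).elim
      · rw [hnew j hj' j0 j2, place_ofNumber_zero] at h
        cases h
    by_cases i2 : i = 2
    · subst i2
      by_cases j0 : j = 0
      · subst j0
        rw [place_ofNumber_zero, place_ofNumber_two] at h
        exact (hv (Sum.inl_injective h).symm).elim
      by_cases j2 : j = 2
      · exact j2.symm
      · rw [hnew j hj' j0 j2, place_ofNumber_two] at h
        cases h
    rw [hnew i hi' i0 i2] at h
    by_cases j0 : j = 0
    · subst j0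
      rw [place_ofNumber_zero] at h
      cases h
    by_cases j2 : j = 2
    · subst j2
      rw [place_ofNumber_two] at h
      cases h
    rw [hnew j hj' j0 j2] at h
    exact ofNumber_injOn hi hj (congrArg Subtype.val (Sum.inr_injective h))
  change IsExtension (W := H.ExtendV) H.graph (SimpleGraph.fromEdgeSet
    (Sym2.map Sum.inl '' H.graph.edgeSet ∪
      Sym2.map (H.place v v') '' augmentedSquareAntiprism.edgeSet ∪
      {s(Sum.inl u, H.place v v' (.inner 0))})) _ _ _ _ _
  refine ⟨Sum.inl_injective, H.place_ofNumber_zero v v', H.place_ofNumber_two v v', hinj, ?_, ?_, ?_⟩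
  · rintro i hi h0 h2 ⟨x, hx⟩
    rw [hnew i hi h0 h2] at hx
    cases hx
  · rintro (x | ⟨x, h0, h1⟩)
    · exact Or.inl ⟨x, rfl⟩
    · refine Or.inr ⟨x.number, x.number_lt, ?_⟩
      rw [ofNumber_number, H.place_of_ne v v' h0 h1]
  · intro a b
    -- `SimpleGraph.fromEdgeSet` discards loops, so identifying vertices could lose edges;
    -- injectivity of the numbering rules this out.
    have hloop : ∀ e ∈ antiprismEdges, H.place v v' (ofNumber e.1) ≠ H.place v v' (ofNumber e.2) := by
      intro e he h
      have key : ∀ e ∈ antiprismEdges, e.1 < 9 ∧ e.2 < 9 ∧ e.1 ≠ e.2 := by decide +kernel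
      exact (key e he).2.2 (hinj (key e he).1 (key e he).2.1 h)
    simp only [SimpleGraph.fromEdgeSet_adj, Set.mem_union, Set.mem_image,
      Set.mem_singleton_iff]
    constructor
    · rintro ⟨(⟨e, he, h⟩ | ⟨e, he, h⟩) | h, -⟩
      · induction e using Sym2.ind with | _ x y => ?_
        rw [Sym2.map_mk, Sym2.eq_iff] at h
        rcases h with ⟨rfl, rfl⟩ | ⟨rfl, rfl⟩
        · exact Or.inl ⟨x, y, he, rfl, rfl⟩
        · exact Or.inl ⟨y, x, he.symm, rfl, rfl⟩
      · induction e using Sym2.ind with | _ x y => ?_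
        obtain ⟨e, he, h'⟩ := exists_edge (x := x) (y := y) he
        rw [h', Sym2.map_mk] at h
        exact Or.inr (Or.inl ⟨e, he, h.symm⟩)
      · exact Or.inr (Or.inr h)
    · rintro (⟨x, y, h, rfl, rfl⟩ | ⟨e, he, h⟩ | h)
      · exact ⟨Or.inl (Or.inl ⟨s(x, y), h, rfl⟩), fun k => h.ne (Sum.inl_injective k)⟩
      · refine ⟨Or.inl (Or.inr ⟨s(ofNumber e.1, ofNumber e.2), adj_ofNumber e he, h.symm⟩), ?_⟩
        rintro rfl
        have := hloop e he
        rcases Sym2.eq_iff.1 h with ⟨h1, h2⟩ | ⟨h1, h2⟩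
        · exact this (h1.symm.trans h2)
        · exact this (h2.symm.trans h1)
      · refine ⟨Or.inr h, ?_⟩
        rintro rfl
        have h1 := hnew 1 (by norm_num) (by norm_num) (by norm_num)
        change s(a, a) = s(Sum.inl u, H.place v v' (ofNumber 1)) at h
        rw [h1] at h
        rcases Sym2.eq_iff.1 h with ⟨h1, h2⟩ | ⟨h1, h2⟩
        · cases h1.symm.trans h2
        · cases h1.symm.trans h2

/-- The list of the instances from which a graph is glued together. -/
inductive IsAssembly : (H : GluedGraph) → List (ℕ → H.V) → Prop
  | single : IsAssembly single [ofNumber]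
  | extend {H : GluedGraph} {L : List (ℕ → H.V)} {v v' u : H.V} :
      IsAssembly H L → (v, v', u) ∈ H.freeSides →
      IsAssembly (H.extend v v' u)
        ((fun i => H.place v v' (ofNumber i)) :: L.map fun pt i => Sum.inl (pt i))

theorem IsGluedFrom.exists_isAssembly {n : ℕ} {H : GluedGraph} (h : H.IsGluedFrom n) :
    ∃ L, IsAssembly H L ∧ L.length = n := by
  induction h with
  | single => exact ⟨_, .single, rfl⟩
  | extend _ hs ih =>
    obtain ⟨L, hL, rfl⟩ := ih
    exact ⟨_, hL.extend hs, (List.length_cons).trans (congrArg _ (List.length_map _))⟩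

end GluedGraph

namespace Refutation

variable {V : Type*} {G : SimpleGraph V}

/-- The points of two instances `p` and `q` of which the second is glued with its side `0` to the
side `k` of the first. -/
def gluing (p : ℕ → V) (k : ℕ) (q : ℕ → V) (i : ℕ) : V :=
  -- The list enumerates the numbers that `second` sends to 9, …, 15. The common vertices `q 0` and
  -- `q 2` appear as the numbers 0 and 2 of the first instance, after a rotation that makes its side
  -- k the side 0.
  if i < 9 then p (symm (2 * k) false i) else q ([1, 3, 4, 5, 6, 7, 8].getD (i - 9) 9)

theorem gluing_first (p : ℕ → V) (k : ℕ) (q : ℕ → V) {i : ℕ} (hi : i < 9) :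
    gluing p k q i = p (symm (2 * k) false i) := if_pos hi

theorem gluing_second {p : ℕ → V} {k : ℕ} {q : ℕ → V} (hk : k < 4) (h0 : q 0 = p (2 * k))
    (h2 : q 2 = p ((2 * k + 2) % 8)) {i : ℕ} (hi : i < 9) : gluing p k q (second i) = q i := by
  have e0 : symm (2 * k) false 0 = 2 * k := by interval_cases k <;> rfl
  have e2 : symm (2 * k) false 2 = (2 * k + 2) % 8 := by interval_cases k <;> rfl
  interval_cases i <;> simp [gluing, second, e0, e2, h0, h2]

end Refutation

theorem IsExtension.map_adj {V W : Type*} {G : SimpleGraph V} {G' : SimpleGraph W} {ι : V → W}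
    {N : ℕ → W} {v v' u : V} (h : IsExtension G G' ι N v v' u) {a b : V} (hab : G.Adj a b) :
    G'.Adj (ι a) (ι b) :=
  (h.adj _ _).2 (Or.inl ⟨a, b, hab, rfl, rfl⟩)

theorem IsExtension.isAntiprism {V W : Type*} {G : SimpleGraph V} {G' : SimpleGraph W} {ι : V → W}
    {N : ℕ → W} {v v' u : V} (h : IsExtension G G' ι N v v' u) : IsAntiprism G' N :=
  ⟨h.injOn, fun e he => (h.adj _ _).2 (Or.inr (Or.inl ⟨e, he, rfl⟩))⟩

theorem Refutation.IsAntiprism.map {V W : Type*} {G : SimpleGraph V} {G' : SimpleGraph W} {ι : V → W}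
    (hι : Function.Injective ι) (hG : ∀ a b, G.Adj a b → G'.Adj (ι a) (ι b)) {pt : ℕ → V}
    (h : IsAntiprism G pt) : IsAntiprism G' fun i => ι (pt i) :=
  ⟨hι.comp_injOn h.1, fun e he => hG _ _ (h.2 e he)⟩

theorem Refutation.IsGlued.map {V W : Type*} {G : SimpleGraph V} {G' : SimpleGraph W} {ι : V → W}
    (hι : Function.Injective ι) (hG : ∀ a b, G.Adj a b → G'.Adj (ι a) (ι b)) {pt : ℕ → V}
    (h : IsGlued G pt) : IsGlued G' fun i => ι (pt i) :=
  ⟨hι.comp_injOn h.1, fun e he => hG _ _ (h.2 e he)⟩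

theorem IsExtension.isGlued {V W : Type*} {G : SimpleGraph V} {G' : SimpleGraph W} {ι : V → W}
    {N : ℕ → W} {v v' u : V} (h : IsExtension G G' ι N v v' u) {p : ℕ → V} (hp : IsAntiprism G p)
    {k : ℕ} (hk : k < 4) (h0 : v = p (2 * k)) (h2 : v' = p ((2 * k + 2) % 8))
    (h1 : u = p (2 * k + 1)) : IsGlued G' (gluing (fun i => ι (p i)) k N) := by
  have hs : ∀ i < 9, gluing (fun i => ι (p i)) k N (Refutation.second i) = N i := fun i hi =>
    gluing_second hk (by rw [h.left, h0]) (by rw [h.right, h2]) hi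
  have hA := (hp.map h.injective fun _ _ => h.map_adj).symm (k := 2 * k) (by omega) false
  have key : ∀ i < 16, (i < 9) ∨ ∃ j < 9, j ≠ 0 ∧ j ≠ 2 ∧ i = Refutation.second j := by decide
  have hfirst : ∀ i < 9, gluing (fun i => ι (p i)) k N i ∈ Set.range ι := fun i hi => by
    rw [gluing_first _ _ _ hi]
    exact ⟨_, rfl⟩
  refine ⟨?_, ?_⟩
  · intro i hi j hj hij
    rcases key i hi with hi' | ⟨i', hi', i0, i2, rfl⟩ <;>
      rcases key j hj with hj' | ⟨j', hj', j0, j2, rfl⟩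
    · rw [gluing_first _ _ _ hi', gluing_first _ _ _ hj'] at hij
      exact hA.1 hi' hj' hij
    · rw [hs j' hj'] at hij
      exact (h.new j' hj' j0 j2 (hij ▸ hfirst i hi')).elim
    · rw [hs i' hi'] at hij
      exact (h.new i' hi' i0 i2 (hij ▸ hfirst j hj')).elim
    · rw [hs i' hi', hs j' hj'] at hij
      rw [h.injOn hi' hj' hij]
  · intro e he
    have hlt : ∀ e ∈ antiprismEdges, e.1 < 9 ∧ e.2 < 9 := by decide +kernel
    rw [gluedEdges, List.mem_append, List.mem_append, List.mem_map, List.mem_singleton] at he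
    rcases he with (he | ⟨e, he, rfl⟩) | rfl
    · rw [gluing_first _ _ _ (hlt e he).1, gluing_first _ _ _ (hlt e he).2]
      exact hA.2 e he
    · simp only [hs _ (hlt e he).1, hs _ (hlt e he).2]
      exact h.isAntiprism.2 e he
    · refine (h.adj _ _).2 (Or.inr (Or.inr ?_))
      have e1 : symm (2 * k) false 1 = 2 * k + 1 := by interval_cases k <;> rfl
      have e9 := hs 1 (by norm_num)
      rw [gluing_first _ _ _ (by norm_num), e1, h1]
      rw [show Refutation.second 1 = 9 from rfl] at e9
      simp only [e9]

end

/-! ### Incidences between the instances of a glued graph -/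

section

open Refutation AntiprismVertex

/-- The number of a vertex that is not on the external quadrilateral. -/
def IsInternal (i : ℕ) : Prop := i % 2 = 1 ∨ i = 8

/-- The structure of a graph that is glued together from the instances in `L` and has the free sides
`F`. -/
structure Assembly {V : Type*} (G : SimpleGraph V) (L : List (ℕ → V)) (F : Set (V × V × V)) :
    Prop where
  isAntiprism : ∀ p ∈ L, IsAntiprism G p
  cover : ∀ a, ∃ p ∈ L, ∃ i < 9, a = p i
  internal : ∀ p ∈ L, ∀ q ∈ L, ∀ i < 9, ∀ j < 9, IsInternal i → p i = q j → p = q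
  free : ∀ a b c, (a, b, c) ∈ F → ∃ p ∈ L, ∃ k < 4, a = p (2 * k) ∧ b = p ((2 * k + 2) % 8) ∧
    c = p (2 * k + 1) ∧ ∀ q ∈ L, ∀ i < 9, ∀ j < 9, q i = a → q j = b → q = p
  edge : ∀ a b, G.Adj a b → (∃ p ∈ L, ∃ e ∈ antiprismEdges, s(a, b) = s(p e.1, p e.2)) ∨
    ∃ p ∈ L, ∃ q ∈ L, ∃ k < 4, IsGlued G (gluing p k q) ∧ q 0 = p (2 * k) ∧
      q 2 = p ((2 * k + 2) % 8) ∧ s(a, b) = s(p (2 * k + 1), q 1)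

theorem lt_nine_of_mem_antiprismEdges : ∀ e ∈ antiprismEdges, e.1 < 9 ∧ e.2 < 9 := by
  decide +kernel

variable {V W : Type*} {G : SimpleGraph V} {G' : SimpleGraph W} {ι : V → W} {N : ℕ → W} {v v' u : V}

theorem IsExtension.eq_of_map_eq (h : IsExtension G G' ι N v v' u) {i : ℕ} (hi : i < 9) {a : V}
    (e : N i = ι a) : i = 0 ∧ a = v ∨ i = 2 ∧ a = v' := by
  by_cases h0 : i = 0
  · exact Or.inl ⟨h0, h.injective (by rw [← e, h0, h.left])⟩
  by_cases h2 : i = 2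
  · exact Or.inr ⟨h2, h.injective (by rw [← e, h2, h.right])⟩
  exact (h.new i hi h0 h2 ⟨a, e.symm⟩).elim

/-- The new instance meets the old graph only in the two ends of a free side, which are external
vertices of an instance P. This keeps internal vertices private to their instances. It also keeps
both ends of each remaining free side in only one instance, as the field `free` requires. -/
theorem Assembly.extend {L : List (ℕ → V)} {F : Set (V × V × V)} (hA : Assembly G L F)
    (h : IsExtension G G' ι N v v' u) (hF : (v, v', u) ∈ F) :
    Assembly G' (N :: L.map fun p i => ι (p i))
      ({t | ∃ a b c, (a, b, c) ∈ F ∧ (a, b, c) ≠ (v, v', u) ∧ t = (ι a, ι b, ι c)} ∪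
        {t | ∃ k < 4, k ≠ 0 ∧ t = (N (2 * k), N ((2 * k + 2) % 8), N (2 * k + 1))}) := by
  obtain ⟨P, hP, k, hk, rfl, rfl, rfl, huniq⟩ := hA.free _ _ _ hF
  have hold : ∀ q ∈ L, (fun i => ι (q i)) ∈ (N :: L.map fun p i => ι (p i)) := fun q hq =>
    List.mem_cons_of_mem _ (List.mem_map_of_mem hq)
  refine ⟨?_, ?_, ?_, ?_, ?_⟩
  · intro p hp
    rcases List.mem_cons.1 hp with rfl | hp
    · exact h.isAntiprism
    · obtain ⟨q, hq, rfl⟩ := List.mem_map.1 hp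
      exact (hA.isAntiprism _ (by assumption)).map h.injective fun _ _ => h.map_adj
  · intro a
    rcases h.cover a with ⟨b, rfl⟩ | ⟨i, hi, rfl⟩
    · obtain ⟨p, hp, i, hi, rfl⟩ := hA.cover b
      exact ⟨_, hold p hp, i, hi, rfl⟩
    · exact ⟨N, List.mem_cons_self, i, hi, rfl⟩
  -- An old vertex of the new instance is an end of the side of P. If it were internal in some old
  -- instance, that instance would be P, where the ends of a side have even numbers below 8.
  · have key : ∀ q ∈ L, ∀ i < 9, ∀ j < 9, IsInternal i → ι (q i) ≠ N j := by
      intro q hq i hi j hj hint e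
      have hodd : ∀ k < 4, i ≠ 2 * k ∧ i ≠ (2 * k + 2) % 8 := by
        intro k hk
        rcases hint with h | h <;> omega
      rcases h.eq_of_map_eq hj e.symm with ⟨-, e⟩ | ⟨-, e⟩
      · have := hA.internal q hq P hP i hi (2 * k) (by omega) hint e
        subst this
        exact (hodd k hk).1 ((hA.isAntiprism _ hq).1 hi (show 2 * k < 9 by omega) e)
      · have := hA.internal q hq P hP i hi ((2 * k + 2) % 8) (by omega) hint e
        subst this
        exact (hodd k hk).2 ((hA.isAntiprism _ hq).1 hi (show (2 * k + 2) % 8 < 9 by omega) e)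
    intro p hp q hq i hi j hj hint e
    rcases List.mem_cons.1 hp with rfl | hp
    · rcases List.mem_cons.1 hq with rfl | hq
      · rfl
      · obtain ⟨q, hq', rfl⟩ := List.mem_map.1 hq
        rcases h.eq_of_map_eq hi e with ⟨e, -⟩ | ⟨e, -⟩ <;> subst e <;>
          exact absurd hint (by unfold IsInternal; omega)
    · obtain ⟨p, hp', rfl⟩ := List.mem_map.1 hp
      rcases List.mem_cons.1 hq with rfl | hq
      · exact (key p hp' i hi j hj hint e).elim
      · obtain ⟨q, hq', rfl⟩ := List.mem_map.1 hq
        rw [hA.internal p hp' q hq' i hi j hj hint (h.injective e)]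
  · intro a b c habc
    rcases habc with ⟨a, b, c, habc, hne, e⟩ | ⟨l, hl, hl0, e⟩
    · simp only [Prod.mk.injEq] at e
      obtain ⟨rfl, rfl, rfl⟩ := e
      obtain ⟨p, hp, l, hl, rfl, rfl, rfl, hu⟩ := hA.free a b c habc
      refine ⟨_, hold p hp, l, hl, rfl, rfl, rfl, ?_⟩
      intro q hq i hi j hj e1 e2
      rcases List.mem_cons.1 hq with rfl | hq
      · exfalso
        -- If the new instance contained both ends of an old free side, these would be the ends of
        -- the side just used. By uniqueness the owner would be P and the side the same, but that
        -- side is no longer free.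
        have hpP : P = p → l ≠ k := by
          rintro rfl rfl
          exact hne rfl
        rcases h.eq_of_map_eq hi e1 with ⟨-, f1⟩ | ⟨-, f1⟩ <;>
          rcases h.eq_of_map_eq hj e2 with ⟨-, f2⟩ | ⟨-, f2⟩
        · have := (hA.isAntiprism p hp).1 (show 2 * l < 9 by omega)
            (show (2 * l + 2) % 8 < 9 by omega) (f1.trans f2.symm)
          omega
        · have hP' := hu P hP (2 * k) (by omega) ((2 * k + 2) % 8) (by omega) f1.symm f2.symm
          have := (hA.isAntiprism p hp).1 (show 2 * l < 9 by omega) (show 2 * k < 9 by omega)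
            (by rw [f1, hP'])
          exact hpP hP' (by omega)
        · have hP' := hu P hP ((2 * k + 2) % 8) (by omega) (2 * k) (by omega) f1.symm f2.symm
          have g1 := (hA.isAntiprism p hp).1 (show 2 * l < 9 by omega)
            (show (2 * k + 2) % 8 < 9 by omega) (by rw [f1, hP'])
          have g2 := (hA.isAntiprism p hp).1 (show (2 * l + 2) % 8 < 9 by omega)
            (show 2 * k < 9 by omega) (by rw [f2, hP'])
          omega
        · have := (hA.isAntiprism p hp).1 (show 2 * l < 9 by omega)
            (show (2 * l + 2) % 8 < 9 by omega) (f1.trans f2.symm)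
          omega
      · obtain ⟨q, hq', rfl⟩ := List.mem_map.1 hq
        rw [hu q hq' i hi j hj (h.injective e1) (h.injective e2)]
    · simp only [Prod.mk.injEq] at e
      obtain ⟨rfl, rfl, rfl⟩ := e
      refine ⟨N, List.mem_cons_self, l, hl, rfl, rfl, rfl, ?_⟩
      intro q hq i hi j hj e1 e2
      rcases List.mem_cons.1 hq with rfl | hq
      · rfl
      · obtain ⟨q, hq', rfl⟩ := List.mem_map.1 hq
        rcases h.eq_of_map_eq (show 2 * l < 9 by omega) e1.symm with ⟨f1, -⟩ | ⟨f1, -⟩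
        · omega
        · rcases h.eq_of_map_eq (show (2 * l + 2) % 8 < 9 by omega) e2.symm with ⟨f2, -⟩ | ⟨f2, -⟩ <;>
            omega
  · intro a b hab
    rcases (h.adj a b).1 hab with ⟨a, b, hab', rfl, rfl⟩ | ⟨e, he, hab⟩ | hab
    · rcases hA.edge a b hab' with ⟨p, hp, e, he, hs⟩ | ⟨p, hp, q, hq, l, hl, hg, h0, h2, hs⟩
      · refine Or.inl ⟨_, hold p hp, e, he, ?_⟩
        simpa using congrArg (Sym2.map ι) hs
      · refine Or.inr ⟨_, hold p hp, _, hold q hq, l, hl, ?_, congrArg ι h0, congrArg ι h2, ?_⟩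
        · have := hg.map h.injective fun _ _ => h.map_adj
          convert this using 2 with i
          simp only [gluing]
          split_ifs <;> rfl
        · simpa using congrArg (Sym2.map ι) hs
    · exact Or.inl ⟨N, List.mem_cons_self, e, he, hab⟩
    · exact Or.inr ⟨_, hold P hP, N, List.mem_cons_self, k, hk,
        h.isGlued (hA.isAntiprism P hP) hk rfl rfl rfl, h.left, h.right, hab⟩

namespace GluedGraph

theorem isAntiprism_ofNumber : IsAntiprism augmentedSquareAntiprism ofNumber :=
  ⟨ofNumber_injOn, adj_ofNumber⟩

theorem mem_freeSides_single (a b c : AntiprismVertex) : (a, b, c) ∈ single.freeSides ↔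
    ∃ k < 4, a = ofNumber (2 * k) ∧ b = ofNumber ((2 * k + 2) % 8) ∧ c = ofNumber (2 * k + 1) := by
  have key : ∀ k < 4, ofNumber (2 * k) = outer (k : ℕ) ∧
      ofNumber ((2 * k + 2) % 8) = outer ((k : ℕ) + 1) ∧ ofNumber (2 * k + 1) = .inner (k : ℕ) := by
    intro k hk
    interval_cases k <;> exact ⟨rfl, rfl, rfl⟩
  constructor
  · rintro ⟨i, hi⟩
    simp only [Prod.mk.injEq] at hi
    obtain ⟨rfl, rfl, rfl⟩ := hi
    have hi : i.val < 4 := ZMod.val_lt i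
    refine ⟨i.val, hi, ?_⟩
    rw [(key _ hi).1, (key _ hi).2.1, (key _ hi).2.2, ZMod.natCast_zmod_val]
    exact ⟨rfl, rfl, rfl⟩
  · rintro ⟨k, hk, rfl, rfl, rfl⟩
    rw [(key _ hk).1, (key _ hk).2.1, (key _ hk).2.2]
    exact ⟨k, rfl⟩

theorem freeSides_extend (H : GluedGraph) (v v' u : H.V) : (H.extend v v' u).freeSides =
    {t : H.ExtendV × H.ExtendV × H.ExtendV | ∃ a b c, (a, b, c) ∈ H.freeSides ∧
        (a, b, c) ≠ (v, v', u) ∧ t = (Sum.inl a, Sum.inl b, Sum.inl c)} ∪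
      {t | ∃ k < 4, k ≠ 0 ∧ t = (H.place v v' (ofNumber (2 * k)),
        H.place v v' (ofNumber ((2 * k + 2) % 8)), H.place v v' (ofNumber (2 * k + 1)))} := by
  have key : ∀ k < 4, ofNumber (2 * k) = outer (k : ℕ) ∧
      ofNumber ((2 * k + 2) % 8) = outer ((k : ℕ) + 1) ∧ ofNumber (2 * k + 1) = .inner (k : ℕ) := by
    intro k hk
    interval_cases k <;> exact ⟨rfl, rfl, rfl⟩
  refine Set.ext fun t => or_congr Iff.rfl ?_
  constructor
  · rintro ⟨i, hi, rfl⟩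
    have hi' : i.val < 4 := ZMod.val_lt i
    refine ⟨i.val, hi', by simpa using hi, ?_⟩
    rw [(key _ hi').1, (key _ hi').2.1, (key _ hi').2.2, ZMod.natCast_zmod_val]
  · rintro ⟨k, hk, hk0, rfl⟩
    rw [(key _ hk).1, (key _ hk).2.1, (key _ hk).2.2]
    refine ⟨k, ?_, rfl⟩
    interval_cases k <;> first | exact (hk0 rfl).elim | decide

theorem assembly_single : Assembly single.graph [ofNumber] single.freeSides where
  isAntiprism p hp := by
    rw [List.mem_singleton.1 hp]
    exact isAntiprism_ofNumber
  cover a := ⟨_, List.mem_singleton_self _, number a, number_lt a, (ofNumber_number a).symm⟩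
  internal p hp q hq _ _ _ _ _ _ := by rw [List.mem_singleton.1 hp, List.mem_singleton.1 hq]
  free a b c h := by
    obtain ⟨k, hk, h1, h2, h3⟩ := (mem_freeSides_single a b c).1 h
    exact ⟨_, List.mem_singleton_self _, k, hk, h1, h2, h3, fun q hq _ _ _ _ _ _ =>
      List.mem_singleton.1 hq⟩
  edge a b h := Or.inl ⟨_, List.mem_singleton_self _, exists_edge h⟩

theorem IsAssembly.assembly {H : GluedGraph} {L : List (ℕ → H.V)} (h : IsAssembly H L) :
    Assembly H.graph L H.freeSides := by
  induction h with
  | single => exact assembly_single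
  | @extend H L v v' u hL hF ih =>
    rw [freeSides_extend]
    refine ih.extend (isExtension H ?_) hF
    obtain ⟨p, hp, k, hk, rfl, rfl, -⟩ := ih.free _ _ _ hF
    intro e
    have := (ih.isAntiprism p hp).1 (show 2 * k < 9 by omega) (show (2 * k + 2) % 8 < 9 by omega) e
    omega

theorem IsAssembly.isExtension {H : GluedGraph} {L : List (ℕ → H.V)} (h : IsAssembly H L)
    {v v' u : H.V} (hF : (v, v', u) ∈ H.freeSides) : IsExtension H.graph (H.extend v v' u).graph
      Sum.inl (fun i => H.place v v' (ofNumber i)) v v' u := by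
  refine GluedGraph.isExtension H ?_
  obtain ⟨p, hp, k, hk, rfl, rfl, -⟩ := h.assembly.free _ _ _ hF
  intro e
  have := (h.assembly.isAntiprism p hp).1 (show 2 * k < 9 by omega)
    (show (2 * k + 2) % 8 < 9 by omega) e
  omega

end GluedGraph

end

/-! ### Instances do not overlap -/

section

open Refutation AntiprismVertex

namespace Refutation

variable {V W : Type*} {G : SimpleGraph V} {χ : V → V → V → Prop} {p q : ℕ → V}

theorem Fact.means_comap (ι : V → W) (χ : W → W → W → Prop) (pt : ℕ → V) (f : Fact) :
    f.Means (fun a b c => χ (ι a) (ι b) (ι c)) pt ↔ f.Means χ fun i => ι (pt i) := by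
  induction f with
  | not f ih => exact not_congr ih
  | _ => exact Iff.rfl

theorem isStandard_comap (ι : V → W) (χ : W → W → W → Prop) (pt : ℕ → V) :
    IsStandard (fun a b c => χ (ι a) (ι b) (ι c)) pt ↔ IsStandard χ fun i => ι (pt i) :=
  forall₂_congr fun f _ => f.means_comap ι χ pt

theorem Fact.means_iff_of_code (hχ : IsPattern G χ) {n : ℕ} (hn : n ≤ 16) {pt : ℕ → V}
    (hpt : Set.InjOn pt {i | i < n}) {f g : Fact} (hf : f.wf n = true) (hg : g.wf n = true)
    (h : f.code = g.code) : f.Means χ pt ↔ g.Means χ pt := by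
  rw [← holds_code hχ hpt hn hf, ← holds_code hχ hpt hn hg, h]

/-- Whether a fact about `n` points is, up to symmetries, in a list. -/
def listed (n : ℕ) (l : List Fact) (g : Fact) : Bool :=
  g.wf n && l.any fun f => f.wf n && Nat.beq f.code g.code

theorem means_of_listed (hχ : IsPattern G χ) {n : ℕ} (hn : n ≤ 16) {pt : ℕ → V}
    (hpt : Set.InjOn pt {i | i < n}) {l : List Fact} (hl : ∀ f ∈ l, f.Means χ pt) {g : Fact}
    (h : listed n l g = true) : g.Means χ pt := by
  simp only [listed, Bool.and_eq_true, List.any_eq_true, Nat.beq_eq] at h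
  obtain ⟨h1, f, hf, h2, h3⟩ := h
  exact (Fact.means_iff_of_code hχ hn hpt h2 h1 h3).1 (hl f hf)

/-- The orientation of an instance. -/
def Positive (χ : V → V → V → Prop) (p : ℕ → V) : Prop := χ (p 8) (p 0) (p 1)

/-- An instance is drawn as in the standard drawing or its mirror image. -/
def IsStandardOrMirror (χ : V → V → V → Prop) (p : ℕ → V) : Prop :=
  IsStandard χ p ∨ IsStandard (fun a b c => χ b a c) p

theorem IsStandard.positive (h : IsStandard χ p) : Positive χ p :=
  h (.orient 8 0 1) (List.mem_append_left _ (List.mem_append_left _ List.mem_cons_self))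

theorem not_positive_of_mirror (hχ : IsPattern G χ) (hp : IsAntiprism G p)
    (h : IsStandard (fun a b c => χ b a c) p) : ¬Positive χ p :=
  (IsPattern.swap_of_distinct hχ hp.1 (by decide)).1 h.positive

theorem IsStandardOrMirror.isStandard (h : IsStandardOrMirror χ p) (hχ : IsPattern G χ)
    (hp : IsAntiprism G p) (hpos : Positive χ p) : IsStandard χ p :=
  h.resolve_right fun k => not_positive_of_mirror hχ hp k hpos

theorem IsStandardOrMirror.isStandard_mirror (h : IsStandardOrMirror χ p) (hpos : ¬Positive χ p) :
    IsStandard (fun a b c => χ b a c) p :=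
  h.resolve_left fun k => hpos k.positive

/-- An even rotation permutes the standard crossings and keeps the orientation at the centre, and
these already determine the whole standard drawing. -/
theorem IsStandard.of_symm (hχ : IsPattern G χ) (hp : IsAntiprism G p) {k : ℕ} (hk : k < 4)
    (h : IsStandard χ fun i => p (symm (2 * k) false i)) : IsStandard χ p := by
  have h' : ∀ f ∈ standardFacts.map (Fact.map (symm (2 * k) false)), f.Means χ p := by
    intro f hf
    obtain ⟨f, hf', rfl⟩ := List.mem_map.1 hf
    exact Fact.means_map.2 (h f hf')
  have key : ∀ k < 4, ∀ f ∈ (.orient 8 0 1 :: standardCrossings),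
      listed 9 (standardFacts.map (Fact.map (symm (2 * k) false))) f = true := by decide +kernel
  have hm := fun f hf => means_of_listed hχ (by norm_num) hp.1 h' (key k hk f hf)
  exact isStandard_of_crosses hχ hp (hm _ List.mem_cons_self) fun f hf =>
    hm f (List.mem_cons_of_mem _ hf)

theorem gluing_symm {k : ℕ} (hk : k < 4) {i : ℕ} (hi : i < 9) :
    gluing p k q (symm (8 - 2 * k) false i) = p i := by
  have h : ∀ k < 4, ∀ i < 9, symm (8 - 2 * k) false i < 9 ∧
      symm (2 * k) false (symm (8 - 2 * k) false i) = i := by decide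
  rw [gluing_first _ _ _ (h k hk i hi).1, (h k hk i hi).2]

/-- Two instances `p` and `q` of which the second is glued with its side `0` to the side `k` of the
first. -/
structure Glued (G : SimpleGraph V) (p : ℕ → V) (k : ℕ) (q : ℕ → V) : Prop where
  lt : k < 4
  left : IsAntiprism G p
  right : IsAntiprism G q
  isGlued : IsGlued G (gluing p k q)
  zero : q 0 = p (2 * k)
  two : q 2 = p ((2 * k + 2) % 8)

namespace Glued

variable {k : ℕ}

theorem gluing_second (h : Glued G p k q) {i : ℕ} (hi : i < 9) :
    gluing p k q (second i) = q i :=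
  Refutation.gluing_second h.lt h.zero h.two hi

theorem isStandard (hχ : IsPattern G χ) (h : Glued G p k q) :
    IsStandard χ p ∧ IsStandard (fun a b c => χ b a c) q ∨
      IsStandard (fun a b c => χ b a c) p ∧ IsStandard χ q := by
  have e1 : ∀ {χ}, IsPattern G χ → IsStandard χ (gluing p k q) → IsStandard χ p := fun hχ hs =>
    (hs.congr fun i hi => gluing_first p k q hi).of_symm hχ h.left h.lt
  have e2 : ∀ {χ}, IsStandard χ (fun i => gluing p k q (second i)) → IsStandard χ q := fun hs =>
    hs.congr fun i hi => h.gluing_second hi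
  exact (h.isGlued.isStandard hχ).imp (And.imp (e1 hχ) e2) (And.imp (e1 hχ.mirror) e2)

/-- Glued instances are numbered alike along their common side but lie on different sides of it,
like mirror images. -/
theorem positive_iff (hχ : IsPattern G χ) (h : Glued G p k q) : Positive χ p ↔ ¬Positive χ q := by
  rcases h.isStandard hχ with ⟨h1, h2⟩ | ⟨h1, h2⟩
  · exact iff_of_true h1.positive (not_positive_of_mirror hχ h.right h2)
  · exact iff_of_false (not_positive_of_mirror hχ h.left h1) (not_not.2 h2.positive)

theorem wf_separatedFacts : ∀ f ∈ separatedFacts, f.wf 16 = true ∧ f.mirror.code = f.code := by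
  have : ∀ f ∈ separatedFacts, (f.wf 16 && Nat.beq f.mirror.code f.code) = true := by
    decide +kernel
  simpa [Nat.beq_eq] using this

theorem separated (hχ : IsPattern G χ) (h : Glued G p k q) :
    ∀ f ∈ separatedFacts, f.Means χ (gluing p k q) := by
  rcases h.isGlued.isStandard hχ with ⟨h1, h2⟩ | ⟨h1, h2⟩
  · exact h.isGlued.separated hχ h1 h2
  · intro f hf
    have := h.isGlued.separated hχ.mirror h1 h2 f hf
    have hw := wf_separatedFacts f hf
    rw [Fact.means_mirror hχ h.isGlued.1 hw.1] at this
    have hm : f.mirror.wf 16 = true := by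
      have key : ∀ f ∈ separatedFacts, f.mirror.wf 16 = true := by decide +kernel
      exact key f hf
    exact (Fact.means_iff_of_code hχ le_rfl h.isGlued.1 hm hw.1 hw.2).1 this

/-- The two instances have opposite orientations, so exchanging them also exchanges the case of a
positive first instance with its mirror image. -/
theorem exchanged_separated (hχ : IsPattern G χ) (h : Glued G p k q) :
    ∀ f ∈ separatedFacts, f.Means χ fun i => gluing p k q (exchange i) := by
  have key : ∀ i < 9, second i = exchange i ∧ exchange (second i) = i := by decide
  have e1 : ∀ {χ}, IsStandard χ (gluing p k q) →
      IsStandard χ fun i => gluing p k q (exchange (second i)) := fun hs =>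
    hs.congr fun i hi => by rw [(key i hi).2]
  have e2 : ∀ {χ}, IsStandard χ (fun i => gluing p k q (second i)) →
      IsStandard χ fun i => gluing p k q (exchange i) := fun hs =>
    hs.congr fun i hi => by rw [(key i hi).1]
  have he := h.isGlued.exchange
  rcases h.isGlued.isStandard hχ with ⟨h1, h2⟩ | ⟨h1, h2⟩
  · intro f hf
    have := he.separated hχ.mirror (e2 h2) (e1 h1) f hf
    have hw := wf_separatedFacts f hf
    rw [Fact.means_mirror hχ he.1 hw.1] at this
    have hm : f.mirror.wf 16 = true := by
      have key : ∀ f ∈ separatedFacts, f.mirror.wf 16 = true := by decide +kernel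
      exact key f hf
    exact (Fact.means_iff_of_code hχ le_rfl he.1 hm hw.1 hw.2).1 this
  · exact he.separated hχ (e2 h2) (e1 h1)

theorem not_inside_left (hχ : IsPattern G χ) (h : Glued G p k q) {t : ℕ × ℕ × ℕ}
    (ht : t ∈ standardTriangles) {j : ℕ} (hj : j < 9) (h0 : j ≠ 0) (h2 : j ≠ 2) :
    ¬Inside χ (p t.1) (p t.2.1) (p t.2.2) (q j) := by
  have key : ∀ k < 4, ∀ t ∈ standardTriangles, ∀ j < 9, (Nat.beq j 0 || Nat.beq j 2 ||
      listed 16 separatedFacts (.not (.inside (symm (8 - 2 * k) false t.1)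
        (symm (8 - 2 * k) false t.2.1) (symm (8 - 2 * k) false t.2.2) (second j)))) = true := by
    decide +kernel
  have hlt : ∀ t ∈ standardTriangles, t.1 < 9 ∧ t.2.1 < 9 ∧ t.2.2 < 9 := by decide +kernel
  have hl := key k h.lt t ht j hj
  simp only [Bool.or_eq_true, Nat.beq_eq, h0, h2, false_or] at hl
  have := means_of_listed hχ le_rfl h.isGlued.1 (h.separated hχ) hl
  simpa only [Fact.Means, gluing_symm h.lt (hlt t ht).1, gluing_symm h.lt (hlt t ht).2.1,
    gluing_symm h.lt (hlt t ht).2.2, h.gluing_second hj] using this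

theorem not_inside_right (hχ : IsPattern G χ) (h : Glued G p k q) {t : ℕ × ℕ × ℕ}
    (ht : t ∈ standardTriangles) {j : ℕ} (hj : j < 9) (h0 : j ≠ 2 * k) (h2 : j ≠ (2 * k + 2) % 8) :
    ¬Inside χ (q t.1) (q t.2.1) (q t.2.2) (p j) := by
  have key : ∀ k < 4, ∀ j < 9, j = 2 * k ∨ j = (2 * k + 2) % 8 ∨ ∃ i ∈ List.range 9,
      i ≠ 0 ∧ i ≠ 2 ∧ exchange (second i) = symm (8 - 2 * k) false j := by decide +kernel
  have hlt : ∀ t ∈ standardTriangles, t.1 < 9 ∧ t.2.1 < 9 ∧ t.2.2 < 9 := by decide +kernel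
  have key' : ∀ t ∈ standardTriangles, ∀ j < 9, (Nat.beq j 0 || Nat.beq j 2 ||
      listed 16 separatedFacts (.not (.inside t.1 t.2.1 t.2.2 (second j)))) = true := by
    decide +kernel
  have he : ∀ i < 9, exchange i = second i := by decide
  obtain ⟨i, hi, i0, i2, e⟩ := ((key k h.lt j hj).resolve_left h0).resolve_left h2
  rw [List.mem_range] at hi
  have hl := key' t ht i hi
  simp only [Bool.or_eq_true, Nat.beq_eq, i0, i2, false_or] at hl
  have := means_of_listed hχ le_rfl h.isGlued.exchange.1 (h.exchanged_separated hχ) hl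
  simpa only [Fact.Means, he _ (hlt t ht).1, he _ (hlt t ht).2.1, he _ (hlt t ht).2.2, e,
    h.gluing_second (hlt t ht).1, h.gluing_second (hlt t ht).2.1, h.gluing_second (hlt t ht).2.2,
    gluing_symm h.lt hj] using this

theorem not_crosses_left (hχ : IsPattern G χ) (h : Glued G p k q) {a b : ℕ}
    (hab : adjOf antiprismEdges a b = true) (ha : a < 9) (hb : b < 9) (ha' : a ≠ 2 * k + 1)
    (hb' : b ≠ 2 * k + 1) (hne : s(a, b) ≠ s(2 * k, (2 * k + 2) % 8)) :
    ¬Crosses χ (p a) (p b) (p (2 * k + 1)) (q 1) := by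
  have key : ∀ k < 4, ∀ a < 9, ∀ b < 9, (!adjOf antiprismEdges a b || Nat.beq a (2 * k + 1) ||
      Nat.beq b (2 * k + 1) || Nat.beq a (2 * k) && Nat.beq b ((2 * k + 2) % 8) ||
      Nat.beq b (2 * k) && Nat.beq a ((2 * k + 2) % 8) ||
      listed 16 separatedFacts (.not (.cross (symm (8 - 2 * k) false a)
        (symm (8 - 2 * k) false b) (symm (8 - 2 * k) false (2 * k + 1)) (second 1)))) = true := by
    decide +kernel
  have hl := key k h.lt a ha b hb
  simp only [ne_eq, Sym2.eq_iff, not_or] at hne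
  simp only [hab, Bool.not_true, Bool.false_or, Bool.or_eq_true, Nat.beq_eq, ha', hb', false_or,
    Bool.and_eq_true, hne.1, and_comm (a := b = 2 * k), hne.2] at hl
  have hk := h.lt
  have := means_of_listed hχ le_rfl h.isGlued.1 (h.separated hχ) hl
  simpa only [Fact.Means, gluing_symm h.lt ha, gluing_symm h.lt hb,
    gluing_symm h.lt (show 2 * k + 1 < 9 by omega), h.gluing_second (show 1 < 9 by norm_num)]
    using this

theorem not_crosses_right (hχ : IsPattern G χ) (h : Glued G p k q) {a b : ℕ}
    (hab : adjOf antiprismEdges a b = true) (ha : a < 9) (hb : b < 9) (ha' : a ≠ 1)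
    (hb' : b ≠ 1) (hne : s(a, b) ≠ s(0, 2)) :
    ¬Crosses χ (q a) (q b) (p (2 * k + 1)) (q 1) := by
  have key : ∀ a < 9, ∀ b < 9, (!adjOf antiprismEdges a b || Nat.beq a 1 ||
      Nat.beq b 1 || Nat.beq a 0 && Nat.beq b 2 || Nat.beq b 0 && Nat.beq a 2 ||
      listed 16 separatedFacts (.not (.cross a b 1 9))) = true := by
    decide +kernel
  have hl := key a ha b hb
  simp only [ne_eq, Sym2.eq_iff, not_or] at hne
  simp only [hab, Bool.not_true, Bool.false_or, Bool.or_eq_true, Nat.beq_eq, ha', hb', false_or,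
    Bool.and_eq_true, hne.1, and_comm (a := b = 0), hne.2] at hl
  have hk := h.lt
  have he : ∀ i < 9, exchange i = second i := by decide
  have := means_of_listed hχ le_rfl h.isGlued.exchange.1 (h.exchanged_separated hχ) hl
  have e1 : symm (2 * k) false 1 = 2 * k + 1 := by interval_cases k <;> rfl
  simp only [Fact.Means, he a ha, he b hb, h.gluing_second ha, h.gluing_second hb,
    show exchange 1 = second 1 from rfl, show exchange 9 = 1 from rfl,
    h.gluing_second (show 1 < 9 by norm_num), gluing_first p k q (show 1 < 9 by norm_num), e1]
    at this
  have hn : [q a, q b, q 1, p (2 * k + 1)].Nodup := by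
    have hd : ∀ a < 9, ∀ b < 9, a ≠ 1 → b ≠ 1 → a ≠ b →
        distinct 16 [second a, second b, second 1, 1] = true := by decide +kernel
    have hne' : a ≠ b := by rintro rfl; exact (adj_of_adjOf h.right.2 hab).ne rfl
    have := nodup_map_of_distinct h.isGlued.1 (hd a ha b hb ha' hb' hne')
    simpa only [List.map_cons, List.map_nil, h.gluing_second ha, h.gluing_second hb,
      h.gluing_second (show 1 < 9 by norm_num), gluing_first p k q (show 1 < 9 by norm_num), e1]
      using this
  rw [← crosses_comm, hχ.crosses_swap (by simp only [List.nodup_cons, List.mem_cons, List.not_mem_nil, or_false, not_or] at hn ⊢; grind),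
    crosses_comm]
  exact this

theorem crosses (hχ : IsPattern G χ) (h : Glued G p k q) :
    Crosses χ (p (2 * k + 1)) (q 1) (q 0) (q 2) := by
  have hk := h.lt
  have e1 : symm (2 * k) false 1 = 2 * k + 1 := by interval_cases k <;> rfl
  have f1 := gluing_first p k q (show 1 < 9 by norm_num)
  have f2 : gluing p k q 9 = q 1 := h.gluing_second (i := 1) (by norm_num)
  have f3 : gluing p k q 0 = q 0 := h.gluing_second (i := 0) (by norm_num)
  have f4 : gluing p k q 2 = q 2 := h.gluing_second (i := 2) (by norm_num)
  rw [e1] at f1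
  rcases h.isGlued.isStandard hχ with ⟨h1, h2⟩ | ⟨h1, h2⟩
  · rw [← f1, ← f2, ← f3, ← f4]
    exact h.isGlued.crosses hχ h1 h2
  · have := h.isGlued.crosses hχ.mirror h1 h2
    rw [hχ.mirror_crosses (nodup_map_of_distinct h.isGlued.1
      (l := [1, 9, 0, 2]) (by decide))] at this
    rwa [← f1, ← f2, ← f3, ← f4]

end Glued

end Refutation

namespace Refutation

/-- The neighbours of a vertex of the augmented square antiprism, without the vertex `r`. -/
def neighbors (r y : ℕ) : List ℕ :=
  (List.range 9).filter fun x => adjOf antiprismEdges y x && !Nat.beq x r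

/-- A set of vertices of an augmented square antiprism without the vertex `r`, given by the list
`l` of its values, is empty or contains all the vertices, or a vertex violates the conditions of
`all_or_none`. -/
def isTrivial (r : ℕ) (l : List Bool) : Bool :=
  (List.range 9).any (fun y => !Nat.beq y r && !l.getD y false &&
    Nat.ble 2 ((neighbors r y).filter fun x => l.getD x false).length) ||
  (List.range 9).any (fun y => !Nat.beq y r && l.getD y false &&
    Nat.ble 4 ((neighbors r y).filter fun x => !l.getD x false).length) ||
  (List.range 9).all (fun y => Nat.beq y r || l.getD y false) ||
  (List.range 9).all fun y => Nat.beq y r || !l.getD y false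

theorem isTrivial_eq_true : ∀ r ∈ [0, 2, 4, 6, 9], ∀ b₀ b₁ b₂ b₃ b₄ b₅ b₆ b₇ b₈ : Bool,
    isTrivial r [b₀, b₁, b₂, b₃, b₄, b₅, b₆, b₇, b₈] = true := by
  decide +kernel

theorem mem_neighbors {r y x : ℕ} :
    x ∈ neighbors r y ↔ x < 9 ∧ adjOf antiprismEdges y x = true ∧ x ≠ r := by
  have : Nat.beq x r = false ↔ x ≠ r := by
    rw [← Bool.not_eq_true, Nat.beq_eq]
  simp [neighbors, List.mem_filter, this]

theorem nodup_neighbors (r y : ℕ) : (neighbors r y).Nodup :=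
  List.nodup_range.filter _

/-- A set of vertices of the antiprism with one external vertex possibly deleted is trivial if it
absorbs every vertex with two neighbours in it and none of its members has four neighbours outside.
This is checked over all assignments of truth values; r = 9 means that no vertex is deleted. -/
theorem all_or_none {I : ℕ → Prop} {r : ℕ} (hr : r ∈ [0, 2, 4, 6, 9])
    (h2 : ∀ y x₁ x₂, y < 9 → y ≠ r → x₁ ∈ neighbors r y → x₂ ∈ neighbors r y → x₁ ≠ x₂ →
      I x₁ → I x₂ → I y)
    (h4 : ∀ y x₁ x₂ x₃ x₄, y < 9 → y ≠ r → x₁ ∈ neighbors r y → x₂ ∈ neighbors r y →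
      x₃ ∈ neighbors r y → x₄ ∈ neighbors r y → [x₁, x₂, x₃, x₄].Nodup → I y →
      I x₁ ∨ I x₂ ∨ I x₃ ∨ I x₄) :
    (∀ i < 9, i ≠ r → I i) ∨ ∀ i < 9, i ≠ r → ¬I i := by
  classical
  have h := isTrivial_eq_true r hr (decide (I 0)) (decide (I 1)) (decide (I 2)) (decide (I 3))
    (decide (I 4)) (decide (I 5)) (decide (I 6)) (decide (I 7)) (decide (I 8))
  set l := [decide (I 0), decide (I 1), decide (I 2), decide (I 3), decide (I 4), decide (I 5),
    decide (I 6), decide (I 7), decide (I 8)] with hl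
  have hI : ∀ i < 9, l.getD i false = true ↔ I i := by
    intro i hi
    interval_cases i <;> simp [hl]
  have hI' : ∀ i < 9, l.getD i false = false ↔ ¬I i := by
    intro i hi
    rw [← hI i hi, Bool.not_eq_true]
  have hne : ∀ y, Nat.beq y r = false ↔ y ≠ r := fun y => by
    rw [← Bool.not_eq_true, Nat.beq_eq]
  simp only [isTrivial, Bool.or_eq_true, List.any_eq_true, List.all_eq_true, List.mem_range,
    Bool.and_eq_true, Bool.not_eq_true', Nat.ble_eq, hne, Nat.beq_eq] at h
  rcases h with ((⟨y, hy, ⟨hyr, hn⟩, hlen⟩ | ⟨y, hy, ⟨hyr, hn⟩, hlen⟩) | h) | h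
  · exfalso
    have hnd := (nodup_neighbors r y).filter fun x => l.getD x false
    have hm : ∀ x ∈ (neighbors r y).filter fun x => l.getD x false, x ∈ neighbors r y ∧ I x := by
      intro x hx
      rw [List.mem_filter] at hx
      exact ⟨hx.1, (hI x (mem_neighbors.1 hx.1).1).1 hx.2⟩
    match (neighbors r y).filter fun x => l.getD x false, hlen, hnd, hm with
    | x₁ :: x₂ :: l', _, hnd, hm =>
      have m1 := hm x₁ (by simp)
      have m2 := hm x₂ (by simp)
      refine (hI' y hy).1 hn (h2 y x₁ x₂ hy hyr m1.1 m2.1 ?_ m1.2 m2.2)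
      rintro rfl
      simp at hnd
  · exfalso
    have hnd := (nodup_neighbors r y).filter fun x => !l.getD x false
    have hm : ∀ x ∈ (neighbors r y).filter fun x => !l.getD x false, x ∈ neighbors r y ∧ ¬I x := by
      intro x hx
      rw [List.mem_filter, Bool.not_eq_true'] at hx
      exact ⟨hx.1, (hI' x (mem_neighbors.1 hx.1).1).1 hx.2⟩
    match (neighbors r y).filter fun x => !l.getD x false, hlen, hnd, hm with
    | x₁ :: x₂ :: x₃ :: x₄ :: l', _, hnd, hm =>
      have m1 := hm x₁ (by simp)
      have m2 := hm x₂ (by simp)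
      have m3 := hm x₃ (by simp)
      have m4 := hm x₄ (by simp)
      rcases h4 y x₁ x₂ x₃ x₄ hy hyr m1.1 m2.1 m3.1 m4.1
        (hnd.sublist (by simp)) ((hI y hy).1 hn) with h | h | h | h
      exacts [m1.2 h, m2.2 h, m3.2 h, m4.2 h]
  · exact Or.inl fun i hi hir => (hI i hi).1 ((h i hi).resolve_left hir)
  · exact Or.inr fun i hi hir => (hI' i hi).1 ((h i hi).resolve_left hir)

variable {V : Type*} {G : SimpleGraph V} {χ : V → V → V → Prop}

/-- An instance that has at most one external vertex in `S`, and no other vertex in common with a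
triangle, lies inside the triangle or outside, apart from the vertices in `S`. -/
theorem inside_or_outside (hχ : IsPattern G χ) {q : ℕ → V} (hq : IsAntiprism G q) {a b c : V}
    (hab : G.Adj a b) (hbc : G.Adj b c) (hac : G.Adj a c) {S : V → Prop}
    (hS : ∀ i < 9, S (q i) → ¬IsInternal i) (hS' : ∀ i < 9, ∀ j < 9, S (q i) → S (q j) → i = j)
    (hd : ∀ i < 9, ¬S (q i) → q i ≠ a ∧ q i ≠ b ∧ q i ≠ c) :
    (∀ i < 9, ¬S (q i) → Inside χ a b c (q i)) ∨ ∀ i < 9, ¬S (q i) → ¬Inside χ a b c (q i) := by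
  -- The only vertex of the instance in S becomes the deleted vertex r, with 9 as the value when
  -- there is none.
  obtain ⟨r, hr, hrS⟩ : ∃ r ∈ [0, 2, 4, 6, 9], ∀ i < 9, i ≠ r ↔ ¬S (q i) := by
    by_cases h : ∃ r < 9, S (q r)
    · obtain ⟨r, hr, hrS⟩ := h
      have h1 := hS r hr hrS
      refine ⟨r, ?_, fun i hi => ⟨fun h k => h (hS' i hi r hr k hrS), fun h k => h (k ▸ hrS)⟩⟩
      unfold IsInternal at h1
      simp only [List.mem_cons, List.not_mem_nil, or_false]
      omega
    · push Not at h
      exact ⟨9, by simp, fun i hi => ⟨fun _ => h i hi, fun _ => by omega⟩⟩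
  have hinj : ∀ {l : List ℕ}, l.Nodup → (∀ i ∈ l, i < 9) → (l.map q).Nodup := fun hl hlt =>
    List.Nodup.map_on (fun x hx y hy h => hq.1 (hlt x hx) (hlt y hy) h) hl
  have hadj : ∀ {y x}, x ∈ neighbors r y → G.Adj (q y) (q x) := fun hx =>
    adj_of_adjOf hq.2 (mem_neighbors.1 hx).2.1
  have hab' := hab.ne
  have hbc' := hbc.ne
  have hac' := hac.ne
  have key : (∀ i < 9, i ≠ r → Inside χ a b c (q i)) ∨ ∀ i < 9, i ≠ r → ¬Inside χ a b c (q i) := by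
    refine all_or_none hr ?_ ?_
    · intro y x₁ x₂ hy hyr h₁ h₂ hne i₁ i₂
      refine hχ.inside_of_two_inside ?_ hab hbc hac (hadj h₁) (hadj h₂) i₁ i₂
      have n1 := (hadj h₁).ne
      have n2 := (hadj h₂).ne
      have n3 : q x₁ ≠ q x₂ := fun e => hne (hq.1 (mem_neighbors.1 h₁).1 (mem_neighbors.1 h₂).1 e)
      have d1 := hd y hy ((hrS y hy).1 hyr)
      have d2 := hd x₁ (mem_neighbors.1 h₁).1 ((hrS x₁ (mem_neighbors.1 h₁).1).1
        (mem_neighbors.1 h₁).2.2)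
      have d3 := hd x₂ (mem_neighbors.1 h₂).1 ((hrS x₂ (mem_neighbors.1 h₂).1).1
        (mem_neighbors.1 h₂).2.2)
      simp only [List.nodup_cons, List.mem_cons, List.not_mem_nil, or_false, not_or]
      grind
    · intro y x₁ x₂ x₃ x₄ hy hyr h₁ h₂ h₃ h₄ hn hi
      refine hχ.not_four_outside ?_ hab hbc hac (hadj h₁) (hadj h₂) (hadj h₃) (hadj h₄) hi
      have hn' : ([y, x₁, x₂, x₃, x₄].map q).Nodup := by
        refine hinj (List.nodup_cons.2 ⟨?_, hn⟩) ?_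
        · have hs : ∀ {x}, x ∈ neighbors r y → y ≠ x := fun hx e => (hadj hx).ne (by rw [e])
          simp [hs h₁, hs h₂, hs h₃, hs h₄]
        · simp [hy, (mem_neighbors.1 h₁).1, (mem_neighbors.1 h₂).1, (mem_neighbors.1 h₃).1,
            (mem_neighbors.1 h₄).1]
      have d : ∀ x ∈ [y, x₁, x₂, x₃, x₄].map q, x ≠ a ∧ x ≠ b ∧ x ≠ c := by
        have hs : ∀ {x}, x ∈ neighbors r y → q x ≠ a ∧ q x ≠ b ∧ q x ≠ c := fun hx =>
          hd _ (mem_neighbors.1 hx).1 ((hrS _ (mem_neighbors.1 hx).1).1 (mem_neighbors.1 hx).2.2)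
        simp only [List.map_cons, List.map_nil, List.forall_mem_cons]
        exact ⟨hd y hy ((hrS y hy).1 hyr), hs h₁, hs h₂, hs h₃, hs h₄, by simp⟩
      change ([a, b, c] ++ [y, x₁, x₂, x₃, x₄].map q).Nodup
      refine List.Nodup.append (by simp [hab', hbc', hac']) hn' ?_
      intro x hx hx'
      have := d x hx'
      simp only [List.mem_cons, List.not_mem_nil, or_false] at hx
      tauto
  refine key.imp (fun h i hi hs => h i hi ((hrS i hi).2 hs)) fun h i hi hs => h i hi ((hrS i hi).2 hs)

theorem lt_nine_of_mem_standardTriangles : ∀ t ∈ standardTriangles, t.1 < 9 ∧ t.2.1 < 9 ∧ t.2.2 < 9 := by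
  decide +kernel

theorem IsAntiprism.adj_triangle {p : ℕ → V} (hp : IsAntiprism G p) {t : ℕ × ℕ × ℕ}
    (ht : t ∈ standardTriangles) : G.Adj (p t.1) (p t.2.1) ∧ G.Adj (p t.2.1) (p t.2.2) ∧
      G.Adj (p t.1) (p t.2.2) := by
  have key : ∀ t ∈ standardTriangles, adjOf antiprismEdges t.1 t.2.1 = true ∧
      adjOf antiprismEdges t.2.1 t.2.2 = true ∧ adjOf antiprismEdges t.1 t.2.2 = true := by
    decide +kernel
  have h := key t ht
  exact ⟨adj_of_adjOf hp.2 h.1, adj_of_adjOf hp.2 h.2.1, adj_of_adjOf hp.2 h.2.2⟩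

end Refutation

theorem IsPattern.comap_extension {V W : Type*} {G : SimpleGraph V} {G' : SimpleGraph W} {ι : V → W}
    {N : ℕ → W} {v v' u : V} (h : IsExtension G G' ι N v v' u) {χ : W → W → W → Prop}
    (hχ : IsPattern G' χ) : IsPattern G fun a b c => χ (ι a) (ι b) (ι c) :=
  hχ.comap ⟨ι, h.map_adj⟩ h.injective

theorem IsExtension.glued {V W : Type*} {G : SimpleGraph V} {G' : SimpleGraph W} {ι : V → W}
    {N : ℕ → W} {p : ℕ → V} {k : ℕ}
    (h : IsExtension G G' ι N (p (2 * k)) (p ((2 * k + 2) % 8)) (p (2 * k + 1)))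
    (hp : IsAntiprism G p) (hk : k < 4) : Glued G' (fun i => ι (p i)) k N :=
  ⟨hk, hp.map h.injective fun _ _ => h.map_adj, h.isAntiprism, h.isGlued hp hk rfl rfl rfl, h.left,
    h.right⟩

namespace GluedGraph.IsAssembly

/-- The glued graph stays connected through its instances when X is removed, because no two
instances have two common vertices in X. A property that is constant on every instance outside X is
thus constant. -/
theorem congr_of_connected {H : GluedGraph} {L : List (ℕ → H.V)} (h : IsAssembly H L) :
    ∀ (X : Set H.V) (F : H.V → Prop),
      (∀ p ∈ L, ∀ q ∈ L, p ≠ q → ∀ i < 9, ∀ j < 9, ∀ i' < 9, ∀ j' < 9, p i = q i' → p j = q j' →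
        p i ≠ p j → p i ∈ X → p j ∉ X) →
      (∀ p ∈ L, ∀ i < 9, ∀ j < 9, p i ∉ X → p j ∉ X → (F (p i) ↔ F (p j))) →
      ∀ a b, a ∉ X → b ∉ X → (F a ↔ F b) := by
  induction h with
  | single =>
    intro X F _ hF (a : AntiprismVertex) (b : AntiprismVertex) ha hb
    have := hF ofNumber (List.mem_singleton_self _) _ a.number_lt _ b.number_lt
    rw [ofNumber_number a, ofNumber_number b] at this
    exact this ha hb
  | @extend H L v v' u hL hs ih =>
    have hext := hL.isExtension hs
    generalize (fun i => H.place v v' (ofNumber i)) = N at hext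
    intro X F hX hF
    obtain ⟨P, hP, k, hk, rfl, rfl, rfl, -⟩ := hL.assembly.free _ _ _ hs
    have hold : ∀ q ∈ L, (fun i => Sum.inl (q i)) ∈ (N :: L.map fun p i => Sum.inl (p i)) :=
      fun q hq => List.mem_cons_of_mem _ (List.mem_map_of_mem hq)
    have hNP : N ≠ fun i => Sum.inl (P i) := fun e =>
      hext.new 1 (by norm_num) (by norm_num) (by norm_num) (by rw [e]; exact ⟨_, rfl⟩)
    -- The new instance and P share the two ends of the side, and at least one of these is not in X;
    -- it links the new vertices to the old ones.
    obtain ⟨a₀, ha₀, i₀, hi₀, e₀⟩ : ∃ a₀ : H.V, (Sum.inl a₀ : H.ExtendV) ∉ X ∧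
        ∃ i < 9, N i = Sum.inl a₀ := by
      by_cases h0 : N 0 ∈ X
      · refine ⟨P ((2 * k + 2) % 8), ?_, 2, by norm_num, hext.right⟩
        have := hX N List.mem_cons_self _ (hold P hP) hNP 0 (by norm_num) 2 (by norm_num) (2 * k)
          (by omega) ((2 * k + 2) % 8) (by omega) hext.left hext.right (fun e => by
            have := hext.injOn (show 0 < 9 by norm_num) (show 2 < 9 by norm_num) e
            omega) h0
        rwa [hext.right] at this
      · exact ⟨P (2 * k), by rwa [hext.left] at h0, 0, by norm_num, hext.left⟩
    have hinl : ∀ a b : H.V, (Sum.inl a : H.ExtendV) ∉ X → (Sum.inl b : H.ExtendV) ∉ X →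
        (F (Sum.inl a) ↔ F (Sum.inl b)) := by
      refine ih {x | Sum.inl x ∈ X} (fun x => F (Sum.inl x)) ?_ ?_
      · intro p hp q hq hne i hi j hj i' hi' j' hj' e1 e2 hne'
        exact hX _ (hold p hp) _ (hold q hq)
          (fun e => hne (funext fun i => Sum.inl_injective (congrFun e i))) i hi j hj i' hi' j' hj'
          (congrArg _ e1) (congrArg _ e2) fun e => hne' (Sum.inl_injective e)
      · intro p hp i hi j hj
        exact hF _ (hold p hp) i hi j hj
    have key : ∀ w, w ∉ X → (F w ↔ F (Sum.inl a₀)) := by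
      intro w hw
      rcases hext.cover w with ⟨a, rfl⟩ | ⟨i, hi, rfl⟩
      · exact hinl a a₀ hw ha₀
      · have := hF N List.mem_cons_self i hi i₀ hi₀ hw (by rwa [e₀])
        rwa [e₀] at this
    intro a b ha hb
    rw [key a ha, key b hb]

/-- Instances do not overlap. -/
theorem not_inside {H : GluedGraph} {L : List (ℕ → H.V)} (h : IsAssembly H L) :
    ∀ χ, IsPattern H.graph χ → ∀ p ∈ L, ∀ q ∈ L, ∀ t ∈ standardTriangles, ∀ j < 9,
      (∀ i < 9, q j ≠ p i) → ¬Inside χ (p t.1) (p t.2.1) (p t.2.2) (q j) := by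
  induction h with
  | single =>
    intro χ _ p hp q hq t _ j hj hne
    rw [List.mem_singleton.1 hp, List.mem_singleton.1 hq] at hne
    exact (hne j hj rfl).elim
  | @extend H L v v' u hL hs ih =>
    have hext := hL.isExtension hs
    generalize (fun i => H.place v v' (ofNumber i)) = N at hext
    intro χ hχ
    have hA := hL.assembly
    obtain ⟨P, hP, k, hk, rfl, rfl, rfl, huniq⟩ := hA.free _ _ _ hs
    have hg := hext.glued (hA.isAntiprism P hP) hk
    have ih := ih _ (hχ.comap_extension hext)
    have hlt := lt_nine_of_mem_standardTriangles
    have hnew : ∀ q ∈ L, ∀ i < 9, ∀ j < 9, N i = Sum.inl (q j) →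
        i = 0 ∧ q j = P (2 * k) ∨ i = 2 ∧ q j = P ((2 * k + 2) % 8) := fun q _ i hi j _ e =>
      hext.eq_of_map_eq hi e
    intro p hp q hq t ht j hj hne
    rcases List.mem_cons.1 hp with rfl | hp₁ <;> rcases List.mem_cons.1 hq with rfl | hq₁
    · exact (hne j hj rfl).elim
    -- A new triangle and an old point. Here S consists of the two ends of the common side. Every
    -- old instance except P has at most one of them and so lies, apart from it, entirely inside or
    -- outside the triangle. P lies outside by the local result, and connectedness outside S carries
    -- this to all old points.
    · obtain ⟨q, hq', rfl⟩ := List.mem_map.1 hq₁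
      have hadj := hext.isAntiprism.adj_triangle ht
      let S : H.ExtendV → Prop := fun x => x = Sum.inl (P (2 * k)) ∨ x = Sum.inl (P ((2 * k + 2) % 8))
      have hPS : ∀ i < 9, ¬S (Sum.inl (P i)) →
          ¬Inside χ (p t.1) (p t.2.1) (p t.2.2) (Sum.inl (P i)) := by
        intro i hi hiS
        refine hg.not_inside_right hχ ht hi ?_ ?_ <;> rintro rfl
        · exact hiS (Or.inl rfl)
        · exact hiS (Or.inr rfl)
      have hconst : ∀ q ∈ L, (∀ i < 9, ¬S (Sum.inl (q i)) →
          Inside χ (p t.1) (p t.2.1) (p t.2.2) (Sum.inl (q i))) ∨ ∀ i < 9, ¬S (Sum.inl (q i)) →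
          ¬Inside χ (p t.1) (p t.2.1) (p t.2.2) (Sum.inl (q i)) := by
        intro q hq
        by_cases hqP : q = P
        · subst hqP
          exact Or.inr hPS
        refine inside_or_outside hχ ((hA.isAntiprism q hq).map hext.injective fun _ _ => hext.map_adj)
          hadj.1 hadj.2.1 hadj.2.2 (S := S) ?_ ?_ ?_
        · intro i hi hiS hint
          refine hqP ?_
          rcases hiS with e | e
          · exact hA.internal q hq P hP i hi (2 * k) (by omega) hint (Sum.inl_injective e)
          · exact hA.internal q hq P hP i hi ((2 * k + 2) % 8) (by omega) hint (Sum.inl_injective e)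
        · intro i hi j hj hiS hjS
          have inj := (hA.isAntiprism q hq).1
          rcases hiS with e | e <;> rcases hjS with e' | e'
          · exact inj hi hj (Sum.inl_injective (e.trans e'.symm))
          · exact (hqP (huniq q hq i hi j hj (Sum.inl_injective e) (Sum.inl_injective e'))).elim
          · exact (hqP (huniq q hq j hj i hi (Sum.inl_injective e') (Sum.inl_injective e))).elim
          · exact inj hi hj (Sum.inl_injective (e.trans e'.symm))
        · have : ∀ m < 9, ∀ i < 9, ¬S (Sum.inl (q i)) → Sum.inl (q i) ≠ p m := by
            intro m hm i hi hiS e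
            rcases hnew q hq m hm i hi e.symm with ⟨-, e⟩ | ⟨-, e⟩
            · exact hiS (Or.inl (congrArg _ e))
            · exact hiS (Or.inr (congrArg _ e))
          exact fun i hi hiS => ⟨this _ (hlt t ht).1 i hi hiS, this _ (hlt t ht).2.1 i hi hiS,
            this _ (hlt t ht).2.2 i hi hiS⟩
      have hall := hL.congr_of_connected {x | S (Sum.inl x)}
        (fun x => Inside χ (p t.1) (p t.2.1) (p t.2.2) (Sum.inl x)) ?_ ?_ (q j) (P (2 * k + 1)) ?_ ?_
      · have := hPS (2 * k + 1) (by omega) ?_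
        · exact fun hc => this (hall.1 hc)
        · have inj := (hA.isAntiprism P hP).1
          rintro (e | e)
          · have := inj (show 2 * k + 1 < 9 by omega) (show 2 * k < 9 by omega) (Sum.inl_injective e)
            omega
          · have := inj (show 2 * k + 1 < 9 by omega) (show (2 * k + 2) % 8 < 9 by omega)
              (Sum.inl_injective e)
            omega
      · intro p' hp' q' hq' hne' i hi j hj i' hi' j' hj' e1 e2 hij hiS hjS
        refine hne' ?_
        rcases hiS with f | f <;> rcases hjS with f' | f'
        · exact (hij (Sum.inl_injective (f.trans f'.symm))).elim
        · rw [huniq p' hp' i hi j hj (Sum.inl_injective f) (Sum.inl_injective f'),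
            huniq q' hq' i' hi' j' hj' (e1.symm.trans (Sum.inl_injective f))
              (e2.symm.trans (Sum.inl_injective f'))]
        · rw [huniq p' hp' j hj i hi (Sum.inl_injective f') (Sum.inl_injective f),
            huniq q' hq' j' hj' i' hi' (e2.symm.trans (Sum.inl_injective f'))
              (e1.symm.trans (Sum.inl_injective f))]
        · exact (hij (Sum.inl_injective (f.trans f'.symm))).elim
      · intro q hq i hi j hj hiS hjS
        rcases hconst q hq with h | h
        · exact iff_of_true (h i hi hiS) (h j hj hjS)
        · exact iff_of_false (h i hi hiS) (h j hj hjS)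
      · rintro (e | e)
        · exact hne 0 (by norm_num) (e.trans hext.left.symm)
        · exact hne 2 (by norm_num) (e.trans hext.right.symm)
      · have inj := (hA.isAntiprism P hP).1
        rintro (e | e)
        · have := inj (show 2 * k + 1 < 9 by omega) (show 2 * k < 9 by omega) (Sum.inl_injective e)
          omega
        · have := inj (show 2 * k + 1 < 9 by omega) (show (2 * k + 2) % 8 < 9 by omega)
            (Sum.inl_injective e)
          omega
    -- An old triangle and a new point. For P this is the local result. Another instance p contains
    -- at most one end of the side, so the new instance lies, apart from it, entirely inside or
    -- outside. An end of the side that is not on p belongs to P and is outside by induction, which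
    -- decides for the outside.
    · obtain ⟨p, hp', rfl⟩ := List.mem_map.1 hp₁
      by_cases hpP : p = P
      · subst hpP
        refine hg.not_inside_left hχ ht hj ?_ ?_ <;> rintro rfl
        · exact hne (2 * k) (by omega) hext.left
        · exact hne ((2 * k + 2) % 8) (by omega) hext.right
      have hadj := ((hA.isAntiprism p hp').map hext.injective fun _ _ =>
        hext.map_adj).adj_triangle ht
      let S : H.ExtendV → Prop := fun x => ∃ i < 9, x = Sum.inl (p i)
      have hside : ∀ i < 9, S (q i) → i = 0 ∨ i = 2 := by
        rintro i hi ⟨m, hm, e⟩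
        exact (hnew p hp' i hi m hm e).imp And.left And.left
      have hout : ¬(S (q 0) ∧ S (q 2)) := by
        rintro ⟨⟨m, hm, e⟩, ⟨m', hm', e'⟩⟩
        exact hpP (huniq p hp' m hm m' hm' (Sum.inl_injective (e.symm.trans hext.left))
          (Sum.inl_injective (e'.symm.trans hext.right)))
      have hP0 : ∀ i < 9, ¬S (Sum.inl (P i)) →
          ¬Inside χ (Sum.inl (p t.1)) (Sum.inl (p t.2.1)) (Sum.inl (p t.2.2)) (Sum.inl (P i)) :=
        fun i hi hiS => ih p hp' P hP t ht i hi fun m hm e => hiS ⟨m, hm, congrArg _ e⟩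
      have hor := inside_or_outside hχ hext.isAntiprism hadj.1 hadj.2.1 hadj.2.2 (S := S) ?_ ?_ ?_
      · rcases hor with hin | hin
        · exfalso
          by_cases h0 : S (q 0)
          · have h2 : ¬S (q 2) := fun h2 => hout ⟨h0, h2⟩
            have := hin 2 (by norm_num) h2
            rw [hext.right] at this h2
            exact hP0 _ (by omega) h2 this
          · have := hin 0 (by norm_num) h0
            rw [hext.left] at this h0
            exact hP0 _ (by omega) h0 this
        · exact hin j hj fun ⟨m, hm, e⟩ => hne m hm e
      · intro i hi hiS
        rcases hside i hi hiS with rfl | rfl <;> (unfold IsInternal; omega)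
      · intro i hi j hj hiS hjS
        rcases hside i hi hiS with rfl | rfl <;> rcases hside j hj hjS with rfl | rfl
        exacts [rfl, (hout ⟨hiS, hjS⟩).elim, (hout ⟨hjS, hiS⟩).elim, rfl]
      · exact fun i hi hiS => ⟨fun e => hiS ⟨_, (hlt t ht).1, e⟩, fun e => hiS ⟨_, (hlt t ht).2.1, e⟩,
          fun e => hiS ⟨_, (hlt t ht).2.2, e⟩⟩
    · obtain ⟨p, hp', rfl⟩ := List.mem_map.1 hp₁
      obtain ⟨q, hq', rfl⟩ := List.mem_map.1 hq₁
      exact ih p hp' q hq' t ht j hj fun i hi e => hne i hi (congrArg _ e)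

end GluedGraph.IsAssembly

namespace IsPattern

variable {V : Type*} {G : SimpleGraph V} {χ : V → V → V → Prop}

theorem mirror_inside (h : IsPattern G χ) {a b c x : V} (hn : [a, b, c, x].Nodup) :
    Inside (fun a b c => χ b a c) a b c x ↔ Inside χ a b c x := by
  simp only [List.nodup_cons, List.mem_cons, List.not_mem_nil, or_false, not_or] at hn
  unfold Inside
  beta_reduce
  rw [h.swap_iff (by tauto : a ≠ b) (by tauto : b ≠ x) (by tauto),
    h.swap_iff (by tauto : b ≠ c) (by tauto : c ≠ x) (by tauto),
    h.swap_iff (by grind : c ≠ a) (by tauto : a ≠ x) (by tauto), not_iff_not, not_iff_not]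

/-- The orientation of a crossing. -/
theorem crosses_orientation (hχ : IsPattern G χ) {a b c d : V} (hn : [a, b, c, d].Nodup)
    (hc : Crosses χ a b c d) : χ a b d ↔ χ c d a := by
  simp only [List.nodup_cons, List.mem_cons, List.not_mem_nil, or_false, not_or] at hn
  have key : ∀ {χ : V → V → V → Prop}, IsPattern G χ → Crosses χ a b c d → χ a b d → χ c d a := by
    intro χ hχ hc hd
    by_contra hn'
    have r : ∀ p q r, χ p q r ↔ χ q r p := hχ.rotate_iff
    have h1 : χ c d b := by unfold Crosses at hc; tauto
    have h2 : χ b a c := by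
      rw [hχ.swap_iff (by tauto) (by tauto) (by tauto)]
      unfold Crosses at hc; tauto
    have h3 : χ d c a := by rwa [hχ.swap_iff (by tauto) (by grind) (by grind)]
    -- Otherwise a would lie inside the triangle c b d, which gives this triangle the wrong
    -- orientation.
    have h4 := hχ.interior c b d a hd ((r d c a).1 h3)
      ((r _ _ _).2 h2)
    rw [r, r] at h4
    have := hχ.swap_iff (a := c) (b := d) (c := b) (by tauto) (by grind) (by grind)
    tauto
  refine ⟨key hχ hc, fun h => ?_⟩
  by_contra hn'
  have hm := key hχ.mirror ((hχ.mirror_crosses (by simp only [List.nodup_cons, List.mem_cons, List.not_mem_nil, or_false, not_or]; tauto)).2 hc)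
    ((hχ.swap_iff (by tauto) (by tauto) (by tauto)).2 hn')
  exact (hχ.swap_iff (by tauto) (by grind) (by grind)).1 hm h

/-- If `cd` is a segment that crosses the side `ab` of the triangle `abc`, then the part of this
triangle on the side of `a` is contained in the triangle `cda`. -/
theorem inside_of_crosses_of_inside (hχ : IsPattern G χ) {a b c d x : V} (hn : [a, b, c, d, x].Nodup)
    (hc : Crosses χ a b c d) (hi : Inside χ a b c x) :
    Inside χ c d a x ∨ Inside χ c d b x := by
  have key : ∀ {χ : V → V → V → Prop}, IsPattern G χ → ∀ {a b : V}, [a, b, c, d, x].Nodup →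
      Crosses χ a b c d → Inside χ a b c x → χ a b d → (χ c d x ↔ χ c d a) → Inside χ c d a x := by
    intro χ hχ a b hn hc hi hd hx
    have hcda := (hχ.crosses_orientation (hn.sublist (by simp)) hc).1 hd
    simp only [List.nodup_cons, List.mem_cons, List.not_mem_nil, or_false, not_or] at hn
    unfold Crosses at hc
    unfold Inside at hi ⊢
    have r := hχ.rotate
    have habc : ¬χ a b c := by tauto
    have habx : ¬χ a b x := by
      intro k
      have k1 : χ b c x := hi.1.1 k
      have k2 : χ c a x := hi.2.1 k1
      exact habc (hχ.interior a b c x (r _ _ _ (r _ _ _ k1)) (r _ _ _ k2) k)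
    have hcax : ¬χ c a x := by tauto
    have h1 : χ a c x := (hχ.swap_iff (by tauto) (by tauto) (by tauto)).2 hcax
    have h2 : χ a x b := r _ _ _ ((hχ.swap_iff (by tauto) (by tauto) (by tauto)).2 habx)
    have h3 : χ a c b := r _ _ _ ((hχ.swap_iff (by tauto) (by tauto) (by tauto)).2 habc)
    have h4 : χ a c d := r _ _ _ (r _ _ _ hcda)
    -- Around a, the directions of x, b and d are on the same side of ac and follow each other in
    -- this order, so d comes after x.
    have h5 := r _ _ _ (r _ _ _ (hχ.trans a c x b d h1 h3 h4 h2 hd))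
    tauto
  have hn' : [b, a, c, d, x].Nodup := (List.Perm.swap b a [c, d, x]).nodup_iff.1 hn
  have p4 : [a, b, c, d].Nodup := hn.sublist (by simp)
  have p4' : [a, b, c, x].Nodup := hn.sublist (by simp)
  have hc' : Crosses χ b a c d := (hχ.crosses_swap p4).2 hc
  have hi' : Inside χ b a c x := (hχ.inside_swap p4').2 hi
  have m : ∀ a b, [a, b, c, d, x].Nodup → Crosses χ a b c d → Inside χ a b c x → χ b a d →
      (χ c d x ↔ χ c d a) → Inside χ c d a x := by
    intro a b hn hc hi hd hx
    have p4 : [a, b, c, d].Nodup := hn.sublist (by simp)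
    have p4' : [a, b, c, x].Nodup := hn.sublist (by simp)
    have hn2 := hn
    simp only [List.nodup_cons, List.mem_cons, List.not_mem_nil, or_false, not_or] at hn2
    have hx' : χ d c x ↔ χ d c a := by
      rw [hχ.swap_iff (a := c) (b := d) (c := x) (by tauto) (by tauto) (by tauto),
        hχ.swap_iff (a := c) (b := d) (c := a) (by tauto) (by grind) (by grind), hx]
    have := key hχ.mirror hn ((hχ.mirror_crosses p4).2 hc) ((hχ.mirror_inside p4').2 hi) hd hx'
    refine (hχ.mirror_inside ?_).1 this
    simp only [List.nodup_cons, List.mem_cons, List.not_mem_nil, or_false, not_or]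
    grind
  have hn2 := hn
  simp only [List.nodup_cons, List.mem_cons, List.not_mem_nil, or_false, not_or] at hn2
  have hab := hχ.swap_iff (a := a) (b := b) (c := d) (by tauto) (by tauto) (by tauto)
  have hside := hc.2
  by_cases hd : χ a b d
  · by_cases hx : χ c d x ↔ χ c d a
    · exact Or.inl (key hχ hn hc hi hd hx)
    · exact Or.inr (m b a hn' hc' hi' hd (by tauto))
  · by_cases hx : χ c d x ↔ χ c d a
    · exact Or.inl (m a b hn hc hi (hab.2 hd) hx)
    · exact Or.inr (key hχ hn' hc' hi' (hab.2 hd) (by tauto))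

theorem crosses_congr (hχ : IsPattern G χ) {a b c d a' b' c' d' : V} (h₁ : s(a, b) = s(a', b'))
    (h₂ : s(c, d) = s(c', d')) (hn : [a, b, c, d].Nodup) :
    [a', b', c', d'].Nodup ∧ (Crosses χ a b c d ↔ Crosses χ a' b' c' d') := by
  have n1 : [b, a, c, d].Nodup := (List.Perm.swap b a [c, d]).nodup_iff.1 hn
  have n2 : ∀ {x y : V}, [x, y, c, d].Nodup → [x, y, d, c].Nodup ∧ [c, d, x, y].Nodup := by
    intro x y h
    simp only [List.nodup_cons, List.mem_cons, List.not_mem_nil, or_false, not_or] at h ⊢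
    grind
  rcases Sym2.eq_iff.1 h₁ with ⟨rfl, rfl⟩ | ⟨rfl, rfl⟩ <;>
    rcases Sym2.eq_iff.1 h₂ with ⟨rfl, rfl⟩ | ⟨rfl, rfl⟩
  · exact ⟨hn, Iff.rfl⟩
  · refine ⟨(n2 hn).1, ?_⟩
    rw [← crosses_comm, ← crosses_comm (a := a), hχ.crosses_swap (n2 hn).2]
  · exact ⟨n1, (hχ.crosses_swap hn).symm⟩
  · refine ⟨(n2 n1).1, ?_⟩
    rw [← hχ.crosses_swap hn, ← crosses_comm, ← crosses_comm (a := b), hχ.crosses_swap (n2 n1).2]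

end IsPattern

end

/-! ### The crossings of a glued graph -/

section

open Refutation AntiprismVertex

/-- A glued graph with a pattern in which all instances are drawn in the standard way and do not
overlap. -/
structure IsDrawn {V : Type*} (G : SimpleGraph V) (L : List (ℕ → V)) (F : Set (V × V × V))
    (χ : V → V → V → Prop) : Prop extends Assembly G L F where
  pattern : IsPattern G χ
  standard : ∀ p ∈ L, IsStandardOrMirror χ p
  not_inside : ∀ p ∈ L, ∀ q ∈ L, ∀ t ∈ standardTriangles, ∀ j < 9,
      (∀ i < 9, q j ≠ p i) → ¬Inside χ (p t.1) (p t.2.1) (p t.2.2) (q j)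

/-- The internal edge `ab` crosses the spoke `cd`. -/
def SpokeCrossing {V : Type*} (L : List (ℕ → V)) (a b c d : V) : Prop :=
  ∃ p ∈ L, ∃ k < 4, s(a, b) = s(p ((2 * k + 7) % 8), p (2 * k + 1)) ∧ s(c, d) = s(p (2 * k), p 8)

/-- The edge `ab` that connects two glued instances crosses their common side `cd`. -/
def SideCrossing {V : Type*} (G : SimpleGraph V) (L : List (ℕ → V)) (a b c d : V) : Prop :=
  ∃ p ∈ L, ∃ q ∈ L, ∃ k, Glued G p k q ∧ s(a, b) = s(p (2 * k + 1), q 1) ∧ s(c, d) = s(q 0, q 2)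

/-- The crossings of the drawings of a glued graph. -/
def CrossingPair {V : Type*} (G : SimpleGraph V) (L : List (ℕ → V)) (a b c d : V) : Prop :=
  (SpokeCrossing L a b c d ∨ SideCrossing G L a b c d) ∨
    SpokeCrossing L c d a b ∨ SideCrossing G L c d a b

variable {V : Type*} {G : SimpleGraph V} {L : List (ℕ → V)} {F : Set (V × V × V)}
  {χ : V → V → V → Prop}

theorem Assembly.eq_of_internal (h : Assembly G L F) {p q : ℕ → V} (hp : p ∈ L) (hq : q ∈ L) {i j : ℕ}
    (hi : i < 9) (hj : j < 9) (hint : IsInternal i) (e : p i = q j) : p = q ∧ i = j := by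
  have := h.internal p hp q hq i hi j hj hint e
  subst this
  exact ⟨rfl, (h.isAntiprism _ hp).1 hi hj e⟩

namespace Refutation

/-- Whether three points span a standard triangle. -/
def isTriangle (a b c : ℕ) : Bool :=
  standardTriangles.any fun t => (Nat.beq t.1 a && Nat.beq t.2.1 b && Nat.beq t.2.2 c) ||
    (Nat.beq t.1 b && Nat.beq t.2.1 c && Nat.beq t.2.2 a) ||
    (Nat.beq t.1 c && Nat.beq t.2.1 a && Nat.beq t.2.2 b) ||
    (Nat.beq t.1 b && Nat.beq t.2.1 a && Nat.beq t.2.2 c) ||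
    (Nat.beq t.1 a && Nat.beq t.2.1 c && Nat.beq t.2.2 b) ||
    (Nat.beq t.1 c && Nat.beq t.2.1 b && Nat.beq t.2.2 a)

theorem lt_nine_of_isTriangle : ∀ {a b c : ℕ}, isTriangle a b c = true → a < 9 ∧ b < 9 ∧ c < 9 := by
  intro a b c h
  simp only [isTriangle, List.any_eq_true, Bool.or_eq_true, Bool.and_eq_true, Nat.beq_eq] at h
  obtain ⟨t, ht, h⟩ := h
  have := lt_nine_of_mem_standardTriangles t ht
  omega

theorem IsStandardOrMirror.means (hχ : IsPattern G χ) {p : ℕ → V} (hp : IsAntiprism G p)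
    (h : IsStandardOrMirror χ p) {f : Fact} (hl : listed 9 standardFacts f = true)
    (hm : f.mirror = f) : f.Means χ p := by
  rcases h with h | h
  · exact means_of_listed hχ (by norm_num) hp.1 h hl
  · have := means_of_listed hχ.mirror (by norm_num) hp.1 h hl
    rw [Fact.means_mirror hχ hp.1 (by simp only [listed, Bool.and_eq_true] at hl; exact hl.1),
      hm] at this
    exact this

end Refutation

namespace IsDrawn

theorem inj (d : IsDrawn G L F χ) {p : ℕ → V} (hp : p ∈ L) {i j : ℕ} (hi : i < 9) (hj : j < 9) :
    p i = p j ↔ i = j :=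
  ⟨fun h => (d.isAntiprism p hp).1 hi hj h, fun h => h ▸ rfl⟩

theorem not_inside_standardTriangle (d : IsDrawn G L F χ) {p : ℕ → V} (hp : p ∈ L) {t : ℕ × ℕ × ℕ}
    (ht : t ∈ standardTriangles) {x : V} (h1 : x ≠ p t.1) (h2 : x ≠ p t.2.1) (h3 : x ≠ p t.2.2) :
    ¬Inside χ (p t.1) (p t.2.1) (p t.2.2) x := by
  by_cases hx : ∃ i < 9, x = p i
  · obtain ⟨i, hi, rfl⟩ := hx
    have key : ∀ t ∈ standardTriangles, ∀ i < 9, (Nat.beq i t.1 || Nat.beq i t.2.1 ||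
        Nat.beq i t.2.2 || listed 9 standardFacts (.not (.inside t.1 t.2.1 t.2.2 i))) = true := by
      decide +kernel
    have hne : ∀ j, p i ≠ p j → i ≠ j := fun j h e => h (by rw [e])
    have hk := key t ht i hi
    simp only [Bool.or_eq_true, Nat.beq_eq, hne _ h1, hne _ h2, hne _ h3, false_or] at hk
    exact (d.standard p hp).means d.pattern (d.isAntiprism p hp) hk rfl
  · obtain ⟨q, hq, j, hj, rfl⟩ := d.cover x
    exact d.not_inside p hp q hq t ht j hj fun i hi e => hx ⟨i, hi, e⟩

theorem not_inside_triangle (d : IsDrawn G L F χ) {p : ℕ → V} (hp : p ∈ L) {a b c : ℕ}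
    (ht : isTriangle a b c = true) {x : V} (h1 : x ≠ p a) (h2 : x ≠ p b) (h3 : x ≠ p c) :
    ¬Inside χ (p a) (p b) (p c) x := by
  simp only [isTriangle, List.any_eq_true, Bool.or_eq_true, Bool.and_eq_true, Nat.beq_eq] at ht
  obtain ⟨t, ht, h⟩ := ht
  have hadj := (d.isAntiprism p hp).adj_triangle ht
  have n1 := hadj.1.ne
  have n2 := hadj.2.1.ne
  have n3 := hadj.2.2.ne
  have main := d.not_inside_standardTriangle hp ht (x := x)
  have hsw := d.pattern.inside_swap (a := p t.1) (b := p t.2.1) (c := p t.2.2) (x := x)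
  have hnd : x ≠ p t.1 → x ≠ p t.2.1 → x ≠ p t.2.2 →
      [p t.1, p t.2.1, p t.2.2, x].Nodup := by
    intro m1 m2 m3
    simp [n1, n2, n3, m1.symm, m2.symm, m3.symm]
  rcases h with ((((⟨⟨rfl, rfl⟩, rfl⟩ | ⟨⟨rfl, rfl⟩, rfl⟩) | ⟨⟨rfl, rfl⟩, rfl⟩) | ⟨⟨rfl, rfl⟩, rfl⟩) |
    ⟨⟨rfl, rfl⟩, rfl⟩) | ⟨⟨rfl, rfl⟩, rfl⟩
  · exact main h1 h2 h3
  · rw [← inside_rotate]; exact main h2 h3 h1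
  · rw [inside_rotate]; exact main h3 h1 h2
  · rw [hsw (hnd h2 h1 h3)]; exact main h2 h1 h3
  · rw [inside_rotate, hsw (hnd h1 h3 h2)]; exact main h1 h3 h2
  · rw [← inside_rotate, hsw (hnd h3 h2 h1)]; exact main h3 h2 h1

/-- An edge that crosses an edge of an instance has an end at an internal vertex of this instance. -/
theorem exists_internal_of_crosses (d : IsDrawn G L F χ) {p : ℕ → V} (hp : p ∈ L) {e : ℕ × ℕ}
    (he : e ∈ antiprismEdges) {x y : V} (hxy : G.Adj x y) (hn : [x, y, p e.1, p e.2].Nodup)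
    (hc : Crosses χ x y (p e.1) (p e.2)) : ∃ i < 9, IsInternal i ∧ (x = p i ∨ y = p i) := by
  by_contra! h
  -- Every edge of an instance is a side of an empty triangle whose third vertex c is internal. If
  -- the crossing edge did not end at c, it would be disjoint from the vertices of the triangle and
  -- would need an end inside it.
  have key : ∀ e ∈ antiprismEdges, ∃ c ∈ [1, 3, 5, 7, 8], isTriangle e.1 e.2 c = true ∧
      adjOf antiprismEdges e.2 c = true ∧ adjOf antiprismEdges e.1 c = true := by decide +kernel
  have hint : ∀ c ∈ [1, 3, 5, 7, 8], c < 9 ∧ IsInternal c := by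
    intro c hc
    simp only [List.mem_cons, List.not_mem_nil, or_false] at hc
    unfold IsInternal
    omega
  obtain ⟨c, hcm, ht, a1, a2⟩ := key e he
  obtain ⟨hx, hy⟩ := h c (hint c hcm).1 (hint c hcm).2
  have ha := d.isAntiprism p hp
  have h1 := ha.2 e he
  have h2 := adj_of_adjOf ha.2 a1
  have h3 := adj_of_adjOf ha.2 a2
  have n2 := h2.ne
  have n3 := h3.ne
  simp only [List.nodup_cons, List.mem_cons, List.not_mem_nil, or_false, not_or] at hn
  rcases d.pattern.inside_of_crosses (by
    simp only [List.nodup_cons, List.mem_cons, List.not_mem_nil, or_false, not_or]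
    grind) h1 h2 h3 hxy hc with k | k
  · exact d.not_inside_triangle hp ht (by tauto) (by tauto) hx k
  · exact d.not_inside_triangle hp ht (by tauto) (by tauto) hy k

theorem crossingPair_comm {a b c d : V} : CrossingPair G L a b c d ↔ CrossingPair G L c d a b :=
  or_comm

theorem eq_of_ends (d : IsDrawn G L F χ) {p q : ℕ → V} (hp : p ∈ L) (hq : q ∈ L) {x y : V} {i j k : ℕ}
    (hi : i < 9) (hint : IsInternal i) (hj : j < 9) (hk : k < 9) (hx : x = p i ∨ y = p i)
    (e : s(x, y) = s(q j, q k)) : p = q := by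
  have key : p i = q j ∨ p i = q k := by
    rcases Sym2.eq_iff.1 e with ⟨rfl, rfl⟩ | ⟨rfl, rfl⟩ <;> rcases hx with h | h <;> simp [← h]
  rcases key with h | h
  · exact (d.eq_of_internal hp hq hi hj hint h).1
  · exact (d.eq_of_internal hp hq hi hk hint h).1

theorem crossingPair_of_same (d : IsDrawn G L F χ) {p : ℕ → V} (hp : p ∈ L) {e f : ℕ × ℕ}
    (he : e ∈ antiprismEdges) (hf : f ∈ antiprismEdges) (hn : [p e.1, p e.2, p f.1, p f.2].Nodup)
    (hc : Crosses χ (p e.1) (p e.2) (p f.1) (p f.2)) :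
    CrossingPair G L (p e.1) (p e.2) (p f.1) (p f.2) := by
  have key : ∀ e ∈ antiprismEdges, ∀ f ∈ antiprismEdges, (!distinct 9 [e.1, e.2, f.1, f.2] ||
      listed 9 standardFacts (.not (.cross e.1 e.2 f.1 f.2)) ||
      ([0, 1, 2, 3].any fun k =>
        (Nat.beq f.1 (2 * k) && Nat.beq f.2 8 && Nat.beq e.1 ((2 * k + 7) % 8) &&
          Nat.beq e.2 (2 * k + 1)) ||
        (Nat.beq e.1 (2 * k) && Nat.beq e.2 8 && Nat.beq f.1 ((2 * k + 7) % 8) &&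
          Nat.beq f.2 (2 * k + 1)))) = true := by
    decide +kernel
  have hk := key e he f hf
  have hlt := lt_nine_of_mem_antiprismEdges
  have hd : distinct 9 [e.1, e.2, f.1, f.2] = true := by
    rw [distinct_iff]
    refine ⟨List.Nodup.of_map p (by simpa using hn), ?_⟩
    simp [hlt e he, hlt f hf]
  have hnl : listed 9 standardFacts (.not (.cross e.1 e.2 f.1 f.2)) = false := by
    rw [← Bool.not_eq_true]
    intro h
    exact (d.standard p hp).means d.pattern (d.isAntiprism p hp) h rfl hc
  simp only [hd, hnl, Bool.not_true, Bool.false_or, List.any_eq_true, Bool.or_eq_true,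
    Bool.and_eq_true, Nat.beq_eq] at hk
  obtain ⟨k, hk, h⟩ := hk
  have hk4 : k < 4 := by
    simp only [List.mem_cons, List.not_mem_nil, or_false] at hk
    omega
  rcases h with ⟨⟨⟨h1, h2⟩, h3⟩, h4⟩ | ⟨⟨⟨h1, h2⟩, h3⟩, h4⟩
  · exact Or.inl (Or.inl ⟨p, hp, k, hk4, by rw [h3, h4], by rw [h1, h2]⟩)
  · exact Or.inr (Or.inl ⟨p, hp, k, hk4, by rw [h3, h4], by rw [h1, h2]⟩)

theorem isInternal_odd (k : ℕ) : IsInternal (2 * k + 1) := by unfold IsInternal; omega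

theorem _root_.Refutation.Glued.adj {p q : ℕ → V} {k : ℕ} (hg : Glued G p k q) :
    G.Adj (p (2 * k + 1)) (q 1) := by
  have hk := hg.lt
  have := hg.isGlued.2 (1, 9) (by simp [gluedEdges])
  have e1 : symm (2 * k) false 1 = 2 * k + 1 := by interval_cases k <;> rfl
  have e9 : gluing p k q 9 = q 1 := hg.gluing_second (i := 1) (by norm_num)
  rwa [gluing_first p k q (show 1 < 9 by norm_num), e1, e9] at this

/-- An edge crossed by a connection belongs to an instance with an internal vertex at an end of the
connection, thus to one of the two connected instances. There `not_crosses_left` and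
`not_crosses_right` leave only the common side. -/
theorem crossingPair_of_connection (d : IsDrawn G L F χ) {r p q : ℕ → V} (hr : r ∈ L) (hp : p ∈ L)
    (hq : q ∈ L) {k : ℕ} (hg : Glued G p k q) {e : ℕ × ℕ} (he : e ∈ antiprismEdges)
    (hn : [p (2 * k + 1), q 1, r e.1, r e.2].Nodup)
    (hc : Crosses χ (p (2 * k + 1)) (q 1) (r e.1) (r e.2)) :
    CrossingPair G L (p (2 * k + 1)) (q 1) (r e.1) (r e.2) := by
  have hk := hg.lt
  have hlt := lt_nine_of_mem_antiprismEdges e he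
  have he' : adjOf antiprismEdges e.1 e.2 = true := by
    simp only [adjOf, List.any_eq_true, Bool.or_eq_true, Bool.and_eq_true, Nat.beq_eq]
    exact ⟨e, he, Or.inl ⟨rfl, rfl⟩⟩
  obtain ⟨i, hi, hint, h⟩ := d.exists_internal_of_crosses hr he hg.adj hn hc
  rw [← crosses_comm] at hc
  simp only [List.nodup_cons, List.mem_cons, List.not_mem_nil, or_false, not_or] at hn
  rcases h with h | h
  · obtain ⟨rfl, -⟩ := d.eq_of_internal hr hp hi (show 2 * k + 1 < 9 by omega) hint h.symm
    by_cases hs : s(e.1, e.2) = s(2 * k, (2 * k + 2) % 8)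
    · refine Or.inl (Or.inr ⟨r, hr, q, hq, k, hg, rfl, ?_⟩)
      have := congrArg (Sym2.map r) hs
      rw [hg.zero, hg.two]
      simpa using this
    · refine (hg.not_crosses_left d.pattern he' hlt.1 hlt.2 ?_ ?_ hs hc).elim
      · intro h; rw [h] at hn; tauto
      · intro h; rw [h] at hn; tauto
  · obtain ⟨rfl, -⟩ := d.eq_of_internal hr hq hi (show 1 < 9 by omega) hint h.symm
    by_cases hs : s(e.1, e.2) = s(0, 2)
    · refine Or.inl (Or.inr ⟨p, hp, r, hr, k, hg, rfl, ?_⟩)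
      simpa using congrArg (Sym2.map r) hs
    · refine (hg.not_crosses_right d.pattern he' hlt.1 hlt.2 ?_ ?_ hs hc).elim
      · intro h; rw [h] at hn; tauto
      · intro h; rw [h] at hn; tauto

/-- A second connection that crosses the first would have an end inside the triangle formed by the
first connection and `q 0`. The common side cuts this triangle, and by `inside_of_crosses_of_inside`
its points lie in the triangles on the common side in the two instances, which are empty. -/
theorem not_crosses_of_connections (d : IsDrawn G L F χ) {p q r s : ℕ → V} (hp : p ∈ L) (hq : q ∈ L)
    (hr : r ∈ L) (hs : s ∈ L) {k l : ℕ} (hg : Glued G p k q) (hg' : Glued G r l s)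
    (hn : [r (2 * l + 1), s 1, p (2 * k + 1), q 1].Nodup) :
    ¬Crosses χ (r (2 * l + 1)) (s 1) (p (2 * k + 1)) (q 1) := by
  intro hc
  have hk := hg.lt
  have hl := hg'.lt
  have hx := hg.crosses d.pattern
  have a1 : G.Adj (q 1) (q 0) := adj_of_adjOf hg.right.2 (by decide +kernel)
  have a2 : G.Adj (p (2 * k + 1)) (q 0) := by
    rw [hg.zero]
    refine adj_of_adjOf hg.left.2 ?_
    interval_cases k <;> decide +kernel
  have a3 : G.Adj (q 1) (q 2) := adj_of_adjOf hg.right.2 (by decide +kernel)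
  have a4 : G.Adj (p (2 * k + 1)) (q 2) := by
    rw [hg.two]
    refine adj_of_adjOf hg.left.2 ?_
    interval_cases k <;> decide +kernel
  have a5 : q 0 ≠ q 2 := by rw [Ne, d.inj hq (by norm_num) (by norm_num)]; norm_num
  have hodd : ∀ z, z = r (2 * l + 1) ∨ z = s 1 → z ≠ q 0 ∧ z ≠ q 2 := by
    rintro z (rfl | rfl)
    · refine ⟨fun e => ?_, fun e => ?_⟩ <;>
      · have := (d.eq_of_internal hr hq (by omega) (by norm_num) (isInternal_odd l) e).2
        omega
    · refine ⟨fun e => ?_, fun e => ?_⟩ <;>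
      · have := (d.eq_of_internal hs hq (by omega) (by norm_num) (isInternal_odd 0) e).2
        omega
  have key : ∀ z, z = r (2 * l + 1) ∨ z = s 1 → z ≠ p (2 * k + 1) → z ≠ q 1 →
      ¬Inside χ (p (2 * k + 1)) (q 1) (q 0) z := by
    intro z hz n1 n2 hi
    have hz' := hodd z hz
    have hn' : [p (2 * k + 1), q 1, q 0, q 2, z].Nodup := by
      have := a1.ne
      have := a2.ne
      have := a3.ne
      have := a4.ne
      have := hg.adj.ne
      simp only [List.nodup_cons, List.mem_cons, List.not_mem_nil, or_false, not_or]
      grind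
    rcases d.pattern.inside_of_crosses_of_inside hn' hx hi with h | h
    · rw [hg.zero, hg.two] at h hz'
      refine d.not_inside_triangle hp ?_ hz'.1 hz'.2 n1 h
      interval_cases k <;> decide +kernel
    · exact d.not_inside_triangle hq (a := 0) (b := 2) (c := 1) (by decide +kernel) hz'.1 hz'.2 n2 h
  simp only [List.nodup_cons, List.mem_cons, List.not_mem_nil, or_false, not_or] at hn
  have hn' : [p (2 * k + 1), q 1, q 0, r (2 * l + 1), s 1].Nodup := by
    have := a1.ne
    have := a2.ne
    simp only [List.nodup_cons, List.mem_cons, List.not_mem_nil, or_false, not_or]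
    grind
  rcases d.pattern.inside_of_crosses hn' hg.adj a1 a2 hg'.adj hc with h | h
  · exact key _ (Or.inl rfl) (by tauto) (by tauto) h
  · exact key _ (Or.inr rfl) (by tauto) (by tauto) h

theorem _root_.Assembly.edge' (h : Assembly G L F) {a b : V} (hab : G.Adj a b) :
    (∃ p ∈ L, ∃ e ∈ antiprismEdges, s(a, b) = s(p e.1, p e.2)) ∨
      ∃ p ∈ L, ∃ q ∈ L, ∃ k, Glued G p k q ∧ s(a, b) = s(p (2 * k + 1), q 1) := by
  refine (h.edge a b hab).imp_right ?_
  rintro ⟨p, hp, q, hq, k, hk, hg, h0, h2, hs⟩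
  exact ⟨p, hp, q, hq, k, ⟨hk, h.isAntiprism p hp, h.isAntiprism q hq, hg, h0, h2⟩, hs⟩

theorem CrossingPair_congr {a b c d a' b' c' d' : V} (h₁ : s(a, b) = s(a', b'))
    (h₂ : s(c, d) = s(c', d')) : CrossingPair G L a b c d ↔ CrossingPair G L a' b' c' d' := by
  simp only [CrossingPair, SpokeCrossing, SideCrossing, h₁, h₂]

theorem crossingPair_of_crosses (d : IsDrawn G L F χ) {a b c e : V} (hab : G.Adj a b)
    (hce : G.Adj c e) (hn : [a, b, c, e].Nodup) (hc : Crosses χ a b c e) :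
    CrossingPair G L a b c e := by
  have hcomm : ∀ {a b c e : V}, [a, b, c, e].Nodup → [c, e, a, b].Nodup := by
    intro a b c e hn
    simp only [List.nodup_cons, List.mem_cons, List.not_mem_nil, or_false, not_or] at hn ⊢
    grind
  rcases d.edge' hab with ⟨p, hp, i, hi, h₁⟩ | ⟨p, hp, q, hq, k, hg, h₁⟩ <;>
    rcases d.edge' hce with ⟨r, hr, j, hj, h₂⟩ | ⟨r, hr, s, hs, l, hg', h₂⟩ <;>
    rw [CrossingPair_congr h₁ h₂] <;> obtain ⟨hn', hc'⟩ := d.pattern.crosses_congr h₁ h₂ hn <;>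
    rw [hc'] at hc
  · obtain ⟨m, hm, hint, h⟩ := d.exists_internal_of_crosses hr hj ((d.isAntiprism p hp).2 i hi) hn' hc
    have hlt := lt_nine_of_mem_antiprismEdges i hi
    obtain rfl := d.eq_of_ends hr hp hm hint hlt.1 hlt.2 h rfl
    exact d.crossingPair_of_same hr hi hj hn' hc
  · rw [crossingPair_comm]
    exact d.crossingPair_of_connection hp hr hs hg' hi (hcomm hn') (crosses_comm.2 hc)
  · exact d.crossingPair_of_connection hr hp hq hg hj hn' hc
  · exact (d.not_crosses_of_connections hr hs hp hq hg' hg hn' hc).elim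

theorem crosses_of_crossingPair (d : IsDrawn G L F χ) {a b c e : V} (hn : [a, b, c, e].Nodup)
    (h : CrossingPair G L a b c e) : Crosses χ a b c e := by
  have key : ∀ {a b c e : V}, [a, b, c, e].Nodup →
      SpokeCrossing L a b c e ∨ SideCrossing G L a b c e → Crosses χ a b c e := by
    rintro a b c e hn (⟨p, hp, k, hk, h₁, h₂⟩ | ⟨p, hp, q, hq, k, hg, h₁, h₂⟩)
    · rw [(d.pattern.crosses_congr h₁ h₂ hn).2]
      refine (d.standard p hp).means d.pattern (d.isAntiprism p hp)
        (f := .cross ((2 * k + 7) % 8) (2 * k + 1) (2 * k) 8) ?_ rfl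
      interval_cases k <;> decide +kernel
    · rw [(d.pattern.crosses_congr h₁ h₂ hn).2]
      exact hg.crosses d.pattern
  rcases h with h | h
  · exact key hn h
  · rw [← crosses_comm]
    refine key ?_ h
    simp only [List.nodup_cons, List.mem_cons, List.not_mem_nil, or_false, not_or] at hn ⊢
    grind

end IsDrawn

end

/-! ### Every edge is crossed at most once -/

section

open Refutation AntiprismVertex

variable {V : Type*} {G : SimpleGraph V} {L : List (ℕ → V)} {F : Set (V × V × V)}
  {χ : V → V → V → Prop}

namespace IsDrawn

/-- Edges of instances of which the first has an internal end. -/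
theorem eq_of_edge_eq (d : IsDrawn G L F χ) {p q : ℕ → V} (hp : p ∈ L) (hq : q ∈ L) {i j k l : ℕ}
    (hi : i < 9) (hint : IsInternal i) (hj : j < 9) (hk : k < 9) (hl : l < 9)
    (e : s(p i, p j) = s(q k, q l)) : p = q ∧ s(i, j) = s(k, l) := by
  have := d.eq_of_ends hp hq hi hint hk hl (Or.inl rfl) e
  subst this
  refine ⟨rfl, ?_⟩
  simpa only [Sym2.eq_iff, d.inj hp hi hk, d.inj hp hi hl, d.inj hp hj hk, d.inj hp hj hl] using e

theorem ne_of_glued {p q : ℕ → V} {k : ℕ} (hg : Glued G p k q) : p ≠ q := by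
  rintro rfl
  have hk := hg.lt
  have h0 := hg.left.1 (show 0 < 9 by norm_num) (show 2 * k < 9 by omega) hg.zero
  have h1 : k = 0 := by omega
  subst h1
  exact hg.adj.ne rfl

theorem connection_ne (d : IsDrawn G L F χ) {p q r : ℕ → V} (hp : p ∈ L) (hq : q ∈ L) (hr : r ∈ L)
    {k i j : ℕ} (hg : Glued G p k q) (hi : i < 9) (hj : j < 9) :
    s(p (2 * k + 1), q 1) ≠ s(r i, r j) := by
  intro e
  have hk := hg.lt
  have h1 := d.eq_of_ends hp hr (show 2 * k + 1 < 9 by omega) (isInternal_odd k) hi hj (Or.inl rfl) e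
  have h2 := d.eq_of_ends hq hr (show 1 < 9 by omega) (isInternal_odd 0) hi hj (Or.inr rfl) e
  exact ne_of_glued hg (h1.trans h2.symm)

/-- A crossed edge joins two odd numbers, or is a spoke to an even number, or is a connection, or is
a common side with two even ends. These four types exclude each other, so two crossings on one edge
are of the same type. In the first three types an internal end determines the instances and with
them the crossing edge; a common side needs a separate argument. -/
theorem atMostOneCrossing (d : IsDrawn G L F χ) : AtMostOneCrossing G χ := by
  intro a b c e f g hab hce hfg hn hn' hc hc'
  have h := d.crossingPair_of_crosses hab hce hn hc
  have h' := d.crossingPair_of_crosses hab hfg hn' hc'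
  rcases h with (⟨p, hp, k, hk, h₁, h₂⟩ | ⟨p, hp, q, hq, k, hg, h₁, h₂⟩) |
    (⟨p, hp, k, hk, h₂, h₁⟩ | ⟨p, hp, q, hq, k, hg, h₂, h₁⟩) <;>
  rcases h' with (⟨p', hp', k', hk', h₁', h₂'⟩ | ⟨p', hp', q', hq', k', hg', h₁', h₂'⟩) |
    (⟨p', hp', k', hk', h₂', h₁'⟩ | ⟨p', hp', q', hq', k', hg', h₂', h₁'⟩) <;>
  have E := h₁.symm.trans h₁' <;> rw [h₂, h₂']
  · obtain ⟨rfl, E'⟩ := d.eq_of_edge_eq hp hp' (by omega) (by unfold IsInternal; omega) (by omega)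
      (by omega) (by omega) E
    rw [Sym2.eq_iff] at E'
    have : k = k' := by omega
    rw [this]
  · exact (d.connection_ne hp' hq' hp hg' (by omega) (by omega) E.symm).elim
  · obtain ⟨rfl, E'⟩ := d.eq_of_edge_eq hp hp' (by omega) (by unfold IsInternal; omega) (by omega)
      (by omega) (by omega) E
    rw [Sym2.eq_iff] at E'
    omega
  · obtain ⟨rfl, E'⟩ := d.eq_of_edge_eq hp hq' (by omega) (by unfold IsInternal; omega) (by omega)
      (by omega) (by omega) E
    rw [Sym2.eq_iff] at E'
    omega
  · exact (d.connection_ne hp hq hp' hg (by omega) (by omega) E).elim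
  · have hk := hg.lt
    have hk' := hg'.lt
    rcases Sym2.eq_iff.1 E with ⟨e1, e2⟩ | ⟨e1, e2⟩
    · obtain ⟨rfl, -⟩ := d.eq_of_internal hq hq' (by omega) (by omega) (isInternal_odd 0) e2
      rfl
    · obtain ⟨rfl, f1⟩ := d.eq_of_internal hp hq' (by omega) (by omega) (isInternal_odd k) e1
      obtain ⟨rfl, f2⟩ := d.eq_of_internal hq hp' (by omega) (by omega) (isInternal_odd 0) e2
      have : k = 0 := by omega
      subst this
      rw [hg.zero, hg.two]
  · exact (d.connection_ne hp hq hp' hg (by omega) (by omega) E).elim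
  · exact (d.connection_ne hp hq hq' hg (by omega) (by omega) E).elim
  · obtain ⟨rfl, E'⟩ := d.eq_of_edge_eq hp' hp (by omega) (by unfold IsInternal; omega) (by omega)
      (by omega) (by omega) E.symm
    rw [Sym2.eq_iff] at E'
    omega
  · exact (d.connection_ne hp' hq' hp hg' (by omega) (by omega) E.symm).elim
  · rw [Sym2.eq_swap, Sym2.eq_swap (a := p' (2 * k'))] at E
    obtain ⟨rfl, E'⟩ := d.eq_of_edge_eq hp hp' (by omega) (by unfold IsInternal; omega) (by omega)
      (by omega) (by omega) E
    rw [Sym2.eq_iff] at E'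
    have : k = k' := by omega
    rw [this]
  · rw [Sym2.eq_swap] at E
    obtain ⟨rfl, E'⟩ := d.eq_of_edge_eq hp hq' (by omega) (by unfold IsInternal; omega) (by omega)
      (by omega) (by omega) E
    rw [Sym2.eq_iff] at E'
    omega
  · obtain ⟨rfl, E'⟩ := d.eq_of_edge_eq hp' hq (by omega) (by unfold IsInternal; omega) (by omega)
      (by omega) (by omega) E.symm
    rw [Sym2.eq_iff] at E'
    omega
  · exact (d.connection_ne hp' hq' hq hg' (by omega) (by omega) E.symm).elim
  · rw [Sym2.eq_swap (a := p' (2 * k'))] at E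
    obtain ⟨rfl, E'⟩ := d.eq_of_edge_eq hp' hq (by omega) (by unfold IsInternal; omega) (by omega)
      (by omega) (by omega) E.symm
    rw [Sym2.eq_iff] at E'
    omega
  · have hk := hg.lt
    have hk' := hg'.lt
    have aux : ∀ {p q p' q' : ℕ → V} {k k' : ℕ}, p ∈ L → q ∈ L → p' ∈ L → q' ∈ L → Glued G p k q →
        Glued G p' k' q' → s(q 0, q 2) = s(q' 0, q' 2) →
        (p = p' ∧ q = q' ∨ p = q' ∧ q = p') → s(p (2 * k + 1), q 1) = s(p' (2 * k' + 1), q' 1) := by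
      rintro p q p' q' k k' hp hq hp' hq' hg hg' E (⟨rfl, rfl⟩ | ⟨rfl, rfl⟩)
      · have hk := hg.lt
        have hk' := hg'.lt
        have h0 := hg.zero.symm.trans hg'.zero
        rw [d.inj hp (by omega) (by omega)] at h0
        have : k = k' := by omega
        rw [this]
      · have hk := hg.lt
        have hk' := hg'.lt
        rw [hg.zero, hg.two, Sym2.eq_iff, d.inj hp (by omega) (by omega),
          d.inj hp (by omega) (by omega), d.inj hp (by omega) (by omega),
          d.inj hp (by omega) (by omega)] at E
        have h0 : k = 0 := by omega
        subst h0
        have h0' := hg.zero.trans hg'.zero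
        rw [d.inj hq (by omega) (by omega)] at h0'
        have : k' = 0 := by omega
        subst this
        exact Sym2.eq_swap
    -- A common side has no internal end. But the second connection crosses it and hence ends at an
    -- internal vertex of p and of q, since the side is an edge of both. This identifies the two
    -- pairs of instances.
    refine aux hp hq hp' hq' hg hg' E ?_
    have hnd : [p' (2 * k' + 1), q' 1, q' 0, q' 2].Nodup := by
      refine (d.pattern.crosses_congr h₂' h₁' ?_).1
      simp only [List.nodup_cons, List.mem_cons, List.not_mem_nil, or_false, not_or] at hn' ⊢
      grind
    have hcr := hg'.crosses d.pattern
    have hE' : s(q' 0, q' 2) = s(p (2 * k), p ((2 * k + 2) % 8)) := by rw [← E, hg.zero, hg.two]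
    have c1 := d.pattern.crosses_congr (rfl : s(p' (2 * k' + 1), q' 1) = _) E.symm hnd
    have c2 := d.pattern.crosses_congr (rfl : s(p' (2 * k' + 1), q' 1) = _) hE' hnd
    have hm : ∀ k < 4, (2 * k, (2 * k + 2) % 8) ∈ antiprismEdges := by decide +kernel
    obtain ⟨i, hi, hint, hi'⟩ := d.exists_internal_of_crosses hq (e := (0, 2)) (hm 0 (by norm_num))
      hg'.adj c1.1 (c1.2.1 hcr)
    obtain ⟨j, hj, hjint, hj'⟩ := d.exists_internal_of_crosses hp (hm k hk) hg'.adj c2.1 (c2.2.1 hcr)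
    have hne := ne_of_glued hg
    have o1 : q = p' ∨ q = q' := hi'.imp
      (fun h => (d.eq_of_internal hq hp' hi (by omega) hint h.symm).1)
      fun h => (d.eq_of_internal hq hq' hi (by omega) hint h.symm).1
    have o2 : p = p' ∨ p = q' := hj'.imp
      (fun h => (d.eq_of_internal hp hp' hj (by omega) hjint h.symm).1)
      fun h => (d.eq_of_internal hp hq' hj (by omega) hjint h.symm).1
    rcases o1 with o1 | o1 <;> rcases o2 with o2 | o2
    · exact (hne (o2.trans o1.symm)).elim
    · exact Or.inr ⟨o2, o1⟩
    · exact Or.inl ⟨o2, o1⟩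
    · exact (hne (o2.trans o1.symm)).elim

end IsDrawn

end

section

open Refutation AntiprismVertex

/-! ### Cyclic orders of directions -/

variable {V : Type*} {G : SimpleGraph V} {χ χ' : V → V → V → Prop}

theorem Cyclic.rotate {a b c d : V} (h : Cyclic χ a b c d) : Cyclic χ a c d b := by
  unfold Cyclic at *
  tauto

namespace IsPattern

/-- `Cyclic` is the majority of three orientations, and reversing the cyclic order negates all
three. -/
theorem cyclic_iff_not (hχ : IsPattern G χ) {a b c d : V} (hn : [a, b, c, d].Nodup) :
    Cyclic χ a b d c ↔ ¬Cyclic χ a b c d := by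
  simp only [List.nodup_cons, List.mem_cons, List.not_mem_nil, or_false, not_or] at hn
  have h1 := hχ.swap_iff (a := a) (b := b) (c := c) (by tauto) (by tauto) (by tauto)
  have key : ∀ x y, a ≠ x → a ≠ y → x ≠ y → (χ a y x ↔ ¬χ a x y) := fun x y h1 h2 h3 => by
    rw [hχ.rotate_iff a y x, hχ.rotate_iff y x a, hχ.rotate_iff x a y,
      ← hχ.swap_iff h1 h3 h2, hχ.rotate_iff a y x, hχ.rotate_iff y x a]
  have h1 := key b c (by tauto) (by tauto) (by tauto)
  have h2 := key c d (by tauto) (by tauto) (by tauto)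
  have h3 := key b d (by tauto) (by tauto) (by tauto)
  unfold Cyclic
  tauto

theorem swap_right (hχ : IsPattern G χ) {a b c : V} (h1 : a ≠ b) (h2 : b ≠ c) (h3 : a ≠ c) :
    χ a c b ↔ ¬χ a b c := by
  rw [hχ.rotate_iff a c b, hχ.rotate_iff c b a, hχ.swap_iff h1 h2 h3]

theorem cyclic_trans (hχ : IsPattern G χ) {a b c d e : V} (hn : [a, b, c, d, e].Nodup)
    (h₁ : Cyclic χ a b c d) (h₂ : Cyclic χ a b d e) : Cyclic χ a b c e := by
  -- With the direction of b as reference, the other three directions lie to its left or right. Only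
  -- the cases with all three on one side need geometry, `trans` on the left and `trans'` on the
  -- right; the others are propositional.
  have key : ∀ bc bd be cd de ce : Prop, (bc → bd → be → cd → de → ce) →
      (¬bc → ¬bd → ¬be → cd → de → ce) → (bc ∨ cd) ∧ (cd ∨ ¬bd) ∧ (¬bd ∨ bc) →
      (bd ∨ de) ∧ (de ∨ ¬be) ∧ (¬be ∨ bd) → (bc ∨ ce) ∧ (ce ∨ ¬be) ∧ (¬be ∨ bc) := by
    grind
  simp only [List.nodup_cons, List.mem_cons, List.not_mem_nil, or_false, not_or] at hn
  obtain ⟨⟨nab, nac, nad, nae⟩, ⟨nbc, nbd, nbe⟩, ⟨ncd, nce⟩, nde, -⟩ := hn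
  unfold Cyclic at *
  rw [hχ.swap_right nab nbd nad] at h₁
  rw [hχ.swap_right nab nbe nae] at h₂ ⊢
  refine key _ _ _ _ _ _ (hχ.trans a b c d e) ?_ h₁ h₂
  rw [← hχ.swap_iff nab nbc nac, ← hχ.swap_iff nab nbd nad, ← hχ.swap_iff nab nbe nae]
  exact hχ.trans' a b c d e

/-- A point outside a triangle that cannot be seen from `a` through the opposite side. -/
theorem cyclic_of_not_inside (hχ : IsPattern G χ) {a y y' z : V} (hn : [a, y, y', z].Nodup)
    (ho : χ a y y') (hi : ¬Inside χ a y y' z) (hc : ¬Crosses χ a z y y') : Cyclic χ a y y' z := by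
  simp only [List.nodup_cons, List.mem_cons, List.not_mem_nil, or_false, not_or] at hn
  obtain ⟨⟨n1, n2, n3⟩, ⟨n4, n5⟩, n6, -⟩ := hn
  have s1 := hχ.swap_right n1 n5 n3
  have s2 := hχ.swap_right n2 n6 n3
  have r5 := hχ.rotate_iff a y y'
  have r6 := hχ.rotate_iff a z y'
  have r7 := hχ.rotate_iff z y' a
  unfold Cyclic Inside Crosses at *
  grind

end IsPattern

/-- Two patterns have the same cyclic order of the edges from `a` to the points in `D`. -/
def AgreeOn (χ χ' : V → V → V → Prop) (a : V) (D : Set V) : Prop :=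
  ∀ b ∈ D, ∀ c ∈ D, ∀ d ∈ D, [b, c, d].Nodup → (Cyclic χ a b c d ↔ Cyclic χ' a b c d)

theorem AgreeOn.mono {a : V} {D D' : Set V} (h : AgreeOn χ χ' a D) (hD : D' ⊆ D) :
    AgreeOn χ χ' a D' :=
  fun b hb c hc d hd => h b (hD hb) c (hD hc) d (hD hd)

theorem agreeOn_singleton (a b : V) : AgreeOn χ χ' a {b} := by
  rintro _ rfl _ rfl _ - hn
  simp at hn

namespace IsPattern

/-- As seen from b and c, nothing changes when y is replaced by y', because neither of them lies
between y and y'. -/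
theorem cyclic_of_next (hχ : IsPattern G χ) {a y y' b c : V} (hn : [a, y, y', b, c].Nodup)
    (hb : Cyclic χ a y y' b) (hc : Cyclic χ a y y' c) : Cyclic χ a y' b c ↔ Cyclic χ a y b c := by
  have key : ∀ {b c}, [a, y, y', b, c].Nodup → Cyclic χ a y y' b → Cyclic χ a y b c →
      Cyclic χ a y' b c := by
    intro b c hn hb h
    have := hχ.cyclic_trans (b := b) (c := c) (d := y) (e := y') (a := a) (by
      simp only [List.nodup_cons, List.mem_cons, List.not_mem_nil, or_false, not_or] at hn ⊢
      grind) h.rotate hb.rotate.rotate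
    exact this.rotate.rotate
  refine ⟨fun h => ?_, key hn hb⟩
  by_contra hc'
  have hn1 : [a, y, b, c].Nodup := hn.sublist (by simp)
  have hn2 : [a, y', b, c].Nodup := hn.sublist (by simp)
  have hn3 : [a, y, y', c, b].Nodup := by
    simp only [List.nodup_cons, List.mem_cons, List.not_mem_nil, or_false, not_or] at hn ⊢
    grind
  have := key hn3 hc ((hχ.cyclic_iff_not hn1).2 hc')
  exact (hχ.cyclic_iff_not hn2).1 this h

theorem cyclic_of_previous (hχ : IsPattern G χ) {a y y' b c : V} (hn : [a, y, y', b, c].Nodup)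
    (hb : Cyclic χ a y' y b) (hc : Cyclic χ a y' y c) : Cyclic χ a y' b c ↔ Cyclic χ a y b c := by
  refine (hχ.cyclic_of_next ?_ hb hc).symm
  simp only [List.nodup_cons, List.mem_cons, List.not_mem_nil, or_false, not_or] at hn ⊢
  grind

end IsPattern

/-- A new edge directly after or before an old one. -/
theorem AgreeOn.insert_adjacent (hχ : IsPattern G χ) (hχ' : IsPattern G χ') {a y y' : V} {D : Set V}
    (h : AgreeOn χ χ' a D) (ha : a ∉ D) (hy : y ∈ D) (hay' : a ≠ y')
    (hyy' : (∀ z ∈ D, z ≠ y → z ≠ y' → Cyclic χ a y y' z ∧ Cyclic χ' a y y' z) ∨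
      ∀ z ∈ D, z ≠ y → z ≠ y' → Cyclic χ a y' y z ∧ Cyclic χ' a y' y z) :
    AgreeOn χ χ' a (insert y' D) := by
  by_cases hmem : y' ∈ D
  · rwa [Set.insert_eq_of_mem hmem]
  have hD : ∀ {z}, z ∈ D → a ≠ z ∧ z ≠ y' := fun hz =>
    ⟨fun e => ha (e ▸ hz), fun e => hmem (e ▸ hz)⟩
  have key : ∀ b ∈ D, ∀ c ∈ D, [y', b, c].Nodup →
      (Cyclic χ a y' b c ↔ Cyclic χ' a y' b c) := by
    intro b hb c hc hn
    simp only [List.nodup_cons, List.mem_cons, List.not_mem_nil, or_false, not_or] at hn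
    have db := hD hb
    have dc := hD hc
    by_cases hby : b = y
    · subst hby
      have hn4 : [a, y', b, c].Nodup := by
        simp only [List.nodup_cons, List.mem_cons, List.not_mem_nil, or_false, not_or]; grind
      have e1 : ∀ χ, Cyclic χ a b c y' ↔ Cyclic χ a y' b c := fun χ =>
        ⟨fun h => h.rotate.rotate, fun h => h.rotate⟩
      have hn5 : [a, b, y', c].Nodup := by
        simp only [List.nodup_cons, List.mem_cons, List.not_mem_nil, or_false, not_or]; grind
      rcases hyy' with h | h
      · have := h c hc (by tauto) (by tauto)
        rw [← e1, ← e1, hχ.cyclic_iff_not hn5, hχ'.cyclic_iff_not hn5]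
        tauto
      · have := h c hc (by tauto) (by tauto)
        tauto
    by_cases hcy : c = y
    · subst hcy
      have hn5 : [a, y', c, b].Nodup := by
        simp only [List.nodup_cons, List.mem_cons, List.not_mem_nil, or_false, not_or]; grind
      have e1 : ∀ χ, Cyclic χ a c y' b ↔ Cyclic χ a y' b c := fun χ =>
        ⟨fun h => h.rotate, fun h => h.rotate.rotate⟩
      rcases hyy' with h | h
      · have := h b hb (by tauto) (by tauto)
        rw [← e1, ← e1]
        tauto
      · have := h b hb (by tauto) (by tauto)
        rw [hχ.cyclic_iff_not hn5, hχ'.cyclic_iff_not hn5]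
        tauto
    have hn5 : [a, y, y', b, c].Nodup := by
      simp only [List.nodup_cons, List.mem_cons, List.not_mem_nil, or_false, not_or]; grind
    have hn3 : [y, b, c].Nodup := by
      simp only [List.nodup_cons, List.mem_cons, List.not_mem_nil, or_false, not_or]; grind
    have hold := h y hy b hb c hc hn3
    rcases hyy' with h | h
    · have h1 := h b hb hby db.2
      have h2 := h c hc hcy dc.2
      rw [hχ.cyclic_of_next hn5 h1.1 h2.1, hχ'.cyclic_of_next hn5 h1.2 h2.2, hold]
    · have h1 := h b hb hby db.2
      have h2 := h c hc hcy dc.2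
      rw [hχ.cyclic_of_previous hn5 h1.1 h2.1, hχ'.cyclic_of_previous hn5 h1.2 h2.2, hold]
  have rot : ∀ χ b c d, Cyclic χ a b c d ↔ Cyclic χ a c d b := fun χ b c d =>
    ⟨fun h => h.rotate, fun h => h.rotate.rotate⟩
  intro b hb c hc d hd hn
  have hn' := hn
  simp only [List.nodup_cons, List.mem_cons, List.not_mem_nil, or_false, not_or] at hn'
  rcases hb with rfl | hb
  · exact key c (hc.resolve_left (by tauto)) d (hd.resolve_left (by tauto)) hn
  rcases hc with rfl | hc
  · rw [rot, rot χ']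
    exact key d (hd.resolve_left (by tauto)) b hb (by
      simp only [List.nodup_cons, List.mem_cons, List.not_mem_nil, or_false, not_or]; grind)
  rcases hd with rfl | hd
  · rw [← rot, ← rot χ']
    exact key b hb c hc (by
      simp only [List.nodup_cons, List.mem_cons, List.not_mem_nil, or_false, not_or]; grind)
  exact h b hb c hc d hd hn

/-- A new edge `xy` that crosses the opposite side of a triangle at `x`. -/
theorem AgreeOn.insert_crossing (hχ : IsPattern G χ) (hχ' : IsPattern G χ') {x y v v' : V} {D : Set V}
    (h : AgreeOn χ χ' x D) (hx : x ∉ D) (hyD : y ∉ D) (hv : v ∈ D) (hv' : v' ∈ D) (hxy : x ≠ y)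
    (hvv' : v ≠ v') (ho : χ x v v' ↔ χ' x v v') (hc : Crosses χ x y v v') (hc' : Crosses χ' x y v v')
    (hD : ∀ z ∈ D, z ≠ v → z ≠ v' → (¬Inside χ x v v' z ∧ ¬Crosses χ x z v v') ∧
      ¬Inside χ' x v v' z ∧ ¬Crosses χ' x z v v') :
    AgreeOn χ χ' x (insert y D) := by
  have hne : ∀ {z}, z ∈ D → x ≠ z ∧ y ≠ z := fun hz =>
    ⟨fun e => hx (e ▸ hz), fun e => hyD (e ▸ hz)⟩
  -- The edge xy leaves the angle between v and v' through the opposite side. Any other edge in this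
  -- angle would end inside the triangle or cross this side as well, so xy directly follows xv.
  have one : ∀ {χ}, IsPattern G χ → ∀ {v v'}, v ∈ D → v' ∈ D → v ≠ v' → χ x v v' →
      Crosses χ x y v v' → (∀ z ∈ D, z ≠ v → z ≠ v' → ¬Inside χ x v v' z ∧ ¬Crosses χ x z v v') →
      ∀ z ∈ D, z ≠ v → z ≠ y → Cyclic χ x v y z := by
    intro χ hχ v v' hv hv' hvv' ho hc hD z hz hzv hzy
    have n1 := hne hv
    have n2 := hne hv'
    have n3 := hne hz
    have o1 : χ x y v' := by
      rw [hχ.crosses_orientation (by simp [hxy, n1.1, n1.2, n2.1, n2.2, hvv']) hc]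
      exact hχ.rotate _ _ _ ho
    have o2 : χ x v y := by
      rw [hχ.swap_right hxy n1.2 n1.1]
      unfold Crosses at hc
      tauto
    have c1 : Cyclic χ x v y v' := ⟨Or.inl o2, Or.inl o1, Or.inr o2⟩
    by_cases hzv' : z = v'
    · rwa [hzv']
    have := hD z hz hzv hzv'
    refine hχ.cyclic_trans ?_ c1 (hχ.cyclic_of_not_inside ?_ ho this.1 this.2)
    · simp [n1.1, n1.2.symm, n2.1, n2.2, hxy, n3.1, n3.2, hvv', Ne.symm hzv, Ne.symm hzv']
    · simp [n1.1, n2.1, n3.1, hvv', Ne.symm hzv, Ne.symm hzv']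
  by_cases hov : χ x v v'
  · refine h.insert_adjacent hχ hχ' hx hv hxy (Or.inl fun z hz h1 h2 => ⟨?_, ?_⟩)
    · exact one hχ hv hv' hvv' hov hc (fun z hz h1 h2 => (hD z hz h1 h2).1) z hz h1 h2
    · exact one hχ' hv hv' hvv' (ho.1 hov) hc' (fun z hz h1 h2 => (hD z hz h1 h2).2) z hz h1 h2
  · have flip : ∀ {χ}, IsPattern G χ → ¬χ x v v' → Crosses χ x y v v' →
        (∀ z ∈ D, z ≠ v → z ≠ v' → ¬Inside χ x v v' z ∧ ¬Crosses χ x z v v') →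
        ∀ z ∈ D, z ≠ v' → z ≠ y → Cyclic χ x v' y z := by
      intro χ hχ ho hc hD
      have n1 := hne hv
      have n2 := hne hv'
      refine one hχ hv' hv hvv'.symm ((hχ.swap_right n1.1 hvv' n2.1).2 ho) ?_ fun z hz h1 h2 => ?_
      · rw [← crosses_comm, hχ.crosses_swap, crosses_comm]
        · exact hc
        · simp [hvv', n1.1.symm, n1.2.symm, n2.1.symm, n2.2.symm, hxy]
      · have n3 := hne hz
        have := hD z hz h2 h1
        rw [← inside_rotate, hχ.inside_swap, ← crosses_comm, hχ.crosses_swap, crosses_comm]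
        · rw [← inside_rotate] at this
          exact this
        all_goals simp [hvv', n1.1.symm, n2.1.symm, n3.1, Ne.symm h2, Ne.symm h1]
    exact h.insert_adjacent hχ hχ' hx hv' hxy (Or.inl fun z hz h1 h2 =>
      ⟨flip hχ hov hc (fun z hz h1 h2 => (hD z hz h1 h2).1) z hz h1 h2,
        flip hχ' (fun k => hov (ho.2 k)) hc' (fun z hz h1 h2 => (hD z hz h1 h2).2) z hz h1 h2⟩)

end

section

open Refutation AntiprismVertex

/-! ### Two patterns of a glued graph -/

namespace Refutation

/-- Whether the standard facts determine the orientation of a triple. -/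
def decided (i j k : ℕ) : Bool :=
  (listed 9 standardFacts (.orient i j k) || listed 9 standardFacts (.not (.orient i j k))) &&
    distinct 9 [i, j, k]

/-- Whether `j` and `k` are directions at `i` of which one directly follows the other. -/
def consecutive (i j k : ℕ) : Bool :=
  isTriangle i j k && decided i j k && adjOf antiprismEdges i j && adjOf antiprismEdges i k &&
    adjOf antiprismEdges j k && (Nat.beq (j % 2) 1 || Nat.beq (k % 2) 1) &&
    (Nat.beq (j % 2) 0 || Nat.beq (k % 2) 0)

/-- Whether any two consecutive members of a list of directions at `i` directly follow each other. -/
def isChain (i : ℕ) : ℕ → List ℕ → Bool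
  | _, [] => true
  | j, k :: l => consecutive i j k && isChain i k l

end Refutation

variable {V : Type*} {G : SimpleGraph V} {L : List (ℕ → V)} {F : Set (V × V × V)}
  {χ χ' : V → V → V → Prop}

namespace IsDrawn

theorem orient_iff (d : IsDrawn G L F χ) (d' : IsDrawn G L F χ') {p : ℕ → V} (hp : p ∈ L)
    (hs : Positive χ p ↔ Positive χ' p) {i j k : ℕ} (h : decided i j k = true) :
    χ (p i) (p j) (p k) ↔ χ' (p i) (p j) (p k) := by
  simp only [decided, Bool.and_eq_true, Bool.or_eq_true] at h
  have ha := d.isAntiprism p hp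
  have key : ∀ {χ χ' : V → V → V → Prop}, IsPattern G χ → IsPattern G χ' → IsStandard χ p →
      IsStandard χ' p → (χ (p i) (p j) (p k) ↔ χ' (p i) (p j) (p k)) := by
    intro χ χ' hχ hχ' h1 h2
    rcases h.1 with h | h
    · exact iff_of_true (means_of_listed hχ (by norm_num) ha.1 h1 h)
        (means_of_listed hχ' (by norm_num) ha.1 h2 h)
    · exact iff_of_false (means_of_listed hχ (by norm_num) ha.1 h1 h)
        (means_of_listed hχ' (by norm_num) ha.1 h2 h)
  by_cases hpos : Positive χ p
  · exact key d.pattern d'.pattern ((d.standard p hp).isStandard d.pattern ha hpos)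
      ((d'.standard p hp).isStandard d'.pattern ha (hs.1 hpos))
  · have := key d.pattern.mirror d'.pattern.mirror ((d.standard p hp).isStandard_mirror hpos)
      ((d'.standard p hp).isStandard_mirror fun k => hpos (hs.2 k))
    have hn := nodup_map_of_distinct ha.1 h.2
    rw [d.pattern.swap (p i) (p j) (p k) hn, d'.pattern.swap _ _ _ hn] at this
    exact not_iff_not.1 this

/-- In every crossing pair, the edges that belong to an instance have ends whose numbers have the
same parity, with the centre 8 counted as even. An edge between an odd and an even number is thus
never crossed. -/
theorem not_crosses_of_odd (d : IsDrawn G L F χ) {p : ℕ → V} (hp : p ∈ L) {j k : ℕ} (hj : j < 9)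
    (hk : k < 9) (hj1 : j % 2 = 1) (hk0 : k % 2 = 0) (hjk : adjOf antiprismEdges j k = true)
    {x z : V} (hxz : G.Adj x z) (hn : [x, z, p j, p k].Nodup) : ¬Crosses χ x z (p j) (p k) := by
  intro hc
  have hint : IsInternal j := Or.inl hj1
  rcases d.crossingPair_of_crosses hxz (adj_of_adjOf (d.isAntiprism p hp).2 hjk) hn hc with
    (⟨q, hq, m, hm, -, h⟩ | ⟨q, hq, r, hr, m, hg, -, h⟩) |
    ⟨q, hq, m, hm, h, -⟩ | ⟨q, hq, r, hr, m, hg, h, -⟩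
  · have := (d.eq_of_edge_eq hp hq hj hint hk (by omega) (by omega) h).2
    rw [Sym2.eq_iff] at this
    omega
  · have := (d.eq_of_edge_eq hp hr hj hint hk (by omega) (by omega) h).2
    rw [Sym2.eq_iff] at this
    omega
  · have := (d.eq_of_edge_eq hp hq hj hint hk (by omega) (by omega) h).2
    rw [Sym2.eq_iff] at this
    omega
  · exact d.connection_ne hq hr hp hg hj hk h.symm

/-- An edge between two consecutive directions would end inside an empty triangle or cross its side
opposite to `p i`; this side joins numbers of different parity and is not crossed. -/
theorem cyclic_of_consecutive (d : IsDrawn G L F χ) {p : ℕ → V} (hp : p ∈ L) {i j k : ℕ}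
    (h : consecutive i j k = true) (ho : χ (p i) (p j) (p k)) {z : V} (hz : G.Adj (p i) z)
    (hj : z ≠ p j) (hk : z ≠ p k) : Cyclic χ (p i) (p j) (p k) z := by
  simp only [consecutive, Bool.and_eq_true, Bool.or_eq_true, Nat.beq_eq] at h
  obtain ⟨⟨⟨⟨⟨⟨ht, -⟩, aij⟩, aik⟩, ajk⟩, h1⟩, h0⟩ := h
  have hlt := lt_nine_of_isTriangle ht
  have a1 := (adj_of_adjOf (d.isAntiprism p hp).2 aij).ne
  have a2 := (adj_of_adjOf (d.isAntiprism p hp).2 aik).ne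
  have a3 := (adj_of_adjOf (d.isAntiprism p hp).2 ajk).ne
  have hn : [p i, z, p j, p k].Nodup := by simp [a1, a2, a3, hz.ne, hj, hk]
  refine d.pattern.cyclic_of_not_inside (by simp [a1, a2, a3, hz.ne, hj.symm, hk.symm]) ho
    (d.not_inside_triangle hp ht hz.ne' hj hk) ?_
  by_cases hodd : j % 2 = 1
  · exact d.not_crosses_of_odd hp hlt.2.1 hlt.2.2 hodd (by omega) ajk hz hn
  · have hn' : [p k, p j, p i, z].Nodup := by
      simp [a1.symm, a2.symm, a3.symm, hz.ne, hj.symm, hk.symm]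
    rw [← crosses_comm, d.pattern.crosses_swap hn', crosses_comm]
    have ajk' : adjOf antiprismEdges k j = true := by
      have key : ∀ j < 9, ∀ k < 9, (!adjOf antiprismEdges j k || adjOf antiprismEdges k j) = true := by
        decide +kernel
      simpa [ajk] using key j hlt.2.1 k hlt.2.2
    exact d.not_crosses_of_odd hp hlt.2.2 hlt.2.1 (by omega) (by omega) ajk' hz
      (by simp [a1, a2, a3.symm, hz.ne, hj, hk])

theorem agreeOn_insert (d : IsDrawn G L F χ) (d' : IsDrawn G L F χ') {p : ℕ → V} (hp : p ∈ L)
    (hs : Positive χ p ↔ Positive χ' p) {i j k : ℕ} (h : consecutive i j k = true) {D : Set V}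
    (hD : ∀ z ∈ D, G.Adj (p i) z) (hj : p j ∈ D) (hA : AgreeOn χ χ' (p i) D) :
    AgreeOn χ χ' (p i) (insert (p k) D) := by
  have h' := h
  simp only [consecutive, Bool.and_eq_true] at h'
  obtain ⟨⟨⟨⟨⟨⟨ht, hdec⟩, aij⟩, aik⟩, ajk⟩, -⟩, -⟩ := h'
  have a1 := (adj_of_adjOf (d.isAntiprism p hp).2 aij).ne
  have a2 := (adj_of_adjOf (d.isAntiprism p hp).2 aik).ne
  have a3 := (adj_of_adjOf (d.isAntiprism p hp).2 ajk).ne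
  have ho := d.orient_iff d' hp hs hdec
  refine hA.insert_adjacent d.pattern d'.pattern (fun hm => (hD _ hm).ne rfl) hj a2 ?_
  by_cases hc : χ (p i) (p j) (p k)
  · exact Or.inl fun z hz h1 h2 => ⟨d.cyclic_of_consecutive hp h hc (hD z hz) h1 h2,
      d'.cyclic_of_consecutive hp h (ho.1 hc) (hD z hz) h1 h2⟩
  · have key : ∀ i < 9, ∀ j < 9, ∀ k < 9, (!consecutive i j k || consecutive i k j) = true := by
      decide +kernel
    have hlt := lt_nine_of_isTriangle ht
    have hsw : consecutive i k j = true := by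
      simpa [h] using key i hlt.1 j hlt.2.1 k hlt.2.2
    refine Or.inr fun z hz h1 h2 => ⟨d.cyclic_of_consecutive hp hsw ?_ (hD z hz) h2 h1,
      d'.cyclic_of_consecutive hp hsw ?_ (hD z hz) h2 h1⟩
    · exact (d.pattern.swap_right a1 a3 a2).2 hc
    · exact (d'.pattern.swap_right a1 a3 a2).2 fun k => hc (ho.2 k)

theorem agreeOn_chain (d : IsDrawn G L F χ) (d' : IsDrawn G L F χ') {p : ℕ → V} (hp : p ∈ L)
    (hs : Positive χ p ↔ Positive χ' p) {i : ℕ} : ∀ (l : List ℕ) {j : ℕ} {D : Set V},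
    isChain i j l = true → (∀ z ∈ D, G.Adj (p i) z) → p j ∈ D → AgreeOn χ χ' (p i) D →
    AgreeOn χ χ' (p i) (D ∪ {z | ∃ k ∈ l, z = p k})
  | [], j, D, _, _, _, hA => by simpa using hA
  | k :: l, j, D, h, hD, hj, hA => by
    simp only [isChain, Bool.and_eq_true] at h
    have hk : G.Adj (p i) (p k) := by
      have h1 := h.1
      simp only [consecutive, Bool.and_eq_true] at h1
      exact adj_of_adjOf (d.isAntiprism p hp).2 h1.1.1.1.2
    refine (agreeOn_chain d d' hp hs l h.2 ?_ (Set.mem_insert _ _)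
      (d.agreeOn_insert d' hp hs h.1 hD hj hA)).mono ?_
    · rintro z (rfl | hz)
      exacts [hk, hD z hz]
    · rintro z (hz | ⟨m, hm, rfl⟩)
      · exact Or.inl (Or.inr hz)
      rcases List.mem_cons.1 hm with rfl | hm
      · exact Or.inl (Or.inl rfl)
      · exact Or.inr ⟨m, hm, rfl⟩

theorem agreeOn_instance (d : IsDrawn G L F χ) (d' : IsDrawn G L F χ') {p : ℕ → V} (hp : p ∈ L)
    (hs : Positive χ p ↔ Positive χ' p) {i : ℕ} (hi : i < 9) :
    AgreeOn χ χ' (p i) {z | ∃ k < 9, adjOf antiprismEdges i k = true ∧ z = p k} := by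
  -- The directions at a vertex, listed so that neighbours have different parity: at even numbers
  -- from i + 2, at odd numbers from i + 1, and at the centre all around.
  have key : ∀ i < 9, ∃ j ∈ List.range 9, ∃ l ∈ [[(i + 1) % 8, 8, (i + 7) % 8, (i + 6) % 8],
      [(i + 2) % 8, 8, (i + 6) % 8, (i + 7) % 8], [1, 2, 3, 4, 5, 6, 7]],
      (isChain i j l && adjOf antiprismEdges i j && (List.range 9).all fun k =>
        !adjOf antiprismEdges i k || Nat.beq k j || l.any (Nat.beq k)) = true := by decide +kernel
  obtain ⟨j, -, l, -, h⟩ := key i hi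
  simp only [Bool.and_eq_true, List.all_eq_true, List.mem_range, Bool.or_eq_true, Nat.beq_eq,
    List.any_eq_true] at h
  refine (d.agreeOn_chain d' hp hs l h.1.1 ?_ (Set.mem_singleton _) (agreeOn_singleton _ _)).mono ?_
  · rintro z rfl
    exact adj_of_adjOf (d.isAntiprism p hp).2 h.1.2
  · rintro z ⟨k, hk, ha, rfl⟩
    rcases h.2 k hk with (h | rfl) | ⟨m, hm, rfl⟩
    · simp [ha] at h
    · exact Or.inl rfl
    · exact Or.inr ⟨_, hm, rfl⟩

/-- The edge that connects two glued instances, at one of its ends. -/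
theorem agreeOn_connection (d : IsDrawn G L F χ) (d' : IsDrawn G L F χ') {p : ℕ → V} (hp : p ∈ L)
    (hs : Positive χ p ↔ Positive χ' p) {i j k : ℕ} (ht : isTriangle i j k = true)
    (hdec : decided i j k = true) {y : V} (hy : G.Adj (p i) y) (hc : Crosses χ (p i) y (p j) (p k))
    (hc' : Crosses χ' (p i) y (p j) (p k)) (hn : [p i, y, p j, p k].Nodup)
    (hjk : G.Adj (p j) (p k)) {D : Set V} (hD : ∀ z ∈ D, G.Adj (p i) z) (hyD : y ∉ D)
    (hj : p j ∈ D) (hk : p k ∈ D) (hA : AgreeOn χ χ' (p i) D) :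
    AgreeOn χ χ' (p i) (insert y D) := by
  have ho := d.orient_iff d' hp hs hdec
  refine hA.insert_crossing d.pattern d'.pattern (fun hm => (hD _ hm).ne rfl) hyD hj hk hy.ne hjk.ne
    ho hc hc' fun z hz h1 h2 => ?_
  have hnz : [p i, z, p j, p k].Nodup := by
    have := (hD z hz).ne
    have := (hD _ hj).ne
    have := (hD _ hk).ne
    have := hjk.ne
    simp only [List.nodup_cons, List.mem_cons, List.not_mem_nil, or_false, not_or]
    grind
  have comm : ∀ {z}, [p i, z, p j, p k].Nodup → [p j, p k, p i, z].Nodup := by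
    intro z hn
    simp only [List.nodup_cons, List.mem_cons, List.not_mem_nil, or_false, not_or] at hn ⊢
    grind
  have key : ∀ {χ}, IsDrawn G L F χ → Crosses χ (p i) y (p j) (p k) →
      ¬Inside χ (p i) (p j) (p k) z ∧ ¬Crosses χ (p i) z (p j) (p k) := by
    intro χ d hc
    refine ⟨d.not_inside_triangle hp ht (hD z hz).ne' h1 h2, fun hcz => ?_⟩
    have := d.atMostOneCrossing _ _ _ _ _ _ hjk hy (hD z hz) (comm hn) (comm hnz)
      (crosses_comm.2 hc) (crosses_comm.2 hcz)
    rw [Sym2.eq_iff] at this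
    have := hy.ne
    have := (hD z hz).ne
    grind
  exact ⟨key d hc, key d' hc'⟩

theorem crosses_iff (d : IsDrawn G L F χ) (d' : IsDrawn G L F χ') {a b c e : V} (hab : G.Adj a b)
    (hce : G.Adj c e) (hn : [a, b, c, e].Nodup) : Crosses χ a b c e ↔ Crosses χ' a b c e :=
  ⟨fun h => d'.crosses_of_crossingPair hn (d.crossingPair_of_crosses hab hce hn h),
    fun h => d.crosses_of_crossingPair hn (d'.crossingPair_of_crosses hab hce hn h)⟩

/-- By `crosses_orientation` the orientation of a crossing can be read off from a triple formed by
either edge and an end of the other. For each kind of crossing one such triple lies in a single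
instance, where the sign of the instance decides it. -/
theorem orientation_iff (d : IsDrawn G L F χ) (d' : IsDrawn G L F χ')
    (hs : ∀ p ∈ L, (Positive χ p ↔ Positive χ' p)) {a b c e : V} (hn : [a, b, c, e].Nodup)
    (h : CrossingPair G L a b c e) : χ a b e ↔ χ' a b e := by
  have hc := d.crosses_of_crossingPair hn h
  have hc' := d'.crosses_of_crossingPair hn h
  have spoke : ∀ {a b c e}, SpokeCrossing L a b c e → (χ a b e ↔ χ' a b e) ∧ (χ c e a ↔ χ' c e a) := by
    rintro a b c e ⟨p, hp, k, hk, h₁, h₂⟩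
    have key : ∀ k < 4, (decided ((2 * k + 7) % 8) (2 * k + 1) (2 * k) &&
        decided ((2 * k + 7) % 8) (2 * k + 1) 8 && decided (2 * k + 1) ((2 * k + 7) % 8) (2 * k) &&
        decided (2 * k + 1) ((2 * k + 7) % 8) 8 && decided (2 * k) 8 ((2 * k + 7) % 8) &&
        decided (2 * k) 8 (2 * k + 1) && decided 8 (2 * k) ((2 * k + 7) % 8) &&
        decided 8 (2 * k) (2 * k + 1)) = true := by decide +kernel
    have hk := key k hk
    simp only [Bool.and_eq_true] at hk
    obtain ⟨⟨⟨⟨⟨⟨⟨k1, k2⟩, k3⟩, k4⟩, k5⟩, k6⟩, k7⟩, k8⟩ := hk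
    have o := fun {i j k} (h : decided i j k = true) => d.orient_iff d' hp (hs p hp) h
    rcases Sym2.eq_iff.1 h₁ with ⟨rfl, rfl⟩ | ⟨rfl, rfl⟩ <;>
      rcases Sym2.eq_iff.1 h₂ with ⟨rfl, rfl⟩ | ⟨rfl, rfl⟩
    · exact ⟨o k2, o k5⟩
    · exact ⟨o k1, o k7⟩
    · exact ⟨o k4, o k6⟩
    · exact ⟨o k3, o k8⟩
  have side : ∀ {a b c e}, SideCrossing G L a b c e → (χ c e a ↔ χ' c e a) := by
    rintro a b c e ⟨p, hp, q, hq, k, hg, h₁, h₂⟩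
    have key : ∀ k < 4, (decided (2 * k) ((2 * k + 2) % 8) (2 * k + 1) &&
        decided ((2 * k + 2) % 8) (2 * k) (2 * k + 1)) = true := by decide +kernel
    have hk := key k hg.lt
    have h0 := key 0 (by norm_num)
    simp only [Bool.and_eq_true] at hk h0
    have o := fun {i j k} (h : decided i j k = true) => d.orient_iff d' hp (hs p hp) h
    have o' := fun {i j k} (h : decided i j k = true) => d.orient_iff d' hq (hs q hq) h
    rcases Sym2.eq_iff.1 h₁ with ⟨rfl, rfl⟩ | ⟨rfl, rfl⟩ <;>
      rcases Sym2.eq_iff.1 h₂ with ⟨rfl, rfl⟩ | ⟨rfl, rfl⟩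
    · rw [hg.zero, hg.two]
      exact o hk.1
    · rw [hg.zero, hg.two]
      exact o hk.2
    · exact o' h0.1
    · exact o' h0.2
  have hn' : [c, e, a, b].Nodup := by
    simp only [List.nodup_cons, List.mem_cons, List.not_mem_nil, or_false, not_or] at hn ⊢
    grind
  rw [d.pattern.crosses_orientation hn hc, d'.pattern.crosses_orientation hn hc']
  have hback := d.pattern.crosses_orientation hn' (crosses_comm.2 hc)
  have hback' := d'.pattern.crosses_orientation hn' (crosses_comm.2 hc')
  rcases h with (h | h) | h | h
  · exact (spoke h).2
  · exact side h
  · have := (spoke h).1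
    unfold Crosses at hc hc'
    tauto
  · have := side h
    unfold Crosses at hc hc'
    tauto

end IsDrawn

end

/-! ### Any two patterns of a glued graph give the same embedding -/

section

open Refutation AntiprismVertex

namespace GluedGraph.IsAssembly

theorem isDrawn_of_standard {H : GluedGraph} {L : List (ℕ → H.V)} (h : IsAssembly H L)
    {χ : H.V → H.V → H.V → Prop} (hχ : IsPattern H.graph χ) (hs : ∀ p ∈ L, IsStandardOrMirror χ p) :
    IsDrawn H.graph L H.freeSides χ :=
  { h.assembly with
    pattern := hχ
    standard := hs
    not_inside := h.not_inside χ hχ }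

/-- The instance to which a new instance is glued. -/
theorem exists_glued {H : GluedGraph} {L : List (ℕ → H.V)} (h : IsAssembly H L) {v v' u : H.V}
    (hs : (v, v', u) ∈ H.freeSides) : ∃ p ∈ L, ∃ k < 4, v = p (2 * k) ∧ v' = p ((2 * k + 2) % 8) ∧
      u = p (2 * k + 1) ∧ Glued (H.extend v v' u).graph (fun i => Sum.inl (p i)) k
        fun i => H.place v v' (ofNumber i) := by
  obtain ⟨p, hp, k, hk, rfl, rfl, rfl, -⟩ := h.assembly.free _ _ _ hs
  exact ⟨p, hp, k, hk, rfl, rfl, rfl,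
    (h.isExtension hs).glued (h.assembly.isAntiprism p hp) hk⟩

theorem length_pos {H : GluedGraph} {L : List (ℕ → H.V)} (h : IsAssembly H L) : 0 < L.length := by
  cases h
  · exact Nat.one_pos
  · exact Nat.succ_pos _

/-- Two instances are needed: in a single one, either quadrilateral may be the external one. In a
larger graph each instance belongs to the graph before the last extension, or is the last one and
glued to another, or there are only two instances. -/
theorem standard {H : GluedGraph} {L : List (ℕ → H.V)} (h : IsAssembly H L) :
    2 ≤ L.length → ∀ χ, IsPattern H.graph χ → ∀ p ∈ L, IsStandardOrMirror χ p := by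
  induction h with
  | single => exact fun h => absurd h (by change ¬2 ≤ 1; norm_num)
  | @extend H L v v' u hL hs ih =>
    intro _ χ hχ p hp
    obtain ⟨P, hP, k, hk, -, -, -, hg⟩ := hL.exists_glued hs
    have hst := hg.isStandard hχ
    rcases List.mem_cons.1 hp with rfl | hp
    · exact hst.elim (fun h => Or.inr h.2) fun h => Or.inl h.2
    obtain ⟨q, hq, rfl⟩ := List.mem_map.1 hp
    by_cases h2 : 2 ≤ L.length
    · exact (ih h2 _ (hχ.comap_extension (hL.isExtension hs)) q hq).imp
        (isStandard_comap _ _ _).1 (isStandard_comap _ (fun a b c => χ b a c) _).1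
    · obtain ⟨x, rfl⟩ := List.length_eq_one_iff.1 (le_antisymm (by omega) hL.length_pos)
      rw [List.mem_singleton] at hP hq
      subst hP hq
      exact hst.imp And.left And.left

theorem isDrawn {H : GluedGraph} {L : List (ℕ → H.V)} (h : IsAssembly H L) (h2 : 2 ≤ L.length)
    {χ : H.V → H.V → H.V → Prop} (hχ : IsPattern H.graph χ) : IsDrawn H.graph L H.freeSides χ :=
  h.isDrawn_of_standard hχ (h.standard h2 χ hχ)

/-- The orientation of one instance determines those of all the others. -/
theorem positive_congr {H : GluedGraph} {L : List (ℕ → H.V)} (h : IsAssembly H L) :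
    ∀ χ χ', IsPattern H.graph χ → IsPattern H.graph χ' → ∀ p ∈ L, ∀ q ∈ L,
      ((Positive χ p ↔ Positive χ' p) ↔ (Positive χ q ↔ Positive χ' q)) := by
  induction h with
  | single =>
    intro χ χ' _ _ p hp q hq
    rw [List.mem_singleton.1 hp, List.mem_singleton.1 hq]
  | @extend H L v v' u hL hs ih =>
    intro χ χ' hχ hχ'
    obtain ⟨P, hP, k, hk, -, -, -, hg⟩ := hL.exists_glued hs
    have key : ∀ q ∈ (fun i => H.place v v' (ofNumber i)) :: L.map fun p i => Sum.inl (p i),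
        ((Positive χ (fun i => Sum.inl (P i)) ↔ Positive χ' fun i => Sum.inl (P i)) ↔
          (Positive χ q ↔ Positive χ' q)) := by
      intro q hq
      rcases List.mem_cons.1 hq with rfl | hq
      · rw [hg.positive_iff hχ, hg.positive_iff hχ', not_iff_not]
      · obtain ⟨r, hr, rfl⟩ := List.mem_map.1 hq
        exact ih _ _ (hχ.comap_extension (hL.isExtension hs))
          (hχ'.comap_extension (hL.isExtension hs)) P hP r hr
    exact fun p hp q hq => (key p hp).symm.trans (key q hq)

/-- Induction on the gluing: at an old vertex the old edges agree by the induction hypothesis, and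
the new edges are inserted one after the other. At a new vertex the edges of the new instance come
first, and the connection is inserted last. -/
theorem agreeOn {H : GluedGraph} {L : List (ℕ → H.V)} (h : IsAssembly H L) :
    ∀ χ χ', IsDrawn H.graph L H.freeSides χ → IsDrawn H.graph L H.freeSides χ' →
      (∀ p ∈ L, (Positive χ p ↔ Positive χ' p)) → ∀ a, AgreeOn χ χ' a {z | H.graph.Adj a z} := by
  induction h with
  | single =>
    intro χ χ' d d' hs (a : AntiprismVertex)
    have := d.agreeOn_instance d' (List.mem_singleton_self _) (hs _ (List.mem_singleton_self _))
      a.number_lt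
    rw [ofNumber_number a] at this
    refine this.mono fun z hz => ?_
    exact ⟨number z, number_lt z, (adj_iff a z).1 hz, (ofNumber_number z).symm⟩
  | @extend H L v v' u hL hF ih =>
    have hext := hL.isExtension hF
    obtain ⟨P, hP, k, hk, hv, hv', hu, hg⟩ := hL.exists_glued hF
    have hA := hL.assembly
    intro χ χ' d d' hs a
    have ds : ∀ {χ}, IsDrawn (H.extend v v' u).graph ((fun i => H.place v v' (ofNumber i)) ::
        L.map fun p i => Sum.inl (p i)) (H.extend v v' u).freeSides χ →
        IsDrawn H.graph L H.freeSides fun a b c => χ (Sum.inl a) (Sum.inl b) (Sum.inl c) := by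
      intro χ d
      refine hL.isDrawn_of_standard (d.pattern.comap_extension hext) fun p hp => ?_
      exact (d.standard _ (List.mem_cons_of_mem _ (List.mem_map_of_mem hp))).imp
        (isStandard_comap _ _ _).2 (isStandard_comap _ (fun a b c => χ b a c) _).2
    have hold := ih _ _ (ds d) (ds d') fun p hp =>
      hs _ (List.mem_cons_of_mem _ (List.mem_map_of_mem hp))
    have hN := List.mem_cons_self (a := fun i => H.place v v' (ofNumber i))
      (l := L.map fun p i => (Sum.inl (p i) : H.ExtendV))
    have hP' : (fun i => Sum.inl (P i)) ∈ ((fun i => H.place v v' (ofNumber i)) ::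
        L.map fun p i => (Sum.inl (p i) : H.ExtendV)) :=
      List.mem_cons_of_mem _ (List.mem_map_of_mem hP)
    generalize (fun i => H.place v v' (ofNumber i)) = N at hext hg d d' hs hN hP'
    generalize (H.extend v v' u).graph = G' at hext hg d d' hs ⊢
    have hsN := hs N hN
    have hsP := hs _ hP'
    have hadj := hext.adj
    have hc := hg.crosses d.pattern
    have hc' := hg.crosses d'.pattern
    have hNN : G'.Adj (N 0) (N 2) := adj_of_adjOf hg.right.2 (by decide +kernel)
    have hvv' : H.graph.Adj v v' := by
      rw [hv, hv']
      refine adj_of_adjOf (hA.isAntiprism P hP).2 ?_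
      interval_cases k <;> decide +kernel
    have huv : H.graph.Adj u v := by
      rw [hv, hu]
      refine adj_of_adjOf (hA.isAntiprism P hP).2 ?_
      interval_cases k <;> decide +kernel
    have huv' : H.graph.Adj u v' := by
      rw [hu, hv']
      refine adj_of_adjOf (hA.isAntiprism P hP).2 ?_
      interval_cases k <;> decide +kernel
    have hcross : [Sum.inl (P (2 * k + 1)), N 1, N 0, N 2].Nodup := by
      have h1 := hg.adj.ne
      have h2 := fun h => huv.ne (hext.injective h)
      have h3 := fun h => huv'.ne (hext.injective h)
      rw [← hext.left, hu] at h2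
      rw [← hext.right, hu] at h3
      have h4 : N 1 ≠ N 0 := fun h => absurd (hext.injOn (show 1 < 9 by norm_num)
        (show 0 < 9 by norm_num) h) (by norm_num)
      have h5 : N 1 ≠ N 2 := fun h => absurd (hext.injOn (show 1 < 9 by norm_num)
        (show 2 < 9 by norm_num) h) (by norm_num)
      simp only [List.nodup_cons, List.mem_cons, List.not_mem_nil, or_false, not_or]
      exact ⟨⟨h1, h2, h3⟩, ⟨h4, h5⟩, hNN.ne, not_false, List.nodup_nil⟩
    have edge : ∀ {i z}, i < 9 → (∃ e ∈ antiprismEdges, s(N i, z) = s(N e.1, N e.2)) →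
        ∃ k < 9, adjOf antiprismEdges i k = true ∧ z = N k := by
      rintro i z hi ⟨e, he, h⟩
      have hlt := lt_nine_of_mem_antiprismEdges e he
      rcases Sym2.eq_iff.1 h with ⟨h1, rfl⟩ | ⟨h1, rfl⟩
      · have := hext.injOn hi hlt.1 h1
        subst this
        refine ⟨e.2, hlt.2, ?_, rfl⟩
        simp only [adjOf, List.any_eq_true, Bool.or_eq_true, Bool.and_eq_true, Nat.beq_eq]
        exact ⟨e, he, Or.inl ⟨rfl, rfl⟩⟩
      · have := hext.injOn hi hlt.2 h1
        subst this
        refine ⟨e.1, hlt.1, ?_, rfl⟩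
        simp only [adjOf, List.any_eq_true, Bool.or_eq_true, Bool.and_eq_true, Nat.beq_eq]
        exact ⟨e, he, Or.inr ⟨rfl, rfl⟩⟩
    by_cases ha : a ∈ Set.range Sum.inl
    · obtain ⟨x, rfl⟩ := ha
      have hD : AgreeOn χ χ' (Sum.inl x) (Sum.inl '' {z | H.graph.Adj x z}) := by
        rintro _ ⟨b, hb, rfl⟩ _ ⟨c, hc, rfl⟩ _ ⟨e, he, rfl⟩ hn
        exact hold x b hb c hc e he (List.Nodup.of_map (Sum.inl : H.V → H.ExtendV) hn)
      have hDadj : ∀ z ∈ (Sum.inl '' {z | H.graph.Adj x z} : Set H.ExtendV), G'.Adj (Sum.inl x) z := by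
        rintro _ ⟨z, hz, rfl⟩
        exact hext.map_adj hz
      have hsub : ∀ z, G'.Adj (Sum.inl x) z → z ∈ (Sum.inl '' {z | H.graph.Adj x z} : Set H.ExtendV) ∨
          (x = v ∧ ∃ k < 9, adjOf antiprismEdges 0 k = true ∧ z = N k) ∨
          (x = v' ∧ ∃ k < 9, adjOf antiprismEdges 2 k = true ∧ z = N k) ∨ x = u ∧ z = N 1 := by
        intro z hz
        rcases (hadj _ _).1 hz with ⟨x', y, hxy, h1, rfl⟩ | ⟨e, he, h⟩ | h
        · obtain rfl := hext.injective h1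
          exact Or.inl ⟨y, hxy, rfl⟩
        · have hlt := lt_nine_of_mem_antiprismEdges e he
          have : ∃ i < 9, N i = Sum.inl x := by
            rcases Sym2.eq_iff.1 h with ⟨h1, -⟩ | ⟨h1, -⟩
            exacts [⟨_, hlt.1, h1.symm⟩, ⟨_, hlt.2, h1.symm⟩]
          obtain ⟨i, hi, hix⟩ := this
          have he' := edge hi ⟨e, he, by rw [hix]; exact h⟩
          rcases hext.eq_of_map_eq hi hix with ⟨rfl, hx⟩ | ⟨rfl, hx⟩
          · exact Or.inr (Or.inl ⟨hx, he'⟩)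
          · exact Or.inr (Or.inr (Or.inl ⟨hx, he'⟩))
        · rcases Sym2.eq_iff.1 h with ⟨h1, h2⟩ | ⟨h1, -⟩
          · exact Or.inr (Or.inr (Or.inr ⟨hext.injective h1, h2⟩))
          · exact (hext.new 1 (by norm_num) (by norm_num) (by norm_num) ⟨x, h1⟩).elim
      by_cases hxv : x = v
      · subst hxv
        -- The common side is already an old edge at this vertex, so the new edges can be attached
        -- to it as a chain of directions.
        have hch := d.agreeOn_chain d' hN hsN (i := 0) [1, 8, 7, 6] (j := 2) (by decide +kernel)
          (by rw [hext.left]; exact hDadj) (by rw [hext.right]; exact ⟨v', hvv', rfl⟩)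
          (by rw [hext.left]; exact hD)
        rw [hext.left] at hch
        refine hch.mono fun z hz => ?_
        rcases hsub z hz with h | ⟨-, m, hm, hm', rfl⟩ | ⟨h, -⟩ | ⟨h, -⟩
        · exact Or.inl h
        · have key : ∀ m < 9, adjOf antiprismEdges 0 m = true → m = 2 ∨ m ∈ [1, 8, 7, 6] := by
            decide +kernel
          rcases key m hm hm' with rfl | h
          · rw [hext.right]
            exact Or.inl ⟨v', hvv', rfl⟩
          · exact Or.inr ⟨m, h, rfl⟩
        · exact (hvv'.ne h).elim
        · exact (huv.ne h.symm).elim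
      by_cases hxv' : x = v'
      · subst hxv'
        have hch := d.agreeOn_chain d' hN hsN (i := 2) [1, 8, 3, 4] (j := 0) (by decide +kernel)
          (by rw [hext.right]; exact hDadj) (by rw [hext.left]; exact ⟨v, hvv'.symm, rfl⟩)
          (by rw [hext.right]; exact hD)
        rw [hext.right] at hch
        refine hch.mono fun z hz => ?_
        rcases hsub z hz with h | ⟨h, -⟩ | ⟨-, m, hm, hm', rfl⟩ | ⟨h, -⟩
        · exact Or.inl h
        · exact (hxv h).elim
        · have key : ∀ m < 9, adjOf antiprismEdges 2 m = true → m = 0 ∨ m ∈ [1, 8, 3, 4] := by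
            decide +kernel
          rcases key m hm hm' with rfl | h
          · rw [hext.left]
            exact Or.inl ⟨v, hvv'.symm, rfl⟩
          · exact Or.inr ⟨m, h, rfl⟩
        · exact (huv'.ne h.symm).elim
      -- At the apex of the old side the connection is the only new edge, and it leaves through the
      -- common side.
      by_cases hxu : x = u
      · subst hxu
        have key : ∀ k < 4, (isTriangle (2 * k + 1) (2 * k) ((2 * k + 2) % 8) &&
          decided (2 * k + 1) (2 * k) ((2 * k + 2) % 8)) = true := by decide +kernel
        have hkk := key k hk
        rw [Bool.and_eq_true] at hkk
        rw [hg.zero, hg.two] at hc hc' hcross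
        rw [hu] at hD hDadj hsub huv huv' ⊢
        have := d.agreeOn_connection d' hP' hsP hkk.1 hkk.2 hg.adj hc hc' hcross
          (by rw [← hg.zero, ← hg.two]; exact hNN) hDadj ?_ ?_ ?_ hD
        · refine this.mono fun z hz => ?_
          rcases hsub z hz with h | ⟨h, -⟩ | ⟨h, -⟩ | ⟨-, rfl⟩
          · exact Or.inr h
          · exact (huv.ne h).elim
          · exact (huv'.ne h).elim
          · exact Or.inl rfl
        · rintro ⟨z, -, hz⟩
          exact hext.new 1 (by norm_num) (by norm_num) (by norm_num) ⟨z, hz⟩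
        · rw [← hv]; exact ⟨v, huv, rfl⟩
        · rw [← hv']; exact ⟨v', huv', rfl⟩
      refine hD.mono fun z hz => ?_
      rcases hsub z hz with h | ⟨h, -⟩ | ⟨h, -⟩ | ⟨h, -⟩
      · exact h
      · exact (hxv h).elim
      · exact (hxv' h).elim
      · exact (hxu h).elim
    · obtain ⟨i, hi, rfl⟩ := (hext.cover a).resolve_left ha
      have hinst := d.agreeOn_instance d' hN hsN hi
      have hsub : ∀ z, G'.Adj (N i) z → (∃ k < 9, adjOf antiprismEdges i k = true ∧ z = N k) ∨
          i = 1 ∧ z = Sum.inl u := by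
        intro z hz
        rcases (hadj _ _).1 hz with ⟨x', y, hxy, h1, rfl⟩ | h | h
        · exact (ha ⟨x', h1.symm⟩).elim
        · exact Or.inl (edge hi h)
        · rcases Sym2.eq_iff.1 h with ⟨h1, h2⟩ | ⟨h1, h2⟩
          · exact (ha ⟨u, h1.symm⟩).elim
          · exact Or.inr ⟨hext.injOn hi (show 1 < 9 by norm_num) h1, h2⟩
      by_cases hi1 : i = 1
      · subst hi1
        have key : isTriangle 1 0 2 = true ∧ decided 1 0 2 = true := by decide +kernel
        have hsw : ∀ {χ}, IsPattern G' χ → Crosses χ (Sum.inl (P (2 * k + 1))) (N 1) (N 0) (N 2) →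
            Crosses χ (N 1) (Sum.inl (P (2 * k + 1))) (N 0) (N 2) := fun hχ h =>
          (hχ.crosses_swap hcross).2 h
        have hcross' : [N 1, Sum.inl (P (2 * k + 1)), N 0, N 2].Nodup := by
          simp only [List.nodup_cons, List.mem_cons, List.not_mem_nil, or_false, not_or] at hcross ⊢
          grind
        have := d.agreeOn_connection d' hN hsN key.1 key.2 hg.adj.symm (hsw d.pattern hc) (hsw d'.pattern hc') hcross'
          hNN ?_ ?_ ?_ ?_ hinst
        · refine this.mono fun z hz => ?_
          rcases hsub z hz with h | ⟨-, rfl⟩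
          · exact Or.inr h
          · rw [hu]; exact Or.inl rfl
        · rintro z ⟨m, -, hm, rfl⟩
          exact adj_of_adjOf hg.right.2 hm
        · rintro ⟨m, hm, -, h⟩
          have hm' := hext.eq_of_map_eq hm h.symm
          rw [← hu] at hm'
          rcases hm' with ⟨-, h⟩ | ⟨-, h⟩
          exacts [huv.ne h, huv'.ne h]
        · exact ⟨0, by norm_num, by decide +kernel, rfl⟩
        · exact ⟨2, by norm_num, by decide +kernel, rfl⟩
      · refine hinst.mono fun z hz => ?_
        rcases hsub z hz with h | ⟨h, -⟩
        · exact h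
        · exact (hi1 h).elim

theorem patternEmbedding_eq {H : GluedGraph} {L : List (ℕ → H.V)} (h : IsAssembly H L)
    (h2 : 2 ≤ L.length) {χ χ' : H.V → H.V → H.V → Prop} (hχ : IsPattern H.graph χ)
    (hχ' : IsPattern H.graph χ') {p : ℕ → H.V} (hp : p ∈ L) (hs : Positive χ p ↔ Positive χ' p) :
    patternEmbedding H.graph χ = patternEmbedding H.graph χ' := by
  have d := h.isDrawn h2 hχ
  have d' := h.isDrawn h2 hχ'
  have hs' := fun q hq => (h.positive_congr χ χ' hχ hχ' p hp q hq).1 hs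
  ext a b c e
  · simp only [patternEmbedding]
    refine and_congr_right fun h1 => and_congr_right fun h2 => and_congr_right fun h3 =>
      and_congr_right fun hn => ?_
    exact h.agreeOn χ χ' d d' hs' a b h1 c h2 e h3 hn
  · simp only [patternEmbedding]
    refine and_congr_right fun h1 => and_congr_right fun h2 => and_congr_right fun hn => ?_
    rw [d.crosses_iff d' h1 h2 hn]
    refine and_congr_right fun hc => ?_
    exact d.orientation_iff d' hs' hn (d'.crossingPair_of_crosses h1 h2 hn hc)
  · exact Iff.rfl

end GluedGraph.IsAssembly

end

/-! ### Reflections, isomorphisms and the uniqueness of the embedding -/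

section

open Refutation AntiprismVertex

variable {V W : Type*} {G : SimpleGraph V}

theorem patternEmbedding_mirror {χ : V → V → V → Prop} (hχ : IsPattern G χ) :
    patternEmbedding G (fun a b c => χ b a c) = (patternEmbedding G χ).mirror := by
  ext a b c e
  · simp only [patternEmbedding, CombinatorialEmbedding.mirror, Cyclic]
    have r : ∀ x y, χ x a y ↔ χ a y x := fun x y => hχ.rotate_iff x a y
    rw [r, r, r]
    have : [b, c, e].Nodup ↔ [e, c, b].Nodup := by
      rw [← List.nodup_reverse]; rfl
    rw [this]
    tauto
  · simp only [patternEmbedding, CombinatorialEmbedding.mirror, Prod.fst_swap, Prod.snd_swap]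
    have hp : [a.1, a.2, b.1, b.2].Nodup ↔ [a.1, a.2, b.2, b.1].Nodup :=
      (((List.Perm.swap b.2 b.1 []).cons a.2).cons a.1).nodup_iff
    rw [← hp, SimpleGraph.adj_comm G b.2 b.1]
    refine and_congr_right fun _ => and_congr_right fun _ => and_congr_right fun hn => ?_
    rw [hχ.mirror_crosses hn]
    rw [← (hχ.crosses_congr (rfl : s(a.1, a.2) = _) (Sym2.eq_swap : s(b.1, b.2) = _) hn).2]
    simp only [List.nodup_cons, List.mem_cons, List.not_mem_nil, or_false, not_or] at hn
    rw [hχ.swap_iff hn.1.1 hn.2.1.2 hn.1.2.2]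
    refine and_congr_right fun hc => ?_
    exact (not_iff.1 fun h => hc.1 h.symm)
  · exact Iff.rfl

/-- The embedding that a map of vertices induces. -/
def CombinatorialEmbedding.comap (f : V → W) (E : CombinatorialEmbedding W) :
    CombinatorialEmbedding V where
  rotation a b c d := E.rotation (f a) (f b) (f c) (f d)
  crosses e g := E.crosses (e.map f f) (g.map f f)
  before e g h := E.before (e.map f f) (g.map f f) (h.map f f)

theorem crossAt_comp {G' : SimpleGraph W} (e : G ≃g G') (p : W → ℂ) (a b c d : V) (x : ℂ) :
    CrossAt G (p ∘ e) a b c d x ↔ CrossAt G' p (e a) (e b) (e c) (e d) x := by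
  have : s(e a, e b) ≠ s(e c, e d) ↔ s(a, b) ≠ s(c, d) := by
    simp only [Ne, Sym2.eq_iff, e.injective.eq_iff]
  simp only [CrossAt, e.map_adj_iff, this, Function.comp]

theorem embeddingOf_comp {G' : SimpleGraph W} (e : G ≃g G') (p : W → ℂ) :
    embeddingOf G (p ∘ e) = (embeddingOf G' p).comap e := by
  ext a b c d
  · simp only [embeddingOf, CombinatorialEmbedding.comap, e.map_adj_iff, Function.comp]
  · simp only [embeddingOf, CombinatorialEmbedding.comap, crossAt_comp, Prod.map, Function.comp]
  · simp only [embeddingOf, CombinatorialEmbedding.comap, crossAt_comp, Prod.map, Function.comp]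

theorem IsRACDrawing.of_iso {G' : SimpleGraph W} (e : G ≃g G') {p : W → ℂ} (hp : IsRACDrawing G' p) :
    IsRACDrawing G (p ∘ e) :=
  hp.comp e.toHom e.injective

theorem HasUniqueRACEmbedding.of_iso {G' : SimpleGraph W} (e : G ≃g G')
    (h : HasUniqueRACEmbedding G') : HasUniqueRACEmbedding G := by
  obtain ⟨E, hE⟩ := h
  refine ⟨E.comap e, Set.ext fun F => ?_⟩
  have hmirror : (E.comap e).mirror = E.mirror.comap e := rfl
  rw [hmirror]
  constructor
  · rintro ⟨p, hp, rfl⟩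
    have hpe : p = (p ∘ e.symm) ∘ e := by ext x; simp
    have : embeddingOf G' (p ∘ e.symm) ∈ ({E, E.mirror} : Set (CombinatorialEmbedding W)) := by
      rw [← hE]
      exact ⟨_, hp.of_iso e.symm, rfl⟩
    rw [hpe, embeddingOf_comp]
    exact this.imp (congrArg _) (congrArg _)
  · have key : ∀ E' ∈ ({E, E.mirror} : Set (CombinatorialEmbedding W)),
        E'.comap e ∈ {F | ∃ p : V → ℂ, IsRACDrawing G p ∧ embeddingOf G p = F} := by
      intro E' hE'
      rw [← hE] at hE'
      obtain ⟨p, hp, rfl⟩ := hE'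
      exact ⟨p ∘ e, hp.of_iso e, embeddingOf_comp e p⟩
    rintro (rfl | rfl)
    exacts [key _ (Or.inl rfl), key _ (Or.inr rfl)]

namespace GluedGraph.IsAssembly

theorem finite {H : GluedGraph} {L : List (ℕ → H.V)} (h : IsAssembly H L) : Finite H.V := by
  refine Set.finite_univ_iff.1 (Set.Finite.subset (s := ⋃ p ∈ {p | p ∈ L}, p '' {i | i < 9}) ?_ ?_)
  · exact (List.finite_toSet L).biUnion fun p _ => (Set.finite_lt_nat 9).image p
  · intro a _
    obtain ⟨p, hp, i, hi, rfl⟩ := h.assembly.cover a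
    exact Set.mem_biUnion hp ⟨i, hi, rfl⟩

/-- Every drawing is compared with one fixed drawing `p₀`, and conjugation of the plane realises the
mirror image. -/
theorem hasUniqueRACEmbedding {H : GluedGraph} {L : List (ℕ → H.V)} (h : IsAssembly H L)
    (h2 : 2 ≤ L.length) (hex : ∃ p, IsRACDrawing H.graph p) : HasUniqueRACEmbedding H.graph := by
  have := h.finite
  obtain ⟨p₀, hp₀⟩ := hex
  obtain ⟨χ₀, hχ₀, hr₀⟩ := hp₀.exists_pattern
  obtain ⟨r, hr⟩ : ∃ r, r ∈ L := List.exists_mem_of_length_pos h.length_pos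
  have hemb : ∀ {p χ}, IsRACDrawing H.graph p → IsPattern H.graph χ → Refines H.graph p χ →
      embeddingOf H.graph p = patternEmbedding H.graph χ := fun hp hχ hr =>
    hp.embeddingOf_eq hr (h.isDrawn h2 hχ).atMostOneCrossing
  refine ⟨patternEmbedding H.graph χ₀, Set.ext fun F => ⟨?_, ?_⟩⟩
  · rintro ⟨p, hp, rfl⟩
    obtain ⟨χ, hχ, hrχ⟩ := hp.exists_pattern
    rw [hemb hp hχ hrχ]
    -- One instance r decides whether the drawing is compared with `χ₀` or with its mirror image;
    -- the other instances then agree automatically.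
    by_cases hs : Positive χ r ↔ Positive χ₀ r
    · exact Or.inl (h.patternEmbedding_eq h2 hχ hχ₀ hr hs)
    · right
      have hm : Positive (fun a b c => χ₀ b a c) r ↔ ¬Positive χ₀ r :=
        IsPattern.swap_of_distinct hχ₀ (h.assembly.isAntiprism r hr).1 (by decide)
      rw [Set.mem_singleton_iff, ← patternEmbedding_mirror hχ₀]
      refine h.patternEmbedding_eq h2 hχ hχ₀.mirror hr ?_
      rw [hm]
      tauto
  · rintro (rfl | rfl)
    · exact ⟨p₀, hp₀, hemb hp₀ hχ₀ hr₀⟩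
    · refine ⟨_, hp₀.conj, ?_⟩
      rw [hemb hp₀.conj hχ₀.mirror (hr₀.conj hχ₀), patternEmbedding_mirror hχ₀]

end GluedGraph.IsAssembly

end

section

open Refutation AntiprismVertex

/-! ### Convex hulls and lines -/

/-- An affine function on the plane. -/
def affine (f : ℝ × ℝ × ℝ) (z : ℂ) : ℝ := f.1 * z.re + f.2.1 * z.im + f.2.2

theorem affine_combination (f : ℝ × ℝ × ℝ) {a b : ℝ} (h : a + b = 1) (x y : ℂ) :
    affine f (a • x + b • y) = a * affine f x + b * affine f y := by
  simp only [affine, Complex.add_re, Complex.add_im, Complex.real_smul, Complex.re_ofReal_mul,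
    Complex.im_ofReal_mul]
  linear_combination (-f.2.2) * h

theorem convex_affine_pos (f : ℝ × ℝ × ℝ) : Convex ℝ {z | 0 < affine f z} := by
  intro x hx y hy a b ha hb hab
  simp only [Set.mem_ofPred_eq] at hx hy ⊢
  rw [affine_combination f hab]
  rcases ha.eq_or_lt with rfl | ha
  · have : b = 1 := by linarith
    simpa [this] using hy
  · nlinarith [mul_pos ha hx, mul_nonneg hb hy.le]

theorem convex_affine_nonpos (f : ℝ × ℝ × ℝ) : Convex ℝ {z | affine f z ≤ 0} := by
  intro x hx y hy a b ha hb hab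
  simp only [Set.mem_ofPred_eq] at hx hy ⊢
  rw [affine_combination f hab]
  nlinarith [mul_nonneg ha (neg_nonneg.2 hx), mul_nonneg hb (neg_nonneg.2 hy)]

theorem affine_pos_of_mem_convexHull {f : ℝ × ℝ × ℝ} {s : Set ℂ} (h : ∀ x ∈ s, 0 < affine f x) {z : ℂ}
    (hz : z ∈ convexHull ℝ s) : 0 < affine f z :=
  convexHull_min (t := {z | 0 < affine f z}) h (convex_affine_pos f) hz

theorem affine_nonpos_of_mem_convexHull {f : ℝ × ℝ × ℝ} {s : Set ℂ} (h : ∀ x ∈ s, affine f x ≤ 0)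
    {z : ℂ} (hz : z ∈ convexHull ℝ s) : affine f z ≤ 0 :=
  convexHull_min (t := {z | affine f z ≤ 0}) h (convex_affine_nonpos f) hz

theorem affine_nonpos_of_mem_segment {f : ℝ × ℝ × ℝ} {x y z : ℂ} (hx : affine f x ≤ 0)
    (hy : affine f y ≤ 0) (hz : z ∈ segment ℝ x y) : affine f z ≤ 0 :=
  (convex_affine_nonpos f).segment_subset hx hy hz

/-- A convex hull and a half-plane that touches it in one vertex. -/
theorem eq_of_mem_convexHull {f : ℝ × ℝ × ℝ} {s : Set ℂ} {x z : ℂ} (hx : affine f x = 0)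
    (h : ∀ y ∈ s, y ≠ x → 0 < affine f y) (hz : z ∈ convexHull ℝ s) (hz0 : affine f z ≤ 0) : z = x := by
  have hz' : z ∈ convexHull ℝ (insert x (s \ {x})) :=
    convexHull_mono (by rw [Set.insert_sdiff_singleton]; exact Set.subset_insert _ _) hz
  rcases (s \ {x}).eq_empty_or_nonempty with he | hne
  · rw [he] at hz'
    simpa using hz'
  rw [convexHull_insert hne, convexJoin_singleton_left, Set.mem_iUnion₂] at hz'
  obtain ⟨y, hy, a, b, ha, hb, hab, rfl⟩ := hz'
  have hpos := affine_pos_of_mem_convexHull (fun w hw => h w hw.1 hw.2) hy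
  rw [affine_combination f hab, hx] at hz0
  have hb0 : b = 0 := by nlinarith [mul_nonneg hb hpos.le]
  have ha1 : a = 1 := by linarith
  simp [hb0, ha1]

theorem not_mem_openSegment_left {x y : ℂ} (h : x ≠ y) : x ∉ openSegment ℝ x y :=
  fun hx => h (left_mem_openSegment_iff.1 hx)

/-! ### A drawing of the augmented square antiprism graph -/

/-- The vertices of the drawing. -/
noncomputable def kite (W : ℝ) : ℕ → ℂ
  -- The outer vertices lie on the axes and the inner ones form a rectangle with sides parallel to
  -- the axes, so spokes along the axes cross it at right angles. Each inner vertex lies on the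
  -- perpendicular bisector of its side: the vertex 1, for example, is the midpoint of the side 02
  -- plus the normal vector (36, W) / W. This makes the connections of glued instances perpendicular
  -- to their common sides.
  | 0 => ⟨-W, 0⟩
  | 1 => ⟨36 / W - W / 2, -17⟩
  | 2 => ⟨0, -36⟩
  | 3 => ⟨3, -17⟩
  | 4 => ⟨12, 0⟩
  | 5 => ⟨3, 17⟩
  | 6 => ⟨0, 36⟩
  | 7 => ⟨36 / W - W / 2, 17⟩
  | _ => 0

/-- The vertices of a side and the inner vertex adjacent to them. -/
def kiteSide : ℕ → ℕ × ℕ × ℕ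
  | 0 => (0, 2, 1)
  | 1 => (2, 4, 3)
  | 2 => (4, 6, 5)
  | _ => (0, 6, 7)

/-- A point beyond a side. -/
noncomputable def kiteCorner (W : ℝ) : ℕ → ℂ
  | 0 => ⟨1 - 72 / W, -38 - 36 / W⟩
  | 1 => ⟨31 / 2, 1 / 2⟩
  | 2 => ⟨5, 41⟩
  | _ => ⟨1 - 72 / W, 38 + 36 / W⟩

/-- The space at a side. -/
def kiteRoom (W : ℝ) (k : ℕ) : Set ℂ :=
  convexHull ℝ {kite W (kiteSide k).1, kite W (kiteSide k).2.1, kite W (kiteSide k).2.2, kiteCorner W k}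

/-- Whether a vertex belongs to a side. -/
def onSide (k i : ℕ) : Bool :=
  Nat.beq i (kiteSide k).1 || Nat.beq i (kiteSide k).2.1 || Nat.beq i (kiteSide k).2.2

/-- A line between a side and the other vertices. -/
def sideLine (W : ℝ) : ℕ → ℝ × ℝ × ℝ
  | 0 => (-36, -W, -26 * W)
  | 1 => (3, -1, -13)
  | 2 => (3, 1, -13)
  | _ => (-36, W, -26 * W)

/-- A line through a vertex of a side that separates the side from the other neighbours. -/
noncomputable def vertexLine (W : ℝ) : ℕ → ℕ → ℝ × ℝ × ℝ
  | 0, 0 => (0, -1, 0)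
  | 0, 2 => (-2, -1, -36)
  | 0, _ => (-36, -W, -36 * (W / 2 - 36 / W) - 17 * W)
  | 1, 2 => (1, 0, 0)
  | 1, 4 => (1, -1, -12)
  | 1, _ => (3, -1, -26)
  | 2, 4 => (1, 1, -12)
  | 2, 6 => (1, 0, 0)
  | 2, _ => (3, 1, -26)
  | _, 0 => (0, 1, 0)
  | _, 6 => (-2, 1, -36)
  | _, _ => (-36, W, -36 * (W / 2 - 36 / W) - 17 * W)

section

variable {W : ℝ}

theorem exists_eq_inv (hW : 400 ≤ W) : ∃ r, r = W⁻¹ ∧ W * r = 1 ∧ 0 < r ∧ r ≤ 1 / 400 := by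
  have hWr : W * W⁻¹ = 1 := mul_inv_cancel₀ (by linarith)
  have hr0 : 0 < W⁻¹ := by positivity
  exact ⟨_, rfl, hWr, hr0, by nlinarith⟩

theorem sideLine_pos (hW : 400 ≤ W) {k : ℕ} (hk : k < 4) :
    (∀ i < 9, onSide k i = true → 0 < affine (sideLine W k) (kite W i)) ∧
      0 < affine (sideLine W k) (kiteCorner W k) ∧
      ∀ i < 9, onSide k i = false → affine (sideLine W k) (kite W i) < 0 := by
  -- Writing r for the inverse of W, with W * r = 1 and small positive r, makes all inequalities
  -- polynomial.
  obtain ⟨r, hr, hWr, hr0, hr1⟩ := exists_eq_inv hW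
  interval_cases k <;> refine ⟨fun i hi hs => ?_, ?_, fun i hi hs => ?_⟩
  all_goals first
    | (interval_cases i <;> first
        | exact absurd hs (by decide)
        | (simp [affine, sideLine, kite, div_eq_mul_inv, ← hr] <;> nlinarith))
    | (simp [affine, sideLine, kiteCorner, div_eq_mul_inv, ← hr]; nlinarith)

theorem vertexLine_pos (hW : 400 ≤ W) {k x : ℕ} (hk : k < 4) (hx : x < 9) (hkx : onSide k x = true) :
    affine (vertexLine W k x) (kite W x) = 0 ∧
      (∀ i < 9, onSide k i = true → i ≠ x → 0 < affine (vertexLine W k x) (kite W i)) ∧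
      0 < affine (vertexLine W k x) (kiteCorner W k) ∧
      ∀ i < 9, adjOf antiprismEdges x i = true → onSide k i = false →
        affine (vertexLine W k x) (kite W i) ≤ 0 := by
  obtain ⟨r, hr, hWr, hr0, hr1⟩ := exists_eq_inv hW
  interval_cases k <;> interval_cases x <;> try exact absurd hkx (by decide)
  all_goals refine ⟨?_, fun i hi hs hix => ?_, ?_, fun i hi ha hs => ?_⟩
  all_goals first
    | (interval_cases i <;> first
        | exact absurd hs (by decide)
        | exact absurd rfl hix
        | exact absurd ha (by decide)
        | (simp [affine, vertexLine, kite, div_eq_mul_inv, ← hr] <;> nlinarith))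
    | (simp [affine, vertexLine, kiteCorner, div_eq_mul_inv, ← hr] <;> nlinarith)
    | (simp [affine, vertexLine, kite, div_eq_mul_inv, ← hr] <;> nlinarith)

end

section

variable {W : ℝ}

theorem affine_openSegment {f : ℝ × ℝ × ℝ} {x y z : ℂ} (hz : z ∈ openSegment ℝ x y) :
    ∃ a b : ℝ, 0 < a ∧ 0 < b ∧ a + b = 1 ∧ affine f z = a * affine f x + b * affine f y := by
  obtain ⟨a, b, ha, hb, hab, rfl⟩ := hz
  exact ⟨a, b, ha, hb, hab, affine_combination f hab x y⟩

theorem lt_nine_of_onSide : ∀ {k i : ℕ}, k < 4 → onSide k i = true → i < 9 := by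
  intro k i hk h
  simp only [onSide, Bool.or_eq_true, Nat.beq_eq] at h
  interval_cases k <;> simp only [kiteSide] at h <;> omega

theorem kiteRoom_forall {P : ℂ → Prop} {k : ℕ} (hk : k < 4)
    (h : ∀ i < 9, onSide k i = true → P (kite W i)) (hc : P (kiteCorner W k)) :
    ∀ z ∈ ({kite W (kiteSide k).1, kite W (kiteSide k).2.1, kite W (kiteSide k).2.2,
      kiteCorner W k} : Set ℂ), P z := by
  have hs : onSide k (kiteSide k).1 = true ∧ onSide k (kiteSide k).2.1 = true ∧
      onSide k (kiteSide k).2.2 = true := by interval_cases k <;> decide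
  rintro z (rfl | rfl | rfl | rfl)
  exacts [h _ (lt_nine_of_onSide hk hs.1) hs.1, h _ (lt_nine_of_onSide hk hs.2.1) hs.2.1,
    h _ (lt_nine_of_onSide hk hs.2.2) hs.2.2, hc]

theorem kite_mem_kiteRoom {k i : ℕ} (h : onSide k i = true) : kite W i ∈ kiteRoom W k := by
  refine subset_convexHull ℝ _ ?_
  simp only [onSide, Bool.or_eq_true, Nat.beq_eq] at h
  rcases h with (rfl | rfl) | rfl <;> simp

theorem sideLine_pos_of_mem (hW : 400 ≤ W) {k : ℕ} (hk : k < 4) {z : ℂ} (hz : z ∈ kiteRoom W k) :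
    0 < affine (sideLine W k) z := by
  obtain ⟨h1, h2, -⟩ := sideLine_pos hW hk
  exact affine_pos_of_mem_convexHull (kiteRoom_forall hk h1 h2) hz

/-- A vertex in the space at a side. -/
theorem onSide_of_mem (hW : 400 ≤ W) {k i : ℕ} (hk : k < 4) (hi : i < 9)
    (hz : kite W i ∈ kiteRoom W k) : onSide k i = true := by
  by_contra h
  have h1 := (sideLine_pos hW hk).2.2 i hi (by simpa using h)
  exact lt_asymm h1 (sideLine_pos_of_mem hW hk hz)

theorem eq_of_mem_kiteRoom {k x : ℕ} (hk : k < 4) {f : ℝ × ℝ × ℝ} (h0 : affine f (kite W x) = 0)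
    (h : ∀ i < 9, onSide k i = true → i ≠ x → 0 < affine f (kite W i))
    (hc : 0 < affine f (kiteCorner W k)) {z : ℂ} (hz : z ∈ kiteRoom W k) (hz0 : affine f z ≤ 0) :
    z = kite W x := by
  refine eq_of_mem_convexHull h0 (kiteRoom_forall hk ?_ ?_) hz hz0
  · intro i hi hs hne
    exact h i hi hs fun e => hne (by rw [e])
  · exact fun _ => hc

/-- An edge in the space at a side. -/
theorem kite_edge (hW : 400 ≤ W) {k : ℕ} (hk : k < 4) {e : ℕ × ℕ} (he : e ∈ antiprismEdges)
    (hs : (onSide k e.1 && onSide k e.2) = false) {z : ℂ} (hz : z ∈ kiteRoom W k)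
    (hze : z ∈ segment ℝ (kite W e.1) (kite W e.2)) :
    ∃ x < 9, onSide k x = true ∧ (x = e.1 ∨ x = e.2) ∧ z = kite W x := by
  have hlt := lt_nine_of_mem_antiprismEdges e he
  have hadj : adjOf antiprismEdges e.1 e.2 = true ∧ adjOf antiprismEdges e.2 e.1 = true := by
    have key : ∀ e ∈ antiprismEdges, adjOf antiprismEdges e.1 e.2 = true ∧
      adjOf antiprismEdges e.2 e.1 = true := by decide +kernel
    exact key e he
  -- An edge from a vertex of the side to another vertex runs in the closed half-plane of
  -- `vertexLine` that the room touches only in the first vertex.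
  have main : ∀ {i j}, i < 9 → j < 9 → onSide k i = true → onSide k j = false →
      adjOf antiprismEdges i j = true → z ∈ segment ℝ (kite W i) (kite W j) → z = kite W i := by
    intro i j hi hj h1 h2 ha hz'
    obtain ⟨f0, fp, fc, fn⟩ := vertexLine_pos hW hk hi h1
    exact eq_of_mem_kiteRoom hk f0 fp fc hz (affine_nonpos_of_mem_segment f0.le (fn j hj ha h2) hz')
  rcases h1 : onSide k e.1 with _ | _ <;> rcases h2 : onSide k e.2 with _ | _
  · have hn := (sideLine_pos hW hk).2.2
    have := affine_nonpos_of_mem_segment (hn _ hlt.1 h1).le (hn _ hlt.2 h2).le hze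
    exact (this.not_gt (sideLine_pos_of_mem hW hk hz)).elim
  · exact ⟨e.2, hlt.2, h2, Or.inr rfl, main hlt.2 hlt.1 h2 h1 hadj.2 (by rwa [segment_symm])⟩
  · exact ⟨e.1, hlt.1, h1, Or.inl rfl, main hlt.1 hlt.2 h1 h2 hadj.1 hze⟩
  · simp [h1, h2] at hs

/-- A line between two sides. -/
def pairLine : ℕ → ℕ → ℝ × ℝ × ℝ
  | 0, 1 => (2, 1, 36)
  | 0, 2 => (3, 1, -13)
  | 0, _ => (0, 1, 0)
  | 1, 2 => (-1, 1, 12)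
  | 1, _ => (-3, 1, 13)
  | _, _ => (-4, 3, -108)

theorem pairLine_pos (hW : 400 ≤ W) {k l : ℕ} (hkl : k < l) (hl : l < 4) :
    (∀ i < 9, onSide k i = true → onSide l i = false → affine (pairLine k l) (kite W i) < 0) ∧
      (∀ i < 9, onSide k i = true → onSide l i = true → affine (pairLine k l) (kite W i) = 0) ∧
      (∀ i < 9, onSide k i = false → onSide l i = true → 0 < affine (pairLine k l) (kite W i)) ∧
      affine (pairLine k l) (kiteCorner W k) < 0 ∧ 0 < affine (pairLine k l) (kiteCorner W l) := by
  obtain ⟨r, hr, hWr, hr0, hr1⟩ := exists_eq_inv hW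
  interval_cases l <;> interval_cases k
  all_goals refine ⟨fun i hi h1 h2 => ?_, fun i hi h1 h2 => ?_, fun i hi h1 h2 => ?_, ?_, ?_⟩
  all_goals first
    | (interval_cases i <;> first
        | exact absurd h1 (by decide)
        | exact absurd h2 (by decide)
        | (simp [affine, pairLine, kite, div_eq_mul_inv, ← hr] <;> nlinarith))
    | (simp [affine, pairLine, kiteCorner, div_eq_mul_inv, ← hr]; nlinarith)

/-- The spaces at two sides. -/
theorem kiteRoom_inter (hW : 400 ≤ W) {k l : ℕ} (hk : k < 4) (hl : l < 4) (hkl : k ≠ l) {z : ℂ}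
    (hz : z ∈ kiteRoom W k) (hz' : z ∈ kiteRoom W l) :
    ∃ x < 9, onSide k x = true ∧ onSide l x = true ∧ z = kite W x := by
  wlog hlt : k < l generalizing k l
  · obtain ⟨x, hx, h1, h2, h⟩ := this hl hk hkl.symm hz' hz (by omega)
    exact ⟨x, hx, h2, h1, h⟩
  obtain ⟨h1, h2, h3, h4, h5⟩ := pairLine_pos hW hlt hl
  have hle : affine (pairLine k l) z ≤ 0 :=
    affine_nonpos_of_mem_convexHull (kiteRoom_forall hk (fun i hi hs => by
      rcases h : onSide l i with _ | _
      exacts [(h1 i hi hs h).le, (h2 i hi hs h).le]) h4.le) hz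
  by_cases hx : ∃ x < 9, onSide k x = true ∧ onSide l x = true
  · obtain ⟨x, hx, hkx, hlx⟩ := hx
    have huniq : ∀ k < 4, ∀ l < 4, ∀ x < 9, ∀ i < 9, (Nat.beq k l ||
        !(onSide k x && onSide l x && onSide k i && onSide l i) || Nat.beq i x) = true := by
      decide +kernel
    refine ⟨x, hx, hkx, hlx, eq_of_mem_kiteRoom hl (h2 x hx hkx hlx) (fun i hi hs hne => ?_) h5 hz' hle⟩
    refine h3 i hi ?_ hs
    rw [← Bool.not_eq_true]
    exact fun h => hne (by simpa [hkl, hkx, hlx, h, hs] using huniq k hk l hl x hx i hi)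
  · push Not at hx
    refine (hle.not_gt (affine_pos_of_mem_convexHull (kiteRoom_forall hl (fun i hi hs => ?_) h5)
      hz')).elim
    refine h3 i hi ?_ hs
    rw [← Bool.not_eq_true]
    exact fun h => hx i hi h hs

theorem kite_injOn (hW : 400 ≤ W) : Set.InjOn (kite W) {i | i < 9} := by
  intro i hi j hj h
  have key : ∀ i < 9, ∀ j < 9, i = j ∨ (∃ k ∈ List.range 4, onSide k i = true ∧ onSide k j = false) ∨
      ∃ k ∈ List.range 4, onSide k j = true ∧ onSide k i = false := by decide +kernel
  rcases key i hi j hj with rfl | ⟨k, hk, h1, h2⟩ | ⟨k, hk, h1, h2⟩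
  · rfl
  · have := onSide_of_mem hW (List.mem_range.1 hk) hj (h ▸ kite_mem_kiteRoom h1)
    simp [h2] at this
  · have := onSide_of_mem hW (List.mem_range.1 hk) hi (h ▸ kite_mem_kiteRoom h1)
    simp [h2] at this

/-- The line through two points. -/
def lineThrough (P Q : ℂ) : ℝ × ℝ × ℝ :=
  (P.im - Q.im, Q.re - P.re, P.re * Q.im - P.im * Q.re)

theorem affine_lineThrough (P Q : ℂ) :
    affine (lineThrough P Q) P = 0 ∧ affine (lineThrough P Q) Q = 0 := by
  constructor <;> simp only [affine, lineThrough] <;> ring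

theorem affine_lineThrough_eq (P Q R : ℂ) : affine (lineThrough P Q) R = triArea P Q R := by
  simp only [affine, lineThrough, triArea, area, Complex.sub_re, Complex.sub_im]
  ring

theorem triArea_kiteSide_ne_zero (hW : 400 ≤ W) {k : ℕ} (hk : k < 4) :
    triArea (kite W (kiteSide k).1) (kite W (kiteSide k).2.1) (kite W (kiteSide k).2.2) ≠ 0 := by
  obtain ⟨r, hr, hWr, hr0, hr1⟩ := exists_eq_inv hW
  interval_cases k <;> simp [triArea, area, kite, kiteSide, div_eq_mul_inv, ← hr] <;>
    first | (norm_num; done) | (refine ne_of_gt ?_; nlinarith) | (refine ne_of_lt ?_; nlinarith)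

/-- Up to scaling, the barycentric coordinate of a vertex in the triangle of the side, which is not
degenerate. -/
theorem exists_affine_ne_zero (hW : 400 ≤ W) {k : ℕ} (hk : k < 4) {x : ℕ} (hx : onSide k x = true) :
    ∃ f, affine f (kite W x) ≠ 0 ∧ ∀ i, onSide k i = true → i ≠ x → affine f (kite W i) = 0 := by
  have h := triArea_kiteSide_ne_zero hW hk
  simp only [onSide, Bool.or_eq_true, Nat.beq_eq] at hx ⊢
  rcases hx with (rfl | rfl) | rfl
  · refine ⟨lineThrough (kite W (kiteSide k).2.1) (kite W (kiteSide k).2.2), ?_, ?_⟩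
    · rwa [affine_lineThrough_eq, triArea_rotate]
    · rintro i ((rfl | rfl) | rfl) hne
      exacts [absurd rfl hne, (affine_lineThrough _ _).1, (affine_lineThrough _ _).2]
  · refine ⟨lineThrough (kite W (kiteSide k).2.2) (kite W (kiteSide k).1), ?_, ?_⟩
    · rwa [affine_lineThrough_eq, triArea_rotate, triArea_rotate]
    · rintro i ((rfl | rfl) | rfl) hne
      exacts [(affine_lineThrough _ _).2, absurd rfl hne, (affine_lineThrough _ _).1]
  · refine ⟨lineThrough (kite W (kiteSide k).1) (kite W (kiteSide k).2.1), ?_, ?_⟩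
    · rwa [affine_lineThrough_eq]
    · rintro i ((rfl | rfl) | rfl) hne
      exacts [(affine_lineThrough _ _).1, (affine_lineThrough _ _).2, absurd rfl hne]

/-- Different edges of a side do not cross. -/
theorem not_cross_of_onSide (hW : 400 ≤ W) {k : ℕ} (hk : k < 4) {a b c d : ℕ} (ha : onSide k a = true)
    (hb : onSide k b = true) (hc : onSide k c = true) (hd : onSide k d = true) (hab : a ≠ b)
    (hne : s(a, b) ≠ s(c, d)) {z : ℂ} (hz : z ∈ openSegment ℝ (kite W a) (kite W b))
    (hz' : z ∈ openSegment ℝ (kite W c) (kite W d)) : False := by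
  have main : ∀ {a b}, onSide k a = true → onSide k b = true → a ≠ b → a ≠ c → a ≠ d →
      z ∉ openSegment ℝ (kite W a) (kite W b) := by
    intro a b ha hb hab hac had hz
    obtain ⟨f, hf, hf0⟩ := exists_affine_ne_zero hW hk ha
    obtain ⟨s, t, hs, -, -, h1⟩ := affine_openSegment (f := f) hz
    obtain ⟨s', t', -, -, -, h2⟩ := affine_openSegment (f := f) hz'
    rw [hf0 b hb hab.symm, mul_zero, add_zero] at h1
    rw [hf0 c hc hac.symm, hf0 d hd had.symm, mul_zero, mul_zero, add_zero] at h2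
    exact mul_ne_zero hs.ne' hf (h1.symm.trans h2)
  rw [Ne, Sym2.eq_iff] at hne
  by_cases h : a ≠ c ∧ a ≠ d
  · exact main ha hb hab h.1 h.2 hz
  · by_cases h' : b ≠ c ∧ b ≠ d
    · exact main hb ha hab.symm h'.1 h'.2 (by rwa [openSegment_symm])
    · grind

/-! ### Crossings -/

/-- The signs of the coordinates of the vertices. -/
def kiteSign : ℕ → SignType × SignType
  | 0 => (-1, 0)
  | 1 => (-1, -1)
  | 2 => (0, -1)
  | 3 => (1, -1)
  | 4 => (1, 0)
  | 5 => (1, 1)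
  | 6 => (0, 1)
  | _ => (-1, 1)

theorem sign_kite (hW : 400 ≤ W) {j : ℕ} (hj : j < 8) :
    SignType.sign (kite W j).re = (kiteSign j).1 ∧ SignType.sign (kite W j).im = (kiteSign j).2 := by
  obtain ⟨r, hr, hWr, hr0, hr1⟩ := exists_eq_inv hW
  have h1 : 36 / W - W / 2 < 0 := by rw [div_eq_mul_inv, ← hr]; nlinarith
  have h2 : -W < 0 := by linarith
  interval_cases j <;> simp only [kite, kiteSign, sign_zero] <;> refine ⟨?_, ?_⟩ <;>
    first
      | exact sign_neg h1
      | exact sign_neg h2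
      | (refine sign_neg ?_; norm_num)
      | (refine sign_pos ?_; norm_num)
      | trivial

theorem exists_of_mem_spoke {j : ℕ} {z : ℂ} (hz : z ∈ openSegment ℝ (kite W j) (kite W 8)) :
    ∃ t : ℝ, 0 < t ∧ t < 1 ∧ z.re = t * (kite W j).re ∧ z.im = t * (kite W j).im := by
  obtain ⟨a, b, ha, hb, hab, rfl⟩ := hz
  refine ⟨a, ha, by linarith, ?_, ?_⟩ <;> simp [kite]

theorem spoke_injective (hW : 400 ≤ W) {i j : ℕ} (hi : i < 8) (hj : j < 8) {z : ℂ}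
    (hz : z ∈ openSegment ℝ (kite W i) (kite W 8)) (hz' : z ∈ openSegment ℝ (kite W j) (kite W 8)) :
    i = j := by
  have key : ∀ i < 8, ∀ j < 8, kiteSign i = kiteSign j → i = j := by decide
  obtain ⟨t, ht, -, h1, h2⟩ := exists_of_mem_spoke hz
  obtain ⟨t', ht', -, h3, h4⟩ := exists_of_mem_spoke hz'
  have hi' := sign_kite hW hi
  have hj' := sign_kite hW hj
  refine key i hi j hj (Prod.ext ?_ ?_)
  · have := congrArg SignType.sign (h1.symm.trans h3)
    rwa [sign_mul, sign_mul, sign_pos ht, sign_pos ht', one_mul, one_mul, hi'.1, hj'.1] at this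
  · have := congrArg SignType.sign (h2.symm.trans h4)
    rwa [sign_mul, sign_mul, sign_pos ht, sign_pos ht', one_mul, one_mul, hi'.2, hj'.2] at this

/-- The edges of the inner quadrilateral. -/
def innerEdges : List (ℕ × ℕ) := [(1, 3), (3, 5), (5, 7), (7, 1)]

theorem innerEdge_coordinates {e : ℕ × ℕ} (he : e ∈ innerEdges) {z : ℂ}
    (hz : z ∈ segment ℝ (kite W e.1) (kite W e.2)) :
    ((kite W e.2 - kite W e.1).im = 0 ∧ z.im = (kite W e.1).im ∧ (z.im = 17 ∨ z.im = -17)) ∨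
      ((kite W e.2 - kite W e.1).re = 0 ∧ z.re = (kite W e.1).re ∧
        (z.re = 3 ∨ z.re = 36 / W - W / 2)) := by
  obtain ⟨a, b, ha, hb, hab, rfl⟩ := hz
  have hc : ∀ x : ℝ, a * x + b * x = x := fun x => by rw [← add_mul, hab, one_mul]
  simp only [innerEdges, List.mem_cons, List.not_mem_nil, or_false] at he
  rcases he with rfl | rfl | rfl | rfl
  · have : a * (-17) + b * (-17) = -17 := hc _
    exact Or.inl ⟨by simp [kite], by simpa [kite] using this, Or.inr (by simpa [kite] using this)⟩
  · exact Or.inr (by simp [kite, hc])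
  · exact Or.inl (by simp [kite, hc])
  · exact Or.inr (by simp [kite, hc])

/-- The spokes to odd numbers end at corners of the inner rectangle and do not meet its sides
earlier. The other spokes lie on the axes and meet only rectangle sides perpendicular to them. -/
theorem inner_eq_zero_of_spoke (hW : 400 ≤ W) {j : ℕ} (hj : j < 8) {e : ℕ × ℕ} (he : e ∈ innerEdges)
    {z : ℂ} (hz : z ∈ openSegment ℝ (kite W j) (kite W 8))
    (hz' : z ∈ openSegment ℝ (kite W e.1) (kite W e.2)) :
    inner ℝ (kite W 8 - kite W j) (kite W e.2 - kite W e.1) = 0 := by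
  obtain ⟨t, ht, ht1, h1, h2⟩ := exists_of_mem_spoke hz
  obtain ⟨r, hr⟩ : ∃ r, r = W⁻¹ := ⟨_, rfl⟩
  have hWr : W * r = 1 := by rw [hr]; exact mul_inv_cancel₀ (by linarith)
  have hr0 : 0 < r := by rw [hr]; positivity
  have hs : 36 / W - W / 2 < 0 := by
    have hr1 : r ≤ 1 / 400 := by nlinarith
    rw [div_eq_mul_inv, ← hr]; nlinarith
  rw [inner_eq_re]
  rcases innerEdge_coordinates he (openSegment_subset_segment ℝ _ _ hz') with
    ⟨e1, -, h⟩ | ⟨e1, -, h⟩ <;> rw [e1] <;>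
    interval_cases j <;> simp only [kite] at h1 h2 <;> first
      | (simp [kite]; done)
      | (exfalso; rcases h with h | h <;>
        nlinarith [mul_neg_of_pos_of_neg ht hs, mul_neg_of_pos_of_neg (sub_pos.2 ht1) hs])

end

section

variable {W : ℝ}

/-- The crossings of the drawing. -/
theorem kite_right_angle (hW : 400 ≤ W) {e e' : ℕ × ℕ} (he : e ∈ antiprismEdges)
    (he' : e' ∈ antiprismEdges) (hne : s(e.1, e.2) ≠ s(e'.1, e'.2)) {z : ℂ}
    (hz : z ∈ openSegment ℝ (kite W e.1) (kite W e.2))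
    (hz' : z ∈ openSegment ℝ (kite W e'.1) (kite W e'.2)) :
    inner ℝ (kite W e.2 - kite W e.1) (kite W e'.2 - kite W e'.1) = 0 := by
  have hends : ∀ {e : ℕ × ℕ} {x : ℕ}, e ∈ antiprismEdges → x = e.1 ∨ x = e.2 →
      kite W x ∉ openSegment ℝ (kite W e.1) (kite W e.2) := by
    intro e x he hx hm
    have hlt := lt_nine_of_mem_antiprismEdges e he
    have hd : e.1 ≠ e.2 := by
      have key : ∀ e ∈ antiprismEdges, e.1 ≠ e.2 := by decide +kernel
      exact key e he
    have hn : kite W e.1 ≠ kite W e.2 := fun h => hd (kite_injOn hW hlt.1 hlt.2 h)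
    rcases hx with rfl | rfl
    · exact not_mem_openSegment_left hn hm
    · exact not_mem_openSegment_left hn.symm (by rwa [openSegment_symm])
  have side : ∀ {e e' : ℕ × ℕ}, e ∈ antiprismEdges → e' ∈ antiprismEdges → s(e.1, e.2) ≠ s(e'.1, e'.2) →
      z ∈ openSegment ℝ (kite W e.1) (kite W e.2) → z ∈ openSegment ℝ (kite W e'.1) (kite W e'.2) →
      ∀ k < 4, (onSide k e'.1 && onSide k e'.2) = true → False := by
    intro e e' he he' hne hz hz' k hk hs
    have hs' := hs
    rw [Bool.and_eq_true] at hs'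
    rcases h : (onSide k e.1 && onSide k e.2) with _ | _
    · obtain ⟨x, -, -, hx, rfl⟩ := kite_edge hW hk he h
        ((convex_convexHull ℝ _).segment_subset (kite_mem_kiteRoom hs'.1) (kite_mem_kiteRoom hs'.2)
          (openSegment_subset_segment ℝ _ _ hz')) (openSegment_subset_segment ℝ _ _ hz)
      exact hends he hx hz
    · rw [Bool.and_eq_true] at h
      have key : ∀ e ∈ antiprismEdges, e.1 ≠ e.2 := by decide +kernel
      exact not_cross_of_onSide hW hk h.1 h.2 hs'.1 hs'.2 (key e he) hne hz hz'
  -- Edges within the triangle of a side are crossed by no edge of the instance, because other edges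
  -- touch the room only in its vertices. Only spokes and edges of the inner rectangle remain.
  have kind : ∀ e ∈ antiprismEdges, (∃ k ∈ List.range 4, (onSide k e.1 && onSide k e.2) = true) ∨
      (e.1 < 8 ∧ e.2 = 8) ∨ e ∈ innerEdges := by decide +kernel
  rcases kind e he with ⟨k, hk, h⟩ | h
  · exact (side he' he hne.symm hz' hz k (List.mem_range.1 hk) h).elim
  rcases kind e' he' with ⟨k, hk, h'⟩ | h'
  · exact (side he he' hne hz hz' k (List.mem_range.1 hk) h').elim
  rcases h with ⟨h1, h2⟩ | h <;> rcases h' with ⟨h1', h2'⟩ | h'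
  · rw [h2] at hz hne
    rw [h2'] at hz' hne
    exact (hne (by rw [spoke_injective hW h1 h1' hz hz'])).elim
  · rw [h2] at hz ⊢
    exact inner_eq_zero_of_spoke hW h1 h' hz hz'
  · rw [h2'] at hz' ⊢
    rw [real_inner_comm]
    exact inner_eq_zero_of_spoke hW h1' h hz' hz
  · have c := innerEdge_coordinates h (openSegment_subset_segment ℝ _ _ hz)
    have c' := innerEdge_coordinates h' (openSegment_subset_segment ℝ _ _ hz')
    have hs : 36 / W - W / 2 < 0 :=
      sign_eq_neg_one_iff.1 (sign_kite hW (j := 1) (by norm_num)).1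
    simp only [innerEdges, List.mem_cons, List.not_mem_nil, or_false] at h h'
    rw [inner_eq_re]
    rcases c with ⟨c1, c2, -⟩ | ⟨c1, c2, -⟩ <;> rcases c' with ⟨c1', c2', -⟩ | ⟨c1', c2', -⟩
    · rcases h with rfl | rfl | rfl | rfl <;> rcases h' with rfl | rfl | rfl | rfl <;> first
        | exact (hne rfl).elim
        | (exfalso; simp only [kite, Complex.sub_im] at c1 c1' c2 c2'; linarith)
    · rw [c1, c1']; ring
    · rw [c1, c1']; ring
    · rcases h with rfl | rfl | rfl | rfl <;> rcases h' with rfl | rfl | rfl | rfl <;> first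
        | exact (hne rfl).elim
        | (exfalso; simp only [kite, Complex.sub_re] at c1 c1' c2 c2'; linarith)

theorem kite_not_on_edge (hW : 400 ≤ W) {e : ℕ × ℕ} (he : e ∈ antiprismEdges) {i : ℕ} (hi : i < 9)
    (h1 : i ≠ e.1) (h2 : i ≠ e.2) : kite W i ∉ segment ℝ (kite W e.1) (kite W e.2) := by
  intro hz
  have key : ∀ e ∈ antiprismEdges, ∀ i < 9, (Nat.beq i e.1 || Nat.beq i e.2 ||
      (List.range 4).any fun k => (onSide k i && (!onSide k e.1 || !onSide k e.2)) ||
        (onSide k e.1 && onSide k e.2 && !Nat.beq e.1 e.2)) = true ∨ i = 8 ∧ e ∈ innerEdges := by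
    decide +kernel
  rcases key e he i hi with h | ⟨rfl, h⟩
  · simp only [Bool.or_eq_true, Nat.beq_eq, h1, h2, false_or, List.any_eq_true, List.mem_range] at h
    obtain ⟨k, hk, h | h⟩ := h
    · rw [Bool.and_eq_true] at h
      have hs : (onSide k e.1 && onSide k e.2) = false := by
        simp only [Bool.or_eq_true, Bool.not_eq_true'] at h
        rcases h.2 with h | h <;> simp [h]
      obtain ⟨x, hx, -, hxe, hix⟩ := kite_edge hW hk he hs (kite_mem_kiteRoom h.1) hz
      obtain rfl := kite_injOn hW hi hx hix
      exact hxe.elim h1 h2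
    · simp only [Bool.and_eq_true] at h
      have hm : kite W i ∈ kiteRoom W k := (convex_convexHull ℝ _).segment_subset
        (kite_mem_kiteRoom h.1.1) (kite_mem_kiteRoom h.1.2) hz
      have hki := onSide_of_mem hW hk hi hm
      obtain ⟨f, hf, hf0⟩ := exists_affine_ne_zero hW hk hki
      obtain ⟨a, b, -, -, hab, hz⟩ := hz
      have := affine_combination f hab (kite W e.1) (kite W e.2)
      rw [hz, hf0 _ h.1.1 h1.symm, hf0 _ h.1.2 h2.symm] at this
      exact hf (by linarith)
  · rcases innerEdge_coordinates h hz with ⟨-, -, h⟩ | ⟨-, -, h⟩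
    · simp [kite] at h
    · have : 36 / W - W / 2 < 0 := (sign_eq_neg_one_iff).1 (sign_kite hW (j := 1) (by norm_num)).1
      simp only [kite, Complex.zero_re] at h
      rcases h with h | h <;> linarith

end

/-! ### Drawings with space at the free sides -/

/-- A side of an instance, with its more crowded vertex first, and a corner of the space at it. -/
structure Room (V : Type*) where
  tip : V
  big : V
  apex : V
  corner : ℂ

namespace Room

variable {V W : Type*}

/-- The vertices of the side. -/
def Mem (r : Room V) (x : V) : Prop := x = r.tip ∨ x = r.big ∨ x = r.apex

/-- The space at the side and the triangle next to it. -/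
def space (p : V → ℂ) (r : Room V) : Set ℂ :=
  convexHull ℝ {p r.tip, p r.big, p r.apex, r.corner}

/-- The shape of the space at a side; `σ` is the direction in which it lies. -/
structure HasShape (p : V → ℂ) (r : Room V) (σ ε h : ℝ) : Prop where
  pos : 0 < ε
  height_pos : 0 < h
  -- The apex lies on the perpendicular bisector of the side, opposite to the corner. The summand 1
  -- / 2 in the corner lets the room reach beyond the perpendicular at `big`, where the new instance
  -- overhangs the side.
  apex : p r.apex = (p r.tip + p r.big) / 2 - σ * h * Complex.I * (p r.big - p r.tip)
  corner : r.corner = p r.big + ε * (1 / 2 + σ * Complex.I) * (p r.big - p r.tip)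

/-- The same side with other names of the vertices and another corner. -/
def map (ι : V → W) (g : ℂ → ℂ) (r : Room V) : Room W :=
  ⟨ι r.tip, ι r.big, ι r.apex, g r.corner⟩

theorem space_map (p : V → ℂ) (g : ℂ →ᵃ[ℝ] ℂ) (r : Room V) :
    (r.map id g).space (g ∘ p) = g '' r.space p := by
  simp only [space, map, AffineMap.image_convexHull, Set.image_insert_eq, Set.image_singleton,
    Function.comp, id]

end Room

/-- A drawing in which the spaces at the sides in `S` are disjoint from the rest of the drawing. -/
structure IsRoomy {V : Type*} (G : SimpleGraph V) (p : V → ℂ) (S : Set (Room V)) : Prop where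
  drawing : IsRACDrawing G p
  shape : ∀ r ∈ S, ∃ σ : ℝ, (σ = 1 ∨ σ = -1) ∧ ∃ ε h, r.HasShape p σ ε h
  edge : ∀ r ∈ S, ∀ x y z, G.Adj x y → ¬(r.Mem x ∧ r.Mem y) → z ∈ segment ℝ (p x) (p y) →
    z ∈ r.space p → ∃ w, r.Mem w ∧ z = p w
  vertex : ∀ r ∈ S, ∀ x, p x ∈ r.space p → r.Mem x
  disjoint : ∀ r ∈ S, ∀ r' ∈ S, r ≠ r' → ∀ z, z ∈ r.space p → z ∈ r'.space p →
    ∃ w, r.Mem w ∧ z = p w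

/-- Similarities of the plane. -/
def IsSimilarity (g : ℂ →ᵃ[ℝ] ℂ) (o : ℝ) : Prop :=
  ∃ α : ℂ, α ≠ 0 ∧ ((o = 1 ∧ ∀ x y, g x - g y = α * (x - y)) ∨
    (o = -1 ∧ ∀ x y, g x - g y = α * (starRingEnd ℂ) (x - y)))

theorem exists_isSimilarity {a b a' b' : ℂ} (hab : a ≠ b) (hab' : a' ≠ b') {o : ℝ}
    (ho : o = 1 ∨ o = -1) : ∃ g : ℂ →ᵃ[ℝ] ℂ, IsSimilarity g o ∧ g a = a' ∧ g b = b' := by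
  have h1 : b - a ≠ 0 := sub_ne_zero.2 hab.symm
  have h2 : b' - a' ≠ 0 := sub_ne_zero.2 hab'.symm
  rcases ho with rfl | rfl
  · set α := (b' - a') / (b - a) with hα
    refine ⟨(LinearMap.mulLeft ℝ α).toAffineMap + AffineMap.const ℝ ℂ (a' - α * a),
      ⟨α, div_ne_zero h2 h1, Or.inl ⟨rfl, fun x y => ?_⟩⟩, ?_, ?_⟩
    · simp; ring
    · simp
    · simp
      have : α * (b - a) = b' - a' := div_mul_cancel₀ _ h1
      linear_combination this
  · have h3 : (starRingEnd ℂ) (b - a) ≠ 0 := (map_ne_zero _).2 h1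
    set α := (b' - a') / (starRingEnd ℂ) (b - a) with hα
    refine ⟨((LinearMap.mulLeft ℝ α).comp Complex.conjAe.toLinearMap).toAffineMap +
      AffineMap.const ℝ ℂ (a' - α * (starRingEnd ℂ) a),
      ⟨α, div_ne_zero h2 h3, Or.inr ⟨rfl, fun x y => ?_⟩⟩, ?_, ?_⟩
    · simp; ring
    · simp
    · have : α * (starRingEnd ℂ) (b - a) = b' - a' := div_mul_cancel₀ _ h3
      rw [map_sub] at this
      simp
      linear_combination this

namespace IsSimilarity

variable {V : Type*} {G : SimpleGraph V} {p : V → ℂ} {S : Set (Room V)} {g : ℂ →ᵃ[ℝ] ℂ} {o : ℝ}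

theorem injective (hg : IsSimilarity g o) : Function.Injective g := by
  intro x y h
  obtain ⟨α, hα, ⟨-, h'⟩ | ⟨-, h'⟩⟩ := hg
  · have := h' x y
    rw [h, sub_self, zero_eq_mul, or_iff_right hα, sub_eq_zero] at this
    exact this
  · have := h' x y
    rw [h, sub_self, zero_eq_mul, or_iff_right hα, map_eq_zero, sub_eq_zero] at this
    exact this

theorem inner_eq_zero (hg : IsSimilarity g o) {a b c d : ℂ} (h : inner ℝ (b - a) (d - c) = 0) :
    inner ℝ (g b - g a) (g d - g c) = 0 := by
  obtain ⟨α, -, ⟨-, h'⟩ | ⟨-, h'⟩⟩ := hg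
  · rw [h', h']
    rw [inner_eq_re] at h ⊢
    simp only [Complex.mul_re, Complex.mul_im]
    linear_combination (α.re ^ 2 + α.im ^ 2) * h
  · rw [h', h']
    rw [inner_eq_re] at h ⊢
    simp only [Complex.mul_re, Complex.mul_im, Complex.conj_re, Complex.conj_im]
    linear_combination (α.re ^ 2 + α.im ^ 2) * h

theorem isRACDrawing (hg : IsSimilarity g o) (hp : IsRACDrawing G p) : IsRACDrawing G (g ∘ p) where
  injective := hg.injective.comp hp.injective
  vertex_not_on_edge a b w hab ha hb hw := by
    rw [Function.comp, Function.comp, Function.comp, ← image_segment,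
      hg.injective.mem_set_image] at hw
    exact hp.vertex_not_on_edge a b w hab ha hb hw
  right_angle a b c d x h := by
    obtain ⟨h1, h2, h3, h4, h5⟩ := h
    simp only [Function.comp] at h4 h5 ⊢
    rw [← image_openSegment] at h4 h5
    obtain ⟨y, hy, rfl⟩ := h4
    rw [hg.injective.mem_set_image] at h5
    exact hg.inner_eq_zero (hp.right_angle a b c d y ⟨h1, h2, h3, hy, h5⟩)

theorem hasShape (hg : IsSimilarity g o) {r : Room V} {σ ε h : ℝ} (hr : r.HasShape p σ ε h) :
    (r.map id g).HasShape (g ∘ p) (o * σ) ε h := by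
  refine ⟨hr.pos, hr.height_pos, ?_, ?_⟩
  · change g (p r.apex) = (g (p r.tip) + g (p r.big)) / 2 -
      (o * σ : ℝ) * h * Complex.I * (g (p r.big) - g (p r.tip))
    obtain ⟨α, -, ⟨rfl, h'⟩ | ⟨rfl, h'⟩⟩ := hg
    · have hx : ∀ x, g x = α * x + g 0 := fun x => by rw [← sub_eq_iff_eq_add, h', sub_zero]
      rw [hx (p r.apex), hx (p r.tip), hx (p r.big), hr.apex]
      push_cast
      ring
    · have hx : ∀ x, g x = α * (starRingEnd ℂ) x + g 0 := fun x => by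
        rw [← sub_eq_iff_eq_add, h', sub_zero]
      rw [hx (p r.apex), hx (p r.tip), hx (p r.big), hr.apex]
      simp only [map_sub, map_mul, map_div₀, map_add, map_ofNat, Complex.conj_ofReal, Complex.conj_I]
      push_cast
      ring
  · change g r.corner = g (p r.big) +
      ε * (1 / 2 + (o * σ : ℝ) * Complex.I) * (g (p r.big) - g (p r.tip))
    obtain ⟨α, -, ⟨rfl, h'⟩ | ⟨rfl, h'⟩⟩ := hg
    · have hx : ∀ x, g x = α * x + g 0 := fun x => by rw [← sub_eq_iff_eq_add, h', sub_zero]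
      rw [hx r.corner, hx (p r.tip), hx (p r.big), hr.corner]
      push_cast
      ring
    · have hx : ∀ x, g x = α * (starRingEnd ℂ) x + g 0 := fun x => by
        rw [← sub_eq_iff_eq_add, h', sub_zero]
      rw [hx r.corner, hx (p r.tip), hx (p r.big), hr.corner]
      simp only [map_sub, map_mul, map_div₀, map_add, map_one, map_ofNat, Complex.conj_ofReal,
        Complex.conj_I]
      push_cast
      ring

theorem isRoomy (hg : IsSimilarity g o) (ho : o = 1 ∨ o = -1) (h : IsRoomy G p S) :
    IsRoomy G (g ∘ p) (Room.map id g '' S) where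
  drawing := hg.isRACDrawing h.drawing
  shape := by
    rintro _ ⟨r, hr, rfl⟩
    obtain ⟨σ, hσ, ε, η, hs⟩ := h.shape r hr
    exact ⟨o * σ, by rcases ho with rfl | rfl <;> rcases hσ with rfl | rfl <;> norm_num, ε, η,
      hg.hasShape hs⟩
  edge := by
    rintro _ ⟨r, hr, rfl⟩ x y z hxy hm hz hz'
    rw [Room.space_map] at hz'
    obtain ⟨z, hz', rfl⟩ := hz'
    rw [Function.comp, Function.comp, ← image_segment, hg.injective.mem_set_image] at hz
    obtain ⟨w, hw, rfl⟩ := h.edge r hr x y z hxy hm hz hz'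
    exact ⟨w, hw, rfl⟩
  vertex := by
    rintro _ ⟨r, hr, rfl⟩ x hx
    rw [Room.space_map, Function.comp, hg.injective.mem_set_image] at hx
    exact h.vertex r hr x hx
  disjoint := by
    rintro _ ⟨r, hr, rfl⟩ _ ⟨r', hr', rfl⟩ hne z hz hz'
    rw [Room.space_map] at hz hz'
    obtain ⟨z, hz, rfl⟩ := hz
    rw [hg.injective.mem_set_image] at hz'
    obtain ⟨w, hw, rfl⟩ := h.disjoint r hr r' hr' (fun e => hne (by rw [e])) z hz hz'
    exact ⟨w, hw, rfl⟩

end IsSimilarity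

section

variable {W ε h : ℝ}

/-- The line through the side `0`. -/
def baseLine (W : ℝ) : ℝ × ℝ × ℝ := (36, W, 36 * W)

/-- The perpendicular bisector of the side `0`. -/
noncomputable def bisector (W : ℝ) : ℝ × ℝ × ℝ := (W, -36, W * W / 2 - 648)

theorem baseLine_kite (hW : 400 ≤ W) : affine (baseLine W) (kite W 0) = 0 ∧
    affine (baseLine W) (kite W 2) = 0 ∧ (∀ i < 9, i ≠ 0 → i ≠ 2 → 0 < affine (baseLine W) (kite W i)) ∧
    ∀ k < 4, k ≠ 0 → 0 < affine (baseLine W) (kiteCorner W k) := by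
  obtain ⟨r, hr, hWr, hr0, hr1⟩ := exists_eq_inv hW
  refine ⟨?_, ?_, fun i hi h0 h2 => ?_, fun k hk h0 => ?_⟩
  · simp [affine, baseLine, kite]
  · simp [affine, baseLine, kite]; ring
  · interval_cases i
    · exact absurd rfl h0
    · simp [affine, baseLine, kite, div_eq_mul_inv, ← hr]; nlinarith
    · exact absurd rfl h2
    all_goals simp [affine, baseLine, kite, div_eq_mul_inv, ← hr]; nlinarith
  · interval_cases k
    · exact absurd rfl h0
    all_goals simp [affine, baseLine, kiteCorner, div_eq_mul_inv, ← hr]; nlinarith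

theorem bisector_kite (hW : 400 ≤ W) : affine (bisector W) (kite W 0) < 0 ∧
    0 < affine (bisector W) (kite W 2) ∧ affine (bisector W) (kite W 1) = 0 := by
  obtain ⟨r, hr⟩ : ∃ r, r = W⁻¹ := ⟨_, rfl⟩
  have hWr : W * r = 1 := by rw [hr]; exact mul_inv_cancel₀ (by linarith)
  refine ⟨?_, ?_, ?_⟩ <;> simp [affine, bisector, kite, div_eq_mul_inv, ← hr]
  · nlinarith
  · nlinarith
  · linear_combination 36 * hWr

theorem mem_of_barycentric {a b c z : ℂ} {s : Set ℂ} (ha : a ∈ s) (hb : b ∈ s) (hc : c ∈ s)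
    {x y w : ℝ} (hx : 0 ≤ x) (hy : 0 ≤ y) (hw : 0 ≤ w) (h1 : x + y + w = 1)
    (hz : z = x * a + y * b + w * c) : z ∈ convexHull ℝ s := by
  have := (convex_convexHull ℝ s).sum_mem (t := Finset.univ) (w := ![x, y, w]) (z := ![a, b, c])
    (fun i _ => by fin_cases i <;> simpa) (by simpa [Fin.sum_univ_three] using h1)
    (fun i _ => by fin_cases i <;> exact subset_convexHull ℝ s (by simpa))
  simpa [Fin.sum_univ_three, hz] using this

/-- The last three hypotheses bound the triangle of tip, `big` and corner in coordinates across and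
along the side, the condition at the tip being strengthened by `hWε`. Seen from the tip, the kite
rises only by an angle of order 1 / W, so that it fits for every ε when W is large. -/
theorem mem_of_baseLine (hε : 0 < ε) (hW : 400 ≤ W) (hWε : 100 * (1 / ε + 1 / 2) ≤ W) {s : Set ℂ}
    (ha : kite W 0 ∈ s) (hb : kite W 2 ∈ s) (hc : (⟨ε * (W / 2 + 36), -36 + ε * (W - 18)⟩ : ℂ) ∈ s)
    {z : ℂ} (h0 : 0 ≤ affine (baseLine W) z)
    (h1 : W * (z.re + W) - 36 * z.im ≤ W ^ 2 + 1296 + affine (baseLine W) z / 2)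
    (h2 : W * affine (baseLine W) z ≤ 100 * (W * (z.re + W) - 36 * z.im)) : z ∈ convexHull ℝ s := by
  have hD : 0 < W ^ 2 + 1296 := by positivity
  have hβ : affine (baseLine W) z = 36 * z.re + W * z.im + 36 * W := rfl
  set β := affine (baseLine W) z with hβdef
  have hE : 100 * (1 / ε + 1 / 2) * β ≤ W * β := mul_le_mul_of_nonneg_right hWε h0
  refine mem_of_barycentric ha hb hc (w := β / (ε * (W ^ 2 + 1296)))
    (x := (W ^ 2 + 1296 + β / 2 - (W * (z.re + W) - 36 * z.im)) / (W ^ 2 + 1296))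
    (y := (W * (z.re + W) - 36 * z.im - (1 / ε + 1 / 2) * β) / (W ^ 2 + 1296)) ?_ ?_ ?_ ?_ ?_
  · exact div_nonneg (by linarith) hD.le
  · exact div_nonneg (by linarith) hD.le
  · positivity
  · field_simp
    ring
  · apply Complex.ext
    · simp only [Complex.add_re, Complex.re_ofReal_mul, kite]
      rw [hβ]
      field_simp
      ring
    · simp only [Complex.add_im, Complex.im_ofReal_mul, kite]
      rw [hβ]
      field_simp
      ring

theorem kite_mem_space (hε : 0 < ε) (hW : 400 ≤ W) (hWε : 100 * (1 / ε + 1 / 2) ≤ W) {s : Set ℂ}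
    (ha : kite W 0 ∈ s) (hb : kite W 2 ∈ s) (hc : (⟨ε * (W / 2 + 36), -36 + ε * (W - 18)⟩ : ℂ) ∈ s) :
    (∀ i < 9, kite W i ∈ convexHull ℝ s) ∧ ∀ k < 4, k ≠ 0 → kiteCorner W k ∈ convexHull ℝ s := by
  obtain ⟨r, hr, hWr, hr0, hr1⟩ := exists_eq_inv hW
  refine ⟨fun i hi => ?_, fun k hk h0 => ?_⟩
  · refine mem_of_baseLine hε hW hWε ha hb hc ?_ ?_ ?_ <;> interval_cases i <;>
      simp [affine, baseLine, kite, div_eq_mul_inv, ← hr] <;> nlinarith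
  · refine mem_of_baseLine hε hW hWε ha hb hc ?_ ?_ ?_ <;> interval_cases k <;>
      first
      | exact absurd rfl h0
      | (simp [affine, baseLine, kiteCorner, div_eq_mul_inv, ← hr]; nlinarith)

theorem hasShape_kite (hW : 400 ≤ W) {V : Type*} {p : V → ℂ} {N : ℕ → V}
    (hp : ∀ i < 9, p (N i) = kite W i) {k : ℕ} (hk : k < 4) :
    ∃ σ : ℝ, (σ = 1 ∨ σ = -1) ∧ ∃ ε h, (Room.mk (N (kiteSide k).1) (N (kiteSide k).2.1)
      (N (kiteSide k).2.2) (kiteCorner W k)).HasShape p σ ε h := by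
  have hW0 : W ≠ 0 := by linarith
  have h0 := hp 0 (by norm_num)
  have h1 := hp 1 (by norm_num)
  have h2 := hp 2 (by norm_num)
  have h3 := hp 3 (by norm_num)
  have h4 := hp 4 (by norm_num)
  have h5 := hp 5 (by norm_num)
  have h6 := hp 6 (by norm_num)
  have h7 := hp 7 (by norm_num)
  -- Each σ says on which side of the direction from the first to the second vertex the exterior
  -- lies. The last side is listed against the counterclockwise order, in order to have the tip 0
  -- first.
  interval_cases k
  · refine ⟨-1, Or.inr rfl, 2 / W, 1 / W, by positivity, by positivity, ?_, ?_⟩ <;>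
      apply Complex.ext <;> simp [kiteSide, kiteCorner, h0, h1, h2, kite] <;> field_simp <;> ring
  · refine ⟨-1, Or.inr rfl, 1 / 12, 1 / 12, by positivity, by positivity, ?_, ?_⟩ <;>
      apply Complex.ext <;> simp [kiteSide, kiteCorner, h2, h3, h4, kite] <;> norm_num
  · refine ⟨-1, Or.inr rfl, 1 / 6, 1 / 12, by positivity, by positivity, ?_, ?_⟩ <;>
      apply Complex.ext <;> simp [kiteSide, kiteCorner, h4, h5, h6, kite] <;> norm_num
  · refine ⟨1, Or.inl rfl, 2 / W, 1 / W, by positivity, by positivity, ?_, ?_⟩ <;>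
      apply Complex.ext <;> simp [kiteSide, kiteCorner, h0, h6, h7, kite] <;> field_simp <;> ring

end

/-! ### A drawing of an extension -/

/-- A drawing `q` of an extension that continues a drawing `p`, with the new instance in the space
`r`. -/
structure FitsRoom {V V' : Type*} (G : SimpleGraph V) (G' : SimpleGraph V') (ι : V → V') (N : ℕ → V')
    (p : V → ℂ) (q : V' → ℂ) (S : Set (Room V)) (r : Room V) (W ε h : ℝ) : Prop where
  le : 400 ≤ W
  pos : 0 < ε
  large : 100 * (1 / ε + 1 / 2) ≤ W
  height_pos : 0 < h
  roomy : IsRoomy G p S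
  mem : r ∈ S
  adj : G.Adj r.tip r.big
  isExtension : IsExtension G G' ι N r.tip r.big r.apex
  tip : p r.tip = kite W 0
  big : p r.big = kite W 2
  apex : p r.apex = ⟨-W / 2 - 36 * h, -18 - h * W⟩
  corner : r.corner = ⟨ε * (W / 2 + 36), -36 + ε * (W - 18)⟩
  old : ∀ x, q (ι x) = p x
  new : ∀ i < 9, q (N i) = kite W i

/-- The spaces at the free sides after an extension. -/
def roomsAfter {V V' : Type*} (ι : V → V') (N : ℕ → V') (S : Set (Room V)) (r : Room V) (W : ℝ) :
    Set (Room V') :=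
  {t | ∃ r' ∈ S, r' ≠ r ∧ t = r'.map ι id} ∪ {t | ∃ k < 4, k ≠ 0 ∧
    t = ⟨N (kiteSide k).1, N (kiteSide k).2.1, N (kiteSide k).2.2, kiteCorner W k⟩}

/-- Choosing one direction for each edge avoids symmetric copies of all the case distinctions about
new edges. -/
theorem isRACDrawing_of_forall {V : Type*} {G : SimpleGraph V} {p : V → ℂ} {K : V → V → Prop}
    (hK : ∀ a b, G.Adj a b → K a b ∨ K b a) (hi : Function.Injective p)
    (hv : ∀ a b w, K a b → w ≠ a → w ≠ b → p w ∉ segment ℝ (p a) (p b))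
    (ha : ∀ a b c d x, K a b → K c d → s(a, b) ≠ s(c, d) → x ∈ openSegment ℝ (p a) (p b) →
      x ∈ openSegment ℝ (p c) (p d) → inner ℝ (p b - p a) (p d - p c) = 0) : IsRACDrawing G p where
  injective := hi
  vertex_not_on_edge a b w hab h1 h2 := by
    rcases hK a b hab with h | h
    · exact hv a b w h h1 h2
    · rw [segment_symm]
      exact hv b a w h h2 h1
  right_angle := by
    have key : ∀ a b c d x, K a b → (K c d ∨ K d c) → s(a, b) ≠ s(c, d) →
        x ∈ openSegment ℝ (p a) (p b) → x ∈ openSegment ℝ (p c) (p d) →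
        inner ℝ (p b - p a) (p d - p c) = 0 := by
      rintro a b c d x h (h' | h') hne hx hx'
      · exact ha a b c d x h h' hne hx hx'
      · rw [Sym2.eq_swap (a := c)] at hne
        rw [openSegment_symm ℝ (p c)] at hx'
        rw [← neg_sub (p c), inner_neg_right, ha a b d c x h h' hne hx hx', neg_zero]
    rintro a b c d x ⟨hab, hcd, hne, hx, hx'⟩
    rcases hK a b hab with h | h
    · exact key a b c d x h (hK c d hcd) hne hx hx'
    · rw [Sym2.eq_swap (a := a)] at hne
      rw [openSegment_symm ℝ (p a)] at hx
      rw [← neg_sub (p a), inner_neg_left, key b a c d x h (hK c d hcd) hne hx hx', neg_zero]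

namespace FitsRoom

variable {V V' : Type*} {G : SimpleGraph V} {G' : SimpleGraph V'} {ι : V → V'} {N : ℕ → V'}
  {p : V → ℂ} {q : V' → ℂ} {S : Set (Room V)} {r : Room V} {W ε h : ℝ}

theorem kite_mem (H : FitsRoom G G' ι N p q S r W ε h) {i : ℕ} (hi : i < 9) :
    kite W i ∈ r.space p := by
  refine (kite_mem_space H.pos H.le H.large ?_ ?_ ?_).1 i hi
  · simp [H.tip]
  · simp [H.big]
  · simp [H.corner]

theorem kiteRoom_subset (H : FitsRoom G G' ι N p q S r W ε h) {k : ℕ} (hk : k < 4) (h0 : k ≠ 0) :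
    kiteRoom W k ⊆ r.space p := by
  refine convexHull_min (kiteRoom_forall hk (fun i hi _ => H.kite_mem hi) ?_) (convex_convexHull ℝ _)
  refine (kite_mem_space H.pos H.le H.large ?_ ?_ ?_).2 k hk h0
  · simp [H.tip]
  · simp [H.big]
  · simp [H.corner]

theorem baseLine_apex (H : FitsRoom G G' ι N p q S r W ε h) : affine (baseLine W) (p r.apex) < 0 := by
  have hh := H.height_pos
  have : affine (baseLine W) (p r.apex) = -(h * (W ^ 2 + 1296)) := by
    rw [H.apex]
    simp only [affine, baseLine]
    ring
  rw [this]
  have : 0 < h * (W ^ 2 + 1296) := by positivity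
  linarith

theorem bisector_apex (H : FitsRoom G G' ι N p q S r W ε h) : affine (bisector W) (p r.apex) = 0 := by
  rw [H.apex]
  simp only [affine, bisector]
  ring

theorem baseLine_nonpos_of_mem (H : FitsRoom G G' ι N p q S r W ε h) {x : V} (hx : r.Mem x) :
    affine (baseLine W) (p x) ≤ 0 := by
  obtain ⟨h0, h2, -⟩ := baseLine_kite H.le
  rcases hx with rfl | rfl | rfl
  · rw [H.tip, h0]
  · rw [H.big, h2]
  · exact H.baseLine_apex.le

/-- Within the room, old edges stay on the old side of the base line, whereas the new instance lies
beyond it. This is what separates old from new. -/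
theorem baseLine_of_edge (H : FitsRoom G G' ι N p q S r W ε h) {x y : V} (hxy : G.Adj x y) {z : ℂ}
    (hz : z ∈ segment ℝ (p x) (p y)) (hz' : z ∈ r.space p) : affine (baseLine W) z ≤ 0 := by
  by_cases hm : r.Mem x ∧ r.Mem y
  · exact affine_nonpos_of_mem_segment (H.baseLine_nonpos_of_mem hm.1)
      (H.baseLine_nonpos_of_mem hm.2) hz
  · obtain ⟨w, hw, rfl⟩ := H.roomy.edge r H.mem x y z hxy hm hz hz'
    exact H.baseLine_nonpos_of_mem hw

theorem baseLine_kite_nonneg (hW : 400 ≤ W) {i : ℕ} (hi : i < 9) : 0 ≤ affine (baseLine W) (kite W i) := by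
  obtain ⟨h0, h2, h, -⟩ := baseLine_kite hW
  by_cases hi0 : i = 0
  · rw [hi0, h0]
  by_cases hi2 : i = 2
  · rw [hi2, h2]
  exact (h i hi hi0 hi2).le

theorem baseLine_of_kite_edge (hW : 400 ≤ W) {e : ℕ × ℕ} (he : e ∈ antiprismEdges) (hne : e ≠ (0, 2))
    {z : ℂ} (hz : z ∈ openSegment ℝ (kite W e.1) (kite W e.2)) : 0 < affine (baseLine W) z := by
  obtain ⟨a, b, ha, hb, -, hz⟩ := affine_openSegment (f := baseLine W) hz
  have hlt := lt_nine_of_mem_antiprismEdges e he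
  have h1 := baseLine_kite_nonneg hW hlt.1
  have h2 := baseLine_kite_nonneg hW hlt.2
  have key : ∀ e ∈ antiprismEdges, e ≠ (0, 2) → (e.1 ≠ 0 ∧ e.1 ≠ 2) ∨ (e.2 ≠ 0 ∧ e.2 ≠ 2) := by
    decide +kernel
  rw [hz]
  rcases key e he hne with ⟨h, h'⟩ | ⟨h, h'⟩
  · have := (baseLine_kite hW).2.2.1 e.1 hlt.1 h h'
    positivity
  · have := (baseLine_kite hW).2.2.1 e.2 hlt.2 h h'
    positivity

theorem kite_segment_subset (H : FitsRoom G G' ι N p q S r W ε h) {i j : ℕ} (hi : i < 9) (hj : j < 9) :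
    segment ℝ (kite W i) (kite W j) ⊆ r.space p :=
  (convex_convexHull ℝ _).segment_subset (H.kite_mem hi) (H.kite_mem hj)

theorem connection_subset (H : FitsRoom G G' ι N p q S r W ε h) :
    segment ℝ (p r.apex) (kite W 1) ⊆ r.space p :=
  (convex_convexHull ℝ _).segment_subset (subset_convexHull ℝ _ (by simp)) (H.kite_mem (by norm_num))

theorem bisector_of_connection (H : FitsRoom G G' ι N p q S r W ε h) {z : ℂ}
    (hz : z ∈ segment ℝ (p r.apex) (kite W 1)) : affine (bisector W) z = 0 := by
  obtain ⟨a, b, -, -, hab, rfl⟩ := hz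
  rw [affine_combination _ hab, H.bisector_apex, (bisector_kite H.le).2.2]
  ring

/-- The part of the connection beyond the old side lies in a triangle of the new instance. -/
theorem connection_mem_kiteRoom (H : FitsRoom G G' ι N p q S r W ε h) {z : ℂ}
    (hz : z ∈ segment ℝ (p r.apex) (kite W 1)) (h0 : 0 ≤ affine (baseLine W) z) : z ∈ kiteRoom W 0 := by
  have hW := H.le
  obtain ⟨a, b, ha, hb, hab, hz'⟩ := hz
  have h1 := (baseLine_kite hW).2.2.1 1 (by norm_num) (by norm_num) (by norm_num)
  have hap := H.baseLine_apex
  have hβ : affine (baseLine W) z ≤ affine (baseLine W) (kite W 1) := by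
    rw [← hz', affine_combination _ hab]
    nlinarith
  have hb0 := H.bisector_of_connection ⟨a, b, ha, hb, hab, hz'⟩
  -- The point lies on the bisector between the midpoint of the side and the vertex 1, and c is its
  -- relative height, so the two ends of the side get equal weights.
  obtain ⟨c, hc⟩ : ∃ c, c = affine (baseLine W) z / affine (baseLine W) (kite W 1) := ⟨_, rfl⟩
  have hc0 : 0 ≤ c := by rw [hc]; positivity
  have hc1 : c ≤ 1 := by rw [hc]; exact (div_le_one h1).2 hβ
  have hcz : affine (baseLine W) z = c * affine (baseLine W) (kite W 1) := by
    rw [hc, div_mul_cancel₀ _ h1.ne']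
  refine mem_of_barycentric (a := kite W 0) (b := kite W 2) (c := kite W 1) (x := (1 - c) / 2)
    (y := (1 - c) / 2) (w := c) (by simp [kiteSide]) (by simp [kiteSide]) (by simp [kiteSide])
    (by linarith) (by linarith) hc0 (by ring) ?_
  have hW0 : W ≠ 0 := by linarith
  have hD : W ^ 2 + 1296 ≠ 0 := by positivity
  have hB : affine (baseLine W) (kite W 1) * W = W ^ 2 + 1296 := by
    simp only [affine, baseLine, kite]
    field_simp
    ring
  have hx : z.re * W = 36 * c - W ^ 2 / 2 := by
    refine mul_left_cancel₀ hD ?_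
    obtain ⟨B, hBe⟩ : ∃ B, B = affine (baseLine W) (kite W 1) := ⟨_, rfl⟩
    rw [← hBe] at hcz hB
    simp only [affine, baseLine, bisector] at hcz hb0
    linear_combination 36 * W * hcz + W ^ 2 * hb0 + 36 * c * hB
  have hy : z.im = c - 18 := by
    refine mul_left_cancel₀ hD ?_
    obtain ⟨B, hBe⟩ : ∃ B, B = affine (baseLine W) (kite W 1) := ⟨_, rfl⟩
    rw [← hBe] at hcz hB
    simp only [affine, baseLine, bisector] at hcz hb0
    linear_combination W * hcz - 36 * hb0 + c * hB
  apply Complex.ext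
  · simp only [Complex.add_re, Complex.re_ofReal_mul, kite]
    field_simp
    linear_combination 2 * hx
  · simp only [Complex.add_im, Complex.im_ofReal_mul, kite]
    linear_combination hy

end FitsRoom

namespace FitsRoom

variable {V V' : Type*} {G : SimpleGraph V} {G' : SimpleGraph V'} {ι : V → V'} {N : ℕ → V'}
  {p : V → ℂ} {q : V' → ℂ} {S : Set (Room V)} {r : Room V} {W ε h : ℝ}

/-- The edges of an extension: old edges, edges of the new instance, and the connection. -/
def EdgeKind (G : SimpleGraph V) (ι : V → V') (N : ℕ → V') (u : V) (a b : V') : Prop :=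
  (∃ x y, G.Adj x y ∧ a = ι x ∧ b = ι y) ∨
    (∃ e ∈ antiprismEdges, e ≠ (0, 2) ∧ a = N e.1 ∧ b = N e.2) ∨ (a = ι u ∧ b = N 1)

/-- The side 02 of the new instance is already an edge of the old graph and is counted as an old
edge only. -/
theorem edgeKind (H : FitsRoom G G' ι N p q S r W ε h) {a b : V'} (hab : G'.Adj a b) :
    EdgeKind G ι N r.apex a b ∨ EdgeKind G ι N r.apex b a := by
  have hE := H.isExtension
  rw [hE.adj] at hab
  rcases hab with hab | ⟨e, he, hab⟩ | hab
  · exact Or.inl (Or.inl hab)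
  · by_cases h0 : e = (0, 2)
    · subst h0
      have h2 := H.adj
      rcases Sym2.eq_iff.1 hab with ⟨rfl, rfl⟩ | ⟨rfl, rfl⟩
      · exact Or.inl (Or.inl ⟨_, _, h2, hE.left, hE.right⟩)
      · exact Or.inr (Or.inl ⟨_, _, h2, hE.left, hE.right⟩)
    · rcases Sym2.eq_iff.1 hab with ⟨rfl, rfl⟩ | ⟨rfl, rfl⟩
      · exact Or.inl (Or.inr (Or.inl ⟨e, he, h0, rfl, rfl⟩))
      · exact Or.inr (Or.inr (Or.inl ⟨e, he, h0, rfl, rfl⟩))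
  · rcases Sym2.eq_iff.1 hab with ⟨rfl, rfl⟩ | ⟨rfl, rfl⟩
    · exact Or.inl (Or.inr (Or.inr ⟨rfl, rfl⟩))
    · exact Or.inr (Or.inr (Or.inr ⟨rfl, rfl⟩))

theorem old_or_new (H : FitsRoom G G' ι N p q S r W ε h) (a : V') :
    (∃ x, a = ι x) ∨ ∃ i < 9, i ≠ 0 ∧ i ≠ 2 ∧ a = N i := by
  rcases H.isExtension.cover a with ⟨x, rfl⟩ | ⟨i, hi, rfl⟩
  · exact Or.inl ⟨x, rfl⟩
  by_cases h0 : i = 0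
  · exact Or.inl ⟨_, by rw [h0, H.isExtension.left]⟩
  by_cases h2 : i = 2
  · exact Or.inl ⟨_, by rw [h2, H.isExtension.right]⟩
  exact Or.inr ⟨i, hi, h0, h2, rfl⟩

/-- An old vertex on the new side of the base line. -/
theorem eq_of_mem_space (H : FitsRoom G G' ι N p q S r W ε h) {x : V} (hx : p x ∈ r.space p)
    (h0 : 0 ≤ affine (baseLine W) (p x)) : ι x = N 0 ∨ ι x = N 2 := by
  rcases H.roomy.vertex r H.mem x hx with rfl | rfl | rfl
  · exact Or.inl H.isExtension.left.symm
  · exact Or.inr H.isExtension.right.symm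
  · exact absurd h0 (not_le.2 H.baseLine_apex)

theorem injective (H : FitsRoom G G' ι N p q S r W ε h) : Function.Injective q := by
  have key : ∀ x, ∀ i < 9, i ≠ 0 → i ≠ 2 → q (ι x) ≠ q (N i) := by
    intro x i hi h0 h2 he
    rw [H.old, H.new i hi] at he
    have hm := H.kite_mem hi
    rw [← he] at hm
    have hb := (baseLine_kite H.le).2.2.1 i hi h0 h2
    rw [← he] at hb
    rcases H.roomy.vertex r H.mem x hm with rfl | rfl | rfl
    · rw [H.tip, (baseLine_kite H.le).1] at hb
      exact lt_irrefl _ hb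
    · rw [H.big, (baseLine_kite H.le).2.1] at hb
      exact lt_irrefl _ hb
    · exact lt_asymm hb H.baseLine_apex
  intro a b hab
  rcases H.old_or_new a with ⟨x, rfl⟩ | ⟨i, hi, hi0, hi2, rfl⟩
  · rcases H.old_or_new b with ⟨y, rfl⟩ | ⟨j, hj, hj0, hj2, rfl⟩
    · rw [H.old, H.old] at hab
      rw [H.roomy.drawing.injective hab]
    · exact absurd hab (key x j hj hj0 hj2)
  · rcases H.old_or_new b with ⟨y, rfl⟩ | ⟨j, hj, hj0, hj2, rfl⟩
    · exact absurd hab.symm (key y i hi hi0 hi2)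
    · rw [H.new i hi, H.new j hj] at hab
      rw [kite_injOn H.le hi hj hab]

theorem not_mem_edge (H : FitsRoom G G' ι N p q S r W ε h) {a b w : V'}
    (hab : EdgeKind G ι N r.apex a b) (hwa : w ≠ a) (hwb : w ≠ b) : q w ∉ segment ℝ (q a) (q b) := by
  have hW := H.le
  intro hw
  rcases hab with ⟨x, y, hxy, rfl, rfl⟩ | ⟨e, he, hne, rfl, rfl⟩ | ⟨rfl, rfl⟩
  · rw [H.old, H.old] at hw
    rcases H.old_or_new w with ⟨w, rfl⟩ | ⟨i, hi, hi0, hi2, rfl⟩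
    · rw [H.old] at hw
      exact H.roomy.drawing.vertex_not_on_edge x y w hxy (fun e => hwa (by rw [e]))
        (fun e => hwb (by rw [e])) hw
    · rw [H.new i hi] at hw
      have h1 := H.baseLine_of_edge hxy hw (H.kite_mem hi)
      exact absurd ((baseLine_kite hW).2.2.1 i hi hi0 hi2) (not_lt.2 h1)
  · have hlt := lt_nine_of_mem_antiprismEdges e he
    have main : ∀ i < 9, w = N i → False := by
      rintro i hi rfl
      rw [H.new i hi, H.new _ hlt.1, H.new _ hlt.2] at hw
      exact kite_not_on_edge hW he hi (fun e => hwa (by rw [e])) (fun e => hwb (by rw [e])) hw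
    rcases H.old_or_new w with ⟨w, rfl⟩ | ⟨i, hi, -, -, hw⟩
    · rw [H.new _ hlt.1, H.new _ hlt.2, H.old] at hw
      have h0 : 0 ≤ affine (baseLine W) (p w) := by
        obtain ⟨a, b, ha, hb, hab, h⟩ := hw
        rw [← h, affine_combination _ hab]
        have h1 := baseLine_kite_nonneg hW hlt.1
        have h2 := baseLine_kite_nonneg hW hlt.2
        positivity
      rcases H.eq_of_mem_space (H.kite_segment_subset hlt.1 hlt.2 hw) h0 with h | h
      · exact main 0 (by norm_num) h
      · exact main 2 (by norm_num) h
    · exact main i hi hw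
  · rw [H.old, H.new 1 (by norm_num)] at hw
    have hm := H.connection_subset hw
    have hb := H.bisector_of_connection hw
    rcases H.old_or_new w with ⟨w, rfl⟩ | ⟨i, hi, hi0, hi2, rfl⟩
    · rw [H.old] at hm hb
      rcases H.roomy.vertex r H.mem w hm with rfl | rfl | rfl
      · rw [H.tip] at hb
        exact (bisector_kite hW).1.ne hb
      · rw [H.big] at hb
        exact (bisector_kite hW).2.1.ne' hb
      · exact hwa rfl
    · rw [H.new i hi] at hw hb
      have h1 := onSide_of_mem hW (by norm_num) hi
        (H.connection_mem_kiteRoom hw (baseLine_kite_nonneg hW hi))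
      simp only [onSide, kiteSide, Bool.or_eq_true, Nat.beq_eq, hi0, hi2, false_or] at h1
      exact hwb (by rw [h1])

theorem inner_connection (H : FitsRoom G G' ι N p q S r W ε h) :
    inner ℝ (p r.big - p r.tip) (kite W 1 - p r.apex) = 0 := by
  have hW0 : W ≠ 0 := by linarith [H.le]
  rw [inner_eq_re, H.big, H.tip, H.apex]
  simp only [kite, Complex.sub_re, Complex.sub_im]
  field_simp
  ring

theorem bisector_ne_zero {f : ℝ × ℝ × ℝ} {x y z : ℂ} (hx : affine f x ≠ 0) (hy : affine f y = 0)
    (hz : z ∈ openSegment ℝ x y) : affine f z ≠ 0 := by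
  obtain ⟨a, b, ha, hb, -, hz⟩ := affine_openSegment (f := f) hz
  rw [hz, hy, mul_zero, add_zero]
  exact mul_ne_zero ha.ne' hx

theorem ne_connection_end (H : FitsRoom G G' ι N p q S r W ε h) {z : ℂ}
    (hz : z ∈ openSegment ℝ (p r.apex) (kite W 1)) : z ≠ p r.apex ∧ z ≠ kite W 1 := by
  have h1 : p r.apex ≠ kite W 1 := by
    intro e
    have h1 := H.baseLine_apex
    rw [e] at h1
    exact absurd (baseLine_kite_nonneg H.le (by norm_num)) (not_le.2 h1)
  refine ⟨?_, ?_⟩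
  · rintro rfl
    exact not_mem_openSegment_left h1 hz
  · rintro rfl
    rw [openSegment_symm] at hz
    exact not_mem_openSegment_left h1.symm hz

/-- The connection runs along the perpendicular bisector of the side. The two edges from the apex
meet the bisector only in the apex, and other old edges meet the room only in its vertices, so only
the side itself is crossed. -/
theorem inner_old_connection (H : FitsRoom G G' ι N p q S r W ε h) {x y : V} (hxy : G.Adj x y) {z : ℂ}
    (hz : z ∈ openSegment ℝ (p x) (p y)) (hz' : z ∈ openSegment ℝ (p r.apex) (kite W 1)) :
    inner ℝ (p y - p x) (kite W 1 - p r.apex) = 0 := by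
  have hW := H.le
  have hs := openSegment_subset_segment ℝ _ _ hz'
  have hb := H.bisector_of_connection hs
  have ht : affine (bisector W) (p r.tip) ≠ 0 := by rw [H.tip]; exact (bisector_kite hW).1.ne
  have hg : affine (bisector W) (p r.big) ≠ 0 := by rw [H.big]; exact (bisector_kite hW).2.1.ne'
  have ha := H.bisector_apex
  by_cases hm : r.Mem x ∧ r.Mem y
  · obtain ⟨hx, hy⟩ := hm
    rcases hx with rfl | rfl | rfl <;> rcases hy with rfl | rfl | rfl
    · exact (G.irrefl hxy).elim
    · exact H.inner_connection
    · exact (bisector_ne_zero ht ha hz hb).elim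
    · rw [← neg_sub, inner_neg_left, H.inner_connection, neg_zero]
    · exact (G.irrefl hxy).elim
    · exact (bisector_ne_zero hg ha hz hb).elim
    · rw [openSegment_symm] at hz
      exact (bisector_ne_zero ht ha hz hb).elim
    · rw [openSegment_symm] at hz
      exact (bisector_ne_zero hg ha hz hb).elim
    · exact (G.irrefl hxy).elim
  · obtain ⟨w, hw, rfl⟩ := H.roomy.edge r H.mem x y z hxy hm (openSegment_subset_segment ℝ _ _ hz)
      (H.connection_subset hs)
    rcases hw with rfl | rfl | rfl
    · exact (ht hb).elim
    · exact (hg hb).elim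
    · exact ((H.ne_connection_end hz').1 rfl).elim

theorem not_cross_old_new (H : FitsRoom G G' ι N p q S r W ε h) {x y : V} (hxy : G.Adj x y)
    {e : ℕ × ℕ} (he : e ∈ antiprismEdges) (hne : e ≠ (0, 2)) {z : ℂ}
    (hz : z ∈ openSegment ℝ (p x) (p y)) (hz' : z ∈ openSegment ℝ (kite W e.1) (kite W e.2)) : False := by
  have hlt := lt_nine_of_mem_antiprismEdges e he
  refine absurd (baseLine_of_kite_edge H.le he hne hz') (not_lt.2 ?_)
  exact H.baseLine_of_edge hxy (openSegment_subset_segment ℝ _ _ hz)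
    (H.kite_segment_subset hlt.1 hlt.2 (openSegment_subset_segment ℝ _ _ hz'))

/-- Beyond the base line the connection lies in the triangle 0 1 2. Edges that leave this triangle
meet it only in vertices, and the edges 01 and 12 meet the bisector only in 1. -/
theorem not_cross_new_connection (H : FitsRoom G G' ι N p q S r W ε h)
    {e : ℕ × ℕ} (he : e ∈ antiprismEdges) (hne : e ≠ (0, 2)) {z : ℂ}
    (hz : z ∈ openSegment ℝ (kite W e.1) (kite W e.2))
    (hz' : z ∈ openSegment ℝ (p r.apex) (kite W 1)) : False := by
  have hW := H.le
  have hlt := lt_nine_of_mem_antiprismEdges e he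
  have hs := openSegment_subset_segment ℝ _ _ hz'
  have hb := H.bisector_of_connection hs
  have hm := H.connection_mem_kiteRoom hs (baseLine_of_kite_edge hW he hne hz).le
  have key : ∀ e ∈ antiprismEdges, e.1 ≠ e.2 := by decide
  have hends : kite W e.1 ≠ kite W e.2 := fun h => key e he (kite_injOn hW hlt.1 hlt.2 h)
  by_cases hk : (onSide 0 e.1 && onSide 0 e.2) = false
  · obtain ⟨x, -, -, rfl | rfl, rfl⟩ :=
      kite_edge hW (by norm_num) he hk hm (openSegment_subset_segment ℝ _ _ hz)
    · exact not_mem_openSegment_left hends hz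
    · rw [openSegment_symm] at hz
      exact not_mem_openSegment_left hends.symm hz
  · have key : ∀ e ∈ antiprismEdges, e ≠ (0, 2) → (onSide 0 e.1 && onSide 0 e.2) = true →
        e = (0, 1) ∨ e = (1, 2) := by decide +kernel
    rcases key e he hne (by simpa using hk) with rfl | rfl
    · exact bisector_ne_zero (bisector_kite hW).1.ne (bisector_kite hW).2.2 hz hb
    · rw [openSegment_symm] at hz
      exact bisector_ne_zero (bisector_kite hW).2.1.ne' (bisector_kite hW).2.2 hz hb

theorem inner_eq_zero (H : FitsRoom G G' ι N p q S r W ε h) {a b c d : V'} {z : ℂ}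
    (hab : EdgeKind G ι N r.apex a b) (hcd : EdgeKind G ι N r.apex c d) (hne : s(a, b) ≠ s(c, d))
    (hz : z ∈ openSegment ℝ (q a) (q b)) (hz' : z ∈ openSegment ℝ (q c) (q d)) :
    inner ℝ (q b - q a) (q d - q c) = 0 := by
  have hW := H.le
  have h1 := H.new 1 (by norm_num)
  rcases hab with ⟨x, y, hxy, rfl, rfl⟩ | ⟨e, he, h02, rfl, rfl⟩ | ⟨rfl, rfl⟩
  · rw [H.old, H.old] at hz ⊢
    rcases hcd with ⟨x', y', hxy', rfl, rfl⟩ | ⟨e', he', h02', rfl, rfl⟩ | ⟨rfl, rfl⟩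
    · rw [H.old, H.old] at hz' ⊢
      exact H.roomy.drawing.right_angle x y x' y' z ⟨hxy, hxy', fun e => hne (by
        have := congrArg (Sym2.map ι) e
        simpa using this), hz, hz'⟩
    · have hlt := lt_nine_of_mem_antiprismEdges e' he'
      rw [H.new _ hlt.1, H.new _ hlt.2] at hz'
      exact (H.not_cross_old_new hxy he' h02' hz hz').elim
    · rw [H.old, h1] at hz' ⊢
      exact H.inner_old_connection hxy hz hz'
  · have hlt := lt_nine_of_mem_antiprismEdges e he
    rw [H.new _ hlt.1, H.new _ hlt.2] at hz ⊢
    rcases hcd with ⟨x', y', hxy', rfl, rfl⟩ | ⟨e', he', h02', rfl, rfl⟩ | ⟨rfl, rfl⟩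
    · rw [H.old, H.old] at hz'
      exact (H.not_cross_old_new hxy' he h02 hz' hz).elim
    · have hlt' := lt_nine_of_mem_antiprismEdges e' he'
      rw [H.new _ hlt'.1, H.new _ hlt'.2] at hz' ⊢
      exact kite_right_angle hW he he' (fun e => hne (by
        have := congrArg (Sym2.map N) e
        simpa using this)) hz hz'
    · rw [H.old, h1] at hz'
      exact (H.not_cross_new_connection he h02 hz hz').elim
  · rw [H.old, h1] at hz ⊢
    rcases hcd with ⟨x', y', hxy', rfl, rfl⟩ | ⟨e', he', h02', rfl, rfl⟩ | ⟨rfl, rfl⟩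
    · rw [H.old, H.old] at hz' ⊢
      rw [real_inner_comm]
      exact H.inner_old_connection hxy' hz' hz
    · have hlt := lt_nine_of_mem_antiprismEdges e' he'
      rw [H.new _ hlt.1, H.new _ hlt.2] at hz'
      exact (H.not_cross_new_connection he' h02' hz' hz).elim
    · exact (hne rfl).elim

theorem isRACDrawing (H : FitsRoom G G' ι N p q S r W ε h) : IsRACDrawing G' q :=
  isRACDrawing_of_forall (fun _ _ => H.edgeKind) H.injective (fun _ _ _ => H.not_mem_edge)
    fun _ _ _ _ _ h h' hne hz hz' => H.inner_eq_zero h h' hne hz hz'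

end FitsRoom

theorem Room.space_map_of_forall {V V' : Type*} {ι : V → V'} {p : V → ℂ} {q : V' → ℂ}
    (hq : ∀ x, q (ι x) = p x) (r : Room V) : (r.map ι id).space q = r.space p := by
  simp only [Room.space, Room.map, hq, id]

theorem Room.mem_map {V V' : Type*} {ι : V → V'} {r : Room V} {x : V} (hx : r.Mem x) (g : ℂ → ℂ) :
    (r.map ι g).Mem (ι x) := by
  rcases hx with rfl | rfl | rfl
  · exact Or.inl rfl
  · exact Or.inr (Or.inl rfl)
  · exact Or.inr (Or.inr rfl)

namespace FitsRoom

variable {V V' : Type*} {G : SimpleGraph V} {G' : SimpleGraph V'} {ι : V → V'} {N : ℕ → V'}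
  {p : V → ℂ} {q : V' → ℂ} {S : Set (Room V)} {r : Room V} {W ε h : ℝ}

theorem space_new (H : FitsRoom G G' ι N p q S r W ε h) {k : ℕ} (hk : k < 4) :
    (Room.mk (N (kiteSide k).1) (N (kiteSide k).2.1) (N (kiteSide k).2.2) (kiteCorner W k)).space q =
      kiteRoom W k := by
  have hs : (kiteSide k).1 < 9 ∧ (kiteSide k).2.1 < 9 ∧ (kiteSide k).2.2 < 9 := by
    interval_cases k <;> decide
  simp only [Room.space, kiteRoom, H.new _ hs.1, H.new _ hs.2.1, H.new _ hs.2.2]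

theorem mem_new {k i : ℕ} (hs : onSide k i = true) {c : ℂ} :
    (Room.mk (N (kiteSide k).1) (N (kiteSide k).2.1) (N (kiteSide k).2.2) c).Mem (N i) := by
  simp only [onSide, Bool.or_eq_true, Nat.beq_eq] at hs
  rcases hs with (rfl | rfl) | rfl
  · exact Or.inl rfl
  · exact Or.inr (Or.inl rfl)
  · exact Or.inr (Or.inr rfl)

/-- The spaces at the new sides touch the base line only in its ends. -/
theorem exists_of_baseLine_nonpos (hW : 400 ≤ W) {k : ℕ} (hk : k < 4) (hk0 : k ≠ 0) {z : ℂ}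
    (hz : z ∈ kiteRoom W k) (h0 : affine (baseLine W) z ≤ 0) :
    ∃ x < 9, onSide k x = true ∧ z = kite W x := by
  obtain ⟨h1, h2, h3, h4⟩ := baseLine_kite hW
  have key : k < 4 → k ≠ 0 → (∃ x < 9, (x = 0 ∨ x = 2) ∧ onSide k x = true ∧
      ∀ i < 9, onSide k i = true → i ≠ x → i ≠ 0 ∧ i ≠ 2) ∨
      ∀ i < 9, onSide k i = true → i ≠ 0 ∧ i ≠ 2 := by
    intro hk hk0
    interval_cases k
    · exact absurd rfl hk0
    · exact Or.inl ⟨2, by decide +kernel⟩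
    · exact Or.inr (by decide +kernel)
    · exact Or.inl ⟨0, by decide +kernel⟩
  rcases key hk hk0 with ⟨x, hx, hx0, hs, h⟩ | h
  · refine ⟨x, hx, hs, eq_of_mem_kiteRoom hk (f := baseLine W) ?_ ?_ (h4 k hk hk0) hz h0⟩
    · rcases hx0 with rfl | rfl
      · exact h1
      · exact h2
    · exact fun i hi hs hix => h3 i hi (h i hi hs hix).1 (h i hi hs hix).2
  · exact absurd h0 (not_le.2 (affine_pos_of_mem_convexHull (kiteRoom_forall hk
      (fun i hi hs => h3 i hi (h i hi hs).1 (h i hi hs).2) (h4 k hk hk0)) hz))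

/-- The edges that are not old lie in the space that contains the new instance. -/
theorem segment_subset (H : FitsRoom G G' ι N p q S r W ε h) {a b : V'}
    (hab : (∃ e ∈ antiprismEdges, e ≠ (0, 2) ∧ a = N e.1 ∧ b = N e.2) ∨ (a = ι r.apex ∧ b = N 1)) :
    segment ℝ (q a) (q b) ⊆ r.space p := by
  rcases hab with ⟨e, he, -, rfl, rfl⟩ | ⟨rfl, rfl⟩
  · have hlt := lt_nine_of_mem_antiprismEdges e he
    rw [H.new _ hlt.1, H.new _ hlt.2]
    exact H.kite_segment_subset hlt.1 hlt.2
  · rw [H.old, H.new 1 (by norm_num)]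
    exact H.connection_subset

theorem edge_old (H : FitsRoom G G' ι N p q S r W ε h) {r' : Room V} (hr' : r' ∈ S) (hne : r' ≠ r)
    {a b : V'} {z : ℂ} (hab : EdgeKind G ι N r.apex a b)
    (hm : ¬((r'.map ι id).Mem a ∧ (r'.map ι id).Mem b)) (hz : z ∈ segment ℝ (q a) (q b))
    (hz' : z ∈ r'.space p) : ∃ w, (r'.map ι id).Mem w ∧ z = q w := by
  rcases hab with ⟨x, y, hxy, rfl, rfl⟩ | hab
  · rw [H.old, H.old] at hz
    obtain ⟨w, hw, rfl⟩ := H.roomy.edge r' hr' x y z hxy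
      (fun hm' => hm ⟨Room.mem_map hm'.1 _, Room.mem_map hm'.2 _⟩) hz hz'
    exact ⟨ι w, Room.mem_map hw _, (H.old w).symm⟩
  · obtain ⟨w, hw, rfl⟩ := H.roomy.disjoint r' hr' r H.mem hne z hz' (H.segment_subset hab hz)
    exact ⟨ι w, Room.mem_map hw _, (H.old w).symm⟩

theorem edge_new (H : FitsRoom G G' ι N p q S r W ε h) {k : ℕ} (hk : k < 4) (hk0 : k ≠ 0) {c : ℂ}
    {a b : V'} {z : ℂ} (hab : EdgeKind G ι N r.apex a b)
    (hm : ¬((Room.mk (N (kiteSide k).1) (N (kiteSide k).2.1) (N (kiteSide k).2.2) c).Mem a ∧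
      (Room.mk (N (kiteSide k).1) (N (kiteSide k).2.1) (N (kiteSide k).2.2) c).Mem b))
    (hz : z ∈ segment ℝ (q a) (q b)) (hz' : z ∈ kiteRoom W k) :
    ∃ x < 9, onSide k x = true ∧ z = kite W x := by
  have hW := H.le
  rcases hab with ⟨x, y, hxy, rfl, rfl⟩ | ⟨e, he, -, rfl, rfl⟩ | ⟨rfl, rfl⟩
  · rw [H.old, H.old] at hz
    exact exists_of_baseLine_nonpos hW hk hk0 hz'
      (H.baseLine_of_edge hxy hz (H.kiteRoom_subset hk hk0 hz'))
  · have hlt := lt_nine_of_mem_antiprismEdges e he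
    rw [H.new _ hlt.1, H.new _ hlt.2] at hz
    obtain ⟨x, hx, hs, -, rfl⟩ := kite_edge hW hk he (by
      by_contra hcon
      simp only [Bool.not_eq_false, Bool.and_eq_true] at hcon
      exact hm ⟨mem_new hcon.1, mem_new hcon.2⟩) hz' hz
    exact ⟨x, hx, hs, rfl⟩
  · rw [H.old, H.new 1 (by norm_num)] at hz
    rcases le_total (affine (baseLine W) z) 0 with h0 | h0
    · exact exists_of_baseLine_nonpos hW hk hk0 hz' h0
    · obtain ⟨x, hx, hs, -, rfl⟩ :=
        kiteRoom_inter hW hk (by norm_num) hk0 hz' (H.connection_mem_kiteRoom hz h0)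
      exact ⟨x, hx, hs, rfl⟩

theorem baseLine_nonneg_of_mem (hW : 400 ≤ W) {k : ℕ} (hk : k < 4) (hk0 : k ≠ 0) {z : ℂ}
    (hz : z ∈ kiteRoom W k) : 0 ≤ affine (baseLine W) z := by
  by_contra h
  obtain ⟨x, hx, -, rfl⟩ := exists_of_baseLine_nonpos hW hk hk0 hz (not_le.1 h).le
  exact h (baseLine_kite_nonneg hW hx)

/-- All new edges and new rooms lie in the room r, which touches the other old rooms only in
vertices. Between new rooms and old edges the base line separates, and among new rooms the lines of
the kite do. -/
theorem isRoomy (H : FitsRoom G G' ι N p q S r W ε h) : IsRoomy G' q (roomsAfter ι N S r W) := by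
  have hW := H.le
  have hsp := fun r' : Room V => r'.space_map_of_forall H.old
  refine ⟨H.isRACDrawing, ?_, ?_, ?_, ?_⟩
  · rintro _ (⟨r', hr', -, rfl⟩ | ⟨k, hk, -, rfl⟩)
    · obtain ⟨σ, hσ, ε, η, hs⟩ := H.roomy.shape r' hr'
      refine ⟨σ, hσ, ε, η, hs.pos, hs.height_pos, ?_, ?_⟩
      · simpa only [Room.map, H.old] using hs.apex
      · simpa only [Room.map, H.old, id] using hs.corner
    · exact hasShape_kite hW H.new hk
  · rintro _ (⟨r', hr', hne, rfl⟩ | ⟨k, hk, hk0, rfl⟩) a b z hab hm hz hz'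
    · rw [hsp] at hz'
      rcases H.edgeKind hab with h | h
      · exact H.edge_old hr' hne h hm hz hz'
      · rw [segment_symm] at hz
        exact H.edge_old hr' hne h (fun h => hm h.symm) hz hz'
    · rw [H.space_new hk] at hz'
      have : ∃ x < 9, onSide k x = true ∧ z = kite W x := by
        rcases H.edgeKind hab with h | h
        · exact H.edge_new hk hk0 h hm hz hz'
        · rw [segment_symm] at hz
          exact H.edge_new hk hk0 h (fun h => hm h.symm) hz hz'
      obtain ⟨x, hx, hs, rfl⟩ := this
      exact ⟨N x, mem_new hs, (H.new x hx).symm⟩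
  · rintro _ (⟨r', hr', hne, rfl⟩ | ⟨k, hk, hk0, rfl⟩) a hz
    · rw [hsp] at hz
      rcases H.old_or_new a with ⟨x, rfl⟩ | ⟨i, hi, -, -, rfl⟩
      · rw [H.old] at hz
        exact Room.mem_map (H.roomy.vertex r' hr' x hz) _
      · rw [H.new i hi] at hz
        obtain ⟨w, hw, he⟩ := H.roomy.disjoint r' hr' r H.mem hne _ hz (H.kite_mem hi)
        rw [← H.new i hi, ← H.old] at he
        rw [H.injective he]
        exact Room.mem_map hw _
    · rw [H.space_new hk] at hz
      have main : ∀ i < 9, a = N i → (Room.mk (N (kiteSide k).1) (N (kiteSide k).2.1)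
          (N (kiteSide k).2.2) (kiteCorner W k)).Mem a := by
        rintro i hi rfl
        rw [H.new i hi] at hz
        exact mem_new (onSide_of_mem hW hk hi hz)
      rcases H.old_or_new a with ⟨x, rfl⟩ | ⟨i, hi, -, -, ha⟩
      · rw [H.old] at hz
        rcases H.eq_of_mem_space (H.kiteRoom_subset hk hk0 hz)
          (baseLine_nonneg_of_mem hW hk hk0 hz) with h | h
        · exact main 0 (by norm_num) h
        · exact main 2 (by norm_num) h
      · exact main i hi ha
  · rintro _ (⟨r', hr', hne, rfl⟩ | ⟨k, hk, hk0, rfl⟩) _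
      (⟨r'', hr'', hne', rfl⟩ | ⟨l, hl, hl0, rfl⟩) hrr z hz hz'
    · rw [hsp] at hz hz'
      obtain ⟨w, hw, rfl⟩ := H.roomy.disjoint r' hr' r'' hr'' (fun e => hrr (by rw [e])) z hz hz'
      exact ⟨ι w, Room.mem_map hw _, (H.old w).symm⟩
    · rw [hsp] at hz
      rw [H.space_new hl] at hz'
      obtain ⟨w, hw, rfl⟩ := H.roomy.disjoint r' hr' r H.mem hne z hz (H.kiteRoom_subset hl hl0 hz')
      exact ⟨ι w, Room.mem_map hw _, (H.old w).symm⟩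
    · rw [hsp] at hz'
      rw [H.space_new hk] at hz
      obtain ⟨w, hw, rfl⟩ := H.roomy.disjoint r H.mem r'' hr'' hne'.symm z
        (H.kiteRoom_subset hk hk0 hz) hz'
      obtain ⟨x, hx, hs, he⟩ := exists_of_baseLine_nonpos hW hk hk0 hz (H.baseLine_nonpos_of_mem hw)
      exact ⟨N x, mem_new hs, by rw [he, H.new x hx]⟩
    · rw [H.space_new hk] at hz
      rw [H.space_new hl] at hz'
      obtain ⟨x, hx, hs, -, rfl⟩ := kiteRoom_inter hW hk hl (fun e => hrr (by rw [e])) hz hz'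
      exact ⟨N x, mem_new hs, (H.new x hx).symm⟩

end FitsRoom

section

variable {V V' : Type*} {G : SimpleGraph V} {G' : SimpleGraph V'} {ι : V → V'} {N : ℕ → V'}
  {p : V → ℂ} {S : Set (Room V)} {r : Room V}

/-- A similarity moves the side to the segment between the vertices 0 and 2 of a kite that is long
enough for the room. -/
theorem exists_extend (hp : IsRoomy G p S) (hr : r ∈ S) (hadj : G.Adj r.tip r.big)
    (hE : IsExtension G G' ι N r.tip r.big r.apex) : ∃ q S', IsRoomy G' q S' ∧
    (∀ r' ∈ S, (r'.tip, r'.big, r'.apex) ≠ (r.tip, r.big, r.apex) →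
      ∃ m, ⟨ι r'.tip, ι r'.big, ι r'.apex, m⟩ ∈ S') ∧
    ∀ k < 4, k ≠ 0 → ∃ m, ⟨N (kiteSide k).1, N (kiteSide k).2.1, N (kiteSide k).2.2, m⟩ ∈ S' := by
  obtain ⟨σ, hσ, ε, η, hs⟩ := hp.shape r hr
  obtain ⟨W, hW, hWε⟩ : ∃ W : ℝ, 400 ≤ W ∧ 100 * (1 / ε + 1 / 2) ≤ W :=
    ⟨_, le_max_left _ _, le_max_right _ _⟩
  have hkite : kite W 0 ≠ kite W 2 := fun h =>
    absurd (kite_injOn hW (show 0 < 9 by norm_num) (show 2 < 9 by norm_num) h) (by norm_num)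
  -- The similarity preserves or reverses orientation according to σ, so that the transformed room
  -- lies on the side with sign σ * σ = 1, where the kite is.
  obtain ⟨g, hg, htip, hbig⟩ := exists_isSimilarity
    (fun h => hadj.ne (hp.drawing.injective h)) hkite hσ
  have hσσ : σ * σ = 1 := by rcases hσ with rfl | rfl <;> norm_num
  have hs' := hg.hasShape hs
  rw [hσσ] at hs'
  have hq : ∀ a, ∃ z, (∀ x, a = ι x → z = g (p x)) ∧ ∀ i < 9, a = N i → z = kite W i := by
    intro a
    have hboth : ∀ i < 9, ∀ x, N i = ι x → g (p x) = kite W i := by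
      intro i hi x h
      rcases hE.eq_of_map_eq hi h with ⟨rfl, rfl⟩ | ⟨rfl, rfl⟩
      · exact htip
      · exact hbig
    rcases hE.cover a with ⟨x, rfl⟩ | ⟨i, hi, rfl⟩
    · exact ⟨g (p x), fun y h => by rw [hE.injective h], fun i hi h => hboth i hi x h.symm⟩
    · exact ⟨kite W i, fun y h => (hboth i hi y h).symm, fun j hj h => by rw [hE.injOn hi hj h]⟩
  choose q hq1 hq2 using hq
  have H : FitsRoom G G' ι N (g ∘ p) q (Room.map id g '' S) (r.map id g) W ε η :=
    { le := hW
      pos := hs.pos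
      large := hWε
      height_pos := hs.height_pos
      roomy := hg.isRoomy hσ hp
      mem := ⟨r, hr, rfl⟩
      adj := hadj
      isExtension := hE
      tip := htip
      big := hbig
      apex := by
        have h := hs'.apex
        simp only [Room.map, id, Function.comp, htip, hbig] at h
        simp only [Room.map, id, Function.comp]
        rw [h]
        apply Complex.ext <;> simp [kite] <;> ring
      corner := by
        have h := hs'.corner
        simp only [Room.map, id, Function.comp, htip, hbig] at h
        simp only [Room.map, id]
        rw [h]
        apply Complex.ext <;> simp [kite] <;> ring
      old := fun x => hq1 _ x rfl
      new := fun i hi => hq2 _ i hi rfl }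
  refine ⟨q, _, H.isRoomy, fun r' hr' hne => ⟨g r'.corner, Or.inl ⟨r'.map id g, ⟨r', hr', rfl⟩, ?_, rfl⟩⟩,
    fun k hk hk0 => ⟨_, Or.inr ⟨k, hk, hk0, rfl⟩⟩⟩
  intro h
  obtain ⟨h1, h2, h3, -⟩ := Room.mk.inj h
  exact hne (Prod.ext h1 (Prod.ext h2 h3))

/-- A single instance. -/
theorem exists_isRoomy_of_isAntiprism {N : ℕ → V} (hinj : Set.InjOn N {i | i < 9})
    (hcover : ∀ a, ∃ i < 9, a = N i)
    (hadj : ∀ a b, G.Adj a b → ∃ e ∈ antiprismEdges, s(a, b) = s(N e.1, N e.2)) :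
    ∃ q S, IsRoomy G q S ∧
      ∀ k < 4, ∃ m, ⟨N (kiteSide k).1, N (kiteSide k).2.1, N (kiteSide k).2.2, m⟩ ∈ S := by
  have hW : (400 : ℝ) ≤ 400 := le_rfl
  choose f hf hN using hcover
  obtain ⟨q, rfl⟩ : ∃ q, q = fun a => kite 400 (f a) := ⟨_, rfl⟩
  have hq : ∀ i < 9, kite 400 (f (N i)) = kite 400 i := fun i hi => by
    rw [← hinj hi (hf _) (hN (N i))]
  have hK : ∀ a b, G.Adj a b → (∃ e ∈ antiprismEdges, a = N e.1 ∧ b = N e.2) ∨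
      ∃ e ∈ antiprismEdges, b = N e.1 ∧ a = N e.2 := by
    intro a b hab
    obtain ⟨e, he, h⟩ := hadj a b hab
    rcases Sym2.eq_iff.1 h with ⟨h1, h2⟩ | ⟨h1, h2⟩
    · exact Or.inl ⟨e, he, h1, h2⟩
    · exact Or.inr ⟨e, he, h2, h1⟩
  have hspace : ∀ k < 4, (Room.mk (N (kiteSide k).1) (N (kiteSide k).2.1) (N (kiteSide k).2.2)
      (kiteCorner 400 k)).space (fun a => kite 400 (f a)) = kiteRoom 400 k := by
    intro k hk
    have hs : (kiteSide k).1 < 9 ∧ (kiteSide k).2.1 < 9 ∧ (kiteSide k).2.2 < 9 := by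
      interval_cases k <;> decide
    simp only [Room.space, kiteRoom, hq _ hs.1, hq _ hs.2.1, hq _ hs.2.2]
  refine ⟨fun a => kite 400 (f a), {t | ∃ k < 4, t = ⟨N (kiteSide k).1, N (kiteSide k).2.1,
    N (kiteSide k).2.2, kiteCorner 400 k⟩}, ⟨?_, ?_, ?_, ?_, ?_⟩, fun k hk => ⟨_, k, hk, rfl⟩⟩
  · refine isRACDrawing_of_forall (K := fun a b => ∃ e ∈ antiprismEdges, a = N e.1 ∧ b = N e.2) hK
      ?_ ?_ ?_
    · intro a b h
      rw [hN a, hN b, kite_injOn hW (hf a) (hf b) h]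
    · rintro _ _ w ⟨e, he, rfl, rfl⟩ h1 h2 hw
      have hlt := lt_nine_of_mem_antiprismEdges e he
      rw [hq _ hlt.1, hq _ hlt.2] at hw
      exact kite_not_on_edge hW he (hf w) (fun h => h1 (by rw [hN w, h]))
        (fun h => h2 (by rw [hN w, h])) hw
    · rintro _ _ _ _ z ⟨e, he, rfl, rfl⟩ ⟨e', he', rfl, rfl⟩ hne hz hz'
      have hlt := lt_nine_of_mem_antiprismEdges e he
      have hlt' := lt_nine_of_mem_antiprismEdges e' he'
      rw [hq _ hlt.1, hq _ hlt.2] at hz ⊢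
      rw [hq _ hlt'.1, hq _ hlt'.2] at hz' ⊢
      exact kite_right_angle hW he he' (fun e => hne (by
        have := congrArg (Sym2.map N) e
        simpa using this)) hz hz'
  · rintro _ ⟨k, hk, rfl⟩
    exact hasShape_kite (p := fun a => kite 400 (f a)) hW hq hk
  · rintro _ ⟨k, hk, rfl⟩ a b z hab hm hz hz'
    rw [hspace k hk] at hz'
    have main : ∃ x < 9, onSide k x = true ∧ z = kite 400 x := by
      have aux : ∀ e ∈ antiprismEdges, ¬((Room.mk (N (kiteSide k).1) (N (kiteSide k).2.1)
          (N (kiteSide k).2.2) (kiteCorner 400 k)).Mem (N e.1) ∧ (Room.mk (N (kiteSide k).1)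
          (N (kiteSide k).2.1) (N (kiteSide k).2.2) (kiteCorner 400 k)).Mem (N e.2)) →
          z ∈ segment ℝ (kite 400 (f (N e.1))) (kite 400 (f (N e.2))) →
          ∃ x < 9, onSide k x = true ∧ z = kite 400 x := by
        intro e he hm hz
        have hlt := lt_nine_of_mem_antiprismEdges e he
        rw [hq _ hlt.1, hq _ hlt.2] at hz
        obtain ⟨x, hx, hs, -, rfl⟩ := kite_edge hW hk he (by
          by_contra hcon
          simp only [Bool.not_eq_false, Bool.and_eq_true] at hcon
          exact hm ⟨FitsRoom.mem_new hcon.1, FitsRoom.mem_new hcon.2⟩) hz' hz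
        exact ⟨x, hx, hs, rfl⟩
      rcases hK a b hab with ⟨e, he, rfl, rfl⟩ | ⟨e, he, rfl, rfl⟩
      · exact aux e he hm hz
      · rw [segment_symm] at hz
        exact aux e he (fun h => hm h.symm) hz
    obtain ⟨x, hx, hs, rfl⟩ := main
    exact ⟨N x, FitsRoom.mem_new hs, (hq x hx).symm⟩
  · rintro _ ⟨k, hk, rfl⟩ a hz
    rw [hspace k hk] at hz
    rw [hN a]
    exact FitsRoom.mem_new (onSide_of_mem hW hk (hf a) hz)
  · rintro _ ⟨k, hk, rfl⟩ _ ⟨l, hl, rfl⟩ hkl z hz hz'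
    rw [hspace k hk] at hz
    rw [hspace l hl] at hz'
    obtain ⟨x, hx, hs, -, rfl⟩ := kiteRoom_inter hW hk hl (fun e => hkl (by rw [e])) hz hz'
    exact ⟨N x, FitsRoom.mem_new hs, (hq x hx).symm⟩

/-- The graph has a drawing with space at each of the sides in `F`. -/
def HasRooms (G : SimpleGraph V) (F : Set (V × V × V)) : Prop :=
  ∃ p S, IsRoomy G p S ∧ ∀ a b c, (a, b, c) ∈ F → ∃ m, ⟨a, b, c, m⟩ ∈ S ∨ ⟨b, a, c, m⟩ ∈ S

/-- The reflection of an instance that exchanges the ends of the side `0`. -/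
def sideFlip (i : ℕ) : ℕ := if i = 8 then 8 else (10 - i) % 8

theorem IsExtension.swap {v v' u : V} (h : IsExtension G G' ι N v v' u) :
    IsExtension G G' ι (fun i => N (sideFlip i)) v' v u where
  injective := h.injective
  left := h.right
  right := h.left
  injOn i hi j hj hij := by
    have key : ∀ i < 9, sideFlip i < 9 := by decide
    have key' : ∀ i < 9, ∀ j < 9, sideFlip i = sideFlip j → i = j := by decide
    exact key' i hi j hj (h.injOn (key i hi) (key j hj) hij)
  new i hi h0 h2 := by
    have key : ∀ i < 9, i ≠ 0 → i ≠ 2 → sideFlip i < 9 ∧ sideFlip i ≠ 0 ∧ sideFlip i ≠ 2 := by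
      decide
    obtain ⟨h1, h3, h4⟩ := key i hi h0 h2
    exact h.new _ h1 h3 h4
  cover w := by
    rcases h.cover w with hw | ⟨i, hi, rfl⟩
    · exact Or.inl hw
    · have key : ∀ i < 9, sideFlip i < 9 ∧ sideFlip (sideFlip i) = i := by decide
      exact Or.inr ⟨sideFlip i, (key i hi).1, by simp only [(key i hi).2]⟩
  adj a b := by
    rw [h.adj]
    have key : ∀ e ∈ antiprismEdges, ∃ e' ∈ antiprismEdges,
        (e.1 = sideFlip e'.1 ∧ e.2 = sideFlip e'.2) ∨ (e.1 = sideFlip e'.2 ∧ e.2 = sideFlip e'.1) := by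
      decide +kernel
    have key' : ∀ e ∈ antiprismEdges, ∃ e' ∈ antiprismEdges,
        (sideFlip e.1 = e'.1 ∧ sideFlip e.2 = e'.2) ∨ (sideFlip e.1 = e'.2 ∧ sideFlip e.2 = e'.1) := by
      decide +kernel
    refine or_congr_right (or_congr_left ⟨?_, ?_⟩)
    · rintro ⟨e, he, hab⟩
      obtain ⟨e', he', ⟨h1, h2⟩ | ⟨h1, h2⟩⟩ := key e he
      · exact ⟨e', he', by rw [hab, h1, h2]⟩
      · exact ⟨e', he', by rw [hab, h1, h2, Sym2.eq_swap]⟩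
    · rintro ⟨e, he, hab⟩
      obtain ⟨e', he', ⟨h1, h2⟩ | ⟨h1, h2⟩⟩ := key' e he
      · exact ⟨e', he', by rw [hab, h1, h2]⟩
      · exact ⟨e', he', by rw [hab, h1, h2, Sym2.eq_swap]⟩

theorem Assembly.not_mem_swap {L : List (ℕ → V)} {F : Set (V × V × V)} (hA : Assembly G L F)
    {v v' u u' : V} (hF : (v, v', u) ∈ F) : (v', v, u') ∉ F := by
  intro hF'
  obtain ⟨P, hP, k, hk, rfl, rfl, -, huniq⟩ := hA.free _ _ _ hF
  obtain ⟨Q, hQ, l, hl, h1, h2, -⟩ := hA.free _ _ _ hF'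
  obtain rfl := huniq Q hQ ((2 * l + 2) % 8) (by omega) (2 * l) (by omega) h2.symm h1.symm
  have hi := (hA.isAntiprism Q hQ).1
  have h3 := hi (show (2 * k + 2) % 8 < 9 by omega) (show 2 * l < 9 by omega) h1
  have h4 := hi (show 2 * k < 9 by omega) (show (2 * l + 2) % 8 < 9 by omega) h2
  omega

/-- A free side may have its tip at either end. If the tip is the second end, the numbering of the
new instance is reflected first. -/
theorem HasRooms.extend {L : List (ℕ → V)} {F : Set (V × V × V)} {v v' u : V} (hA : Assembly G L F)
    (h : HasRooms G F) (hE : IsExtension G G' ι N v v' u) (hF : (v, v', u) ∈ F) :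
    HasRooms G' ({t | ∃ a b c, (a, b, c) ∈ F ∧ (a, b, c) ≠ (v, v', u) ∧ t = (ι a, ι b, ι c)} ∪
        {t | ∃ k < 4, k ≠ 0 ∧ t = (N (2 * k), N ((2 * k + 2) % 8), N (2 * k + 1))}) := by
  obtain ⟨p, S, hp, hS⟩ := h
  have hadj : G.Adj v v' := by
    obtain ⟨P, hP, k, hk, rfl, rfl, -⟩ := hA.free _ _ _ hF
    have key : ∀ k < 4, (2 * k, (2 * k + 2) % 8) ∈ antiprismEdges := by decide +kernel
    exact (hA.isAntiprism P hP).2 _ (key k hk)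
  have hsw := fun u' => hA.not_mem_swap (u' := u') hF
  obtain ⟨m, hm | hm⟩ := hS v v' u hF
  · obtain ⟨q, S', hq, hold, hnew⟩ := exists_extend hp hm hadj hE
    refine ⟨q, S', hq, ?_⟩
    rintro a b c (⟨a', b', c', hF', hne, he⟩ | ⟨k, hk, hk0, he⟩) <;>
      simp only [Prod.mk.injEq] at he <;> obtain ⟨rfl, rfl, rfl⟩ := he
    · obtain ⟨m', hm' | hm'⟩ := hS a' b' c' hF'
      · obtain ⟨m'', h⟩ := hold _ hm' hne
        exact ⟨m'', Or.inl h⟩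
      · obtain ⟨m'', h⟩ := hold _ hm' (fun e => by
          simp only [Prod.mk.injEq] at e
          obtain ⟨rfl, rfl, rfl⟩ := e
          exact hsw _ hF')
        exact ⟨m'', Or.inr h⟩
    · obtain ⟨m'', h⟩ := hnew k hk hk0
      interval_cases k
      · exact absurd rfl hk0
      · exact ⟨m'', Or.inl h⟩
      · exact ⟨m'', Or.inl h⟩
      · exact ⟨m'', Or.inr h⟩
  · obtain ⟨q, S', hq, hold, hnew⟩ := exists_extend hp hm hadj.symm hE.swap
    refine ⟨q, S', hq, ?_⟩
    rintro a b c (⟨a', b', c', hF', hne, he⟩ | ⟨k, hk, hk0, he⟩) <;>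
      simp only [Prod.mk.injEq] at he <;> obtain ⟨rfl, rfl, rfl⟩ := he
    · obtain ⟨m', hm' | hm'⟩ := hS a' b' c' hF'
      · obtain ⟨m'', h⟩ := hold _ hm' (fun e => by
          simp only [Prod.mk.injEq] at e
          obtain ⟨rfl, rfl, rfl⟩ := e
          exact hsw _ hF')
        exact ⟨m'', Or.inl h⟩
      · obtain ⟨m'', h⟩ := hold _ hm' (fun e => by
          simp only [Prod.mk.injEq] at e
          obtain ⟨rfl, rfl, rfl⟩ := e
          exact hne rfl)
        exact ⟨m'', Or.inr h⟩
    -- The reflection that exchanges the ends of the side 0 takes the side k to the side 4 - k.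
    · obtain ⟨m'', h⟩ := hnew (4 - k) (by omega) (by omega)
      interval_cases k
      · exact absurd rfl hk0
      · exact ⟨m'', Or.inl h⟩
      · exact ⟨m'', Or.inr h⟩
      · exact ⟨m'', Or.inr h⟩

end

namespace GluedGraph

theorem IsAssembly.hasRooms {H : GluedGraph} {L : List (ℕ → H.V)} (h : IsAssembly H L) :
    HasRooms H.graph H.freeSides := by
  induction h with
  | single =>
    obtain ⟨q, S, hq, hS⟩ := exists_isRoomy_of_isAntiprism ofNumber_injOn
      (fun a => ⟨number a, number_lt a, (ofNumber_number a).symm⟩)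
      (fun a b (hab : augmentedSquareAntiprism.Adj a b) => exists_edge hab)
    refine ⟨q, S, hq, fun a b c h => ?_⟩
    obtain ⟨k, hk, rfl, rfl, rfl⟩ := (mem_freeSides_single a b c).1 h
    obtain ⟨m, hm⟩ := hS k hk
    interval_cases k
    · exact ⟨m, Or.inl hm⟩
    · exact ⟨m, Or.inl hm⟩
    · exact ⟨m, Or.inl hm⟩
    · exact ⟨m, Or.inr hm⟩
  | @extend H L v v' u hL hF ih =>
    rw [freeSides_extend]
    exact ih.extend hL.assembly (hL.isExtension hF) hF

/-- Glued graphs have straight-line RAC drawings. -/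
theorem IsAssembly.exists_isRACDrawing {H : GluedGraph} {L : List (ℕ → H.V)} (h : IsAssembly H L) :
    ∃ p, IsRACDrawing H.graph p :=
  let ⟨p, _, hp, _⟩ := h.hasRooms
  ⟨p, hp.drawing⟩

theorem IsAssembly.freeSides_nonempty {H : GluedGraph} {L : List (ℕ → H.V)} (h : IsAssembly H L) :
    H.freeSides.Nonempty := by
  cases h with
  | single => exact ⟨_, 0, rfl⟩
  | extend => exact ⟨_, Or.inr ⟨1, by decide, rfl⟩⟩

/-- Glued graphs can be large. -/
theorem exists_isGluedFrom_card (n : ℕ) : ∃ H : GluedGraph, H.IsGluedFrom (n + 1) ∧ Finite H.V ∧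
    n < Nat.card H.V := by
  induction n with
  | zero =>
    have : Finite single.V := IsAssembly.single.finite
    exact ⟨single, .single, this, Nat.card_pos_iff.2 ⟨⟨AntiprismVertex.center⟩, this⟩⟩
  | succ n ih =>
    obtain ⟨H, hH, hfin, hlt⟩ := ih
    obtain ⟨L, hL, -⟩ := hH.exists_isAssembly
    obtain ⟨⟨v, v', u⟩, hF⟩ := hL.freeSides_nonempty
    have hfin' : Finite (H.extend v v' u).V := (hL.extend hF).finite
    refine ⟨_, hH.extend hF, hfin', ?_⟩
    have : Finite (H.V ⊕ {x : AntiprismVertex // x ≠ outer 0 ∧ x ≠ outer 1}) := hfin'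
    change n + 1 < Nat.card (H.V ⊕ {x : AntiprismVertex // x ≠ outer 0 ∧ x ≠ outer 1})
    have : Finite {x : AntiprismVertex // x ≠ outer 0 ∧ x ≠ outer 1} := Finite.sum_right H.V
    have hpos : 0 < Nat.card {x : AntiprismVertex // x ≠ outer 0 ∧ x ≠ outer 1} :=
      Nat.card_pos_iff.2 ⟨⟨.center, by simp, by simp⟩, this⟩
    rw [Nat.card_sum]
    omega

end GluedGraph

end

theorem mainTheorem3 :
    (∀ N : ℕ, ∃ (V : Type) (G : SimpleGraph V),
      InAntiprismClass G ∧ Finite V ∧ N < Nat.card V) ∧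
    ∀ {V : Type*} (G : SimpleGraph V), InAntiprismClass G → HasUniqueRACEmbedding G := by
  refine ⟨fun N => ?_, ?_⟩
  -- With N + 1 in place of N there are N + 2 instances, hence at least one extension.
  · obtain ⟨H, hH, hfin, hlt⟩ := GluedGraph.exists_isGluedFrom_card (N + 1)
    exact ⟨H.V, H.graph, ⟨N + 2, by omega, H, hH, ⟨SimpleGraph.Iso.refl⟩⟩, hfin, by omega⟩
  · rintro V G ⟨n, hn, H, hH, ⟨e⟩⟩
    obtain ⟨L, hL, rfl⟩ := hH.exists_isAssembly
    exact HasUniqueRACEmbedding.of_iso e (hL.hasUniqueRACEmbedding hn hL.exists_isRACDrawing)
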